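/- **Setting.** Let $\phi_\sigma,\phi_\varepsilon$ be distributions on $\mathbb{R}$ with support in $[0,1]$, and for $s\ne 0$ on the Riemann surface of the logarithm put $\Phi_\sigma(s)=\langle\phi_\sigma(\alpha),s^\alpha\rangle$, $\Phi_\varepsilon(s)=\langle\phi_\varepsilon(\alpha),s^\alpha\rangle$. Let $\mathcal{S}'_+$ be the space of tempered distributions on $\mathbb{R}$ supported in $[0,\infty)$, $\mathcal{S}'(\mathbb{R}\times\mathbb{R}_+)$ the space of tempered distributions on $\mathbb{R}^2\ni(x,t)$ vanishing for $t<0$, $\mathcal{L}$ the Laplace transform in $t$ on $\operatorname{Re}s>0$, and $H$ the Heaviside function. Assume: - (A1) $\Phi_\varepsilon/\Phi_\sigma$ has an inverse Laplace transform $\ell=\mathcal{L}^{-1}(\Phi_\varepsilon/\Phi_\sigma)$ in $\mathcal{S}'_+$. - (A2) $s^2\,\Phi_\sigma(s)/\Phi_\varepsilon(s)\in\mathbb{C}\setminus(-\infty,0]$ for all $s$ with $\operatorname{Re}s>0$. - (A3) $\Phi_\sigma/\Phi_\varepsilon$ has an inverse Laplace transform in $\mathcal{S}'_+$. For $\operatorname{Re}s>0$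 let $\sqrt{\Phi_\sigma(s)/\Phi_\varepsilon(s)}$ be the branch for which $s\sqrt{\Phi_\sigma(s)/\Phi_\varepsilon(s)}$ has positive real part, and put $$\tilde K(x,s)=\tfrac12\sqrt{\tfrac{\Phi_\sigma(s)}{\Phi_\varepsilon(s)}}\;e^{-|x|s\sqrt{\Phi_\sigma(s)/\Phi_\varepsilon(s)}},\qquad x\in\mathbb{R}.$$ Assume further: - (A4) $\tilde K$ has only the branch points $0$ and $\infty$ and no other singularity: $\sqrt{\Phi_\sigma/\Phi_\varepsilon}$ (equivalently $\tilde K(x,\cdot)$ for every $x$) continues analytically to the plane cut along $(-\infty,0]$, including both edges $s=qe^{\pm i\pi}$, $q>0$, of the cut. The continuation is denoted by the same symbol. - (A5) There is $k\ge 0$ with $\lim_{R\to\infty}\bigl|\sqrt{\Phi_\sigma/\Phi_\varepsilon}\,(Re^{i\varphi})\bigr|=k$ for every $\varphi\in[-\pi,-\frac\pi2)\cup(\frac\pi2,\pi]$. - (A6) $\lim_{\eta\to0^+}\bigl|\eta\sqrt{\Phi_\sigma/\Phi_\varepsilon}\,(\eta e^{i\varphi})\bigr|=0$ for every $\varphi\in[-\pi,\pi]$.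 **Theorem.** There is exactly one $K\in\mathcal{S}'(\mathbb{R}\times\mathbb{R}_+)$ whose Laplace transform in $t$ is $\tilde K(x,s)$, $\operatorname{Re}s>0$, and the following hold. 1. For all $u_0,v_0\in\mathcal{S}'(\mathbb{R})$ the generalized Cauchy problem $$\partial_t^2u=\ell*_t\partial_x^2u+u_0(x)\,\delta'(t)+v_0(x)\,\delta(t)$$ has exactly one solution $u\in\mathcal{S}'(\mathbb{R}\times\mathbb{R}_+)$, and $$u=K*_{x,t}\bigl(u_0(x)\,\delta(t)+v_0(x)\,H(t)\bigr).$$ 2. In the open cone $\{(x,t):k|x|<t\}$ (that is, $t>0$ and $|x|<ct$ with $c=1/k$, where $c=\infty$ if $k=0$) the distribution $K$ is the continuous function $$K(x,t)=\frac1{4\pi i}\int_0^\infty\left(\sqrt{\tfrac{\Phi_\sigma(qe^{-i\pi})}{\Phi_\varepsilon(qe^{-i\pi})}}\;e^{|x|q\sqrt{\frac{\Phi_\sigma(qe^{-i\pi})}{\Phi_\varepsilon(qe^{-i\pi})}}}-\sqrt{\tfrac{\Phi_\sigma(qe^{i\pi})}{\Phi_\varepsilon(qe^{i\pi})}}\;e^{|x|q\sqrt{\frac{\Phi_\sigma(qe^{i\pi})}{\Phi_\varepsilon(qe^{i\pi})}}}\right)e^{-qt}\,dq,$$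 where the integral is $\lim_{\eta\to0^+,\,R\to\infty}\int_\eta^R$, which exists at every point of the cone. 3. $K$ vanishes on the open set $\{(x,t):t<k|x|\}$; for $k>0$ this is $|x|>ct$. So $K$ is supported in the closed cone $k|x|\le t$. -/

import Mathlib

open Set Filter MeasureTheory Topology
open scoped SchwartzMap LineDeriv ContDiff
open Distribution (IsVanishingOn)

noncomputable section

namespace DOWave

/-! ### Test functions -/

/-- The tensor product `(x, t) ↦ a x * b t` of two Schwartz functions, as a continuous linear
map in `b`. -/
def tensorCLM (a : 𝓢(ℝ, ℂ)) : 𝓢(ℝ, ℂ) →L[ℂ] 𝓢(ℝ × ℝ, ℂ) :=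
  SchwartzMap.mkCLM (fun (b : 𝓢(ℝ, ℂ)) (p : ℝ × ℝ) => a p.1 * b p.2)
    (fun f g x => by simp [mul_add])
    (fun c f x => by simp [mul_left_comm])
    (fun f => ((a.smooth ⊤).comp contDiff_fst).mul ((f.smooth ⊤).comp contDiff_snd))
    (by
      rintro ⟨k, n⟩
      refine ⟨(Finset.range (k + 1)) ×ˢ (Finset.range (n + 1)),
        ∑ i ∈ Finset.range (n + 1), (n.choose i : ℝ) *
          (SchwartzMap.seminorm ℂ k i a + SchwartzMap.seminorm ℂ 0 i a), by positivity, ?_⟩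
      intro f x
      set S := ((Finset.range (k + 1)) ×ˢ (Finset.range (n + 1))).sup
        (schwartzSeminormFamily ℂ ℝ ℂ) with hS
      have hsem : ∀ j ≤ k, ∀ i ≤ n, SchwartzMap.seminorm ℂ j i f ≤ S f := by
        intro j hj i hi
        have hmem : (j, i) ∈ (Finset.range (k + 1)) ×ˢ (Finset.range (n + 1)) := by
          simp; omega
        exact (Finset.le_sup (f := schwartzSeminormFamily ℂ ℝ ℂ) hmem) f
      have hfst : ∀ i, ‖iteratedFDeriv ℝ i (fun p : ℝ × ℝ => a p.1) x‖
          ≤ ‖iteratedFDeriv ℝ i a x.1‖ := by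
        intro i
        have h := (ContinuousLinearMap.fst ℝ ℝ ℝ).iteratedFDeriv_comp_right
          (f := (a : ℝ → ℂ)) (a.smooth ⊤) x (i := i) (by exact_mod_cast le_top)
        have h1 : (fun p : ℝ × ℝ => a p.1) = (a : ℝ → ℂ) ∘ (ContinuousLinearMap.fst ℝ ℝ ℝ) := rfl
        rw [h1, h]
        refine (ContinuousMultilinearMap.norm_compContinuousLinearMap_le _ _).trans ?_
        refine mul_le_of_le_one_right (norm_nonneg _) ?_
        exact Finset.prod_le_one (fun _ _ => norm_nonneg _)
          (fun _ _ => ContinuousLinearMap.norm_fst_le ℝ ℝ ℝ)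
      have hsnd : ∀ i, ‖iteratedFDeriv ℝ i (fun p : ℝ × ℝ => f p.2) x‖
          ≤ ‖iteratedFDeriv ℝ i f x.2‖ := by
        intro i
        have h := (ContinuousLinearMap.snd ℝ ℝ ℝ).iteratedFDeriv_comp_right
          (f := (f : ℝ → ℂ)) (f.smooth ⊤) x (i := i) (by exact_mod_cast le_top)
        have h1 : (fun p : ℝ × ℝ => f p.2) = (f : ℝ → ℂ) ∘ (ContinuousLinearMap.snd ℝ ℝ ℝ) := rfl
        rw [h1, h]
        refine (ContinuousMultilinearMap.norm_compContinuousLinearMap_le _ _).trans ?_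
        refine mul_le_of_le_one_right (norm_nonneg _) ?_
        exact Finset.prod_le_one (fun _ _ => norm_nonneg _)
          (fun _ _ => ContinuousLinearMap.norm_snd_le ℝ ℝ ℝ)
      have hx : ‖x‖ ^ k ≤ ‖x.1‖ ^ k + ‖x.2‖ ^ k := by
        rcases le_total ‖x.1‖ ‖x.2‖ with h | h
        · rw [Prod.norm_def, max_eq_right h]
          have : 0 ≤ ‖x.1‖ ^ k := by positivity
          linarith
        · rw [Prod.norm_def, max_eq_left h]
          have : 0 ≤ ‖x.2‖ ^ k := by positivity
          linarith
      have hmul := norm_iteratedFDeriv_mul_le (𝕜 := ℝ) (N := (∞ : ℕ∞ω))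
        (f := fun p : ℝ × ℝ => a p.1) (g := fun p : ℝ × ℝ => f p.2)
        ((a.smooth ⊤).comp contDiff_fst) ((f.smooth ⊤).comp contDiff_snd) x (n := n)
        (by exact_mod_cast le_top)
      calc ‖x‖ ^ k * ‖iteratedFDeriv ℝ n (fun p : ℝ × ℝ => a p.1 * f p.2) x‖
          ≤ ‖x‖ ^ k * ∑ i ∈ Finset.range (n + 1), (n.choose i : ℝ) *
              ‖iteratedFDeriv ℝ i (fun p : ℝ × ℝ => a p.1) x‖ *
              ‖iteratedFDeriv ℝ (n - i) (fun p : ℝ × ℝ => f p.2) x‖ := by gcongr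
        _ = ∑ i ∈ Finset.range (n + 1), (n.choose i : ℝ) * (‖x‖ ^ k *
              ‖iteratedFDeriv ℝ i (fun p : ℝ × ℝ => a p.1) x‖ *
              ‖iteratedFDeriv ℝ (n - i) (fun p : ℝ × ℝ => f p.2) x‖) := by
            rw [Finset.mul_sum]; refine Finset.sum_congr rfl fun i _ => by ring
        _ ≤ ∑ i ∈ Finset.range (n + 1), (n.choose i : ℝ) *
              ((SchwartzMap.seminorm ℂ k i a + SchwartzMap.seminorm ℂ 0 i a) * S f) := by
            refine Finset.sum_le_sum fun i hi => ?_
            refine mul_le_mul_of_nonneg_left ?_ (by positivity)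
            have hin : i ≤ n := by simpa [Nat.lt_succ_iff] using hi
            have e1 := SchwartzMap.le_seminorm ℂ k i a x.1
            have e2 := SchwartzMap.le_seminorm ℂ 0 i a x.1
            have e3 := (SchwartzMap.le_seminorm ℂ k (n - i) f x.2).trans
              (hsem k le_rfl (n - i) (Nat.sub_le _ _))
            have e4 := (SchwartzMap.le_seminorm ℂ 0 (n - i) f x.2).trans
              (hsem 0 (Nat.zero_le _) (n - i) (Nat.sub_le _ _))
            rw [pow_zero, one_mul] at e2 e4
            calc ‖x‖ ^ k * ‖iteratedFDeriv ℝ i (fun p : ℝ × ℝ => a p.1) x‖ *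
                  ‖iteratedFDeriv ℝ (n - i) (fun p : ℝ × ℝ => f p.2) x‖
                ≤ (‖x.1‖ ^ k + ‖x.2‖ ^ k) * ‖iteratedFDeriv ℝ i a x.1‖ *
                  ‖iteratedFDeriv ℝ (n - i) f x.2‖ := by
                  gcongr
                  · exact hfst i
                  · exact hsnd (n - i)
              _ = (‖x.1‖ ^ k * ‖iteratedFDeriv ℝ i a x.1‖) * ‖iteratedFDeriv ℝ (n - i) f x.2‖
                  + ‖iteratedFDeriv ℝ i a x.1‖ *
                    (‖x.2‖ ^ k * ‖iteratedFDeriv ℝ (n - i) f x.2‖) := by ring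
              _ ≤ SchwartzMap.seminorm ℂ k i a * S f + SchwartzMap.seminorm ℂ 0 i a * S f := by
                  gcongr
              _ = _ := by ring
        _ = _ := by
            rw [Finset.sum_mul]; refine Finset.sum_congr rfl fun i _ => by ring)

@[simp] theorem tensorCLM_apply (a b : 𝓢(ℝ, ℂ)) (p : ℝ × ℝ) :
    tensorCLM a b p = a p.1 * b p.2 := rfl

/-- A smooth cutoff on the line: `0` for `t ≤ -2` and `1` for `-1 ≤ t`. -/
def halfLineCutoff (t : ℝ) : ℝ := Real.smoothTransition (t + 2)

/-- For `Re s > 0`, the Schwartz function `t ↦ χ(t) e^{-st}`, where the smooth function `χ` is `1`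
on a neighbourhood of `[0, ∞)` and `0` on a neighbourhood of `-∞`. -/
def laplaceKernel (s : ℂ) (hs : 0 < s.re) : 𝓢(ℝ, ℂ) where
  toFun t := (halfLineCutoff t : ℂ) * Complex.exp (-s * t)
  smooth' := by
    have h1 : ContDiff ℝ ∞ halfLineCutoff :=
      Real.smoothTransition.contDiff.comp (contDiff_id.add contDiff_const)
    exact (Complex.ofRealCLM.contDiff.comp h1).mul
      (Complex.contDiff_exp.comp (contDiff_const.mul Complex.ofRealCLM.contDiff))
  decay' := by
    intro k n
    have h1 : ContDiff ℝ ∞ halfLineCutoff :=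
      Real.smoothTransition.contDiff.comp (contDiff_id.add contDiff_const)
    have h2 : ContDiff ℝ ∞ (fun t : ℝ => (halfLineCutoff t : ℂ) * Complex.exp (-s * t)) :=
      (Complex.ofRealCLM.contDiff.comp h1).mul
        (Complex.contDiff_exp.comp (contDiff_const.mul Complex.ofRealCLM.contDiff))
    set f : ℝ → ℂ := fun t : ℝ => (halfLineCutoff t : ℂ) * Complex.exp (-s * t) with hf
    set g : ℝ → ℝ := fun t => ‖t‖ ^ k * ‖iteratedFDeriv ℝ n f t‖ with hg
    have hgc : Continuous g :=
      (continuous_norm.pow k).mul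
        (h2.continuous_iteratedFDeriv (m := n) (by exact_mod_cast le_top)).norm
    have hleft : ∀ t < -2, g t = 0 := by
      intro t ht
      have he : f =ᶠ[𝓝 t] fun _ => (0 : ℂ) := by
        filter_upwards [Iio_mem_nhds ht] with y hy
        have hy' : y < -2 := hy
        simp [hf, halfLineCutoff, Real.smoothTransition.zero_of_nonpos
          (show y + 2 ≤ 0 by linarith)]
      have : iteratedFDeriv ℝ n f t = 0 := by
        rw [(he.iteratedFDeriv ℝ n).eq_of_nhds]
        have : (fun _ : ℝ => (0 : ℂ)) = 0 := rfl
        rw [this, iteratedFDeriv_zero]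
        rfl
      simp [hg, this]
    have hexp : ∀ m : ℕ, iteratedDeriv m (fun t : ℝ => Complex.exp (-s * t))
        = fun t : ℝ => (-s) ^ m * Complex.exp (-s * t) := by
      intro m
      induction m with
      | zero => simp
      | succ m ih =>
        rw [iteratedDeriv_succ, ih]
        funext t
        have hd : HasDerivAt (fun t : ℝ => Complex.exp (-s * t))
            (Complex.exp (-s * t) * (-s * 1)) t :=
          ((Complex.ofRealCLM.hasDerivAt (x := t)).const_mul (-s)).cexp
        rw [(hd.const_mul ((-s) ^ m)).deriv]
        ring
    have hright : ∀ t > -1, g t = ‖s‖ ^ n * (|t| ^ k * Real.exp (-s.re * t)) := by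
      intro t ht
      have he : f =ᶠ[𝓝 t] fun t : ℝ => Complex.exp (-s * t) := by
        filter_upwards [Ioi_mem_nhds ht] with y hy
        have hy' : -1 < y := hy
        simp [hf, halfLineCutoff, Real.smoothTransition.one_of_one_le
          (show 1 ≤ y + 2 by linarith)]
      have h3 : ‖iteratedFDeriv ℝ n f t‖ = ‖s‖ ^ n * Real.exp (-s.re * t) := by
        rw [(he.iteratedFDeriv ℝ n).eq_of_nhds, norm_iteratedFDeriv_eq_norm_iteratedDeriv, hexp n]
        simp [Complex.norm_exp]
      simp only [hg, h3, Real.norm_eq_abs]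
      ring
    have htend : Tendsto g atTop (𝓝 0) := by
      have h4 : Tendsto (fun t : ℝ => ‖s‖ ^ n * (t ^ k * Real.exp (-s.re * t))) atTop
          (𝓝 (‖s‖ ^ n * 0)) := by
        refine Tendsto.const_mul _ ?_
        have := tendsto_rpow_mul_exp_neg_mul_atTop_nhds_zero (k : ℝ) s.re hs
        simpa using this
      rw [mul_zero] at h4
      refine h4.congr' ?_
      filter_upwards [eventually_gt_atTop 0] with t ht
      rw [hright t (by linarith), abs_of_pos ht]
    obtain ⟨T, hT⟩ := (htend.eventually (gt_mem_nhds one_pos)).exists_forall_of_atTop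
    obtain ⟨C, hC⟩ := (isCompact_Icc (a := (-2 : ℝ)) (b := T)).exists_bound_of_continuousOn
      hgc.continuousOn
    refine ⟨max C 1, fun t => ?_⟩
    change g t ≤ _
    rcases lt_or_ge t (-2) with h | h
    · rw [hleft t h]; positivity
    rcases le_or_gt t T with h' | h'
    · exact (le_abs_self _).trans ((hC t ⟨h, h'⟩).trans (le_max_left _ _))
    · exact (hT t h'.le).le.trans (le_max_right _ _)

/-- The compactly supported smooth function `α ↦ χ(α) e^{αz}`, where `χ` is smooth, compactly
supported, and `1` on a neighbourhood of `[0, 1]`. -/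
def expKernel (z : ℂ) : 𝓢(ℝ, ℂ) :=
  let χ : ContDiffBump (1 / 2 : ℝ) := ⟨1, 2, one_pos, one_lt_two⟩
  HasCompactSupport.toSchwartzMap (f := fun α : ℝ => (χ α : ℂ) * Complex.exp (α * z))
    ((χ.hasCompactSupport.comp_left (g := fun y : ℝ => (y : ℂ)) Complex.ofReal_zero).mul_right)
    ((Complex.ofRealCLM.contDiff.comp χ.contDiff).mul
      (Complex.contDiff_exp.comp (Complex.ofRealCLM.contDiff.mul contDiff_const)))

/-! ### Distributions -/

/-- The partial pairing `⟨u(x,t), a(x)⟩_x`, a tempered distribution in `t`. -/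
def slice (u : 𝓢'(ℝ × ℝ, ℂ)) (a : 𝓢(ℝ, ℂ)) : 𝓢'(ℝ, ℂ) :=
  PointwiseConvergenceCLM.precomp ℂ (tensorCLM a) u

/-- `w(x,t) = f(x) g(t)`, the tensor product of distributions. -/
def IsTensor (f g : 𝓢'(ℝ, ℂ)) (w : 𝓢'(ℝ × ℝ, ℂ)) : Prop :=
  ∀ a b : 𝓢(ℝ, ℂ), w (tensorCLM a b) = f a * g b

/-- The Heaviside function as a tempered distribution. -/
def heaviside : 𝓢'(ℝ, ℂ) :=
  haveI : (volume.restrict (Ioi (0 : ℝ))).HasTemperateGrowth := by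
    obtain ⟨n, hn⟩ := (inferInstance : (volume : Measure ℝ).HasTemperateGrowth).exists_integrable
    exact ⟨⟨n, hn.mono_measure Measure.restrict_le_self⟩⟩
  (volume.restrict (Ioi (0 : ℝ))).toTemperedDistribution

section Convolution

variable {E : Type*} [NormedAddCommGroup E] [NormedSpace ℝ E]

/-- The Schwartz function `y ↦ φ (x - y)`. -/
def reflTranslate (φ : 𝓢(E, ℂ)) (x : E) : 𝓢(E, ℂ) :=
  SchwartzMap.compSubConstCLM ℂ x
    (SchwartzMap.compCLMOfContinuousLinearEquiv ℂ (ContinuousLinearEquiv.neg ℝ) φ)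

theorem reflTranslate_apply (φ : 𝓢(E, ℂ)) (x y : E) : reflTranslate φ x y = φ (x - y) := by
  simp [reflTranslate]

/-- The regularization `f * φ` of a distribution by a test function, `(f * φ)(x) = ⟨f, φ(x - ·)⟩`. -/
def regularize (f : 𝓢'(E, ℂ)) (φ : 𝓢(E, ℂ)) (x : E) : ℂ := f (reflTranslate φ x)

/-- `f` and `g` are convolvable and `w = f * g` (Chevalley's definition): for all test functions
`φ, ψ` (smooth with compact support) the functions `f * φ` and `g * ψ` are convolvable, i.e.
`y ↦ (f * φ)(x - y) (g * ψ)(y)` is integrable for every `x`, and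
`(w * φ) * ψ = (f * φ) * (g * ψ)`. -/
def IsConv [MeasureSpace E] (f g w : 𝓢'(E, ℂ)) : Prop :=
  ∀ φ ψ : 𝓢(E, ℂ), HasCompactSupport φ → HasCompactSupport ψ → ∀ x : E,
    Integrable (fun y => regularize f φ (x - y) * regularize g ψ y) ∧
    ∫ y, regularize w φ (x - y) * ψ y = ∫ y, regularize f φ (x - y) * regularize g ψ y

end Convolution

/-- `w = ℓ *_t u`, the convolution in the time variable only. -/
def IsTimeConv (ℓ : 𝓢'(ℝ, ℂ)) (u w : 𝓢'(ℝ × ℝ, ℂ)) : Prop :=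
  ∀ a : 𝓢(ℝ, ℂ), IsConv ℓ (slice u a) (slice w a)

/-- The Laplace transform `⟨y, e^{-st}⟩`, `Re s > 0`, of a tempered distribution `y` supported
in `[0, ∞)`. -/
def laplace (y : 𝓢'(ℝ, ℂ)) (s : ℂ) : ℂ := if hs : 0 < s.re then y (laplaceKernel s hs) else 0

/-- `y` is a tempered distribution supported in `[0, ∞)` and `y` is the inverse Laplace transform
of `Y`. -/
def IsInvLaplace (Y : ℂ → ℂ) (y : 𝓢'(ℝ, ℂ)) : Prop :=
  IsVanishingOn y (Iio 0) ∧ ∀ s : ℂ, 0 < s.re → laplace y s = Y s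

/-! ### The symbols -/

/-- `Φ(e^z) = ⟨φ(α), e^{αz}⟩` for a distribution `φ` supported in `[0, 1]`; this is the function
`Φ(s) = ⟨φ(α), s^α⟩` on the Riemann surface of the logarithm. -/
def symbolLog (φ : 𝓢'(ℝ, ℂ)) (z : ℂ) : ℂ := φ (expKernel z)

/-- `Φ(s) = ⟨φ(α), s^α⟩`, with the principal branch of `s^α`. -/
def symbol (φ : 𝓢'(ℝ, ℂ)) (s : ℂ) : ℂ := symbolLog φ (Complex.log s)

/-- `√(Φσ(s)/Φε(s)) = √(ω(s)) / s`, where `ω(s) = s² Φσ(s)/Φε(s)` and `√(ω(s))` is the root with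
positive real part. -/
def sqrtRatio (φσ φε : 𝓢'(ℝ, ℂ)) (s : ℂ) : ℂ :=
  (s ^ 2 * (symbol φσ s / symbol φε s)) ^ (1 / 2 : ℂ) / s

/-- `K̃(x, s) = ½ √(Φσ/Φε) e^{-|x| s √(Φσ/Φε)}`, `Re s > 0`. -/
def Ktilde (φσ φε : 𝓢'(ℝ, ℂ)) (x : ℝ) (s : ℂ) : ℂ :=
  1 / 2 * sqrtRatio φσ φε s * Complex.exp (-((|x| : ℝ) : ℂ) * s * sqrtRatio φσ φε s)

/-- `F`, a function of `z = log s`, is an analytic continuation of `f` from the half plane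
`Re s > 0` to the plane cut along the negative half axis, including both edges
`arg s = π` and `arg s = -π` of the cut (across which it is locally analytic). -/
def IsCutPlaneContinuation (f F : ℂ → ℂ) : Prop :=
  AnalyticOnNhd ℂ F {z | |z.im| ≤ Real.pi} ∧
  ∀ z : ℂ, |z.im| < Real.pi / 2 → F z = f (Complex.exp z)

/-- The point `log R + iθ`, the logarithm of `R e^{iθ}`. -/
def polarLog (R θ : ℝ) : ℂ := (Real.log R : ℂ) + (θ : ℂ) * Complex.I

/-! ### The Cauchy problem and the fundamental solution -/

/-- `u` is a tempered distribution on the plane vanishing for `t < 0` which solves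
`∂_t² u = ℓ *_t ∂_x² u + u₀(x) δ'(t) + v₀(x) δ(t)`. -/
def IsCauchySolution (ℓ u₀ v₀ : 𝓢'(ℝ, ℂ)) (u : 𝓢'(ℝ × ℝ, ℂ)) : Prop :=
  IsVanishingOn u {p : ℝ × ℝ | p.2 < 0} ∧
  ∃ L A B : 𝓢'(ℝ × ℝ, ℂ),
    IsTimeConv ℓ (∂_{((1, 0) : ℝ × ℝ)} (∂_{((1, 0) : ℝ × ℝ)} u)) L ∧
    IsTensor u₀ (TemperedDistribution.derivCLM ℂ (TemperedDistribution.delta 0)) A ∧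
    IsTensor v₀ (TemperedDistribution.delta 0) B ∧
    ∂_{((0, 1) : ℝ × ℝ)} (∂_{((0, 1) : ℝ × ℝ)} u) = L + A + B

/-- `K` is a tempered distribution on the plane vanishing for `t < 0`, and it is the inverse Laplace
transform in `t` of `K̃(x, s)`. -/
def IsFundamentalSolution (φσ φε : 𝓢'(ℝ, ℂ)) (K : 𝓢'(ℝ × ℝ, ℂ)) : Prop :=
  IsVanishingOn K {p : ℝ × ℝ | p.2 < 0} ∧
  ∀ a : 𝓢(ℝ, ℂ), IsInvLaplace (fun s => ∫ x : ℝ, Ktilde φσ φε x s * a x) (slice K a)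

/-- The integral over `η < q < R` of the difference of the values on the lower and upper edges of
the cut; `r z` stands for `√(Φσ/Φε)` at `s = e^z`. -/
def cutIntegral (r : ℂ → ℂ) (x t η R : ℝ) : ℂ :=
  1 / (4 * Real.pi * Complex.I) *
    ∫ q in η..R,
      (r (polarLog q (-Real.pi)) * Complex.exp (((|x| : ℝ) : ℂ) * q * r (polarLog q (-Real.pi))) -
        r (polarLog q Real.pi) * Complex.exp (((|x| : ℝ) : ℂ) * q * r (polarLog q Real.pi))) *
      Complex.exp (-q * t)

end DOWave

end

/-! Write ρ = √(Φσ/Φε) and p(s) = sρ(s). By (A2), p is a holomorphic self-map of the right half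
plane, and nearly everything follows from this.

Existence and the Cauchy problem. The Schwarz–Pick lemma (`schwarz_pick_halfPlane`) bounds |ρ| and
1/Re p by powers of (1 + |s|)(1 + 1/Re s); see `IsWaveSpeed.of_pos`. Hence for large m the function
(1 + s)^{-m} K̃(x, s) is the Laplace transform of a continuous function g(x, t), zero for t < 0, of
polynomial growth in t and of any prescribed decay in x (`IsWaveSpeed.exists_kernel`). Then K = (1 +
∂_t)^m g, and K * W is given by absolutely convergent integrals for each tempered W vanishing for t
< 0: the decay order of g is chosen after W. For fixed s the Laplace transform in t turns the wave
equation into an equation p²V - V'' = source in x. It is solved by convolution with e^{-p|x|}/(2p),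
and its homogeneous version has no nonzero tempered solution because Re p > 0 (`cauchy_problem`).

Support. The angular derivative k' = inf Re p / Re s = lim p(R)/R gives |e^{-|x|p}| ≤ e^{-k'|x| Re
s}; moving the inversion line to Re s → ∞ shows K = 0 for t < k'|x|. To see k' = k, work with z =
log s. There Φσ and Φε are entire functions of controlled growth, so their quotient is at most exp(C
x²) on suitable vertical segments (`HasExpGrowth.exists_segment`). This is enough for
Phragmén–Lindelöf in the half strips of |Im z| ≤ π, which makes the limits (A5) and (A6) on the two
edges uniform in arg s (`IsCutPlaneContinuation.isCutSpeed`). Lindelöf's theorem then carries the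
limit k' of ρ on the positive axis to the ray arg s = 3π/4, where (A5) says that its modulus is k
(`IsCutSpeed.isWaveSpeed`).

The cone. Paired with a test function supported in k|x| < t, the inversion integral over a chord of
Re s = 1 is deformed to an arc of the circle |s| = R, and the arc is completed to arg s = ±π at a
cost O(1/R) (`IsCutSpeed.exists_norm_wavePairing_le`). By Cauchy's theorem in log s, the difference
of two full circles is the integral over the two edges of the cut (`cutIntegral_eq`). The small
circle disappears by (A6), and the cut integrals converge locally uniformly in the cone, which gives
both the formula and the continuity. -/

noncomputable section

namespace DOWave

/-! ### Norms and bounds on the Schwartz space -/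

section SchwartzNorms

variable {E : Type*} [NormedAddCommGroup E] [NormedSpace ℝ E]

variable (E) in
/-- The increasing sequence of norms defining the topology of the Schwartz space. -/
def schwartzNorm (m : ℕ) : Seminorm ℂ 𝓢(E, ℂ) :=
  (Finset.Iic (m, m)).sup (schwartzSeminormFamily ℂ E ℂ)

theorem seminorm_le_schwartzNorm {k n m : ℕ} (hk : k ≤ m) (hn : n ≤ m) (f : 𝓢(E, ℂ)) :
    SchwartzMap.seminorm ℂ k n f ≤ schwartzNorm E m f := by
  have hmem : (k, n) ∈ Finset.Iic (m, m) := by simp [hk, hn]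
  exact (Finset.le_sup (f := schwartzSeminormFamily ℂ E ℂ) hmem) f

theorem schwartzNorm_le {m : ℕ} {f : 𝓢(E, ℂ)} {B : ℝ} (hB : 0 ≤ B)
    (h : ∀ k ≤ m, ∀ n ≤ m, SchwartzMap.seminorm ℂ k n f ≤ B) : schwartzNorm E m f ≤ B := by
  refine Seminorm.finset_sup_apply_le hB ?_
  rintro ⟨k, n⟩ hkn
  have : k ≤ m ∧ n ≤ m := by simpa using hkn
  exact h k this.1 n this.2

theorem schwartzNorm_mono {m m' : ℕ} (h : m ≤ m') (f : 𝓢(E, ℂ)) :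
    schwartzNorm E m f ≤ schwartzNorm E m' f :=
  schwartzNorm_le (apply_nonneg _ _) fun _ hk _ hn =>
    seminorm_le_schwartzNorm (hk.trans h) (hn.trans h) f

theorem sup_le_schwartzNorm (s : Finset (ℕ × ℕ)) :
    ∃ m, ∀ f : 𝓢(E, ℂ), s.sup (schwartzSeminormFamily ℂ E ℂ) f ≤ schwartzNorm E m f := by
  refine ⟨s.sup fun i => max i.1 i.2, fun f => ?_⟩
  refine Seminorm.finset_sup_apply_le (apply_nonneg _ _) fun i hi => ?_
  have := Finset.le_sup (f := fun i : ℕ × ℕ => max i.1 i.2) hi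
  exact seminorm_le_schwartzNorm ((le_max_left _ _).trans this) ((le_max_right _ _).trans this) f

theorem continuous_schwartzNorm (m : ℕ) : Continuous (schwartzNorm E m) := by
  classical
  refine Seminorm.continuous_of_le (q := ∑ i ∈ Finset.Iic (m, m), schwartzSeminormFamily ℂ E ℂ i) ?_
    (Seminorm.finset_sup_le_sum _ _)
  have : (⇑(∑ i ∈ Finset.Iic (m, m), schwartzSeminormFamily ℂ E ℂ i) : 𝓢(E, ℂ) → ℝ) =
      fun f => ∑ i ∈ Finset.Iic (m, m), schwartzSeminormFamily ℂ E ℂ i f := by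
    funext f
    rw [← FunLike.coeAddMonoidHom_apply, map_sum, Finset.sum_apply]
    rfl
  rw [this]
  exact continuous_finsetSum _ fun i _ => (schwartz_withSeminorms ℂ E ℂ).continuous_seminorm i

theorem exists_norm_le_schwartzNorm (u : 𝓢'(E, ℂ)) :
    ∃ m : ℕ, ∃ C : ℝ, 0 ≤ C ∧ ∀ f, ‖u f‖ ≤ C * schwartzNorm E m f := by
  have hu : Continuous u := map_continuous u
  obtain ⟨s, C, -, h⟩ := Seminorm.bound_of_continuous (schwartz_withSeminorms ℂ E ℂ)
    ((normSeminorm ℂ ℂ).comp (u : 𝓢(E, ℂ) →ₗ[ℂ] ℂ)) (continuous_norm.comp hu)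
  obtain ⟨m, hm⟩ := sup_le_schwartzNorm (E := E) s
  refine ⟨m, C, C.2, fun f => (h f).trans ?_⟩
  exact mul_le_mul_of_nonneg_left (hm f) C.2

theorem exists_schwartzNorm_comp_le {E' : Type*} [NormedAddCommGroup E'] [NormedSpace ℝ E']
    (A : 𝓢(E, ℂ) →L[ℂ] 𝓢(E', ℂ)) (m : ℕ) :
    ∃ m' : ℕ, ∃ C : ℝ, 0 ≤ C ∧ ∀ f, schwartzNorm E' m (A f) ≤ C * schwartzNorm E m' f := by
  obtain ⟨s, C, -, h⟩ := Seminorm.bound_of_continuous (schwartz_withSeminorms ℂ E ℂ)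
    ((schwartzNorm E' m).comp (A : 𝓢(E, ℂ) →ₗ[ℂ] 𝓢(E', ℂ)))
    ((continuous_schwartzNorm m).comp A.continuous)
  obtain ⟨m', hm⟩ := sup_le_schwartzNorm (E := E) s
  refine ⟨m', C, C.2, fun f => (h f).trans ?_⟩
  exact mul_le_mul_of_nonneg_left (hm f) C.2

theorem tendsto_schwartz_iff {Y : Type*} {l : Filter Y} {F : Y → 𝓢(E, ℂ)} {f : 𝓢(E, ℂ)} :
    Tendsto F l (𝓝 f) ↔ ∀ m, Tendsto (fun y => schwartzNorm E m (F y - f)) l (𝓝 0) := by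
  constructor
  · intro h m
    have := ((continuous_schwartzNorm (E := E) m).tendsto 0).comp (tendsto_sub_nhds_zero_iff.2 h)
    simpa [Function.comp_def] using this
  · intro h
    rw [(schwartz_withSeminorms ℂ E ℂ).tendsto_nhds]
    rintro ⟨k, n⟩ ε hε
    filter_upwards [(h (max k n)).eventually (gt_mem_nhds hε)] with y hy
    exact (seminorm_le_schwartzNorm (le_max_left _ _) (le_max_right _ _) _).trans_lt hy

/-- A tempered distribution from a linear functional with a bound. -/
def distOfBound (A : 𝓢(E, ℂ) → ℂ) (hadd : ∀ f g, A (f + g) = A f + A g)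
    (hsmul : ∀ (a : ℂ) f, A (a • f) = a * A f) (m : ℕ) (C : ℝ) (hC : 0 ≤ C)
    (h : ∀ f, ‖A f‖ ≤ C * schwartzNorm E m f) : 𝓢'(E, ℂ) :=
  ContinuousLinearMap.toPointwiseConvergenceCLM ℂ (RingHom.id ℂ) 𝓢(E, ℂ) ℂ
    (SchwartzMap.mkCLMtoNormedSpace A hadd hsmul ⟨_, C, hC, h⟩)

@[simp] theorem distOfBound_apply (A : 𝓢(E, ℂ) → ℂ) (hadd hsmul) (m : ℕ) (C : ℝ) (hC : 0 ≤ C)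
    (h : ∀ f, ‖A f‖ ≤ C * schwartzNorm E m f) (f : 𝓢(E, ℂ)) :
    distOfBound A hadd hsmul m C hC h f = A f := rfl

end SchwartzNorms

/-! ### Weak integrals of Schwartz-valued functions -/

section WeakIntegral

variable {E : Type*} [NormedAddCommGroup E] [NormedSpace ℝ E]

variable (E) in
/-- The Banach space of bounded continuous functions with values in the `n`-linear maps. -/
def JetComponent (n : ℕ) : Type _ :=
  BoundedContinuousFunction E (ContinuousMultilinearMap ℝ (fun _ : Fin n => E) ℂ)

instance (n : ℕ) : NormedAddCommGroup (JetComponent E n) :=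
  inferInstanceAs (NormedAddCommGroup
    (BoundedContinuousFunction E (ContinuousMultilinearMap ℝ (fun _ : Fin n => E) ℂ)))

instance (n : ℕ) : NormedSpace ℂ (JetComponent E n) :=
  inferInstanceAs (NormedSpace ℂ
    (BoundedContinuousFunction E (ContinuousMultilinearMap ℝ (fun _ : Fin n => E) ℂ)))

instance (n : ℕ) : CompleteSpace (JetComponent E n) :=
  inferInstanceAs (CompleteSpace
    (BoundedContinuousFunction E (ContinuousMultilinearMap ℝ (fun _ : Fin n => E) ℂ)))

/-- Evaluation at a point. -/
def JetComponent.eval {n : ℕ} (x : E) :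
    JetComponent E n →L[ℂ] ContinuousMultilinearMap ℝ (fun _ : Fin n => E) ℂ :=
  BoundedContinuousFunction.evalCLM ℂ x

theorem JetComponent.ext_eval {n : ℕ} {a b : JetComponent E n} (h : ∀ x, eval x a = eval x b) :
    a = b :=
  BoundedContinuousFunction.ext h

/-- The bounded function `x ↦ ‖x‖ ^ k • Dⁿ f(x)`. -/
def weightedDeriv (k n : ℕ) (f : 𝓢(E, ℂ)) : JetComponent E n :=
  BoundedContinuousFunction.ofNormedAddCommGroup
    (fun x => ‖x‖ ^ k • iteratedFDeriv ℝ n f x)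
    ((continuous_norm.pow k).smul ((f.smooth ⊤).continuous_iteratedFDeriv (by exact_mod_cast le_top)))
    (SchwartzMap.seminorm ℂ k n f)
    (fun x => by
      rw [norm_smul, norm_pow, norm_norm]
      exact SchwartzMap.le_seminorm ℂ k n f x)

@[simp] theorem eval_weightedDeriv (k n : ℕ) (f : 𝓢(E, ℂ)) (x : E) :
    JetComponent.eval x (weightedDeriv k n f) = ‖x‖ ^ k • iteratedFDeriv ℝ n f x := rfl

theorem norm_weightedDeriv_le (k n : ℕ) (f : 𝓢(E, ℂ)) :
    ‖weightedDeriv k n f‖ ≤ SchwartzMap.seminorm ℂ k n f :=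
  BoundedContinuousFunction.norm_ofNormedAddCommGroup_le _ (apply_nonneg _ _) _

theorem seminorm_le_norm_weightedDeriv (k n : ℕ) (f : 𝓢(E, ℂ)) :
    SchwartzMap.seminorm ℂ k n f ≤ ‖weightedDeriv k n f‖ := by
  refine SchwartzMap.seminorm_le_bound ℂ k n f (norm_nonneg (weightedDeriv k n f)) fun x => ?_
  have : ‖JetComponent.eval x (weightedDeriv k n f)‖ ≤ ‖weightedDeriv k n f‖ :=
    BoundedContinuousFunction.norm_coe_le_norm (β := ContinuousMultilinearMap ℝ _ ℂ)
      (weightedDeriv k n f) x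
  rwa [eval_weightedDeriv, norm_smul, norm_pow, norm_norm] at this

variable (E) in
/-- The product of the spaces of weighted derivatives of order at most `m`. -/
abbrev JetSpace (m : ℕ) : Type _ :=
  (i : Fin (m + 1) × Fin (m + 1)) → JetComponent E i.2

variable (E) in
/-- The linear embedding of the Schwartz space in a finite product of spaces of bounded continuous
functions, by the weighted derivatives of order at most `m`. -/
def jet (m : ℕ) : 𝓢(E, ℂ) →ₗ[ℂ] JetSpace E m where
  toFun f i := weightedDeriv i.1 i.2 f
  map_add' f g := by
    funext i
    refine JetComponent.ext_eval fun x => ?_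
    have := iteratedFDeriv_add_apply (𝕜 := ℝ) (i := (i.2 : ℕ)) (f := f) (g := g) (x := x)
      ((f.smooth ⊤).contDiffAt.of_le (by exact_mod_cast le_top))
      ((g.smooth ⊤).contDiffAt.of_le (by exact_mod_cast le_top))
    have h2 : ((f + g : 𝓢(E, ℂ)) : E → ℂ) = ⇑f + ⇑g := rfl
    simp [h2, this, smul_add]
  map_smul' c f := by
    funext i
    refine JetComponent.ext_eval fun x => ?_
    have := iteratedFDeriv_const_smul_apply (𝕜 := ℝ) (i := (i.2 : ℕ)) (f := f) (a := c) (x := x)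
      ((f.smooth ⊤).contDiffAt.of_le (by exact_mod_cast le_top))
    have h2 : ((c • f : 𝓢(E, ℂ)) : E → ℂ) = c • ⇑f := rfl
    simp [h2, this, smul_comm c]

theorem norm_jet (m : ℕ) (f : 𝓢(E, ℂ)) : ‖jet E m f‖ = schwartzNorm E m f := by
  refine le_antisymm ?_ ?_
  · refine (pi_norm_le_iff_of_nonneg (apply_nonneg _ _)).2 fun i => ?_
    exact (norm_weightedDeriv_le _ _ f).trans
      (seminorm_le_schwartzNorm (Nat.lt_succ_iff.1 i.1.2) (Nat.lt_succ_iff.1 i.2.2) f)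
  · refine schwartzNorm_le (norm_nonneg _) fun k hk n hn => ?_
    exact (seminorm_le_norm_weightedDeriv k n f).trans
      (norm_le_pi_norm (jet E m f) (⟨k, Nat.lt_succ_iff.2 hk⟩, ⟨n, Nat.lt_succ_iff.2 hn⟩))

theorem jet_injective (m : ℕ) : Function.Injective (jet E m) := by
  rw [injective_iff_map_eq_zero]
  intro f hf
  ext x
  have h1 : schwartzNorm E m f = 0 := by rw [← norm_jet, hf, norm_zero]
  have h2 := (SchwartzMap.norm_le_seminorm ℂ f x).trans
    (seminorm_le_schwartzNorm (Nat.zero_le m) (Nat.zero_le m) f)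
  rw [h1] at h2
  simpa using h2

/-- A tempered distribution is bounded by a single `schwartzNorm`, which is the norm of the jet.
Hahn–Banach therefore extends it to the Banach space `JetSpace`, where Bochner integrals commute
with continuous functionals. -/
theorem exists_extension_jet (u : 𝓢'(E, ℂ)) : ∃ m : ℕ,
    ∃ g : StrongDual ℂ (JetSpace E m), ∀ f, g (jet E m f) = u f := by
  obtain ⟨m, C, -, h⟩ := exists_norm_le_schwartzNorm u
  let e := LinearEquiv.ofInjective (jet E m) (jet_injective m)
  let φ : StrongDual ℂ (LinearMap.range (jet E m)) :=
    ((u : 𝓢(E, ℂ) →ₗ[ℂ] ℂ).comp (e.symm : _ →ₗ[ℂ] 𝓢(E, ℂ))).mkContinuous C (by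
      intro x
      obtain ⟨f, rfl⟩ := e.surjective x
      have h1 : ‖e f‖ = schwartzNorm E m f := norm_jet m f
      simpa [h1] using h f)
  obtain ⟨g, hg, -⟩ := exists_extension_norm_eq _ φ
  refine ⟨m, g, fun f => ?_⟩
  have h1 := hg (e f)
  have h2 : φ (e f) = u f := by
    simp [φ]
  rw [← h2, ← h1]
  rfl

variable {Y : Type*} [TopologicalSpace Y] [SecondCountableTopology Y] [MeasurableSpace Y]
  [OpensMeasurableSpace Y] {μ : Measure Y}

theorem continuous_jet (m : ℕ) : Continuous (jet E m) := by
  rw [continuous_iff_continuousAt]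
  intro f
  rw [ContinuousAt, tendsto_iff_norm_sub_tendsto_zero]
  have := tendsto_schwartz_iff.1 (tendsto_id (x := 𝓝 f)) m
  refine this.congr fun g => ?_
  rw [← map_sub, norm_jet]; rfl

theorem integrable_jet {F : Y → 𝓢(E, ℂ)} (hF : Continuous F) {m : ℕ}
    (hint : Integrable (fun y => schwartzNorm E m (F y)) μ) :
    Integrable (fun y => jet E m (F y)) μ := by
  refine hint.mono' ((continuous_jet m).comp hF).aestronglyMeasurable ?_
  exact Eventually.of_forall fun y => (norm_jet m (F y)).le

omit [SecondCountableTopology Y] in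
theorem integrable_dist {F : Y → 𝓢(E, ℂ)} (hF : Continuous F)
    (hint : ∀ m, Integrable (fun y => schwartzNorm E m (F y)) μ) (u : 𝓢'(E, ℂ)) :
    Integrable (fun y => u (F y)) μ := by
  obtain ⟨m, C, -, h⟩ := exists_norm_le_schwartzNorm u
  exact ((hint m).const_mul C).mono' ((map_continuous u).comp hF).aestronglyMeasurable
    (Eventually.of_forall fun y => h (F y))

theorem integrable_iteratedFDeriv {F : Y → 𝓢(E, ℂ)} (hF : Continuous F)
    (hint : ∀ m, Integrable (fun y => schwartzNorm E m (F y)) μ) (n : ℕ) (x : E) :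
    Integrable (fun y => iteratedFDeriv ℝ n (F y) x) μ := by
  have h1 : Continuous fun y => jet E n (F y) := (continuous_jet n).comp hF
  have h2 : Continuous fun y => JetComponent.eval x ((jet E n (F y)) (0, Fin.last n)) :=
    (JetComponent.eval x).continuous.comp ((continuous_apply (0, Fin.last n)).comp h1)
  have h3 : (fun y => JetComponent.eval x ((jet E n (F y)) (0, Fin.last n))) =
      fun y => iteratedFDeriv ℝ n (F y) x := by
    funext y
    change ‖x‖ ^ 0 • iteratedFDeriv ℝ n (F y) x = _
    simp
  rw [h3] at h2
  refine (hint n).mono' h2.aestronglyMeasurable (Eventually.of_forall fun y => ?_)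
  exact (SchwartzMap.norm_iteratedFDeriv_le_seminorm ℂ (F y) n x).trans
    (seminorm_le_schwartzNorm (Nat.zero_le _) le_rfl _)

/-- Differentiation under the integral sign, one direction at a time: the (n+1)-st derivative in the
direction `w 0` is the derivative of an integral which is identically zero by induction. The norm of
order n + 1 is the dominating function. -/
theorem integral_iteratedFDeriv_eq_zero {F : Y → 𝓢(E, ℂ)} (hF : Continuous F)
    (hint : ∀ m, Integrable (fun y => schwartzNorm E m (F y)) μ)
    (h0 : ∀ x, ∫ y, F y x ∂μ = 0) (n : ℕ) (x : E) :
    ∫ y, iteratedFDeriv ℝ n (F y) x ∂μ = 0 := by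
  induction n generalizing x with
  | zero =>
    have h1 := (continuousMultilinearCurryFin0 ℝ E ℂ).symm.toContinuousLinearEquiv.integral_comp_comm
      (fun y => F y x) (μ := μ)
    simp only [iteratedFDeriv_zero_eq_comp]
    refine h1.trans ?_
    rw [h0, map_zero]
  | succ n ih =>
    have hb : ∀ y x' (w : Fin (n + 1) → E), ‖iteratedFDeriv ℝ (n + 1) (F y) x' w‖ ≤
        schwartzNorm E (n + 1) (F y) * ∏ i, ‖w i‖ := fun y x' w => by
      refine (ContinuousMultilinearMap.le_opNorm _ _).trans ?_
      gcongr
      exact (SchwartzMap.norm_iteratedFDeriv_le_seminorm ℂ (F y) (n + 1) x').trans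
        (seminorm_le_schwartzNorm (Nat.zero_le _) le_rfl _)
    ext w
    have h1 : ∀ k x' (w : Fin k → E), Integrable (fun y => iteratedFDeriv ℝ k (F y) x' w) μ ∧
        (∫ y, iteratedFDeriv ℝ k (F y) x' ∂μ) w = ∫ y, iteratedFDeriv ℝ k (F y) x' w ∂μ :=
      fun k x' w => ⟨(ContinuousMultilinearMap.apply ℝ (fun _ : Fin k => E) ℂ w).integrable_comp
        (integrable_iteratedFDeriv hF hint k x'),
        ((ContinuousMultilinearMap.apply ℝ (fun _ : Fin k => E) ℂ w).integral_comp_comm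
        (integrable_iteratedFDeriv hF hint k x')).symm⟩
    rw [(h1 _ x w).2, zero_apply]
    have hd : ∀ y (τ : ℝ), HasDerivAt
        (fun τ : ℝ => iteratedFDeriv ℝ n (F y) (x + τ • w 0) (Fin.tail w))
        (iteratedFDeriv ℝ (n + 1) (F y) (x + τ • w 0) w) τ := fun y τ => by
      have e1 := (((F y).smooth ⊤).differentiable_iteratedFDeriv (m := n)
        (by exact_mod_cast ENat.natCast_lt_top n) (x + τ • w 0)).hasFDerivAt
      have e2 : HasDerivAt (fun τ : ℝ => x + τ • w 0) (w 0) τ := by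
        simpa using ((hasDerivAt_id τ).smul_const (w 0)).const_add x
      have e3 := e1.comp_hasDerivAt τ e2
      have e4 := (ContinuousMultilinearMap.apply ℝ (fun _ : Fin n => E) ℂ
        (Fin.tail w)).hasFDerivAt.comp_hasDerivAt τ e3
      rw [iteratedFDeriv_succ_apply_left]
      exact e4
    have key := hasDerivAt_integral_of_dominated_loc_of_deriv_le (μ := μ) (𝕜 := ℝ)
      (F := fun τ y => iteratedFDeriv ℝ n (F y) (x + τ • w 0) (Fin.tail w))
      (F' := fun τ y => iteratedFDeriv ℝ (n + 1) (F y) (x + τ • w 0) w) (x₀ := 0)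
      (s := Set.univ) (bound := fun y => schwartzNorm E (n + 1) (F y) * ∏ i, ‖w i‖) univ_mem
      (Eventually.of_forall fun τ => (h1 n _ _).1.aestronglyMeasurable)
      (h1 n _ _).1 (h1 (n + 1) _ _).1.aestronglyMeasurable
      (Eventually.of_forall fun y τ _ => hb y _ w) ((hint (n + 1)).mul_const _)
      (Eventually.of_forall fun y τ _ => hd y τ)
    have h2 := key.2
    have h3 : (fun τ : ℝ => ∫ y, iteratedFDeriv ℝ n (F y) (x + τ • w 0) (Fin.tail w) ∂μ) =
        fun _ => 0 := by
      funext τ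
      rw [← (h1 n _ _).2, ih, zero_apply]
    rw [h3] at h2
    simpa using h2.unique (hasDerivAt_const _ _)

/-- If an integral of Schwartz functions vanishes pointwise, then it vanishes weakly. -/
theorem integral_dist_eq_zero {F : Y → 𝓢(E, ℂ)} (hF : Continuous F)
    (hint : ∀ m, Integrable (fun y => schwartzNorm E m (F y)) μ)
    (h0 : ∀ x, ∫ y, F y x ∂μ = 0) (u : 𝓢'(E, ℂ)) : ∫ y, u (F y) ∂μ = 0 := by
  obtain ⟨m, g, hg⟩ := exists_extension_jet u
  have hJ := integrable_jet hF (hint m)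
  -- Point evaluations separate the elements of the jet space, so the Bochner integral of the jets
  -- is determined by the pointwise integrals of the derivatives.
  have h1 : ∫ y, jet E m (F y) ∂μ = 0 := by
    funext i
    refine JetComponent.ext_eval fun x => ?_
    have e1 := ((JetComponent.eval x).comp (ContinuousLinearMap.proj (R := ℂ)
      (φ := fun i : Fin (m + 1) × Fin (m + 1) => JetComponent E i.2) i)).integral_comp_comm hJ
    refine e1.symm.trans ?_
    rw [Pi.zero_apply, map_zero]
    change ∫ y, ‖x‖ ^ (i.1 : ℕ) • iteratedFDeriv ℝ i.2 (F y) x ∂μ = 0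
    rw [integral_smul, integral_iteratedFDeriv_eq_zero hF hint h0, smul_zero]
  have h2 := g.integral_comp_comm hJ
  rw [h1, map_zero] at h2
  rw [← h2]
  exact integral_congr_ae (Eventually.of_forall fun y => (hg (F y)).symm)

end WeakIntegral

/-! ### Translates of test functions and regularization -/

section Translation

variable {E : Type*} [NormedAddCommGroup E] [NormedSpace ℝ E]

/-- The translate `x ↦ f (x - y)`. -/
abbrev translate (y : E) : 𝓢(E, ℂ) →L[ℂ] 𝓢(E, ℂ) := SchwartzMap.compSubConstCLM ℂ y

theorem one_add_norm_pow_mul_le {m k n : ℕ} (hk : k ≤ m) (hn : n ≤ m) (f : 𝓢(E, ℂ)) (x : E) :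
    (1 + ‖x‖) ^ k * ‖iteratedFDeriv ℝ n f x‖ ≤ 2 ^ m * schwartzNorm E m f :=
  SchwartzMap.one_add_le_sup_seminorm_apply (𝕜 := ℂ) (m := (m, m)) hk hn f x

theorem iteratedFDeriv_translate (n : ℕ) (y : E) (f : 𝓢(E, ℂ)) (x : E) :
    iteratedFDeriv ℝ n (translate y f) x = iteratedFDeriv ℝ n f (x - y) :=
  iteratedFDeriv_comp_sub n y x

theorem schwartzNorm_translate_le (m : ℕ) (y : E) (f : 𝓢(E, ℂ)) :
    schwartzNorm E m (translate y f) ≤ 2 ^ m * (1 + ‖y‖) ^ m * schwartzNorm E m f := by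
  refine schwartzNorm_le (by positivity) fun k hk n hn => ?_
  refine SchwartzMap.seminorm_le_bound ℂ k n _ (by positivity) fun x => ?_
  rw [iteratedFDeriv_translate]
  have h1 : ‖x‖ ≤ (1 + ‖y‖) * (1 + ‖x - y‖) := by
    have : ‖x‖ ≤ ‖x - y‖ + ‖y‖ := by simpa using norm_add_le (x - y) y
    nlinarith [norm_nonneg y, norm_nonneg (x - y)]
  calc ‖x‖ ^ k * ‖iteratedFDeriv ℝ n f (x - y)‖
      ≤ ((1 + ‖y‖) * (1 + ‖x - y‖)) ^ k * ‖iteratedFDeriv ℝ n f (x - y)‖ := by gcongr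
    _ = (1 + ‖y‖) ^ k * ((1 + ‖x - y‖) ^ k * ‖iteratedFDeriv ℝ n f (x - y)‖) := by
        rw [mul_pow, mul_assoc]
    _ ≤ (1 + ‖y‖) ^ m * (2 ^ m * schwartzNorm E m f) := by
        refine mul_le_mul (pow_le_pow_right₀ (by linarith [norm_nonneg y]) hk)
          (one_add_norm_pow_mul_le hk hn f _) (by positivity) (by positivity)
    _ = _ := by ring

/-- Mean value inequality on the segment from x - y₀ to x - y, at the price of one more derivative.
-/
theorem schwartzNorm_translate_sub_le (m : ℕ) (y y₀ : E) (hy : ‖y - y₀‖ ≤ 1) (f : 𝓢(E, ℂ)) :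
    schwartzNorm E m (translate y f - translate y₀ f) ≤
      2 ^ (m + 1) * (2 + ‖y₀‖) ^ m * schwartzNorm E (m + 1) f * ‖y - y₀‖ := by
  refine schwartzNorm_le (by positivity) fun k hk n hn => ?_
  refine SchwartzMap.seminorm_le_bound ℂ k n _ (by positivity) fun x => ?_
  have h0 : iteratedFDeriv ℝ n (translate y f - translate y₀ f : 𝓢(E, ℂ)) x =
      iteratedFDeriv ℝ n f (x - y) - iteratedFDeriv ℝ n f (x - y₀) := by
    rw [← iteratedFDeriv_translate, ← iteratedFDeriv_translate]
    exact iteratedFDeriv_sub_apply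
      (((translate y f).smooth ⊤).contDiffAt.of_le (by exact_mod_cast le_top))
      (((translate y₀ f).smooth ⊤).contDiffAt.of_le (by exact_mod_cast le_top))
  set B := 2 ^ (m + 1) * schwartzNorm E (m + 1) f with hB
  have hpos : 0 < (1 + ‖x‖) ^ k := by positivity
  -- The mean value inequality needs one constant for the whole segment, so the weight at x is
  -- divided out here. It is comparable with the weight at z because z stays within distance 1 of x
  -- - y₀.
  have h1 : ∀ z ∈ segment ℝ (x - y₀) (x - y),
      ‖fderiv ℝ (iteratedFDeriv ℝ n f) z‖ ≤ (2 + ‖y₀‖) ^ m * B / (1 + ‖x‖) ^ k := by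
    intro z hz
    have hz' : ‖z - (x - y₀)‖ ≤ 1 := by
      have := (convex_closedBall (x - y₀) (1 : ℝ)).segment_subset
        (by simp) (show x - y ∈ Metric.closedBall (x - y₀) 1 by
          rw [mem_closedBall_iff_norm, sub_sub_sub_cancel_left, ← norm_neg, neg_sub]; exact hy) hz
      rwa [mem_closedBall_iff_norm] at this
    have hx : 1 + ‖x‖ ≤ (2 + ‖y₀‖) * (1 + ‖z‖) := by
      have : ‖x‖ ≤ ‖z‖ + ‖z - (x - y₀)‖ + ‖y₀‖ := by
        have e : x = z - (z - (x - y₀)) + y₀ := by abel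
        calc ‖x‖ = ‖z - (z - (x - y₀)) + y₀‖ := by rw [← e]
          _ ≤ _ := (norm_add_le _ _).trans (by gcongr; exact norm_sub_le _ _)
      nlinarith [norm_nonneg z, norm_nonneg y₀]
    rw [norm_fderiv_iteratedFDeriv, le_div_iff₀ hpos]
    calc ‖iteratedFDeriv ℝ (n + 1) f z‖ * (1 + ‖x‖) ^ k
        ≤ ‖iteratedFDeriv ℝ (n + 1) f z‖ * ((2 + ‖y₀‖) * (1 + ‖z‖)) ^ k := by gcongr
      _ = (2 + ‖y₀‖) ^ k * ((1 + ‖z‖) ^ k * ‖iteratedFDeriv ℝ (n + 1) f z‖) := by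
          rw [mul_pow]; ring
      _ ≤ (2 + ‖y₀‖) ^ m * B := by
          gcongr
          · linarith [norm_nonneg y₀]
          · exact one_add_norm_pow_mul_le (by omega) (by omega) f z
  have h2 := (convex_segment (𝕜 := ℝ) (x - y₀) (x - y)).norm_image_sub_le_of_norm_fderiv_le
    (𝕜 := ℝ) (f := iteratedFDeriv ℝ n f)
    (fun z _ => (f.smooth ⊤).differentiable_iteratedFDeriv (m := n)
        (by exact_mod_cast ENat.natCast_lt_top n) z) h1
    (left_mem_segment ℝ _ _) (right_mem_segment ℝ _ _)
  rw [h0]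
  have h3 : ‖x - y - (x - y₀)‖ = ‖y - y₀‖ := by
    rw [sub_sub_sub_cancel_left, ← norm_neg, neg_sub]
  rw [h3] at h2
  calc ‖x‖ ^ k * ‖iteratedFDeriv ℝ n f (x - y) - iteratedFDeriv ℝ n f (x - y₀)‖
      ≤ (1 + ‖x‖) ^ k * ((2 + ‖y₀‖) ^ m * B / (1 + ‖x‖) ^ k * ‖y - y₀‖) := by
        gcongr
        linarith [norm_nonneg x]
    _ = _ := by rw [hB]; field_simp

theorem continuous_translate (f : 𝓢(E, ℂ)) : Continuous fun y : E => translate y f := by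
  rw [continuous_iff_continuousAt]
  intro y₀
  rw [ContinuousAt, tendsto_schwartz_iff]
  intro m
  have h : Tendsto (fun y : E =>
      2 ^ (m + 1) * (2 + ‖y₀‖) ^ m * schwartzNorm E (m + 1) f * ‖y - y₀‖) (𝓝 y₀) (𝓝 0) := by
    have : Continuous fun y : E =>
      2 ^ (m + 1) * (2 + ‖y₀‖) ^ m * schwartzNorm E (m + 1) f * ‖y - y₀‖ := by fun_prop
    simpa using this.tendsto y₀
  refine squeeze_zero' (Eventually.of_forall fun y => apply_nonneg _ _) ?_ h
  filter_upwards [Metric.closedBall_mem_nhds y₀ one_pos] with y hy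
  exact schwartzNorm_translate_sub_le m y y₀ (mem_closedBall_iff_norm.1 hy) f

/-- The reflection `x ↦ f (-x)`. -/
abbrev reflect : 𝓢(E, ℂ) →L[ℂ] 𝓢(E, ℂ) :=
  SchwartzMap.compCLMOfContinuousLinearEquiv ℂ (ContinuousLinearEquiv.neg ℝ)

@[simp] theorem reflect_apply (f : 𝓢(E, ℂ)) (x : E) : reflect f x = f (-x) := rfl

theorem reflTranslate_eq (f : 𝓢(E, ℂ)) (x : E) : reflTranslate f x = translate x (reflect f) := rfl

theorem continuous_reflTranslate (f : 𝓢(E, ℂ)) : Continuous (reflTranslate f) :=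
  continuous_translate _

theorem exists_dist_translate_le (u : 𝓢'(E, ℂ)) : ∃ m : ℕ, ∃ C : ℝ, 0 ≤ C ∧
    ∀ f y, ‖u (translate y f)‖ ≤ C * (1 + ‖y‖) ^ m * schwartzNorm E m f := by
  obtain ⟨m, C, hC, h⟩ := exists_norm_le_schwartzNorm u
  refine ⟨m, C * 2 ^ m, by positivity, fun f y => (h _).trans ?_⟩
  calc C * schwartzNorm E m (translate y f)
      ≤ C * (2 ^ m * (1 + ‖y‖) ^ m * schwartzNorm E m f) := by
        gcongr; exact schwartzNorm_translate_le m y f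
    _ = _ := by ring

theorem exists_regularize_le (u : 𝓢'(E, ℂ)) (f : 𝓢(E, ℂ)) : ∃ m : ℕ, ∃ C : ℝ, 0 ≤ C ∧
    ∀ y, ‖regularize u f y‖ ≤ C * (1 + ‖y‖) ^ m := by
  obtain ⟨m, C, hC, h⟩ := exists_dist_translate_le u
  refine ⟨m, C * schwartzNorm E m (reflect f), by positivity, fun y => (h (reflect f) y).trans ?_⟩
  exact le_of_eq (by ring)

theorem continuous_regularize (u : 𝓢'(E, ℂ)) (f : 𝓢(E, ℂ)) : Continuous (regularize u f) :=
  (map_continuous u).comp (continuous_reflTranslate f)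

/-- Fundamental theorem of calculus in the weak sense. -/
theorem dist_eq_intervalIntegral {F : ℝ → 𝓢(E, ℂ)} (hF : Continuous F) {a b : ℝ} {f : 𝓢(E, ℂ)}
    (h : ∀ x, f x = ∫ τ in a..b, F τ x) (u : 𝓢'(E, ℂ)) : u f = ∫ τ in a..b, u (F τ) := by
  wlog hab : a ≤ b generalizing a b f
  · have := this (f := -f) (a := b) (b := a)
      (fun x => by rw [intervalIntegral.integral_symm, ← h x]; rfl) (le_of_not_ge hab)
    rw [intervalIntegral.integral_symm, ← this, map_neg, neg_neg]
  rcases hab.eq_or_lt with rfl | hlt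
  · have : f = 0 := by ext x; simp [h x]
    simp [this]
  have hba : (b - a) ≠ 0 := by linarith
  -- Spreading f evenly over the interval reduces the claim to an integral that vanishes pointwise.
  have key := integral_dist_eq_zero (μ := volume.restrict (Ioc a b))
    (F := fun τ => F τ - ((b - a : ℝ)⁻¹ : ℂ) • f) (hF.sub continuous_const)
    (fun m => (((continuous_schwartzNorm m).comp
      (hF.sub continuous_const)).integrableOn_Icc (a := a) (b := b)).mono_set Ioc_subset_Icc_self) ?_ u
  · simp only [map_sub] at key
    rw [integral_sub] at key
    · rw [intervalIntegral.integral_of_le hab]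
      have e : ∫ _ in Ioc a b, u (((b - a : ℝ)⁻¹ : ℂ) • f) = u f := by
        simp only [map_smul, integral_const, smul_eq_mul]
        rw [measureReal_restrict_apply_univ, Real.volume_real_Ioc_of_le hab, Complex.real_smul]
        have : ((b - a : ℝ) : ℂ) ≠ 0 := by exact_mod_cast hba
        field_simp
      rw [e] at key
      exact (sub_eq_zero.1 key).symm
    · exact (((map_continuous u).comp hF).integrableOn_Icc).mono_set Ioc_subset_Icc_self
    · exact (continuous_const.integrableOn_Icc).mono_set Ioc_subset_Icc_self
  · intro x
    have hc : Continuous fun τ => F τ x :=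
      (map_continuous (TemperedDistribution.delta x)).comp hF
    change ∫ τ in Ioc a b, (F τ x - ((b - a : ℝ)⁻¹ : ℂ) * f x) = 0
    rw [integral_sub ((hc.integrableOn_Icc).mono_set Ioc_subset_Icc_self)
      ((continuous_const.integrableOn_Icc).mono_set Ioc_subset_Icc_self),
      ← intervalIntegral.integral_of_le hab, ← h x, integral_const,
      measureReal_restrict_apply_univ, Real.volume_real_Ioc_of_le hab, Complex.real_smul]
    have : ((b - a : ℝ) : ℂ) ≠ 0 := by exact_mod_cast hba
    field_simp
    simp

/-- The weak fundamental theorem of calculus writes the function as the integral of the continuous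
candidate derivative; this replaces the convergence of difference quotients in the Schwartz
topology. -/
theorem hasDerivAt_dist_translate (u : 𝓢'(E, ℂ)) (f : 𝓢(E, ℂ)) (y m : E) (τ : ℝ) :
    HasDerivAt (fun τ : ℝ => u (translate (y + τ • m) f))
      (-u (translate (y + τ • m) (∂_{m} f))) τ := by
  have hc : Continuous fun τ : ℝ => -translate (y + τ • m) (∂_{m} f) :=
    ((continuous_translate (∂_{m} f)).comp (by fun_prop : Continuous fun τ : ℝ => y + τ • m)).neg
  have h1 : ∀ σ : ℝ, u (translate (y + σ • m) f) - u (translate y f) =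
      ∫ τ in (0 : ℝ)..σ, u (-translate (y + τ • m) (∂_{m} f)) := by
    intro σ
    rw [← map_sub]
    refine dist_eq_intervalIntegral hc (fun x => ?_) u
    have hd : ∀ τ : ℝ, HasDerivAt (fun τ : ℝ => f (x - (y + τ • m)))
        (-(∂_{m} f : 𝓢(E, ℂ)) (x - (y + τ • m))) τ := by
      intro τ
      have e1 := ((f.differentiable) (x - (y + τ • m))).hasFDerivAt
      have e2 : HasDerivAt (fun τ : ℝ => x - (y + τ • m)) (-m) τ := by
        simpa using (((hasDerivAt_id τ).smul_const m).const_add y).const_sub x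
      have e3 := e1.comp_hasDerivAt τ e2
      rw [map_neg, ← SchwartzMap.lineDerivOp_apply_eq_fderiv] at e3
      exact e3
    have := intervalIntegral.integral_eq_sub_of_hasDerivAt (a := 0) (b := σ)
      (fun τ _ => hd τ) (((∂_{m} f : 𝓢(E, ℂ)).continuous.comp (by fun_prop)).neg.intervalIntegrable _ _)
    change f (x - (y + σ • m)) - f (x - y) = ∫ τ in (0 : ℝ)..σ, -(∂_{m} f : 𝓢(E, ℂ)) (x - (y + τ • m))
    rw [this]
    simp
  have h2 : (fun τ : ℝ => u (translate (y + τ • m) f)) = fun σ =>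
      (∫ τ in (0 : ℝ)..σ, u (-translate (y + τ • m) (∂_{m} f))) + u (translate y f) := by
    funext σ; rw [← h1 σ]; ring
  rw [h2]
  have hc' : Continuous fun τ : ℝ => u (-translate (y + τ • m) (∂_{m} f)) :=
    (map_continuous u).comp hc
  have := (intervalIntegral.integral_hasDerivAt_right (hc'.intervalIntegrable 0 τ)
    (hc'.stronglyMeasurableAtFilter _ _) hc'.continuousAt).add_const (u (translate y f))
  rwa [map_neg] at this

end Translation

/-! ### Density of compactly supported test functions -/

section CompactSupport

variable {E : Type*} [NormedAddCommGroup E] [NormedSpace ℝ E] [FiniteDimensional ℝ E]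

/-- The approximants are θ(x/(n+1)) f(x) with a fixed bump θ. All derivatives of the rescaled bumps
are bounded uniformly in n, and the error lives on ‖x‖ ≥ n + 1. -/
theorem exists_tendsto_compactSupport (f : 𝓢(E, ℂ)) : ∃ g : ℕ → 𝓢(E, ℂ),
    (∀ n, HasCompactSupport (g n)) ∧ (∀ n, tsupport (g n) ⊆ tsupport f) ∧
      Tendsto g atTop (𝓝 f) := by
  let χ : ContDiffBump (0 : E) := ⟨1, 2, one_pos, one_lt_two⟩
  let θ : E → ℂ := fun x => (χ x : ℂ)
  have hθc : HasCompactSupport θ :=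
    χ.hasCompactSupport.comp_left (g := fun y : ℝ => (y : ℂ)) Complex.ofReal_zero
  have hθs : ContDiff ℝ ∞ θ := Complex.ofRealCLM.contDiff.comp χ.contDiff
  have hbd : ∀ j : ℕ, ∃ C : ℝ, 0 ≤ C ∧ ∀ x, ‖iteratedFDeriv ℝ j θ x‖ ≤ C := fun j => by
    obtain ⟨C, hC⟩ := (hθc.iteratedFDeriv (𝕜 := ℝ) j).exists_bound_of_continuous
      (hθs.continuous_iteratedFDeriv (by exact_mod_cast le_top))
    exact ⟨C, (norm_nonneg _).trans (hC 0), hC⟩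
  choose C hC0 hC using hbd
  let L : ℕ → E →L[ℝ] E := fun n => ((n : ℝ) + 1)⁻¹ • ContinuousLinearMap.id ℝ E
  have hL : ∀ n x, L n x = ((n : ℝ) + 1)⁻¹ • x := fun n x => rfl
  have hLn : ∀ n, ‖L n‖ ≤ 1 := fun n => by
    refine ContinuousLinearMap.opNorm_le_bound _ zero_le_one fun x => ?_
    rw [hL, norm_smul, Real.norm_of_nonneg (by positivity), one_mul]
    refine mul_le_of_le_one_left (norm_nonneg _) ?_
    exact inv_le_one_of_one_le₀ (by linarith [n.cast_nonneg (α := ℝ)])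
  have hLc : ∀ n, HasCompactSupport (θ ∘ L n) := fun n =>
    hθc.comp_homeomorph (Homeomorph.smulOfNeZero (((n : ℝ) + 1)⁻¹) (by positivity))
  have hLs : ∀ n, ContDiff ℝ ∞ (θ ∘ L n) := fun n => hθs.comp (L n).contDiff
  have hLt : ∀ n, (θ ∘ L n).HasTemperateGrowth := fun n => (hLc n).hasTemperateGrowth (hLs n)
  have hval : ∀ n x, SchwartzMap.smulLeftCLM ℂ (θ ∘ L n) f x = θ (L n x) * f x := fun n x => by
    rw [SchwartzMap.smulLeftCLM_apply_apply (hLt n)]; rfl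
  refine ⟨fun n => SchwartzMap.smulLeftCLM ℂ (θ ∘ L n) f, fun n => ?_, fun n =>
    (SchwartzMap.tsupport_smulLeftCLM_subset _ f).trans inter_subset_left, ?_⟩
  · have : (⇑(SchwartzMap.smulLeftCLM ℂ (θ ∘ L n) f) : E → ℂ) = (θ ∘ L n) * ⇑f :=
      funext (hval n)
    rw [this]
    exact (hLc n).mul_right
  rw [tendsto_schwartz_iff]
  intro m
  set A : ℝ := ∑ j ∈ Finset.range (m + 1), (C j + 1) with hA
  have hA0 : 0 ≤ A := Finset.sum_nonneg fun j _ => by linarith [hC0 j]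
  have hCA : ∀ j ≤ m, C j + 1 ≤ A := fun j hj =>
    Finset.single_le_sum (f := fun j => C j + 1) (fun j _ => by linarith [hC0 j])
      (Finset.mem_range.2 (Nat.lt_succ_iff.2 hj))
  set B : ℝ := 2 ^ m * A * schwartzNorm E (m + 1) f with hB
  have hB0 : 0 ≤ B := by positivity
  have hmain : ∀ n : ℕ, schwartzNorm E m (SchwartzMap.smulLeftCLM ℂ (θ ∘ L n) f - f) ≤
      B * ((n : ℝ) + 1)⁻¹ := by
    intro n
    refine schwartzNorm_le (by positivity) fun k hk i hi => ?_
    refine SchwartzMap.seminorm_le_bound ℂ k i _ (by positivity) fun x => ?_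
    have hfun : (⇑(SchwartzMap.smulLeftCLM ℂ (θ ∘ L n) f - f) : E → ℂ) =
        fun x => ((θ ∘ L n) x - 1) * f x := by
      funext x
      change SchwartzMap.smulLeftCLM ℂ (θ ∘ L n) f x - f x = _
      rw [hval]; simp; ring
    rw [hfun]
    rcases lt_or_ge ‖x‖ ((n : ℝ) + 1) with hx | hx
    · have hev : (fun x => ((θ ∘ L n) x - 1) * f x) =ᶠ[𝓝 x] fun _ => (0 : ℂ) := by
        filter_upwards [(isOpen_lt continuous_norm continuous_const).mem_nhds hx] with y hy
        have hy' : ‖y‖ < (n : ℝ) + 1 := hy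
        have : χ (L n y) = 1 := χ.one_of_mem_closedBall (by
          rw [mem_closedBall_zero_iff, hL, norm_smul, Real.norm_of_nonneg (by positivity)]
          change _ ≤ (1 : ℝ)
          rw [inv_mul_le_iff₀ (by positivity)]; linarith)
        simp [θ, this]
      rw [(hev.iteratedFDeriv ℝ i).eq_of_nhds]
      have : (fun _ : E => (0 : ℂ)) = 0 := rfl
      rw [this, iteratedFDeriv_zero]
      simp only [Pi.zero_apply, norm_zero, mul_zero]
      positivity
    · have hd : ∀ j ≤ m, ‖iteratedFDeriv ℝ j (fun x => (θ ∘ L n) x - 1) x‖ ≤ A := by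
        intro j hj
        have e1 : ‖iteratedFDeriv ℝ j (θ ∘ L n) x‖ ≤ C j := by
          rw [(L n).iteratedFDeriv_comp_right hθs x (by exact_mod_cast le_top)]
          refine (ContinuousMultilinearMap.norm_compContinuousLinearMap_le _ _).trans ?_
          refine (mul_le_of_le_one_right (norm_nonneg _) ?_).trans (hC j _)
          exact Finset.prod_le_one (fun _ _ => norm_nonneg _) (fun _ _ => hLn n)
        have e2 : ‖iteratedFDeriv ℝ j (fun _ : E => (1 : ℂ)) x‖ ≤ 1 := by
          rcases Nat.eq_zero_or_pos j with rfl | hj'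
          · simp
          · rw [iteratedFDeriv_const_of_ne (by omega)]; simp
        have e3 : iteratedFDeriv ℝ j (fun x => (θ ∘ L n) x - 1) x =
            iteratedFDeriv ℝ j (θ ∘ L n) x - iteratedFDeriv ℝ j (fun _ : E => (1 : ℂ)) x :=
          iteratedFDeriv_sub_apply ((hLs n).contDiffAt.of_le (by exact_mod_cast le_top))
            contDiffAt_const
        rw [e3]
        exact ((norm_sub_le _ _).trans (add_le_add e1 e2)).trans (hCA j hj)
      have hmul := norm_iteratedFDeriv_mul_le (𝕜 := ℝ) (N := (∞ : ℕ∞ω))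
        (f := fun x => (θ ∘ L n) x - 1) (g := f) ((hLs n).sub contDiff_const) (f.smooth ⊤) x
        (n := i) (by exact_mod_cast le_top)
      have hn0 : (0 : ℝ) < (n : ℝ) + 1 := by positivity
      -- Where the error does not vanish, one extra power of the weight is worth a factor 1/(n+1).
      have hx1 : ‖x‖ ^ k ≤ ((n : ℝ) + 1)⁻¹ * ‖x‖ ^ (k + 1) := by
        rw [le_inv_mul_iff₀ hn0, pow_succ, mul_comm]
        gcongr
      calc ‖x‖ ^ k * ‖iteratedFDeriv ℝ i (fun x => ((θ ∘ L n) x - 1) * f x) x‖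
          ≤ (((n : ℝ) + 1)⁻¹ * ‖x‖ ^ (k + 1)) * ∑ j ∈ Finset.range (i + 1), (i.choose j : ℝ) *
              ‖iteratedFDeriv ℝ j (fun x => (θ ∘ L n) x - 1) x‖ *
              ‖iteratedFDeriv ℝ (i - j) f x‖ := by gcongr
        _ = ∑ j ∈ Finset.range (i + 1), (i.choose j : ℝ) * (((n : ℝ) + 1)⁻¹ *
              ‖iteratedFDeriv ℝ j (fun x => (θ ∘ L n) x - 1) x‖ *
              (‖x‖ ^ (k + 1) * ‖iteratedFDeriv ℝ (i - j) f x‖)) := by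
            rw [Finset.mul_sum]; refine Finset.sum_congr rfl fun j _ => by ring
        _ ≤ ∑ j ∈ Finset.range (i + 1), (i.choose j : ℝ) *
              (((n : ℝ) + 1)⁻¹ * A * schwartzNorm E (m + 1) f) := by
            refine Finset.sum_le_sum fun j hj => ?_
            have hji : j ≤ i := by simpa [Nat.lt_succ_iff] using hj
            gcongr
            · exact hd j (hji.trans hi)
            · exact (SchwartzMap.le_seminorm ℂ (k + 1) (i - j) f x).trans
                (seminorm_le_schwartzNorm (by omega) (by omega) f)
        _ = 2 ^ i * (((n : ℝ) + 1)⁻¹ * A * schwartzNorm E (m + 1) f) := by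
            rw [← Finset.sum_mul]
            congr 1
            exact_mod_cast Nat.sum_range_choose i
        _ ≤ 2 ^ m * (((n : ℝ) + 1)⁻¹ * A * schwartzNorm E (m + 1) f) := by
            gcongr
            exact one_le_two
        _ = _ := by rw [hB]; ring
  refine squeeze_zero (fun n => apply_nonneg _ _) hmain ?_
  have := (tendsto_one_div_add_atTop_nhds_zero_nat (𝕜 := ℝ)).const_mul B
  simpa using this

theorem isVanishingOn_of_compactSupport {u : 𝓢'(E, ℂ)} {s : Set E}
    (h : ∀ f : 𝓢(E, ℂ), HasCompactSupport f → tsupport f ⊆ s → u f = 0) : IsVanishingOn u s := by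
  intro f hf
  obtain ⟨g, hg, hgs, hlim⟩ := exists_tendsto_compactSupport f
  have h1 := ((map_continuous u).tendsto f).comp hlim
  refine tendsto_nhds_unique h1 ?_
  have : (⇑u ∘ g) = fun _ => 0 := funext fun n => h _ (hg n) ((hgs n).trans hf)
  rw [this]
  exact tendsto_const_nhds

theorem dist_ext_compactSupport {u v : 𝓢'(E, ℂ)}
    (h : ∀ f : 𝓢(E, ℂ), HasCompactSupport f → u f = v f) : u = v := by
  ext f
  have := isVanishingOn_of_compactSupport (u := u - v) (s := univ)
    (fun f hf _ => by change u f - v f = 0; rw [h f hf, sub_self]) f (subset_univ _)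
  exact sub_eq_zero.1 this

end CompactSupport

/-! ### Distributions vanishing on a half space -/

section Cutoff

theorem contDiff_halfLineCutoff : ContDiff ℝ ∞ halfLineCutoff :=
  Real.smoothTransition.contDiff.comp (contDiff_id.add contDiff_const)

theorem halfLineCutoff_eq_zero {t : ℝ} (ht : t ≤ -2) : halfLineCutoff t = 0 :=
  Real.smoothTransition.zero_of_nonpos (by linarith)

theorem halfLineCutoff_eq_one {t : ℝ} (ht : -1 ≤ t) : halfLineCutoff t = 1 :=
  Real.smoothTransition.one_of_one_le (by linarith)

theorem hasTemperateGrowth_halfLineCutoff :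
    (fun t : ℝ => (halfLineCutoff t : ℂ)).HasTemperateGrowth := by
  have hs : ContDiff ℝ ∞ (fun t : ℝ => (halfLineCutoff t : ℂ)) :=
    Complex.ofRealCLM.contDiff.comp contDiff_halfLineCutoff
  refine ⟨hs, fun n => ⟨0, ?_⟩⟩
  rcases Nat.eq_zero_or_pos n with rfl | hn
  · refine ⟨1, fun t => ?_⟩
    simp only [norm_iteratedFDeriv_zero, pow_zero, mul_one, Complex.norm_real, Real.norm_eq_abs]
    rw [halfLineCutoff, abs_of_nonneg (Real.smoothTransition.nonneg _)]
    exact Real.smoothTransition.le_one _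
  · obtain ⟨C, hC⟩ := (isCompact_Icc (a := (-2 : ℝ)) (b := -1)).exists_bound_of_continuousOn
      (hs.continuous_iteratedFDeriv (m := n) (by exact_mod_cast le_top)).continuousOn
    have hz : ∀ (c : ℂ) (t : ℝ), (fun t : ℝ => (halfLineCutoff t : ℂ)) =ᶠ[𝓝 t] (fun _ => c) →
        iteratedFDeriv ℝ n (fun t : ℝ => (halfLineCutoff t : ℂ)) t = 0 := fun c t h => by
      rw [(h.iteratedFDeriv ℝ n).eq_of_nhds, iteratedFDeriv_const_of_ne (by omega)]
      rfl
    refine ⟨max C 0, fun t => ?_⟩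
    rw [pow_zero, mul_one]
    rcases lt_or_ge t (-2) with h | h
    · rw [hz 0 t, norm_zero]
      · exact le_max_right _ _
      · filter_upwards [Iio_mem_nhds h] with y hy
        rw [halfLineCutoff_eq_zero (le_of_lt hy)]; simp
    rcases le_or_gt t (-1) with h' | h'
    · exact (hC t ⟨h, h'⟩).trans (le_max_left _ _)
    · rw [hz 1 t, norm_zero]
      · exact le_max_right _ _
      · filter_upwards [Ioi_mem_nhds h'] with y hy
        rw [halfLineCutoff_eq_one (le_of_lt hy)]; simp

variable {E : Type*} [NormedAddCommGroup E] [NormedSpace ℝ E]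

/-- Multiplication by the half line cutoff in the variable `L x`. -/
def cutoffCLM (L : E →L[ℝ] ℝ) : 𝓢(E, ℂ) →L[ℂ] 𝓢(E, ℂ) :=
  SchwartzMap.smulLeftCLM ℂ ((fun t : ℝ => (halfLineCutoff t : ℂ)) ∘ L)

@[simp] theorem cutoffCLM_apply (L : E →L[ℝ] ℝ) (f : 𝓢(E, ℂ)) (x : E) :
    cutoffCLM L f x = halfLineCutoff (L x) * f x := by
  rw [cutoffCLM, SchwartzMap.smulLeftCLM_apply_apply
    (hasTemperateGrowth_halfLineCutoff.comp L.hasTemperateGrowth)]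
  rfl

/-- The margin -1 matters: functions that agree for L x > -1 differ by a function whose closed
support lies in L x ≤ -1, inside the open half space where u vanishes. This is what allows pairings
with e^{-st}, whose growth for t → -∞ is cut off. -/
theorem dist_congr_halfSpace {L : E →L[ℝ] ℝ} {u : 𝓢'(E, ℂ)} (hu : IsVanishingOn u {x | L x < 0})
    {f g : 𝓢(E, ℂ)} (h : ∀ x, -1 < L x → f x = g x) : u f = u g := by
  have h : u (f - g) = 0 := by
    refine hu _ ?_
    have hsub : tsupport (⇑(f - g) : E → ℂ) ⊆ {x | L x ≤ -1} := by
      refine closure_minimal (fun x hx => ?_) (isClosed_le L.continuous continuous_const)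
      by_contra hcon
      refine hx ?_
      change f x - g x = 0
      rw [h x (not_le.1 hcon), sub_self]
    intro x hx
    have : L x ≤ -1 := hsub hx
    change L x < 0
    linarith
  rwa [map_sub, sub_eq_zero] at h

theorem dist_cutoffCLM {L : E →L[ℝ] ℝ} {u : 𝓢'(E, ℂ)} (hu : IsVanishingOn u {x | L x < 0})
    (f : 𝓢(E, ℂ)) : u (cutoffCLM L f) = u f :=
  dist_congr_halfSpace hu fun x hx => by
    rw [cutoffCLM_apply, halfLineCutoff_eq_one hx.le, Complex.ofReal_one, one_mul]

end Cutoff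

/-! ### Exponential weights and Fourier uniqueness -/

section ExpWeight

-- From y^j ≤ j! e^y at y = 1 + cx; the 3 bounds e. The dependence on c is explicit because c = Re
-- (s ρ(s)) will vary with s.
open Nat in
theorem one_add_pow_mul_exp_neg_le {x c : ℝ} (hx : 0 ≤ x) (hc : 0 < c) (j : ℕ) :
    (1 + x) ^ j * Real.exp (-(c * x)) ≤ 3 * j ! * (1 + c⁻¹) ^ j := by
  have h1 : 1 + x ≤ (1 + c⁻¹) * (1 + c * x) := by
    have : (1 + c⁻¹) * (1 + c * x) = 1 + x + (c * x + c⁻¹) := by field_simp; ring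
    rw [this]
    have : 0 ≤ c * x + c⁻¹ := by positivity
    linarith
  have h2 : (1 + c * x) ^ j ≤ j ! * Real.exp (1 + c * x) := by
    have := Real.pow_div_factorial_le_exp (1 + c * x) (by positivity) j
    rwa [div_le_iff₀ (by positivity), mul_comm _ (j ! : ℝ)] at this
  calc (1 + x) ^ j * Real.exp (-(c * x))
      ≤ ((1 + c⁻¹) * (1 + c * x)) ^ j * Real.exp (-(c * x)) := by gcongr
    _ = (1 + c⁻¹) ^ j * (1 + c * x) ^ j * Real.exp (-(c * x)) := by rw [mul_pow]
    _ ≤ (1 + c⁻¹) ^ j * (j ! * Real.exp (1 + c * x)) * Real.exp (-(c * x)) := by gcongr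
    _ = (1 + c⁻¹) ^ j * j ! * Real.exp 1 := by
        rw [mul_assoc, mul_assoc, mul_assoc, ← Real.exp_add]; ring_nf
    _ ≤ (1 + c⁻¹) ^ j * j ! * 3 := by
        gcongr
        exact Real.exp_one_lt_d9.le.trans (by norm_num)
    _ = _ := by ring

theorem exists_pow_mul_exp_neg_le (a : ℝ) {c : ℝ} (hc : 0 < c) (M : ℕ) : ∃ K : ℝ, 0 ≤ K ∧
    ∀ t, a ≤ t → (1 + |t|) ^ M * Real.exp (-(c * t)) ≤ K * Real.exp (-(c / 2 * (t - a))) := by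
  refine ⟨(1 + |a|) ^ M * Real.exp (-(c * a)) * (3 * M.factorial * (1 + (c / 2)⁻¹) ^ M),
    by positivity, fun t ht => ?_⟩
  have h1 : 1 + |t| ≤ (1 + |a|) * (1 + (t - a)) := by
    have : |t| ≤ (t - a) + |a| := by
      have := abs_add_le (t - a) a
      rwa [sub_add_cancel, abs_of_nonneg (sub_nonneg.2 ht)] at this
    nlinarith [abs_nonneg a]
  have h2 := one_add_pow_mul_exp_neg_le (sub_nonneg.2 ht) (half_pos hc) M
  calc (1 + |t|) ^ M * Real.exp (-(c * t))
      ≤ ((1 + |a|) * (1 + (t - a))) ^ M * Real.exp (-(c * t)) := by gcongr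
    _ = (1 + |a|) ^ M * Real.exp (-(c * a)) *
        ((1 + (t - a)) ^ M * Real.exp (-(c / 2 * (t - a)))) * Real.exp (-(c / 2 * (t - a))) := by
        rw [mul_pow, show -(c * t) = -(c * a) + -(c / 2 * (t - a)) + -(c / 2 * (t - a)) by ring,
          Real.exp_add, Real.exp_add]
        ring
    _ ≤ _ := by gcongr

theorem integrable_exp_half (a : ℝ) {c : ℝ} (hc : 0 < c) (K : ℝ) :
    Integrable (indicator (Ici a) fun t => K * Real.exp (-(c / 2 * (t - a)))) := by
  rw [integrable_indicator_iff measurableSet_Ici, integrableOn_Ici_iff_integrableOn_Ioi]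
  have h : (fun t => K * Real.exp (-(c / 2 * (t - a)))) =
      fun t => K * Real.exp (c / 2 * a) * Real.exp (-(c / 2) * t) := by
    funext t
    rw [mul_assoc, ← Real.exp_add]
    ring_nf
  rw [h]
  exact (exp_neg_integrableOn_Ioi a (half_pos hc)).const_mul _

variable {f : ℝ → ℂ} {a C : ℝ} {M : ℕ}

theorem norm_exp_neg_mul (s : ℂ) (t : ℝ) :
    ‖Complex.exp (-s * t)‖ = Real.exp (-(s.re * t)) := by
  rw [Complex.norm_exp]; simp

theorem exists_norm_exp_neg_mul_le (h0 : ∀ t, t < a → f t = 0)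
    (hb : ∀ t, ‖f t‖ ≤ C * (1 + |t|) ^ M) {c : ℝ} (hc : 0 < c) : ∃ K : ℝ, 0 ≤ K ∧
    ∀ s : ℂ, s.re = c → ∀ t : ℝ, ‖Complex.exp (-s * t) * f t‖ ≤
      indicator (Ici a) (fun t => K * Real.exp (-(c / 2 * (t - a)))) t := by
  obtain ⟨K, hK, h⟩ := exists_pow_mul_exp_neg_le a hc M
  have hC : 0 ≤ C := by simpa using (norm_nonneg _).trans (hb 0)
  refine ⟨C * K, by positivity, fun s hs t => ?_⟩
  rw [norm_mul, norm_exp_neg_mul, hs]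
  rcases lt_or_ge t a with ht | ht
  · rw [h0 t ht, indicator_of_notMem (by simpa using ht)]; simp
  · rw [indicator_of_mem (by simpa using ht)]
    calc Real.exp (-(c * t)) * ‖f t‖ ≤ Real.exp (-(c * t)) * (C * (1 + |t|) ^ M) := by
          gcongr; exact hb t
      _ = C * ((1 + |t|) ^ M * Real.exp (-(c * t))) := by ring
      _ ≤ C * (K * Real.exp (-(c / 2 * (t - a)))) := mul_le_mul_of_nonneg_left (h t ht) hC
      _ = _ := by ring

theorem integrable_exp_neg_mul (hf : AEStronglyMeasurable f) (h0 : ∀ t, t < a → f t = 0)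
    (hb : ∀ t, ‖f t‖ ≤ C * (1 + |t|) ^ M) {s : ℂ} (hs : 0 < s.re) :
    Integrable fun t : ℝ => Complex.exp (-s * t) * f t := by
  obtain ⟨K, hK, h⟩ := exists_norm_exp_neg_mul_le h0 hb hs
  refine (integrable_exp_half a hs K).mono' ?_ (Eventually.of_forall (h s rfl))
  exact (Continuous.aestronglyMeasurable (by fun_prop)).mul hf

theorem bddAbove_exp_neg_mul (h0 : ∀ t, t < a → f t = 0)
    (hb : ∀ t, ‖f t‖ ≤ C * (1 + |t|) ^ M) {s : ℂ} (hs : 0 < s.re) :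
    BddAbove (range fun t : ℝ => ‖Complex.exp (-s * t) * f t‖) := by
  obtain ⟨K, hK, h⟩ := exists_norm_exp_neg_mul_le h0 hb hs
  refine ⟨K, ?_⟩
  rintro _ ⟨t, rfl⟩
  refine (h s rfl t).trans ?_
  refine indicator_le' (fun t ht => ?_) (fun _ _ => hK) t
  refine mul_le_of_le_one_right hK (Real.exp_le_one_iff.2 ?_)
  have : 0 ≤ t - a := sub_nonneg.2 ht
  have : 0 ≤ s.re / 2 * (t - a) := by positivity
  linarith

-- Fourier inversion, in the angular frequency w so that the hypothesis reads as the vanishing of a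
-- Laplace transform on a vertical line.
open FourierTransform in
theorem eq_zero_of_fourier_eq_zero {h : ℝ → ℂ} (hc : Continuous h) (hi : Integrable h)
    (h0 : ∀ w : ℝ, ∫ t : ℝ, Complex.exp (-(w * Complex.I) * t) * h t = 0) : h = 0 := by
  have hF : 𝓕 h = 0 := by
    funext ξ
    rw [Real.fourier_eq', Pi.zero_apply]
    rw [← h0 (2 * Real.pi * ξ)]
    refine integral_congr_ae (Eventually.of_forall fun t => ?_)
    simp only [smul_eq_mul]
    congr 2
    simp [inner]
    ring
  have := hc.fourierInv_fourier_eq hi (by rw [hF]; exact integrable_zero _ _ _)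
  rw [← this, hF]
  funext t
  rw [Real.fourierInv_eq']
  simp

end ExpWeight

/-! ### Laplace transform and convolution on the half line -/

section LaplaceLine

/-- A tempered distribution on the line vanishing on the negative half line. -/
theorem regularize_eq_zero_of_lt {y : 𝓢'(ℝ, ℂ)} (hy : IsVanishingOn y (Iio 0)) {φ : 𝓢(ℝ, ℂ)}
    {R : ℝ} (hR : ∀ x, R < |x| → φ x = 0) {t : ℝ} (ht : t < -(R + 1)) : regularize y φ t = 0 := by
  have h := dist_congr_halfSpace (L := ContinuousLinearMap.id ℝ ℝ) (u := y) hy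
    (f := reflTranslate φ t) (g := 0) (fun x hx => by
      rw [reflTranslate_apply]
      refine hR _ ?_
      have : (-1 : ℝ) < x := hx
      rw [lt_abs]; right; linarith)
  rw [regularize, h, map_zero]

theorem exists_abs_bound_of_hasCompactSupport {φ : 𝓢(ℝ, ℂ)} (hφ : HasCompactSupport φ) :
    ∃ R : ℝ, 0 ≤ R ∧ ∀ x, R < |x| → φ x = 0 := by
  obtain ⟨R, hR⟩ := hφ.isCompact.isBounded.exists_norm_le
  refine ⟨max R 0, le_max_right _ _, fun x hx => ?_⟩
  by_contra h
  have := hR x (subset_tsupport _ h)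
  rw [Real.norm_eq_abs] at this
  exact absurd hx (not_lt.2 (this.trans (le_max_left _ _)))

theorem laplace_of_pos (y : 𝓢'(ℝ, ℂ)) {s : ℂ} (hs : 0 < s.re) :
    laplace y s = y (laplaceKernel s hs) := dif_pos hs

theorem laplaceKernel_apply {s : ℂ} (hs : 0 < s.re) (t : ℝ) :
    laplaceKernel s hs t = (halfLineCutoff t : ℂ) * Complex.exp (-s * t) := rfl

/-- For fixed x, ∫ e^{-st} φ(t - x) dt = e^{-sx} ∫ e^{-st} φ(t) dt; the point is to apply y in x
under the integral. Both sides are made integrals of Schwartz-valued functions of t with equal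
pointwise integrals, and `integral_dist_eq_zero` passes from points to y. -/
theorem integral_exp_regularize {y : 𝓢'(ℝ, ℂ)} (hy : IsVanishingOn y (Iio 0)) {φ : 𝓢(ℝ, ℂ)}
    (hφ : HasCompactSupport φ) {s : ℂ} (hs : 0 < s.re) :
    ∫ t : ℝ, Complex.exp (-s * t) * regularize y φ t =
      laplace y s * ∫ t : ℝ, Complex.exp (-s * t) * φ t := by
  obtain ⟨R, hR0, hR⟩ := exists_abs_bound_of_hasCompactSupport hφ
  have hcs : HasCompactSupport fun t : ℝ => Complex.exp (-s * t) * φ t := hφ.mul_left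
  set L := ContinuousLinearMap.id ℝ ℝ
  -- The cutoff in x does not change the pairing with y, but makes F(t) vanish for t < -(R + 2),
  -- where e^{-st} would be large.
  let F : ℝ → 𝓢(ℝ, ℂ) := fun t => Complex.exp (-s * t) • cutoffCLM L (reflTranslate φ t)
  let B : ℝ → 𝓢(ℝ, ℂ) := fun t => (Complex.exp (-s * t) * φ t) • laplaceKernel s hs
  have hFc : Continuous F := by
    have : Continuous fun t : ℝ => Complex.exp (-s * t) := by fun_prop
    exact this.smul ((cutoffCLM L).continuous.comp (continuous_reflTranslate φ))
  have hgc : Continuous fun t : ℝ => Complex.exp (-s * t) * φ t :=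
    (by fun_prop : Continuous fun t : ℝ => Complex.exp (-s * t)).mul φ.continuous
  have hBc : Continuous B := hgc.smul continuous_const
  have hF0 : ∀ t, t < -(R + 2) → F t = 0 := fun t ht => by
    ext x
    change Complex.exp (-s * t) * cutoffCLM L (reflTranslate φ t) x = 0
    rw [cutoffCLM_apply, reflTranslate_apply]
    rcases le_or_gt x (-2) with hx | hx
    · rw [show L x = x from rfl, halfLineCutoff_eq_zero hx]; simp
    · rw [hR (t - x) (by rw [lt_abs]; right; linarith)]; simp
  have hFi : ∀ m, Integrable (fun t => schwartzNorm ℝ m (F t)) := fun m => by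
    obtain ⟨m', C, hC, h⟩ := exists_schwartzNorm_comp_le (cutoffCLM L) m
    have hb : ∀ t, ‖((schwartzNorm ℝ m (cutoffCLM L (indicator (Ici (-(R + 2)))
        (fun t => reflTranslate φ t) t)) : ℝ) : ℂ)‖ ≤
        (C * 2 ^ m' * schwartzNorm ℝ m' (reflect φ)) * (1 + |t|) ^ m' := fun t => by
      rw [Complex.norm_real, Real.norm_of_nonneg (apply_nonneg _ _)]
      refine (h _).trans ?_
      by_cases ht : t ∈ Ici (-(R + 2))
      · rw [indicator_of_mem ht, reflTranslate_eq]
        calc C * schwartzNorm ℝ m' (translate t (reflect φ))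
            ≤ C * (2 ^ m' * (1 + ‖t‖) ^ m' * schwartzNorm ℝ m' (reflect φ)) := by
              gcongr; exact schwartzNorm_translate_le _ _ _
          _ = _ := by rw [Real.norm_eq_abs]; ring
      · rw [indicator_of_notMem ht, map_zero]; simp only [mul_zero]; positivity
    have h0 : ∀ t, t < -(R + 2) → ((schwartzNorm ℝ m (cutoffCLM L (indicator (Ici (-(R + 2)))
        (fun t => reflTranslate φ t) t)) : ℝ) : ℂ) = 0 := fun t ht => by
      rw [indicator_of_notMem (by simpa using ht)]; simp
    obtain ⟨K, hK, hle⟩ := exists_norm_exp_neg_mul_le h0 hb hs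
    refine (integrable_exp_half (-(R + 2)) hs K).mono'
      ((continuous_schwartzNorm m).comp hFc).aestronglyMeasurable (Eventually.of_forall fun t => ?_)
    refine le_trans (le_of_eq ?_) (hle s rfl t)
    rw [Real.norm_of_nonneg (apply_nonneg _ _), norm_mul, Complex.norm_real,
      Real.norm_of_nonneg (apply_nonneg _ _)]
    by_cases ht : t ∈ Ici (-(R + 2))
    · rw [indicator_of_mem ht, ← map_smul_eq_mul]
    · rw [indicator_of_notMem ht, hF0 t (by simpa using ht)]; simp
  have hBi : ∀ m, Integrable (fun t => schwartzNorm ℝ m (B t)) := fun m => by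
    have : (fun t : ℝ => schwartzNorm ℝ m (B t)) = fun t : ℝ =>
        ‖Complex.exp (-s * t) * φ t‖ * schwartzNorm ℝ m (laplaceKernel s hs) :=
      funext fun t => map_smul_eq_mul _ _ _
    rw [this]
    exact (hgc.integrable_of_hasCompactSupport hcs).norm.mul_const _
  have key := integral_dist_eq_zero (F := fun t => F t - B t) (μ := volume) (hFc.sub hBc)
    (fun m => ((hFi m).add (hBi m)).mono'
      ((continuous_schwartzNorm m).comp (hFc.sub hBc)).aestronglyMeasurable
      (Eventually.of_forall fun t => by
        rw [Real.norm_of_nonneg (apply_nonneg _ _)]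
        exact map_sub_le_add _ _ _)) ?_ y
  · simp only [map_sub] at key
    rw [integral_sub (integrable_dist hFc hFi y) (integrable_dist hBc hBi y), sub_eq_zero] at key
    have e1 : ∀ t : ℝ, y (F t) = Complex.exp (-s * t) * regularize y φ t := fun t => by
      change y (Complex.exp (-s * t) • cutoffCLM L (reflTranslate φ t)) = _
      rw [map_smul, dist_cutoffCLM hy, smul_eq_mul]; rfl
    have e2 : ∀ t : ℝ, y (B t) = laplace y s * (Complex.exp (-s * t) * φ t) := fun t => by
      change y ((Complex.exp (-s * t) * φ t) • laplaceKernel s hs) = _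
      rw [map_smul, laplace_of_pos y hs, smul_eq_mul, mul_comm]
    simp only [e1, e2] at key
    rw [key, integral_const_mul]
  · intro x
    change ∫ t : ℝ, (Complex.exp (-s * t) * cutoffCLM L (reflTranslate φ t) x -
      (Complex.exp (-s * t) * φ t) * laplaceKernel s hs x) = 0
    simp only [cutoffCLM_apply, reflTranslate_apply, laplaceKernel_apply]
    have e : ∀ t : ℝ, Complex.exp (-s * (t : ℂ)) * ((halfLineCutoff (L x) : ℂ) * φ (t - x)) =
        ((halfLineCutoff x : ℂ) * Complex.exp (-s * x)) *
          (Complex.exp (-s * ((t - x : ℝ) : ℂ)) * φ (t - x)) := fun t => by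
      have : Complex.exp (-s * t) = Complex.exp (-s * x) * Complex.exp (-s * ((t - x : ℝ) : ℂ)) := by
        rw [← Complex.exp_add]; push_cast; ring_nf
      rw [this, show L x = x from rfl]; ring
    have hgi := hgc.integrable_of_hasCompactSupport hcs (μ := volume)
    simp only [e]
    rw [integral_sub ((hgi.comp_sub_right x).const_mul _) (hgi.mul_const _), integral_const_mul,
      integral_mul_const, integral_sub_right_eq_self (fun t : ℝ => Complex.exp (-s * t) * φ t) x]
    ring

/-- The weighted regularization is continuous, integrable and bounded. -/
theorem exp_mul_regularize_props {y : 𝓢'(ℝ, ℂ)} (hy : IsVanishingOn y (Iio 0)) {φ : 𝓢(ℝ, ℂ)}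
    (hφ : HasCompactSupport φ) {s : ℂ} (hs : 0 < s.re) :
    Continuous (fun t : ℝ => Complex.exp (-s * t) * regularize y φ t) ∧
    Integrable (fun t : ℝ => Complex.exp (-s * t) * regularize y φ t) ∧
    BddAbove (range fun t : ℝ => ‖Complex.exp (-s * t) * regularize y φ t‖) := by
  obtain ⟨R, -, hR⟩ := exists_abs_bound_of_hasCompactSupport hφ
  obtain ⟨M, C, -, hC⟩ := exists_regularize_le y φ
  have h0 : ∀ t, t < -(R + 1) → regularize y φ t = 0 := fun t =>
    regularize_eq_zero_of_lt hy hR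
  exact ⟨(by fun_prop : Continuous fun t : ℝ => Complex.exp (-s * t)).mul
      (continuous_regularize y φ),
    integrable_exp_neg_mul (continuous_regularize y φ).aestronglyMeasurable h0 hC hs,
    bddAbove_exp_neg_mul h0 hC hs⟩

theorem exp_mul_schwartz_props {φ : 𝓢(ℝ, ℂ)} (hφ : HasCompactSupport φ) (s : ℂ) :
    Continuous (fun t : ℝ => Complex.exp (-s * t) * φ t) ∧
    Integrable (fun t : ℝ => Complex.exp (-s * t) * φ t) ∧
    BddAbove (range fun t : ℝ => ‖Complex.exp (-s * t) * φ t‖) := by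
  have hc : Continuous (fun t : ℝ => Complex.exp (-s * t) * φ t) :=
    (by fun_prop : Continuous fun t : ℝ => Complex.exp (-s * t)).mul φ.continuous
  have hcs : HasCompactSupport fun t : ℝ => Complex.exp (-s * t) * φ t := hφ.mul_left
  obtain ⟨C, hC⟩ := hcs.exists_bound_of_continuous hc
  exact ⟨hc, hc.integrable_of_hasCompactSupport hcs, C, by rintro _ ⟨t, rfl⟩; exact hC t⟩

theorem exp_mul_convolution {f g : ℝ → ℂ} (s : ℂ) (x y : ℝ) :
    Complex.exp (-s * x) * (f (x - y) * g y) =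
      (Complex.exp (-s * y) * g y) * (Complex.exp (-s * ((x - y : ℝ) : ℂ)) * f (x - y)) := by
  have : Complex.exp (-s * x) = Complex.exp (-s * y) * Complex.exp (-s * ((x - y : ℝ) : ℂ)) := by
    rw [← Complex.exp_add]; push_cast; ring_nf
  rw [this]; ring

open Convolution in
theorem exp_mul_integral_eq_convolution {f g : ℝ → ℂ} (s : ℂ) (x : ℝ) :
    Complex.exp (-s * x) * ∫ y, f (x - y) * g y =
      ((fun y : ℝ => Complex.exp (-s * y) * g y) ⋆[ContinuousLinearMap.mul ℂ ℂ]
        (fun y : ℝ => Complex.exp (-s * y) * f y)) x := by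
  rw [← integral_const_mul, convolution_def]
  exact integral_congr_ae (Eventually.of_forall fun y => exp_mul_convolution s x y)

/-- Laplace transform of a convolution of functions. -/
theorem integral_exp_mul_convolution {f g : ℝ → ℂ} {s : ℂ}
    (hf : Integrable fun t : ℝ => Complex.exp (-s * t) * f t)
    (hg : Integrable fun t : ℝ => Complex.exp (-s * t) * g t) :
    ∫ x : ℝ, Complex.exp (-s * x) * ∫ y, f (x - y) * g y =
      (∫ t : ℝ, Complex.exp (-s * t) * f t) * ∫ t : ℝ, Complex.exp (-s * t) * g t := by
  simp only [exp_mul_integral_eq_convolution]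
  rw [integral_convolution _ hg hf, ContinuousLinearMap.mul_apply', mul_comm]

/-- After multiplication by e^{-x} both sides of Chevalley's identity are continuous and integrable,
and their Fourier transforms are the Laplace transforms on Re s = 1, where they agree. -/
theorem isConv_of_laplace {y₁ y₂ y₃ : 𝓢'(ℝ, ℂ)} (h₁ : IsVanishingOn y₁ (Iio 0))
    (h₂ : IsVanishingOn y₂ (Iio 0)) (h₃ : IsVanishingOn y₃ (Iio 0))
    (h : ∀ s : ℂ, 0 < s.re → laplace y₃ s = laplace y₁ s * laplace y₂ s) : IsConv y₁ y₂ y₃ := by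
  intro φ ψ hφ hψ x
  have p1 := fun {s : ℂ} (hs : 0 < s.re) => exp_mul_regularize_props h₁ hφ hs
  have p2 := fun {s : ℂ} (hs : 0 < s.re) => exp_mul_regularize_props h₂ hψ hs
  have p3 := fun {s : ℂ} (hs : 0 < s.re) => exp_mul_regularize_props h₃ hφ hs
  have p4 := fun (s : ℂ) => exp_mul_schwartz_props hψ s
  have h1 : 0 < (1 : ℂ).re := by simp
  refine ⟨?_, ?_⟩
  · have := (p2 h1).2.2
    obtain ⟨C, hC⟩ := (p1 h1).2.2
    have hi : Integrable fun y : ℝ => (Complex.exp (-1 * y) * regularize y₂ ψ y) *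
        (Complex.exp (-1 * ((x - y : ℝ) : ℂ)) * regularize y₁ φ (x - y)) :=
      (p2 h1).2.1.mul_bdd (c := C)
        (((p1 h1).1.comp (continuous_const.sub continuous_id)).aestronglyMeasurable)
        (Eventually.of_forall fun y => hC ⟨x - y, rfl⟩)
    refine (hi.const_mul (Complex.exp (1 * x))).congr (Eventually.of_forall fun y => ?_)
    simp only [← exp_mul_convolution]
    rw [← mul_assoc, ← Complex.exp_add]
    simp
  · let D : ℝ → ℂ := fun x => (∫ y, regularize y₃ φ (x - y) * ψ y) -
      ∫ y, regularize y₁ φ (x - y) * regularize y₂ ψ y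
    have hD : (fun x : ℝ => Complex.exp (-1 * x) * D x) = 0 := by
      have hc3 := BddAbove.continuous_convolution_right_of_integrable
        (ContinuousLinearMap.mul ℂ ℂ) (p3 h1).2.2 (p4 1).2.1 (p3 h1).1
      have hc1 := BddAbove.continuous_convolution_right_of_integrable
        (ContinuousLinearMap.mul ℂ ℂ) (p1 h1).2.2 (p2 h1).2.1 (p1 h1).1
      have hi3 := Integrable.integrable_convolution (ContinuousLinearMap.mul ℂ ℂ) (p4 1).2.1
        (p3 h1).2.1
      have hi1 := Integrable.integrable_convolution (ContinuousLinearMap.mul ℂ ℂ) (p2 h1).2.1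
        (p1 h1).2.1
      refine eq_zero_of_fourier_eq_zero ?_ ?_ fun w => ?_
      · refine (hc3.sub hc1).congr fun x => ?_
        simp only [Pi.sub_apply, ← exp_mul_integral_eq_convolution, D, mul_sub]
      · refine (hi3.sub hi1).congr (Eventually.of_forall fun x => ?_)
        simp only [Pi.sub_apply, ← exp_mul_integral_eq_convolution, D, mul_sub]
      · set s : ℂ := 1 + w * Complex.I with hs
        have hs0 : 0 < s.re := by simp [hs]
        have e : ∀ x : ℝ, Complex.exp (-(w * Complex.I) * x) * (Complex.exp (-1 * x) * D x) =
            Complex.exp (-s * x) * (∫ y, regularize y₃ φ (x - y) * ψ y) -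
            Complex.exp (-s * x) * ∫ y, regularize y₁ φ (x - y) * regularize y₂ ψ y := fun x => by
          rw [← mul_assoc, ← Complex.exp_add, ← mul_sub, hs]; congr 2; ring
        simp only [e]
        rw [integral_sub, integral_exp_mul_convolution (p3 hs0).2.1 (p4 s).2.1,
          integral_exp_mul_convolution (p1 hs0).2.1 (p2 hs0).2.1,
          integral_exp_regularize h₃ hφ hs0, integral_exp_regularize h₁ hφ hs0,
          integral_exp_regularize h₂ hψ hs0, h s hs0]
        · ring
        · simp only [exp_mul_integral_eq_convolution]
          exact Integrable.integrable_convolution _ (p4 s).2.1 (p3 hs0).2.1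
        · simp only [exp_mul_integral_eq_convolution]
          exact Integrable.integrable_convolution _ (p2 hs0).2.1 (p1 hs0).2.1
    have := congrFun hD x
    simp only [Pi.zero_apply, mul_eq_zero, Complex.exp_ne_zero, false_or] at this
    exact sub_eq_zero.1 this

theorem hasCompactSupport_expKernel (z : ℂ) : HasCompactSupport (expKernel z) := by
  let χ : ContDiffBump (1 / 2 : ℝ) := ⟨1, 2, one_pos, one_lt_two⟩
  exact (χ.hasCompactSupport.comp_left (g := fun y : ℝ => (y : ℂ)) Complex.ofReal_zero).mul_right

theorem integral_exp_neg_mul_expKernel_ne_zero (s : ℂ) :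
    ∫ t : ℝ, Complex.exp (-s * t) * expKernel s t ≠ 0 := by
  let χ : ContDiffBump (1 / 2 : ℝ) := ⟨1, 2, one_pos, one_lt_two⟩
  have : ∀ t : ℝ, Complex.exp (-s * t) * expKernel s t = ((χ t : ℝ) : ℂ) := fun t => by
    change Complex.exp (-s * t) * ((χ t : ℂ) * Complex.exp (t * s)) = _
    rw [mul_left_comm, ← Complex.exp_add]
    ring_nf
    simp
  simp only [this]
  rw [integral_complex_ofReal]
  exact_mod_cast (χ.integral_pos (μ := volume)).ne'

/-- Taking the Laplace transform of the defining identity leaves a factor from each test function.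
With both equal to `expKernel s` this factor is the integral of a bump function, which is nonzero
and cancels. -/
theorem laplace_of_isConv {y₁ y₂ y₃ : 𝓢'(ℝ, ℂ)} (h₁ : IsVanishingOn y₁ (Iio 0))
    (h₂ : IsVanishingOn y₂ (Iio 0)) (h₃ : IsVanishingOn y₃ (Iio 0)) (h : IsConv y₁ y₂ y₃)
    {s : ℂ} (hs : 0 < s.re) : laplace y₃ s = laplace y₁ s * laplace y₂ s := by
  have hφ := hasCompactSupport_expKernel s
  have key : ∫ x : ℝ, Complex.exp (-s * x) *
      (∫ y, regularize y₃ (expKernel s) (x - y) * expKernel s y) =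
      ∫ x : ℝ, Complex.exp (-s * x) *
      ∫ y, regularize y₁ (expKernel s) (x - y) * regularize y₂ (expKernel s) y :=
    integral_congr_ae (Eventually.of_forall fun x => by simp only [(h _ _ hφ hφ x).2])
  rw [integral_exp_mul_convolution (exp_mul_regularize_props h₃ hφ hs).2.1
      (exp_mul_schwartz_props hφ s).2.1,
    integral_exp_mul_convolution (exp_mul_regularize_props h₁ hφ hs).2.1
      (exp_mul_regularize_props h₂ hφ hs).2.1,
    integral_exp_regularize h₃ hφ hs, integral_exp_regularize h₁ hφ hs,
    integral_exp_regularize h₂ hφ hs] at key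
  have h0 := integral_exp_neg_mul_expKernel_ne_zero s
  refine mul_right_cancel₀ (mul_ne_zero h0 h0) ?_
  linear_combination key

/-- The value on f is the regularization by the reflected f at 0, and regularizations are functions
to which Fourier uniqueness applies on Re s = 1. -/
theorem eq_of_laplace_eq {y₁ y₂ : 𝓢'(ℝ, ℂ)} (h₁ : IsVanishingOn y₁ (Iio 0))
    (h₂ : IsVanishingOn y₂ (Iio 0)) (h : ∀ s : ℂ, 0 < s.re → laplace y₁ s = laplace y₂ s) :
    y₁ = y₂ := by
  refine dist_ext_compactSupport fun f hf => ?_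
  have hr : HasCompactSupport (reflect f) := hf.comp_homeomorph (Homeomorph.neg ℝ)
  have h1 : 0 < (1 : ℂ).re := by simp
  have p1 := exp_mul_regularize_props h₁ hr h1
  have p2 := exp_mul_regularize_props h₂ hr h1
  have hD : (fun t : ℝ => Complex.exp (-1 * t) * regularize y₁ (reflect f) t -
      Complex.exp (-1 * t) * regularize y₂ (reflect f) t) = 0 := by
    refine eq_zero_of_fourier_eq_zero (p1.1.sub p2.1) (p1.2.1.sub p2.2.1) fun w => ?_
    set s : ℂ := 1 + w * Complex.I with hs
    have hs0 : 0 < s.re := by simp [hs]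
    have e : ∀ t : ℝ, Complex.exp (-(w * Complex.I) * t) *
        (Complex.exp (-1 * t) * regularize y₁ (reflect f) t -
          Complex.exp (-1 * t) * regularize y₂ (reflect f) t) =
        Complex.exp (-s * t) * regularize y₁ (reflect f) t -
          Complex.exp (-s * t) * regularize y₂ (reflect f) t := fun t => by
      rw [← mul_sub, ← mul_sub, ← mul_assoc, ← Complex.exp_add, hs]; congr 2; ring
    simp only [e]
    rw [integral_sub (exp_mul_regularize_props h₁ hr hs0).2.1
      (exp_mul_regularize_props h₂ hr hs0).2.1, integral_exp_regularize h₁ hr hs0,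
      integral_exp_regularize h₂ hr hs0, h s hs0, sub_self]
  have := congrFun hD 0
  have e : reflTranslate (reflect f) 0 = f := by
    ext x; rw [reflTranslate_apply, reflect_apply]; simp
  simpa [regularize, e, sub_eq_zero] using this

end LaplaceLine

/-! ### Tensor products determine distributions on the plane -/

section TensorDensity

theorem tsupport_bump_pos (δ : ℝ) (hδ : 0 < δ) : ∃ b : 𝓢(ℝ, ℂ), ∃ β : ℝ → ℝ,
    (∀ x, b x = β x) ∧ Continuous β ∧ HasCompactSupport β ∧ (∀ x, 0 ≤ β x) ∧
      (∀ x, δ ≤ |x| → β x = 0) ∧ 0 < ∫ x, β x := by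
  let χ : ContDiffBump (0 : ℝ) := ⟨δ / 2, δ, half_pos hδ, half_lt_self hδ⟩
  refine ⟨HasCompactSupport.toSchwartzMap (f := fun x : ℝ => (χ x : ℂ))
    (χ.hasCompactSupport.comp_left (g := fun y : ℝ => (y : ℂ)) Complex.ofReal_zero)
    (Complex.ofRealCLM.contDiff.comp χ.contDiff), χ, fun x => rfl, χ.continuous,
    χ.hasCompactSupport, fun x => χ.nonneg, fun x hx => ?_, χ.integral_pos⟩
  refine χ.zero_of_le_dist ?_
  rwa [dist_zero_right, Real.norm_eq_abs]

theorem integrable_schwartzNorm_smul {E : Type*} [NormedAddCommGroup E] [NormedSpace ℝ E]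
    [MeasurableSpace E] [BorelSpace E] [SecondCountableTopology E]
    {μ : Measure E} [IsFiniteMeasureOnCompacts μ] {c : E → ℂ} (hc : Continuous c)
    (hcs : HasCompactSupport c) {F : E → 𝓢(E, ℂ)} (hF : Continuous F) (m : ℕ) :
    Integrable (fun y => schwartzNorm E m (c y • F y)) μ := by
  refine Continuous.integrable_of_hasCompactSupport
    ((continuous_schwartzNorm m).comp (hc.smul hF)) ?_
  refine hcs.mono' ?_
  intro y hy
  refine subset_tsupport _ ?_
  intro h0
  refine hy ?_
  simp [h0]

/-- Both sides are u applied to the convolution f * g, which is commutative pointwise. -/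
theorem integral_mul_dist_translate_comm {E : Type*} [NormedAddCommGroup E] [NormedSpace ℝ E]
    [MeasurableSpace E] [BorelSpace E] [SecondCountableTopology E] {μ : Measure E}
    [IsFiniteMeasureOnCompacts μ] [μ.IsAddLeftInvariant] [μ.IsNegInvariant] (u : 𝓢'(E, ℂ)) {f g : 𝓢(E, ℂ)}
    (hf : HasCompactSupport f) (hg : HasCompactSupport g) :
    ∫ y, g y * u (translate y f) ∂μ = ∫ y, f y * u (translate y g) ∂μ := by
  have c1 : Continuous fun y => g y • translate y f := g.continuous.smul (continuous_translate f)
  have c2 : Continuous fun y => f y • translate y g := f.continuous.smul (continuous_translate g)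
  have i1 := integrable_schwartzNorm_smul (μ := μ) g.continuous hg (continuous_translate f)
  have i2 := integrable_schwartzNorm_smul (μ := μ) f.continuous hf (continuous_translate g)
  have key := integral_dist_eq_zero (μ := μ)
    (F := fun y => g y • translate y f - f y • translate y g) (c1.sub c2)
    (fun m => ((i1 m).add (i2 m)).mono'
      ((continuous_schwartzNorm m).comp (c1.sub c2)).aestronglyMeasurable
      (Eventually.of_forall fun t => by
        rw [Real.norm_of_nonneg (apply_nonneg _ _)]
        exact map_sub_le_add _ _ _)) ?_ u
  · have hsub : ∀ y, u (g y • translate y f - f y • translate y g) =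
        u (g y • translate y f) - u (f y • translate y g) := fun y => map_sub _ _ _
    rw [integral_congr_ae (Eventually.of_forall hsub)] at key
    rw [integral_sub (integrable_dist c1 i1 u) (integrable_dist c2 i2 u), sub_eq_zero] at key
    simpa only [map_smul, smul_eq_mul] using key
  · intro x
    change ∫ y, (g y * f (x - y) - f y * g (x - y)) ∂μ = 0
    rw [integral_sub]
    · rw [← integral_sub_left_eq_self (fun y => f y * g (x - y)) μ x]
      simp only [sub_sub_cancel]
      simp only [mul_comm, sub_self]
    · exact Continuous.integrable_of_hasCompactSupport
        (g.continuous.mul (f.continuous.comp (continuous_const.sub continuous_id))) hg.mul_right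
    · exact Continuous.integrable_of_hasCompactSupport
        (f.continuous.mul (g.continuous.comp (continuous_const.sub continuous_id))) hf.mul_right

theorem translate_tensorCLM (a b : 𝓢(ℝ, ℂ)) (y : ℝ × ℝ) :
    translate y (tensorCLM a b) = tensorCLM (translate y.1 a) (translate y.2 b) := rfl

/-- A tempered distribution on the plane is determined by its values on tensor products. -/
theorem dist_ext_tensor {u v : 𝓢'(ℝ × ℝ, ℂ)}
    (h : ∀ a b : 𝓢(ℝ, ℂ), u (tensorCLM a b) = v (tensorCLM a b)) : u = v := by
  refine dist_ext_compactSupport fun f hf => ?_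
  set w := u - v with hw
  have hw0 : ∀ a b, w (tensorCLM a b) = 0 := fun a b => by
    change u _ - v _ = 0; rw [h, sub_self]
  suffices w f = 0 from sub_eq_zero.1 this
  by_contra hne
  have hcont : Continuous fun y : ℝ × ℝ => w (translate y f) :=
    (map_continuous w).comp (continuous_translate f)
  have hT0 : translate (0 : ℝ × ℝ) f = f := by
    ext x; change f (x - 0) = f x; rw [sub_zero]
  obtain ⟨δ, hδ, hball⟩ := Metric.continuousAt_iff.1 (hcont.continuousAt (x := 0)) (‖w f‖ / 2)
    (by positivity)
  obtain ⟨b, β, hb, hβc, hβs, hβ0, hβz, hβi⟩ := tsupport_bump_pos δ hδ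
  have hbs : HasCompactSupport (tensorCLM b b) := by
    refine HasCompactSupport.intro (hβs.isCompact.prod hβs.isCompact) fun x hx => ?_
    rw [tensorCLM_apply, hb, hb]
    rw [mem_prod, not_and_or] at hx
    rcases hx with hx | hx <;> simp [image_eq_zero_of_notMem_tsupport hx]
  -- Exchanging the roles of f and b ⊗ b puts w on translates of b ⊗ b, which are again tensor
  -- products. On the other hand, b ⊗ b is concentrated where w(translate y f) is within ‖w f‖/2 of
  -- w f, so the integral could not vanish.
  have hzero : ∫ y : ℝ × ℝ, tensorCLM b b y * w (translate y f) = 0 := by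
    rw [integral_mul_dist_translate_comm w hf hbs]
    simp [translate_tensorCLM, hw0]
  have hmass : ∫ y : ℝ × ℝ, β y.1 * β y.2 = (∫ x, β x) * ∫ x, β x :=
    integral_prod_mul β β
  have hi2 : Integrable fun y : ℝ × ℝ => β y.1 * β y.2 :=
    (hβc.integrable_of_hasCompactSupport hβs).mul_prod (hβc.integrable_of_hasCompactSupport hβs)
  have hi1 : Integrable fun y : ℝ × ℝ => tensorCLM b b y * w (translate y f) :=
    ((tensorCLM b b).continuous.mul hcont).integrable_of_hasCompactSupport hbs.mul_right
  have hdiff : ∫ y : ℝ × ℝ, tensorCLM b b y * (w (translate y f) - w f) =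
      -(((∫ x, β x) * (∫ x, β x) : ℝ) : ℂ) * w f := by
    simp only [mul_sub]
    rw [integral_sub hi1, hzero, zero_sub, integral_mul_const, neg_mul, ← hmass,
      ← integral_complex_ofReal]
    · simp only [tensorCLM_apply, hb, Complex.ofReal_mul]
    · exact ((tensorCLM b b).continuous.mul continuous_const).integrable_of_hasCompactSupport
        hbs.mul_right
  have hle : ‖∫ y : ℝ × ℝ, tensorCLM b b y * (w (translate y f) - w f)‖ ≤
      ∫ y : ℝ × ℝ, β y.1 * β y.2 * (‖w f‖ / 2) := by
    refine norm_integral_le_of_norm_le (hi2.mul_const _) (Eventually.of_forall fun y => ?_)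
    rw [norm_mul, tensorCLM_apply, hb, hb, ← Complex.ofReal_mul, Complex.norm_real,
      Real.norm_of_nonneg (mul_nonneg (hβ0 _) (hβ0 _))]
    by_cases hy : dist y 0 < δ
    · have := hball hy
      rw [hT0, dist_eq_norm] at this
      exact mul_le_mul_of_nonneg_left this.le (mul_nonneg (hβ0 _) (hβ0 _))
    · rw [dist_zero_right, Prod.norm_def, not_lt, le_max_iff] at hy
      rcases hy with hy | hy <;> simp [hβz _ hy]
  rw [hdiff, integral_mul_const, hmass, norm_mul, norm_neg, Complex.norm_real,
    Real.norm_of_nonneg (by positivity)] at hle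
  have hpos : 0 < (∫ x, β x) * (∫ x, β x) * ‖w f‖ := by
    have := norm_pos_iff.2 hne
    positivity
  linarith

end TensorDensity

/-! ### Growth of distributions vanishing for negative time -/

section HalfPlaneGrowth

/-- Only the values of h for t ≥ -2 enter, so h may be large elsewhere; q pays for the growth
allowed to the derivatives of the cutoff. -/
theorem exists_schwartzNorm_cutoff_le (m : ℕ) : ∃ q : ℕ, ∃ A : ℝ, 0 ≤ A ∧
    ∀ (h : 𝓢(ℝ × ℝ, ℂ)) (B : ℝ), 0 ≤ B →
      (∀ i ≤ m, ∀ x : ℝ × ℝ, -2 ≤ x.2 → (1 + ‖x‖) ^ (m + q) * ‖iteratedFDeriv ℝ i h x‖ ≤ B) →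
      schwartzNorm (ℝ × ℝ) m (cutoffCLM (ContinuousLinearMap.snd ℝ ℝ ℝ) h) ≤ A * B := by
  set L := ContinuousLinearMap.snd ℝ ℝ ℝ
  set χ : ℝ × ℝ → ℂ := (fun t : ℝ => (halfLineCutoff t : ℂ)) ∘ L with hχ
  have hT : χ.HasTemperateGrowth := hasTemperateGrowth_halfLineCutoff.comp L.hasTemperateGrowth
  obtain ⟨q, C, hC, hle⟩ := hT.norm_iteratedFDeriv_le_uniform m
  refine ⟨q, 2 ^ m * C, by positivity, fun h B hB hb => ?_⟩
  refine schwartzNorm_le (by positivity) fun k hk i hi => ?_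
  refine SchwartzMap.seminorm_le_bound ℂ k i _ (by positivity) fun x => ?_
  have hfun : (⇑(cutoffCLM L h) : ℝ × ℝ → ℂ) = fun x => χ x * h x :=
    funext fun x => cutoffCLM_apply L h x
  rw [hfun]
  rcases lt_or_ge x.2 (-2) with hx | hx
  · have hev : (fun x => χ x * h x) =ᶠ[𝓝 x] fun _ => (0 : ℂ) := by
      filter_upwards [(isOpen_lt continuous_snd continuous_const).mem_nhds hx] with y hy
      have hy' : y.2 < -2 := hy
      have : χ y = ((halfLineCutoff y.2 : ℝ) : ℂ) := rfl
      rw [this, halfLineCutoff_eq_zero hy'.le]; simp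
    rw [(hev.iteratedFDeriv ℝ i).eq_of_nhds]
    have : (fun _ : ℝ × ℝ => (0 : ℂ)) = 0 := rfl
    rw [this, iteratedFDeriv_zero]
    simp only [Pi.zero_apply, norm_zero, mul_zero]
    positivity
  · have hmul := norm_iteratedFDeriv_mul_le (𝕜 := ℝ) (N := (∞ : ℕ∞ω))
        (f := χ) (g := h) hT.1 (h.smooth ⊤) x (n := i) (by exact_mod_cast le_top)
    have h1 : ‖x‖ ^ k ≤ (1 + ‖x‖) ^ m :=
      (pow_le_pow_left₀ (norm_nonneg x) (by linarith) k).trans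
        (pow_le_pow_right₀ (by linarith [norm_nonneg x]) hk)
    calc ‖x‖ ^ k * ‖iteratedFDeriv ℝ i (fun x => χ x * h x) x‖
        ≤ (1 + ‖x‖) ^ m * ∑ j ∈ Finset.range (i + 1), (i.choose j : ℝ) *
          ‖iteratedFDeriv ℝ j χ x‖ * ‖iteratedFDeriv ℝ (i - j) h x‖ := by gcongr
      _ = ∑ j ∈ Finset.range (i + 1), (i.choose j : ℝ) * ((1 + ‖x‖) ^ m *
          ‖iteratedFDeriv ℝ j χ x‖ * ‖iteratedFDeriv ℝ (i - j) h x‖) := by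
          rw [Finset.mul_sum]; refine Finset.sum_congr rfl fun j _ => by ring
      _ ≤ ∑ j ∈ Finset.range (i + 1), (i.choose j : ℝ) * (C * B) := by
          refine Finset.sum_le_sum fun j hj => ?_
          have hji : j ≤ i := by simpa [Nat.lt_succ_iff] using hj
          refine mul_le_mul_of_nonneg_left ?_ (by positivity)
          calc (1 + ‖x‖) ^ m * ‖iteratedFDeriv ℝ j χ x‖ * ‖iteratedFDeriv ℝ (i - j) h x‖
              ≤ (1 + ‖x‖) ^ m * (C * (1 + ‖x‖) ^ q) * ‖iteratedFDeriv ℝ (i - j) h x‖ := by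
                gcongr; exact hle j (hji.trans hi) x
            _ = C * ((1 + ‖x‖) ^ (m + q) * ‖iteratedFDeriv ℝ (i - j) h x‖) := by ring
            _ ≤ C * B := by
                gcongr
                exact hb (i - j) ((Nat.sub_le _ _).trans hi) x hx
      _ = 2 ^ i * (C * B) := by
          rw [← Finset.sum_mul]
          congr 1
          exact_mod_cast Nat.sum_range_choose i
      _ ≤ 2 ^ m * (C * B) := by
          gcongr
          exact one_le_two
      _ = _ := by ring

/-- Growth of the translates of a distribution on the plane vanishing for `t < 0`: polynomial, and
rapidly decreasing in the direction of negative time. -/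
structure HasGrowth (W : 𝓢'(ℝ × ℝ, ℂ)) (M : ℕ) : Prop where
  poly : ∃ C : ℝ, 0 ≤ C ∧ ∀ f z, ‖W (translate z f)‖ ≤
    C * (1 + ‖z‖) ^ M * schwartzNorm (ℝ × ℝ) M f
  decay : ∀ N : ℕ, ∃ C : ℝ, 0 ≤ C ∧ ∀ f, ∀ y t : ℝ, 0 ≤ t →
    ‖W (translate (-(y, t)) f)‖ * (1 + t) ^ N ≤
      C * (1 + |y|) ^ M * schwartzNorm (ℝ × ℝ) (M + N) f

/-- After the shift by -(y, t) the distribution sees f only at points w of height at least t - 2,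
where 1 + t ≤ 3(1 + ‖w‖). Powers of 1 + t are thus bought with weights in the norm of f, while y
costs only a fixed power. -/
theorem exists_hasGrowth {W : 𝓢'(ℝ × ℝ, ℂ)} (hW : IsVanishingOn W {p : ℝ × ℝ | p.2 < 0}) :
    ∃ M, HasGrowth W M := by
  set L := ContinuousLinearMap.snd ℝ ℝ ℝ
  obtain ⟨m, C, hC, h⟩ := exists_norm_le_schwartzNorm W
  obtain ⟨q, A, hA, hcut⟩ := exists_schwartzNorm_cutoff_le m
  obtain ⟨m', C', hC', h'⟩ := exists_dist_translate_le W
  refine ⟨max (m + q) m', ⟨C', hC', fun f z => ?_⟩, fun N => ?_⟩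
  · refine (h' f z).trans ?_
    have : schwartzNorm (ℝ × ℝ) m' f ≤ schwartzNorm (ℝ × ℝ) (max (m + q) m') f :=
      schwartzNorm_mono (le_max_right _ _) f
    have h2 : (1 + ‖z‖) ^ m' ≤ (1 + ‖z‖) ^ (max (m + q) m') :=
      pow_le_pow_right₀ (by linarith [norm_nonneg z]) (le_max_right _ _)
    gcongr
  · refine ⟨C * A * (3 ^ (m + q + N) * 2 ^ (m + q + N)), by positivity, fun f y t ht => ?_⟩
    have hpos : 0 < (1 + t) ^ N := by positivity
    set S := schwartzNorm (ℝ × ℝ) (m + q + N) f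
    set B := 3 ^ (m + q + N) * 2 ^ (m + q + N) * (1 + |y|) ^ (m + q) * S / (1 + t) ^ N with hB
    have h1 : schwartzNorm (ℝ × ℝ) m (cutoffCLM L (translate (-(y, t)) f)) ≤ A * B := by
      refine hcut _ _ (by positivity) fun i hi x hx => ?_
      rw [iteratedFDeriv_translate, hB, le_div_iff₀ hpos]
      set w := x - -(y, t) with hw
      have hw1 : w.1 = x.1 + y := by simp [hw]
      have hw2 : w.2 = x.2 + t := by simp [hw]
      have n1 : |w.1| ≤ ‖w‖ := norm_fst_le w
      have n2 : |w.2| ≤ ‖w‖ := norm_snd_le w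
      have e1 : 1 + ‖x‖ ≤ 3 * (1 + |y|) * (1 + ‖w‖) := by
        have : ‖x‖ ≤ ‖w‖ + |y| + 2 := by
          rw [Prod.norm_def]
          refine max_le ?_ ?_
          · have : x.1 = w.1 - y := by rw [hw1]; ring
            rw [Real.norm_eq_abs, this]
            exact (abs_sub _ _).trans (by linarith)
          · rw [Real.norm_eq_abs, abs_le]
            have := (abs_le.1 n2).2
            constructor <;> linarith [abs_nonneg y, norm_nonneg w]
        nlinarith [abs_nonneg y, norm_nonneg w]
      have e2 : 1 + t ≤ 3 * (1 + ‖w‖) := by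
        have := (abs_le.1 n2).2
        linarith [norm_nonneg w]
      calc (1 + ‖x‖) ^ (m + q) * ‖iteratedFDeriv ℝ i f w‖ * (1 + t) ^ N
          ≤ (3 * (1 + |y|) * (1 + ‖w‖)) ^ (m + q) * ‖iteratedFDeriv ℝ i f w‖ *
            (3 * (1 + ‖w‖)) ^ N := by gcongr
        _ = 3 ^ (m + q + N) * (1 + |y|) ^ (m + q) *
            ((1 + ‖w‖) ^ (m + q + N) * ‖iteratedFDeriv ℝ i f w‖) := by
            rw [mul_pow, mul_pow, mul_pow, pow_add _ (m + q) N, pow_add _ (m + q) N]; ring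
        _ ≤ 3 ^ (m + q + N) * (1 + |y|) ^ (m + q) * (2 ^ (m + q + N) * S) := by
            exact mul_le_mul_of_nonneg_left (one_add_norm_pow_mul_le le_rfl (by omega) f w)
              (by positivity)
        _ = _ := by ring
    have h2 : ‖W (translate (-(y, t)) f)‖ ≤ C * (A * B) := by
      rw [← dist_cutoffCLM (L := L) hW]
      exact (h _).trans (by gcongr)
    have h3 : S ≤ schwartzNorm (ℝ × ℝ) (max (m + q) m' + N) f :=
      schwartzNorm_mono (by omega) f
    have h4 : (1 + |y|) ^ (m + q) ≤ (1 + |y|) ^ (max (m + q) m') :=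
      pow_le_pow_right₀ (by linarith [abs_nonneg y]) (le_max_left _ _)
    calc ‖W (translate (-(y, t)) f)‖ * (1 + t) ^ N ≤ C * (A * B) * (1 + t) ^ N := by gcongr
      _ = C * A * (3 ^ (m + q + N) * 2 ^ (m + q + N)) * (1 + |y|) ^ (m + q) * S := by
          rw [hB]; field_simp
      _ ≤ _ := by gcongr

theorem HasGrowth.mono {W : 𝓢'(ℝ × ℝ, ℂ)} {M M' : ℕ} (h : HasGrowth W M) (hM : M ≤ M') :
    HasGrowth W M' := by
  refine ⟨?_, fun N => ?_⟩
  · obtain ⟨C, hC, h⟩ := h.poly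
    refine ⟨C, hC, fun f z => (h f z).trans ?_⟩
    have h1 := schwartzNorm_mono hM f
    have h2 : (1 + ‖z‖) ^ M ≤ (1 + ‖z‖) ^ M' :=
      pow_le_pow_right₀ (by linarith [norm_nonneg z]) hM
    gcongr
  · obtain ⟨C, hC, h⟩ := h.decay N
    refine ⟨C, hC, fun f y t ht => (h f y t ht).trans ?_⟩
    have h1 := schwartzNorm_mono (show M + N ≤ M' + N by omega) f
    have h2 : (1 + |y|) ^ M ≤ (1 + |y|) ^ M' :=
      pow_le_pow_right₀ (by linarith [abs_nonneg y]) hM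
    gcongr

end HalfPlaneGrowth

/-! ### Convolution of a kernel with a distribution -/

section KernelConv

/-- A continuous function on the plane, vanishing for `t < 0`, of polynomial growth in `t` and of
decay of order `M + 2` in `x`. -/
structure IsKernel (g : ℝ × ℝ → ℂ) (M : ℕ) : Prop where
  cont : Continuous g
  zero : ∀ ζ : ℝ × ℝ, ζ.2 < 0 → g ζ = 0
  bound : ∃ N : ℕ, ∃ C : ℝ, 0 ≤ C ∧ ∀ ζ : ℝ × ℝ,
    ‖g ζ‖ * (1 + |ζ.1|) ^ (M + 2) ≤ C * (1 + |ζ.2|) ^ N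

/-- The integrable weight `(1 + |y|)⁻²`. -/
def invSq (y : ℝ) : ℝ := ((1 + |y|) ^ 2)⁻¹

theorem invSq_nonneg (y : ℝ) : 0 ≤ invSq y := by unfold invSq; positivity

theorem integrable_invSq : Integrable invSq := by
  have h := integrable_one_add_norm (E := ℝ) (μ := volume) (r := 2) (by simp)
  refine h.congr (Eventually.of_forall fun y => ?_)
  simp only [invSq, Real.norm_eq_abs]
  rw [Real.rpow_neg (by positivity)]
  norm_num

theorem mul_pow_le_invSq {a K y : ℝ} {M : ℕ} (h : a * (1 + |y|) ^ (M + 2) ≤ K) :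
    a * (1 + |y|) ^ M ≤ K * invSq y := by
  have hy : 0 < (1 + |y|) ^ 2 := by positivity
  rw [invSq, ← div_eq_mul_inv, le_div_iff₀ hy]
  calc a * (1 + |y|) ^ M * (1 + |y|) ^ 2 = a * (1 + |y|) ^ (M + 2) := by ring
    _ ≤ K := h

variable {g : ℝ × ℝ → ℂ} {W : 𝓢'(ℝ × ℝ, ℂ)} {M : ℕ}

theorem continuous_kernel_mul (hg : IsKernel g M) (ψ : 𝓢(ℝ × ℝ, ℂ)) :
    Continuous fun ζ : ℝ × ℝ => g ζ * W (translate (-ζ) ψ) :=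
  hg.cont.mul ((map_continuous W).comp ((continuous_translate ψ).comp continuous_neg))

/-- In x, the decay of order M + 2 of g absorbs the growth of order M of W. In t, where g grows with
order N, the decay of W is used with order N + 2. In each variable two powers are left over, which
is the integrable weight. -/
theorem exists_kernel_mul_le (hg : IsKernel g M) (hW : HasGrowth W M) : ∃ m : ℕ, ∃ C : ℝ, 0 ≤ C ∧
    ∀ ψ (ζ : ℝ × ℝ), ‖g ζ * W (translate (-ζ) ψ)‖ ≤
      C * schwartzNorm (ℝ × ℝ) m ψ * (invSq ζ.1 * invSq ζ.2) := by
  obtain ⟨N, C, hC, hb⟩ := hg.bound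
  obtain ⟨C', hC', hd⟩ := hW.decay (N + 2)
  refine ⟨M + (N + 2), C * C', by positivity, fun ψ ζ => ?_⟩
  rcases lt_or_ge ζ.2 0 with h | h
  · rw [hg.zero ζ h, zero_mul, norm_zero]
    have := invSq_nonneg ζ.1
    have := invSq_nonneg ζ.2
    positivity
  · have h1 := mul_pow_le_invSq (hb ζ)
    have h2 := hd ψ ζ.1 ζ.2 h
    rw [show ((ζ.1, ζ.2) : ℝ × ℝ) = ζ from rfl] at h2
    rw [← abs_of_nonneg h] at h2
    have h3 := mul_pow_le_invSq h2
    rw [norm_mul]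
    have p1 : 0 < (1 + |ζ.1|) ^ M := by positivity
    have p2 : 0 < (1 + |ζ.2|) ^ N := by positivity
    have := mul_le_mul h1 h3 (by positivity) (by have := invSq_nonneg ζ.1; positivity)
    have p3 : 0 < (1 + |ζ.1|) ^ M * (1 + |ζ.2|) ^ N := mul_pos p1 p2
    refine le_of_mul_le_mul_right ?_ p3
    calc ‖g ζ‖ * ‖W (translate (-ζ) ψ)‖ * ((1 + |ζ.1|) ^ M * (1 + |ζ.2|) ^ N)
        = ‖g ζ‖ * (1 + |ζ.1|) ^ M * (‖W (translate (-ζ) ψ)‖ * (1 + |ζ.2|) ^ N) := by ring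
      _ ≤ _ := this
      _ = _ := by ring

theorem integrable_kernel_mul (hg : IsKernel g M) (hW : HasGrowth W M) (ψ : 𝓢(ℝ × ℝ, ℂ)) :
    Integrable fun ζ : ℝ × ℝ => g ζ * W (translate (-ζ) ψ) := by
  obtain ⟨m, C, hC, h⟩ := exists_kernel_mul_le hg hW
  exact ((integrable_invSq.mul_prod integrable_invSq).const_mul _).mono'
    (continuous_kernel_mul hg ψ).aestronglyMeasurable (Eventually.of_forall (h ψ))

/-- The convolution of a kernel and a distribution vanishing for `t < 0`. -/
def kernelConv (hg : IsKernel g M) (hW : HasGrowth W M) : 𝓢'(ℝ × ℝ, ℂ) :=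
  distOfBound (fun ψ => ∫ ζ : ℝ × ℝ, g ζ * W (translate (-ζ) ψ))
    (fun φ ψ => by
      rw [← integral_add (integrable_kernel_mul hg hW φ) (integrable_kernel_mul hg hW ψ)]
      simp only [map_add, mul_add])
    (fun c ψ => by
      rw [← integral_const_mul]
      simp only [map_smul, smul_eq_mul, mul_left_comm])
    (exists_kernel_mul_le hg hW).choose
    ((exists_kernel_mul_le hg hW).choose_spec.choose *
      ((∫ y, invSq y) * ∫ y, invSq y))
    (by
      have : 0 ≤ ∫ y, invSq y := integral_nonneg invSq_nonneg
      have := (exists_kernel_mul_le hg hW).choose_spec.choose_spec.1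
      positivity)
    (fun ψ => by
      have h := (exists_kernel_mul_le hg hW).choose_spec.choose_spec.2 ψ
      refine (norm_integral_le_of_norm_le
        ((integrable_invSq.mul_prod integrable_invSq).const_mul _)
        (Eventually.of_forall h)).trans (le_of_eq ?_)
      have e := integral_prod_mul (μ := volume) (ν := volume) invSq invSq
      rw [integral_const_mul]
      erw [e]
      ring)

@[simp] theorem kernelConv_apply (hg : IsKernel g M) (hW : HasGrowth W M) (ψ : 𝓢(ℝ × ℝ, ℂ)) :
    kernelConv hg hW ψ = ∫ ζ : ℝ × ℝ, g ζ * W (translate (-ζ) ψ) :=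
  distOfBound_apply ..

theorem translate_neg_reflTranslate {E : Type*} [NormedAddCommGroup E] [NormedSpace ℝ E]
    (φ : 𝓢(E, ℂ)) (z ζ : E) : translate (-ζ) (reflTranslate φ z) = reflTranslate φ (z - ζ) := by
  ext x
  change reflTranslate φ z (x - -ζ) = _
  rw [reflTranslate_apply, reflTranslate_apply]
  congr 1; abel

theorem regularize_kernelConv (hg : IsKernel g M) (hW : HasGrowth W M) (φ : 𝓢(ℝ × ℝ, ℂ))
    (z : ℝ × ℝ) : regularize (kernelConv hg hW) φ z = ∫ ζ : ℝ × ℝ, g ζ * regularize W φ (z - ζ) := by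
  simp only [regularize, kernelConv_apply, translate_neg_reflTranslate]

theorem regularize_comm {E : Type*} [NormedAddCommGroup E] [NormedSpace ℝ E]
    [MeasurableSpace E] [BorelSpace E] [SecondCountableTopology E] {μ : Measure E}
    [IsFiniteMeasureOnCompacts μ] [μ.IsAddLeftInvariant] [μ.IsNegInvariant] (u : 𝓢'(E, ℂ))
    {φ ψ : 𝓢(E, ℂ)} (hφ : HasCompactSupport φ) (hψ : HasCompactSupport ψ) (z : E) :
    ∫ y, regularize u φ (z - y) * ψ y ∂μ = ∫ y, regularize u ψ (z - y) * φ y ∂μ := by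
  have hr : ∀ {f : 𝓢(E, ℂ)}, HasCompactSupport f → HasCompactSupport (reflect f) :=
    fun hf => hf.comp_homeomorph (Homeomorph.neg E)
  have key := integral_mul_dist_translate_comm (μ := μ)
    (PointwiseConvergenceCLM.precomp ℂ (translate z) u) (hr hφ) (hr hψ)
  have e : ∀ (f h : 𝓢(E, ℂ)), ∫ y, regularize u f (z - y) * h y ∂μ = ∫ y, reflect h y *
      (PointwiseConvergenceCLM.precomp ℂ (translate z) u) (translate y (reflect f)) ∂μ := by
    intro f h
    rw [← integral_neg_eq_self]
    refine integral_congr_ae (Eventually.of_forall fun y => ?_)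
    simp only [reflect_apply]
    rw [mul_comm]
    congr 1
    change u (reflTranslate f (z - -y)) = u (translate z (translate y (reflect f)))
    congr 1
    ext x
    rw [reflTranslate_apply]
    change _ = f (-((x - z) - y))
    congr 1; abel
  rw [e, e, key]

theorem hasCompactSupport_bound {φ : 𝓢(ℝ × ℝ, ℂ)} (hφ : HasCompactSupport φ) :
    ∃ R : ℝ, 0 ≤ R ∧ ∀ x, R < ‖x‖ → φ x = 0 := by
  obtain ⟨R, hR⟩ := hφ.isCompact.isBounded.exists_norm_le
  refine ⟨max R 0, le_max_right _ _, fun x hx => ?_⟩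
  by_contra h
  exact absurd hx (not_lt.2 ((hR x (subset_tsupport _ h)).trans (le_max_left _ _)))

theorem regularize_eq_zero_of_snd_lt (hW : IsVanishingOn W {p : ℝ × ℝ | p.2 < 0})
    {φ : 𝓢(ℝ × ℝ, ℂ)} {R : ℝ} (hR : ∀ x, R < ‖x‖ → φ x = 0) {z : ℝ × ℝ} (hz : z.2 < -(R + 1)) :
    regularize W φ z = 0 := by
  have h := dist_congr_halfSpace (L := ContinuousLinearMap.snd ℝ ℝ ℝ) (u := W) hW
    (f := reflTranslate φ z) (g := 0) (fun x hx => by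
      rw [reflTranslate_apply]
      refine hR _ ?_
      have h1 : (-1 : ℝ) < x.2 := hx
      refine lt_of_lt_of_le ?_ (norm_snd_le (z - x))
      rw [Real.norm_eq_abs, lt_abs]; right
      change R < -(z.2 - x.2)
      linarith)
  rw [regularize, h, map_zero]

/-- In time the integrand lives in a bounded interval, since g vanishes for negative times and W * φ
vanishes below -(R + 1); in space the decay of g dominates. -/
theorem integrable_kernel_regularize_mul (hg : IsKernel g M) (hW : HasGrowth W M)
    (hW0 : IsVanishingOn W {p : ℝ × ℝ | p.2 < 0}) {φ ψ : 𝓢(ℝ × ℝ, ℂ)}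
    (hφ : HasCompactSupport φ) (hψ : HasCompactSupport ψ) (x : ℝ × ℝ) :
    Integrable (fun q : (ℝ × ℝ) × (ℝ × ℝ) => g q.1 * (regularize W φ (x - q.1 - q.2) * ψ q.2)) := by
  obtain ⟨R, hR0, hR⟩ := hasCompactSupport_bound hφ
  obtain ⟨R', hR0', hR'⟩ := hasCompactSupport_bound hψ
  obtain ⟨N, C, hC, hb⟩ := hg.bound
  obtain ⟨C', hC', hp⟩ := hW.poly
  -- For ζ.2 > T and ‖y‖ ≤ R' the time of x - ζ - y is below -(R + 1).
  set T := ‖x‖ + R' + R + 1 with hT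
  have hT0 : 0 ≤ T := by positivity
  set D := C * (1 + T) ^ N * (C' * (1 + ‖x‖ + R' + T) ^ M * schwartzNorm (ℝ × ℝ) M (reflect φ))
  have hi1 : Integrable fun ζ : ℝ × ℝ => invSq ζ.1 * (indicator (Icc 0 T) (fun _ => (1 : ℝ)) ζ.2) :=
    integrable_invSq.mul_prod ((integrable_indicator_iff measurableSet_Icc).2
      (by simp))
  have hi2 : Integrable fun y : ℝ × ℝ => ‖ψ y‖ :=
    (ψ.continuous.integrable_of_hasCompactSupport hψ).norm
  refine ((hi1.mul_prod hi2).const_mul D).mono' ?_ (Eventually.of_forall fun q => ?_)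
  · refine Continuous.aestronglyMeasurable ?_
    have := hg.cont
    have := continuous_regularize W φ
    have := ψ.continuous
    fun_prop
  · obtain ⟨ζ, y⟩ := q
    simp only
    have hnn : 0 ≤ D * (invSq ζ.1 * (indicator (Icc 0 T) (fun _ => (1 : ℝ)) ζ.2) * ‖ψ y‖) := by
      have := invSq_nonneg ζ.1
      have : 0 ≤ (indicator (Icc 0 T) (fun _ => (1 : ℝ)) ζ.2) :=
        indicator_nonneg (fun _ _ => zero_le_one) _
      positivity
    by_cases hy : R' < ‖y‖
    · rw [hR' y hy]; simp
    by_cases h0 : ζ.2 < 0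
    · rw [hg.zero ζ h0, zero_mul, norm_zero]; exact hnn
    rw [not_lt] at hy h0
    by_cases h1 : T < ζ.2
    · rw [regularize_eq_zero_of_snd_lt hW0 hR, zero_mul, mul_zero, norm_zero]
      · exact hnn
      · change x.2 - ζ.2 - y.2 < _
        have e1 : x.2 ≤ ‖x‖ := (le_abs_self _).trans (norm_snd_le x)
        have e2 : -y.2 ≤ ‖y‖ := (neg_le_abs _).trans (norm_snd_le y)
        linarith
    rw [not_lt] at h1
    rw [indicator_of_mem (show ζ.2 ∈ Icc 0 T from ⟨h0, h1⟩), mul_one, norm_mul, norm_mul]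
    have hgb : ‖g ζ‖ * (1 + |ζ.1|) ^ M ≤ C * (1 + T) ^ N * invSq ζ.1 := by
      refine (mul_pow_le_invSq (hb ζ)).trans ?_
      have := invSq_nonneg ζ.1
      rw [abs_of_nonneg h0]
      gcongr
    have hwb : ‖regularize W φ (x - ζ - y)‖ ≤ (1 + |ζ.1|) ^ M *
        (C' * (1 + ‖x‖ + R' + T) ^ M * schwartzNorm (ℝ × ℝ) M (reflect φ)) := by
      refine (hp (reflect φ) (x - ζ - y)).trans ?_
      have e1 : ‖x - ζ - y‖ ≤ ‖x‖ + ‖ζ‖ + ‖y‖ :=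
        (norm_sub_le _ _).trans (by gcongr; exact norm_sub_le _ _)
      have e2 : ‖ζ‖ ≤ |ζ.1| + T := by
        rw [Prod.norm_def]
        refine max_le ?_ ?_
        · rw [Real.norm_eq_abs]; linarith
        · rw [Real.norm_eq_abs, abs_of_nonneg h0]; linarith [abs_nonneg ζ.1]
      have e3 : 1 + ‖x - ζ - y‖ ≤ (1 + |ζ.1|) * (1 + ‖x‖ + R' + T) := by
        nlinarith [abs_nonneg ζ.1, norm_nonneg x]
      calc C' * (1 + ‖x - ζ - y‖) ^ M * schwartzNorm (ℝ × ℝ) M (reflect φ)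
          ≤ C' * ((1 + |ζ.1|) * (1 + ‖x‖ + R' + T)) ^ M * schwartzNorm (ℝ × ℝ) M (reflect φ) := by
            gcongr
        _ = _ := by rw [mul_pow]; ring
    calc ‖g ζ‖ * (‖regularize W φ (x - ζ - y)‖ * ‖ψ y‖)
        ≤ ‖g ζ‖ * ((1 + |ζ.1|) ^ M *
        (C' * (1 + ‖x‖ + R' + T) ^ M * schwartzNorm (ℝ × ℝ) M (reflect φ)) * ‖ψ y‖) := by gcongr
      _ = (‖g ζ‖ * (1 + |ζ.1|) ^ M) *
        ((C' * (1 + ‖x‖ + R' + T) ^ M * schwartzNorm (ℝ × ℝ) M (reflect φ)) * ‖ψ y‖) := by ring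
      _ ≤ (C * (1 + T) ^ N * invSq ζ.1) *
        ((C' * (1 + ‖x‖ + R' + T) ^ M * schwartzNorm (ℝ × ℝ) M (reflect φ)) * ‖ψ y‖) := by gcongr
      _ = _ := by ring

theorem measurePreserving_sub_sub (x : ℝ × ℝ) : MeasurePreserving
    (fun q : (ℝ × ℝ) × (ℝ × ℝ) => (q.1, x - q.1 - q.2)) := by
  have h1 := measurePreserving_prod_add (volume : Measure (ℝ × ℝ)) (volume : Measure (ℝ × ℝ))
  have h2 := (MeasurePreserving.id (volume : Measure (ℝ × ℝ))).prod
    (Measure.measurePreserving_sub_left (volume : Measure (ℝ × ℝ)) x)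
  have h3 := h2.comp h1
  have e : (fun q : (ℝ × ℝ) × (ℝ × ℝ) => (q.1, x - q.1 - q.2)) =
      (Prod.map id fun t => x - t) ∘ fun z => (z.1, z.1 + z.2) := by
    funext q; simp [sub_sub]
  rw [e]
  exact h3

/-- The measure-preserving substitution of x - ζ - y for y exchanges the two test functions and
reduces this to the previous statement. -/
theorem integrable_kernel_mul_regularize (hg : IsKernel g M) (hW : HasGrowth W M)
    (hW0 : IsVanishingOn W {p : ℝ × ℝ | p.2 < 0}) {φ ψ : 𝓢(ℝ × ℝ, ℂ)}
    (hφ : HasCompactSupport φ) (hψ : HasCompactSupport ψ) (x : ℝ × ℝ) :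
    Integrable (fun q : (ℝ × ℝ) × (ℝ × ℝ) => g q.1 * (φ (x - q.2 - q.1) * regularize W ψ q.2)) := by
  have h := integrable_kernel_regularize_mul hg hW hW0 hψ hφ x
  rw [← (measurePreserving_sub_sub x).integrable_comp] 
  · refine h.congr (Eventually.of_forall fun q => ?_)
    simp only [Function.comp]
    rw [mul_comm (φ _)]
    congr 3
    abel
  · refine Continuous.aestronglyMeasurable ?_
    have := hg.cont
    have := continuous_regularize W ψ
    have := φ.continuous
    fun_prop

/-- Since W₀ is the Dirac distribution, the first factor is the function g itself. By Fubini the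
identity reduces, for each fixed ζ, to (W * φ) * ψ = (W * ψ) * φ. -/
theorem isConv_kernelConv {W₀ : 𝓢'(ℝ × ℝ, ℂ)} (hW₀ : HasGrowth W₀ M)
    (hδ : ∀ ψ, W₀ ψ = ψ 0) (hg : IsKernel g M) (hW : HasGrowth W M)
    (hW0 : IsVanishingOn W {p : ℝ × ℝ | p.2 < 0}) :
    IsConv (kernelConv hg hW₀) W (kernelConv hg hW) := by
  intro φ ψ hφ hψ x
  have hr : ∀ z, regularize (kernelConv hg hW₀) φ z = ∫ ζ : ℝ × ℝ, g ζ * φ (z - ζ) := fun z => by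
    rw [regularize_kernelConv]
    simp only [regularize, hδ, reflTranslate_apply, sub_zero]
  have i1 := integrable_kernel_regularize_mul hg hW hW0 hφ hψ x
  have i2 := integrable_kernel_mul_regularize hg hW hW0 hφ hψ x
  have e2 : ∀ y, regularize (kernelConv hg hW₀) φ (x - y) * regularize W ψ y =
      ∫ ζ : ℝ × ℝ, g ζ * (φ (x - y - ζ) * regularize W ψ y) := fun y => by
    rw [hr, ← integral_mul_const]
    simp only [mul_assoc]
  refine ⟨?_, ?_⟩
  · simp only [e2]
    exact i2.integral_prod_right
  · simp only [e2]
    have e1 : ∀ y, regularize (kernelConv hg hW) φ (x - y) * ψ y =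
        ∫ ζ : ℝ × ℝ, g ζ * (regularize W φ (x - ζ - y) * ψ y) := fun y => by
      rw [regularize_kernelConv, ← integral_mul_const]
      simp only [mul_assoc, sub_right_comm]
    simp only [e1]
    rw [integral_integral_swap (f := fun y ζ => g ζ * (regularize W φ (x - ζ - y) * ψ y)) i1.swap,
      integral_integral_swap (f := fun y ζ => g ζ * (φ (x - y - ζ) * regularize W ψ y)) i2.swap]
    refine integral_congr_ae (Eventually.of_forall fun ζ => ?_)
    simp only [integral_const_mul]
    congr 1
    rw [regularize_comm W hφ hψ, ← integral_sub_left_eq_self _ _ (x - ζ)]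
    refine integral_congr_ae (Eventually.of_forall fun y => ?_)
    simp only [sub_sub_cancel]
    rw [mul_comm, sub_right_comm]

theorem isVanishingOn_kernelConv (hg : IsKernel g M) (hW : HasGrowth W M)
    (hW0 : IsVanishingOn W {p : ℝ × ℝ | p.2 < 0}) :
    IsVanishingOn (kernelConv hg hW) {p : ℝ × ℝ | p.2 < 0} := by
  intro ψ hψ
  rw [kernelConv_apply]
  refine integral_eq_zero_of_ae (Eventually.of_forall fun ζ => ?_)
  simp only [Pi.zero_apply]
  rcases lt_or_ge ζ.2 0 with h | h
  · rw [hg.zero ζ h, zero_mul]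
  · rw [hW0 (translate (-ζ) ψ), mul_zero]
    intro x hx
    have h1 : x - -ζ ∈ tsupport ψ := by
      have : tsupport (translate (-ζ) ψ) ⊆ (fun x => x - -ζ) ⁻¹' tsupport ψ :=
        closure_minimal (fun x hx => subset_tsupport _ hx)
          ((isClosed_tsupport _).preimage (continuous_sub_right _))
      exact this hx
    have h2 : (x - -ζ).2 < 0 := hψ h1
    have h3 : (x - -ζ).2 = x.2 + ζ.2 := by simp
    change x.2 < 0
    linarith

end KernelConv

/-! ### The operators (1 + σ∂)^m -/

section DiffOp

variable {E : Type*} [NormedAddCommGroup E] [NormedSpace ℝ E]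

/-- The differential operator `(1 + σ ∂_v)^m` on Schwartz functions. -/
def diffOp (v : E) (σ : ℂ) : ℕ → 𝓢(E, ℂ) →L[ℂ] 𝓢(E, ℂ)
  | 0 => ContinuousLinearMap.id ℂ _
  | m + 1 => (diffOp v σ m).comp
      (ContinuousLinearMap.id ℂ _ + σ • LineDeriv.lineDerivOpCLM ℂ 𝓢(E, ℂ) v)

theorem diffOp_zero (v : E) (σ : ℂ) (f : 𝓢(E, ℂ)) : diffOp v σ 0 f = f := rfl

theorem diffOp_succ (v : E) (σ : ℂ) (m : ℕ) (f : 𝓢(E, ℂ)) :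
    diffOp v σ (m + 1) f = diffOp v σ m (f + σ • ∂_{v} f) := rfl

theorem lineDerivOp_reflTranslate (v : E) (φ : 𝓢(E, ℂ)) (z : E) :
    ∂_{v} (reflTranslate φ z) = -reflTranslate (∂_{v} φ) z := by
  ext x
  change _ = -reflTranslate (∂_{v} φ) z x
  rw [SchwartzMap.lineDerivOp_apply_eq_fderiv, reflTranslate_apply,
    SchwartzMap.lineDerivOp_apply_eq_fderiv]
  have h : (⇑(reflTranslate φ z) : E → ℂ) = fun x => φ (z - x) :=
    funext fun x => reflTranslate_apply φ z x
  have h1 := (φ.differentiable (z - x)).hasFDerivAt.comp x ((hasFDerivAt_id x).const_sub z)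
  have h2 : fderiv ℝ (fun x => φ (z - x)) x = _ := h1.fderiv
  rw [h, h2]
  simp

theorem lineDerivOp_translate (v : E) (φ : 𝓢(E, ℂ)) (z : E) :
    ∂_{v} (translate z φ) = translate z (∂_{v} φ) := by
  ext x
  change _ = (∂_{v} φ : 𝓢(E, ℂ)) (x - z)
  rw [SchwartzMap.lineDerivOp_apply_eq_fderiv, SchwartzMap.lineDerivOp_apply_eq_fderiv]
  have h : (⇑(translate z φ) : E → ℂ) = fun x => φ (x - z) := rfl
  have h1 := (φ.differentiable (x - z)).hasFDerivAt.comp x ((hasFDerivAt_id x).sub_const z)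
  have h2 : fderiv ℝ (fun x => φ (x - z)) x = _ := h1.fderiv
  rw [h, h2]
  simp

theorem diffOp_reflTranslate (v : E) (m : ℕ) (φ : 𝓢(E, ℂ)) (z : E) :
    diffOp v (-1) m (reflTranslate φ z) = reflTranslate (diffOp v 1 m φ) z := by
  induction m generalizing φ with
  | zero => rfl
  | succ m ih =>
    rw [diffOp_succ, diffOp_succ, ← ih]
    congr 1
    rw [lineDerivOp_reflTranslate, one_smul, neg_one_smul, neg_neg]
    ext x
    change reflTranslate φ z x + reflTranslate (∂_{v} φ) z x = _
    simp only [reflTranslate_apply]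
    rfl

theorem tsupport_lineDerivOp_subset (v : E) (f : 𝓢(E, ℂ)) :
    tsupport (⇑(∂_{v} f : 𝓢(E, ℂ)) : E → ℂ) ⊆ tsupport f := by
  refine closure_minimal (fun x hx => ?_) (isClosed_tsupport _)
  refine support_fderiv_subset ℝ (f := f) fun h => hx ?_
  rw [SchwartzMap.lineDerivOp_apply_eq_fderiv, h]
  rfl

theorem tsupport_diffOp_subset (v : E) (σ : ℂ) (m : ℕ) (f : 𝓢(E, ℂ)) :
    tsupport (diffOp v σ m f) ⊆ tsupport f := by
  induction m generalizing f with
  | zero => exact subset_rfl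
  | succ m ih =>
    rw [diffOp_succ]
    refine (ih _).trans ((tsupport_add _ _).trans (union_subset subset_rfl ?_))
    exact (closure_mono (Function.support_const_smul_subset σ _)).trans
      (tsupport_lineDerivOp_subset v f)

theorem hasCompactSupport_diffOp (v : E) (σ : ℂ) (m : ℕ) {f : 𝓢(E, ℂ)} (hf : HasCompactSupport f) :
    HasCompactSupport (diffOp v σ m f) :=
  hf.mono' (subset_closure.trans (tsupport_diffOp_subset v σ m f))

/-- The distribution `(1 + ∂_v)^m u`. -/
def distOp (v : E) (m : ℕ) (u : 𝓢'(E, ℂ)) : 𝓢'(E, ℂ) :=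
  PointwiseConvergenceCLM.precomp ℂ (diffOp v (-1) m) u

theorem distOp_apply (v : E) (m : ℕ) (u : 𝓢'(E, ℂ)) (f : 𝓢(E, ℂ)) :
    distOp v m u f = u (diffOp v (-1) m f) := rfl

theorem isVanishingOn_distOp (v : E) (m : ℕ) {u : 𝓢'(E, ℂ)} {s : Set E}
    (hu : IsVanishingOn u s) : IsVanishingOn (distOp v m u) s := fun f hf =>
  hu _ ((tsupport_diffOp_subset v _ m f).trans hf)

theorem regularize_distOp (v : E) (m : ℕ) (u : 𝓢'(E, ℂ)) (φ : 𝓢(E, ℂ)) :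
    regularize (distOp v m u) φ = regularize u (diffOp v 1 m φ) := by
  funext z
  rw [regularize, distOp_apply, diffOp_reflTranslate]
  rfl

/-- Regularization moves the operator to the first test function, so this is the identity for f, g,
w at another compactly supported φ. -/
theorem isConv_distOp [MeasureSpace E] (v : E) (m : ℕ) {f g w : 𝓢'(E, ℂ)} (h : IsConv f g w) :
    IsConv (distOp v m f) g (distOp v m w) := by
  intro φ ψ hφ hψ x
  simp only [regularize_distOp]
  exact h _ _ (hasCompactSupport_diffOp v 1 m hφ) hψ x

theorem lineDerivOp_snd_tensorCLM (a b : 𝓢(ℝ, ℂ)) :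
    ∂_{((0, 1) : ℝ × ℝ)} (tensorCLM a b) = tensorCLM a (∂_{(1 : ℝ)} b) := by
  ext x
  rw [SchwartzMap.lineDerivOp_apply_eq_fderiv, tensorCLM_apply,
    SchwartzMap.lineDerivOp_apply_eq_fderiv]
  have h : (⇑(tensorCLM a b) : ℝ × ℝ → ℂ) = fun p => a p.1 * b p.2 := rfl
  have h1 : HasFDerivAt (fun p : ℝ × ℝ => a p.1) _ x :=
    (a.differentiable x.1).hasFDerivAt.comp x hasFDerivAt_fst
  have h2 : HasFDerivAt (fun p : ℝ × ℝ => b p.2) _ x :=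
    (b.differentiable x.2).hasFDerivAt.comp x hasFDerivAt_snd
  have h3 : fderiv ℝ (fun p : ℝ × ℝ => a p.1 * b p.2) x = _ := (h1.mul h2).fderiv
  rw [h, h3]
  simp

theorem lineDerivOp_fst_tensorCLM (a b : 𝓢(ℝ, ℂ)) :
    ∂_{((1, 0) : ℝ × ℝ)} (tensorCLM a b) = tensorCLM (∂_{(1 : ℝ)} a) b := by
  ext x
  rw [SchwartzMap.lineDerivOp_apply_eq_fderiv, tensorCLM_apply,
    SchwartzMap.lineDerivOp_apply_eq_fderiv]
  have h : (⇑(tensorCLM a b) : ℝ × ℝ → ℂ) = fun p => a p.1 * b p.2 := rfl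
  have h1 : HasFDerivAt (fun p : ℝ × ℝ => a p.1) _ x :=
    (a.differentiable x.1).hasFDerivAt.comp x hasFDerivAt_fst
  have h2 : HasFDerivAt (fun p : ℝ × ℝ => b p.2) _ x :=
    (b.differentiable x.2).hasFDerivAt.comp x hasFDerivAt_snd
  have h3 : fderiv ℝ (fun p : ℝ × ℝ => a p.1 * b p.2) x = _ := (h1.mul h2).fderiv
  rw [h, h3]
  simp [mul_comm]

theorem diffOp_tensorCLM (σ : ℂ) (m : ℕ) (a b : 𝓢(ℝ, ℂ)) :
    diffOp ((0, 1) : ℝ × ℝ) σ m (tensorCLM a b) = tensorCLM a (diffOp 1 σ m b) := by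
  induction m generalizing b with
  | zero => rfl
  | succ m ih =>
    rw [diffOp_succ, diffOp_succ, lineDerivOp_snd_tensorCLM, ← map_smul, ← map_add, ih]

theorem lineDerivOp_one_eq_deriv (f : 𝓢(ℝ, ℂ)) (t : ℝ) : (∂_{(1 : ℝ)} f : 𝓢(ℝ, ℂ)) t = deriv f t := by
  rw [SchwartzMap.lineDerivOp_apply_eq_fderiv]
  simp

theorem lineDerivOp_of_eq_exp {f : 𝓢(ℝ, ℂ)} {s c : ℂ}
    (h : ∀ t : ℝ, -1 < t → f t = c * Complex.exp (-s * t)) {t : ℝ} (ht : -1 < t) :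
    (∂_{(1 : ℝ)} f : 𝓢(ℝ, ℂ)) t = -s * c * Complex.exp (-s * t) := by
  rw [lineDerivOp_one_eq_deriv]
  have he : (f : ℝ → ℂ) =ᶠ[𝓝 t] fun t : ℝ => c * Complex.exp (-s * t) := by
    filter_upwards [Ioi_mem_nhds ht] with y hy using h y hy
  rw [he.deriv_eq]
  have hd : HasDerivAt (fun t : ℝ => Complex.exp (-s * t)) (Complex.exp (-s * t) * (-s * 1)) t :=
    ((Complex.ofRealCLM.hasDerivAt (x := t)).const_mul (-s)).cexp
  rw [(hd.const_mul c).deriv]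
  ring

theorem laplaceKernel_of_gt {s : ℂ} (hs : 0 < s.re) {t : ℝ} (ht : -1 < t) :
    laplaceKernel s hs t = 1 * Complex.exp (-s * t) := by
  rw [laplaceKernel_apply, halfLineCutoff_eq_one ht.le, Complex.ofReal_one]

/-- The exponential e^{-st} is an eigenfunction of 1 - ∂ with eigenvalue 1 + s. This produces the
factor (1 + s)^m that cancels the regularization of K̃. -/
theorem diffOp_of_eq_exp {f : 𝓢(ℝ, ℂ)} {s c : ℂ}
    (h : ∀ t : ℝ, -1 < t → f t = c * Complex.exp (-s * t)) (m : ℕ) {t : ℝ} (ht : -1 < t) :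
    diffOp 1 (-1) m f t = (1 + s) ^ m * c * Complex.exp (-s * t) := by
  induction m generalizing f c with
  | zero => rw [diffOp_zero, h t ht]; ring
  | succ m ih =>
    rw [diffOp_succ, ih (c := (1 + s) * c)]
    · ring
    · intro t ht
      change f t + -1 * (∂_{(1 : ℝ)} f : 𝓢(ℝ, ℂ)) t = _
      rw [h t ht, lineDerivOp_of_eq_exp h ht]
      ring

end DiffOp

/-! ### The distributions v(x)δ(t) and v(x)H(t) -/

section Tensors

theorem hasTemperateGrowth_inl : (fun x : ℝ => ((x, 0) : ℝ × ℝ)).HasTemperateGrowth :=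
  (ContinuousLinearMap.inl ℝ ℝ ℝ).hasTemperateGrowth

/-- Restriction of a Schwartz function to the line `t = 0`. -/
def restrictZero : 𝓢(ℝ × ℝ, ℂ) →L[ℂ] 𝓢(ℝ, ℂ) :=
  SchwartzMap.compCLM ℂ hasTemperateGrowth_inl ⟨1, 1, fun x => by
    simp [Prod.norm_def]⟩

@[simp] theorem restrictZero_apply (ψ : 𝓢(ℝ × ℝ, ℂ)) (x : ℝ) : restrictZero ψ x = ψ (x, 0) := rfl

/-- Restriction of a Schwartz function to the line at height `t`. -/
def timeSlice (t : ℝ) : 𝓢(ℝ × ℝ, ℂ) →L[ℂ] 𝓢(ℝ, ℂ) := restrictZero.comp (translate ((0, -t) : ℝ × ℝ))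

@[simp] theorem timeSlice_apply (t : ℝ) (ψ : 𝓢(ℝ × ℝ, ℂ)) (x : ℝ) : timeSlice t ψ x = ψ (x, t) := by
  change ψ ((x, 0) - (0, -t)) = _
  simp

theorem continuous_timeSlice (ψ : 𝓢(ℝ × ℝ, ℂ)) : Continuous fun t => timeSlice t ψ :=
  restrictZero.continuous.comp ((continuous_translate ψ).comp (by fun_prop))

/-- Two extra powers of the weight in the plane are spent on integrability in t. -/
theorem schwartzNorm_timeSlice_le (m : ℕ) (t : ℝ) (ψ : 𝓢(ℝ × ℝ, ℂ)) :
    schwartzNorm ℝ m (timeSlice t ψ) ≤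
      2 ^ (m + 2) * schwartzNorm (ℝ × ℝ) (m + 2) ψ * invSq t := by
  have hpos : 0 < (1 + |t|) ^ 2 := by positivity
  have hi := invSq_nonneg t
  refine schwartzNorm_le (by positivity) fun k hk n hn => ?_
  refine SchwartzMap.seminorm_le_bound ℂ k n _ (by positivity) fun x => ?_
  have h1 : ‖iteratedFDeriv ℝ n (timeSlice t ψ) x‖ ≤ ‖iteratedFDeriv ℝ n ψ (x, t)‖ := by
    have e : (⇑(timeSlice t ψ) : ℝ → ℂ) =
        (⇑(translate ((0, -t) : ℝ × ℝ) ψ) : ℝ × ℝ → ℂ) ∘ ContinuousLinearMap.inl ℝ ℝ ℝ := rfl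
    rw [e, (ContinuousLinearMap.inl ℝ ℝ ℝ).iteratedFDeriv_comp_right
      ((translate ((0, -t) : ℝ × ℝ) ψ).smooth ⊤) x (by exact_mod_cast le_top)]
    refine (ContinuousMultilinearMap.norm_compContinuousLinearMap_le _ _).trans ?_
    refine (mul_le_of_le_one_right (norm_nonneg _) ?_).trans (le_of_eq ?_)
    · exact Finset.prod_le_one (fun _ _ => norm_nonneg _)
        (fun _ _ => ContinuousLinearMap.norm_inl_le_one ℝ ℝ ℝ)
    · rw [iteratedFDeriv_translate]
      simp
  have hx : ‖x‖ ≤ 1 + ‖((x, t) : ℝ × ℝ)‖ := by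
    have := norm_fst_le ((x, t) : ℝ × ℝ); simp only at this; linarith
  have ht : 1 + |t| ≤ 1 + ‖((x, t) : ℝ × ℝ)‖ := by
    have := norm_snd_le ((x, t) : ℝ × ℝ); simp only [Real.norm_eq_abs] at this ⊢; linarith
  rw [invSq, ← div_eq_mul_inv, le_div_iff₀ hpos]
  calc ‖x‖ ^ k * ‖iteratedFDeriv ℝ n (timeSlice t ψ) x‖ * (1 + |t|) ^ 2
      ≤ (1 + ‖((x, t) : ℝ × ℝ)‖) ^ k * ‖iteratedFDeriv ℝ n ψ (x, t)‖ *
        (1 + ‖((x, t) : ℝ × ℝ)‖) ^ 2 := by gcongr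
    _ = (1 + ‖((x, t) : ℝ × ℝ)‖) ^ (k + 2) * ‖iteratedFDeriv ℝ n ψ (x, t)‖ := by ring
    _ ≤ _ := one_add_norm_pow_mul_le (by omega) (by omega) ψ _

/-- The distribution `v(x) δ(t)`. -/
def tensorDelta (v : 𝓢'(ℝ, ℂ)) : 𝓢'(ℝ × ℝ, ℂ) := PointwiseConvergenceCLM.precomp ℂ restrictZero v

theorem tensorDelta_apply (v : 𝓢'(ℝ, ℂ)) (ψ : 𝓢(ℝ × ℝ, ℂ)) :
    tensorDelta v ψ = v (restrictZero ψ) := rfl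

theorem restrictZero_tensorCLM (a b : 𝓢(ℝ, ℂ)) : restrictZero (tensorCLM a b) = b 0 • a := by
  ext x
  change a x * b 0 = b 0 * a x
  ring

theorem isTensor_tensorDelta (v : 𝓢'(ℝ, ℂ)) :
    IsTensor v (TemperedDistribution.delta 0) (tensorDelta v) := fun a b => by
  rw [tensorDelta_apply, restrictZero_tensorCLM, map_smul, TemperedDistribution.delta_apply,
    smul_eq_mul, mul_comm]

theorem isVanishingOn_tensorDelta (v : 𝓢'(ℝ, ℂ)) :
    IsVanishingOn (tensorDelta v) {p : ℝ × ℝ | p.2 < 0} := fun ψ hψ => by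
  have : restrictZero ψ = 0 := by
    ext x
    rw [restrictZero_apply]
    by_contra h
    exact lt_irrefl (0 : ℝ) (hψ (subset_tsupport _ h))
  rw [tensorDelta_apply, this, map_zero]

theorem isTensor_derivDelta (v : 𝓢'(ℝ, ℂ)) :
    IsTensor v (TemperedDistribution.derivCLM ℂ (TemperedDistribution.delta 0))
      (∂_{((0, 1) : ℝ × ℝ)} (tensorDelta v)) := fun a b => by
  rw [TemperedDistribution.lineDerivOp_apply_apply, lineDerivOp_snd_tensorCLM,
    TemperedDistribution.derivCLM_apply_apply, map_neg, isTensor_tensorDelta, map_neg,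
    TemperedDistribution.delta_apply, TemperedDistribution.delta_apply, lineDerivOp_one_eq_deriv,
    SchwartzMap.derivCLM_apply, mul_neg]

theorem integrable_dist_timeSlice_norm (ψ : 𝓢(ℝ × ℝ, ℂ)) (m : ℕ) :
    Integrable fun t => schwartzNorm ℝ m (timeSlice t ψ) :=
  (integrable_invSq.const_mul (2 ^ (m + 2) * schwartzNorm (ℝ × ℝ) (m + 2) ψ)).mono'
    ((continuous_schwartzNorm m).comp (continuous_timeSlice ψ)).aestronglyMeasurable
    (Eventually.of_forall fun t => by
      rw [Real.norm_of_nonneg (apply_nonneg _ _)]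
      exact schwartzNorm_timeSlice_le m t ψ)

theorem integrable_dist_timeSlice (v : 𝓢'(ℝ, ℂ)) (ψ : 𝓢(ℝ × ℝ, ℂ)) :
    Integrable fun t => v (timeSlice t ψ) :=
  integrable_dist (continuous_timeSlice ψ) (integrable_dist_timeSlice_norm ψ) v

theorem exists_dist_timeSlice_le (v : 𝓢'(ℝ, ℂ)) : ∃ m : ℕ, ∃ C : ℝ, 0 ≤ C ∧ ∀ ψ t,
    ‖v (timeSlice t ψ)‖ ≤ C * schwartzNorm (ℝ × ℝ) m ψ * invSq t := by
  obtain ⟨m, C, hC, h⟩ := exists_norm_le_schwartzNorm v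
  refine ⟨m + 2, C * 2 ^ (m + 2), by positivity, fun ψ t => (h _).trans ?_⟩
  calc C * schwartzNorm ℝ m (timeSlice t ψ)
      ≤ C * (2 ^ (m + 2) * schwartzNorm (ℝ × ℝ) (m + 2) ψ * invSq t) := by
        gcongr; exact schwartzNorm_timeSlice_le m t ψ
    _ = _ := by ring

/-- The distribution `v(x) H(t)`. -/
def tensorHeaviside (v : 𝓢'(ℝ, ℂ)) : 𝓢'(ℝ × ℝ, ℂ) :=
  distOfBound (fun ψ => ∫ t in Ioi (0 : ℝ), v (timeSlice t ψ))
    (fun φ ψ => by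
      rw [← integral_add (integrable_dist_timeSlice v φ).integrableOn
        (integrable_dist_timeSlice v ψ).integrableOn]
      simp only [map_add])
    (fun c ψ => by
      rw [← integral_const_mul]
      simp only [map_smul, smul_eq_mul])
    (exists_dist_timeSlice_le v).choose
    ((exists_dist_timeSlice_le v).choose_spec.choose * ∫ t in Ioi (0 : ℝ), invSq t)
    (by
      have : 0 ≤ ∫ t in Ioi (0 : ℝ), invSq t := integral_nonneg invSq_nonneg
      have := (exists_dist_timeSlice_le v).choose_spec.choose_spec.1
      positivity)
    (fun ψ => by
      have h := (exists_dist_timeSlice_le v).choose_spec.choose_spec.2 ψ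
      refine (norm_integral_le_of_norm_le
        (integrable_invSq.integrableOn.const_mul _)
        (Eventually.of_forall h)).trans (le_of_eq ?_)
      rw [integral_const_mul]
      ring)

theorem tensorHeaviside_apply (v : 𝓢'(ℝ, ℂ)) (ψ : 𝓢(ℝ × ℝ, ℂ)) :
    tensorHeaviside v ψ = ∫ t in Ioi (0 : ℝ), v (timeSlice t ψ) := distOfBound_apply ..

theorem timeSlice_tensorCLM (t : ℝ) (a b : 𝓢(ℝ, ℂ)) : timeSlice t (tensorCLM a b) = b t • a := by
  ext x
  rw [timeSlice_apply, tensorCLM_apply]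
  change a x * b t = b t * a x
  ring

theorem heaviside_apply (b : 𝓢(ℝ, ℂ)) : heaviside b = ∫ t in Ioi (0 : ℝ), b t := by
  have : (volume.restrict (Ioi (0 : ℝ))).HasTemperateGrowth := by
    obtain ⟨n, hn⟩ := (inferInstance : (volume : Measure ℝ).HasTemperateGrowth).exists_integrable
    exact ⟨⟨n, hn.mono_measure Measure.restrict_le_self⟩⟩
  exact Measure.toTemperedDistribution_apply (volume.restrict (Ioi (0 : ℝ))) b

theorem tensorHeaviside_tensorCLM (v : 𝓢'(ℝ, ℂ)) (a b : 𝓢(ℝ, ℂ)) :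
    tensorHeaviside v (tensorCLM a b) = v a * ∫ t in Ioi (0 : ℝ), b t := by
  rw [tensorHeaviside_apply, ← integral_const_mul]
  simp only [timeSlice_tensorCLM, map_smul, smul_eq_mul, mul_comm]

theorem isTensor_tensorHeaviside (v : 𝓢'(ℝ, ℂ)) :
    IsTensor v heaviside (tensorHeaviside v) := fun a b => by
  rw [tensorHeaviside_tensorCLM, heaviside_apply]

theorem isVanishingOn_tensorHeaviside (v : 𝓢'(ℝ, ℂ)) :
    IsVanishingOn (tensorHeaviside v) {p : ℝ × ℝ | p.2 < 0} := fun ψ hψ => by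
  rw [tensorHeaviside_apply]
  refine setIntegral_eq_zero_of_forall_eq_zero fun t ht => ?_
  have : timeSlice t ψ = 0 := by
    ext x
    rw [timeSlice_apply]
    by_contra h
    have h1 : t < 0 := hψ (subset_tsupport _ h)
    exact lt_asymm ht h1
  rw [this, map_zero]

theorem isVanishingOn_add {E : Type*} [NormedAddCommGroup E] [NormedSpace ℝ E] {u v : 𝓢'(E, ℂ)}
    {s : Set E} (hu : IsVanishingOn u s) (hv : IsVanishingOn v s) : IsVanishingOn (u + v) s :=
  fun ψ hψ => by
    change u ψ + v ψ = 0
    rw [hu ψ hψ, hv ψ hψ, add_zero]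

theorem isVanishingOn_sub {E : Type*} [NormedAddCommGroup E] [NormedSpace ℝ E] {u v : 𝓢'(E, ℂ)}
    {s : Set E} (hu : IsVanishingOn u s) (hv : IsVanishingOn v s) : IsVanishingOn (u - v) s :=
  fun ψ hψ => by
    change u ψ - v ψ = 0
    rw [hu ψ hψ, hv ψ hψ, sub_zero]

theorem IsTensor.unique {f g : 𝓢'(ℝ, ℂ)} {w w' : 𝓢'(ℝ × ℝ, ℂ)} (h : IsTensor f g w)
    (h' : IsTensor f g w') : w = w' :=
  dist_ext_tensor fun a b => by rw [h, h']

end Tensors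

/-! ### Laplace transform in time and the equation V'' = p²V -/

section SliceLaplace

variable {u : 𝓢'(ℝ × ℝ, ℂ)}

theorem slice_apply (u : 𝓢'(ℝ × ℝ, ℂ)) (a b : 𝓢(ℝ, ℂ)) : slice u a b = u (tensorCLM a b) := rfl

theorem isVanishingOn_slice (hu : IsVanishingOn u {p : ℝ × ℝ | p.2 < 0}) (a : 𝓢(ℝ, ℂ)) :
    IsVanishingOn (slice u a) (Iio 0) := fun b hb => hu _ fun x hx => by
  have : tsupport (tensorCLM a b) ⊆ Prod.snd ⁻¹' tsupport b :=
    closure_minimal (fun x hx => subset_tsupport _ (right_ne_zero_of_mul hx))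
      ((isClosed_tsupport _).preimage continuous_snd)
  exact hb (this hx)

theorem laplace_slice_snd_deriv (hu : IsVanishingOn u {p : ℝ × ℝ | p.2 < 0}) (a : 𝓢(ℝ, ℂ)) {s : ℂ}
    (hs : 0 < s.re) :
    laplace (slice (∂_{((0, 1) : ℝ × ℝ)} u) a) s = s * laplace (slice u a) s := by
  rw [laplace_of_pos _ hs, laplace_of_pos _ hs, slice_apply, slice_apply,
    TemperedDistribution.lineDerivOp_apply_apply, lineDerivOp_snd_tensorCLM, ← smul_eq_mul,
    ← map_smul]
  refine dist_congr_halfSpace (L := ContinuousLinearMap.snd ℝ ℝ ℝ) hu fun x hx => ?_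
  have hx' : -1 < x.2 := hx
  change -(a x.1 * (∂_{(1 : ℝ)} (laplaceKernel s hs) : 𝓢(ℝ, ℂ)) x.2) =
    s * (a x.1 * laplaceKernel s hs x.2)
  rw [lineDerivOp_of_eq_exp (fun t ht => laplaceKernel_of_gt hs ht) hx', laplaceKernel_of_gt hs hx']
  ring

theorem laplace_slice_fst_deriv (u : 𝓢'(ℝ × ℝ, ℂ)) (a : 𝓢(ℝ, ℂ)) {s : ℂ} (hs : 0 < s.re) :
    laplace (slice (∂_{((1, 0) : ℝ × ℝ)} u) a) s = -laplace (slice u (∂_{(1 : ℝ)} a)) s := by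
  rw [laplace_of_pos _ hs, laplace_of_pos _ hs, slice_apply, slice_apply,
    TemperedDistribution.lineDerivOp_apply_apply, lineDerivOp_fst_tensorCLM, map_neg]

theorem laplace_sub (f g : 𝓢'(ℝ, ℂ)) (s : ℂ) : laplace (f - g) s = laplace f s - laplace g s := by
  unfold laplace
  split_ifs
  · rfl
  · simp

theorem slice_sub (u v : 𝓢'(ℝ × ℝ, ℂ)) (a : 𝓢(ℝ, ℂ)) : slice (u - v) a = slice u a - slice v a :=
  rfl

theorem laplace_slice_tensorDelta (v : 𝓢'(ℝ, ℂ)) (a : 𝓢(ℝ, ℂ)) {s : ℂ} (hs : 0 < s.re) :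
    laplace (slice (tensorDelta v) a) s = v a := by
  rw [laplace_of_pos _ hs, slice_apply, tensorDelta_apply, restrictZero_tensorCLM, map_smul,
    laplaceKernel_of_gt hs (by norm_num)]
  simp

/-- The distribution `a ↦ ⟨u(x,t), a(x) e^{-st}⟩`. -/
def laplaceSlice (u : 𝓢'(ℝ × ℝ, ℂ)) (s : ℂ) (hs : 0 < s.re) : 𝓢'(ℝ, ℂ) :=
  PointwiseConvergenceCLM.precomp ℂ
    ((SchwartzMap.compCLMOfContinuousLinearEquiv ℂ (ContinuousLinearEquiv.prodComm ℝ ℝ ℝ)).comp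
      (tensorCLM (laplaceKernel s hs))) u

theorem laplaceSlice_apply (u : 𝓢'(ℝ × ℝ, ℂ)) {s : ℂ} (hs : 0 < s.re) (a : 𝓢(ℝ, ℂ)) :
    laplaceSlice u s hs a = laplace (slice u a) s := by
  rw [laplace_of_pos _ hs, slice_apply]
  change u _ = u _
  congr 1
  ext x
  change laplaceKernel s hs x.2 * a x.1 = _
  rw [tensorCLM_apply, mul_comm]

/-- A tempered solution of `V'' = p² V` with `Re p > 0` vanishes. -/
theorem eq_zero_of_second_deriv {V : 𝓢'(ℝ, ℂ)} {p : ℂ} (hp : 0 < p.re)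
    (h : ∀ a : 𝓢(ℝ, ℂ), V (∂_{(1 : ℝ)} (∂_{(1 : ℝ)} a)) = p ^ 2 * V a) : V = 0 := by
  ext a
  set f : ℝ → ℂ := fun τ => V (translate τ a) with hf
  set f' : ℝ → ℂ := fun τ => -V (translate τ (∂_{(1 : ℝ)} a)) with hf'
  have d : ∀ (b : 𝓢(ℝ, ℂ)) τ, HasDerivAt (fun τ : ℝ => V (translate τ b))
      (-V (translate τ (∂_{(1 : ℝ)} b))) τ := fun b τ => by
    have := hasDerivAt_dist_translate V b 0 (1 : ℝ) τ
    simpa using this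
  have d1 : ∀ τ, HasDerivAt f (f' τ) τ := d a
  have d2 : ∀ τ, HasDerivAt f' (p ^ 2 * f τ) τ := fun τ => by
    have := (d (∂_{(1 : ℝ)} a) τ).neg
    rwa [neg_neg, ← lineDerivOp_translate, ← lineDerivOp_translate, h] at this
  obtain ⟨m, C, hC, hb⟩ := exists_dist_translate_le V
  set S := C * (schwartzNorm ℝ m a + schwartzNorm ℝ m (∂_{(1 : ℝ)} a)) * (1 + ‖p‖) with hS
  have b0 : ∀ τ, ‖f' τ + p * f τ‖ ≤ S * (1 + |τ|) ^ m := fun τ => by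
    have e1 := hb a τ
    have e2 := hb (∂_{(1 : ℝ)} a) τ
    rw [Real.norm_eq_abs] at e1 e2
    have hA := apply_nonneg (schwartzNorm ℝ m) a
    have hB := apply_nonneg (schwartzNorm ℝ m) (∂_{(1 : ℝ)} a : 𝓢(ℝ, ℂ))
    calc ‖f' τ + p * f τ‖ ≤ ‖f' τ‖ + ‖p‖ * ‖f τ‖ := by
          rw [← norm_mul]; exact norm_add_le _ _
      _ ≤ C * (1 + |τ|) ^ m * schwartzNorm ℝ m (∂_{(1 : ℝ)} a) +
          ‖p‖ * (C * (1 + |τ|) ^ m * schwartzNorm ℝ m a) := by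
          rw [hf', norm_neg]; gcongr
      _ ≤ _ := by
          rw [hS]
          have h1 : 0 ≤ C * (1 + |τ|) ^ m := by positivity
          have h2 : 0 ≤ C * (1 + |τ|) ^ m * schwartzNorm ℝ m a := by positivity
          have h3 : 0 ≤ ‖p‖ * (C * (1 + |τ|) ^ m * schwartzNorm ℝ m (∂_{(1 : ℝ)} a)) := by
            positivity
          nlinarith
  have tend : ∀ S' : ℝ, Tendsto (fun τ : ℝ => S' * (1 + |τ|) ^ m * Real.exp (-(p.re * τ))) atTop
      (𝓝 0) := fun S' => by
    obtain ⟨K, hK, hle⟩ := exists_pow_mul_exp_neg_le 0 hp m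
    have h1 : Tendsto (fun τ : ℝ => K * Real.exp (-(p.re / 2 * (τ - 0)))) atTop (𝓝 (K * 0)) := by
      refine (Real.tendsto_exp_neg_atTop_nhds_zero.comp ?_).const_mul K
      simp only [sub_zero]
      exact tendsto_id.const_mul_atTop (half_pos hp)
    rw [mul_zero] at h1
    have h2 : Tendsto (fun τ : ℝ => (1 + |τ|) ^ m * Real.exp (-(p.re * τ))) atTop (𝓝 0) :=
      squeeze_zero' (Eventually.of_forall fun τ => by positivity)
        ((eventually_ge_atTop 0).mono fun τ hτ => hle τ hτ) h1
    simpa [mul_assoc] using h2.const_mul S'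
  have const_eq : ∀ (G : ℝ → ℂ) (q : ℂ), (∀ τ, HasDerivAt G (q * G τ) τ) →
      ∀ τ : ℝ, Complex.exp (-q * (τ : ℂ)) * G τ = G 0 := fun G q hG τ => by
    have hd : ∀ τ : ℝ, HasDerivAt (fun τ : ℝ => Complex.exp (-q * τ) * G τ) 0 τ := fun τ => by
      have he : HasDerivAt (fun t : ℝ => Complex.exp (-q * t)) (Complex.exp (-q * τ) * (-q * 1)) τ :=
        ((Complex.ofRealCLM.hasDerivAt (x := τ)).const_mul (-q)).cexp
      exact (he.fun_mul (hG τ)).congr_deriv (by ring)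
    have := is_const_of_deriv_eq_zero (fun τ => (hd τ).differentiableAt) (fun τ => (hd τ).deriv) τ 0
    simpa using this
  -- The function G = f' + pf satisfies G' = pG, so it is G(0)e^{pτ}. As τ → +∞ this contradicts
  -- polynomial growth unless G(0) = 0.
  have z1 : ∀ τ, f' τ + p * f τ = 0 := by
    have hG : ∀ τ, HasDerivAt (fun τ => f' τ + p * f τ) (p * (f' τ + p * f τ)) τ := fun τ => by
      exact ((d2 τ).fun_add ((d1 τ).const_mul p)).congr_deriv (by ring)
    have h0 : f' 0 + p * f 0 = 0 := by
      have hl := squeeze_zero_norm' (f := fun τ : ℝ => Complex.exp (-p * τ) * (f' τ + p * f τ))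
        (a := fun τ : ℝ => S * (1 + |τ|) ^ m * Real.exp (-(p.re * τ))) (t₀ := atTop)
        (Eventually.of_forall fun τ => by
          rw [norm_mul, norm_exp_neg_mul, mul_comm]; gcongr; exact b0 τ) (tend S)
      have : (fun τ : ℝ => Complex.exp (-p * τ) * (f' τ + p * f τ)) = fun _ => f' 0 + p * f 0 :=
        funext fun τ => const_eq _ p hG τ
      rw [this] at hl
      exact tendsto_nhds_unique tendsto_const_nhds hl
    intro τ
    have := const_eq _ p hG τ
    rw [h0] at this
    simpa using this
  -- Now f is f(0)e^{-pτ}, and the same growth argument at τ → -∞ gives f(0) = 0.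
  have hf1 : ∀ τ, HasDerivAt f (-p * f τ) τ := fun τ => by
    have : -p * f τ = f' τ := by linear_combination -z1 τ
    rw [this]; exact d1 τ
  have hl := squeeze_zero_norm' (f := fun τ : ℝ => Complex.exp (p * (-τ : ℝ)) * f (-τ))
      (a := fun τ : ℝ => C * schwartzNorm ℝ m a * (1 + |τ|) ^ m * Real.exp (-(p.re * τ)))
      (t₀ := atTop)
      (Eventually.of_forall fun τ => by
        have e1 := hb a (-τ)
        rw [norm_neg, Real.norm_eq_abs] at e1
        rw [norm_mul, Complex.norm_exp, mul_comm]
        have : (p * ((-τ : ℝ) : ℂ)).re = -(p.re * τ) := by simp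
        rw [this]
        gcongr
        exact e1.trans (le_of_eq (by ring))) (tend _)
  have : (fun τ : ℝ => Complex.exp (p * (-τ : ℝ)) * f (-τ)) = fun _ => f 0 := funext fun τ => by
    have := const_eq f (-p) hf1 (-τ)
    simpa using this
  rw [this] at hl
  have hf0 := tendsto_nhds_unique tendsto_const_nhds hl
  have e : translate (0 : ℝ) a = a := by ext x; change a (x - 0) = a x; rw [sub_zero]
  simpa [hf, e] using hf0

/-- Integration by parts for the fundamental solution of `p² - ∂²`. -/
theorem integral_exp_mul_dist_translate (v : 𝓢'(ℝ, ℂ)) {p : ℂ} (hp : 0 < p.re) (a : 𝓢(ℝ, ℂ)) :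
    Integrable (fun y : ℝ => Complex.exp (-p * |y|) * v (translate y a)) ∧
    ∫ y : ℝ, Complex.exp (-p * |y|) * v (translate y (∂_{(1 : ℝ)} (∂_{(1 : ℝ)} a))) =
      p ^ 2 * (∫ y : ℝ, Complex.exp (-p * |y|) * v (translate y a)) - 2 * p * v a := by
  have d : ∀ (b : 𝓢(ℝ, ℂ)) τ, HasDerivAt (fun τ : ℝ => v (translate τ b))
      (-v (translate τ (∂_{(1 : ℝ)} b))) τ := fun b τ => by
    have := hasDerivAt_dist_translate v b 0 (1 : ℝ) τ
    simpa using this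
  have hcont : ∀ b : 𝓢(ℝ, ℂ), Continuous fun τ : ℝ => v (translate τ b) := fun b =>
    (map_continuous v).comp (continuous_translate b)
  obtain ⟨m, C, hC, hb⟩ := exists_dist_translate_le v
  obtain ⟨K, hK, hle⟩ := exists_pow_mul_exp_neg_le 0 hp m
  have hbd : ∀ (b : 𝓢(ℝ, ℂ)) (y : ℝ), ‖Complex.exp (-p * |y|) * v (translate y b)‖ ≤
      C * schwartzNorm ℝ m b * K * Real.exp (-(p.re / 2 * |y|)) := fun b y => by
    rw [norm_mul, norm_exp_neg_mul]
    have h1 := hb b y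
    have h2 := hle |y| (abs_nonneg y)
    rw [abs_abs, sub_zero] at h2
    rw [Real.norm_eq_abs] at h1
    calc Real.exp (-(p.re * |y|)) * ‖v (translate y b)‖
        ≤ Real.exp (-(p.re * |y|)) * (C * (1 + |y|) ^ m * schwartzNorm ℝ m b) := by gcongr
      _ = C * schwartzNorm ℝ m b * ((1 + |y|) ^ m * Real.exp (-(p.re * |y|))) := by ring
      _ ≤ C * schwartzNorm ℝ m b * (K * Real.exp (-(p.re / 2 * |y|))) := by gcongr
      _ = _ := by ring
  have hexp : Integrable fun y : ℝ => Real.exp (-(p.re / 2 * |y|)) := by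
    refine (integrable_invSq.const_mul (3 * (Nat.factorial 2) * (1 + (p.re / 2)⁻¹) ^ 2)).mono'
      (by fun_prop) (Eventually.of_forall fun y => ?_)
    have hy : 0 < (1 + |y|) ^ 2 := by positivity
    rw [Real.norm_of_nonneg (Real.exp_nonneg _), invSq, ← div_eq_mul_inv, le_div_iff₀ hy, mul_comm]
    exact one_add_pow_mul_exp_neg_le (abs_nonneg y) (half_pos hp) 2
  have hint : ∀ b : 𝓢(ℝ, ℂ), Integrable fun y : ℝ => Complex.exp (-p * |y|) * v (translate y b) :=
    fun b => (hexp.const_mul _).mono' ((by fun_prop : Continuous fun y : ℝ =>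
      Complex.exp (-p * |y|)).mul (hcont b)).aestronglyMeasurable (Eventually.of_forall (hbd b))
  refine ⟨hint a, ?_⟩
  set a1 : 𝓢(ℝ, ℂ) := ∂_{(1 : ℝ)} a with ha1
  set a2 : 𝓢(ℝ, ℂ) := ∂_{(1 : ℝ)} a1 with ha2
  have tend : ∀ b : 𝓢(ℝ, ℂ), Tendsto (fun y : ℝ => Complex.exp (-p * |y|) * v (translate y b)) atTop
      (𝓝 0) ∧ Tendsto (fun y : ℝ => Complex.exp (-p * |y|) * v (translate y b)) atBot (𝓝 0) :=
    fun b => by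
    have h0 : Tendsto (fun x : ℝ => C * schwartzNorm ℝ m b * K * Real.exp (-(p.re / 2 * x))) atTop
        (𝓝 0) := by
      have := (Real.tendsto_exp_neg_atTop_nhds_zero.comp
        (tendsto_id.const_mul_atTop (half_pos hp))).const_mul (C * schwartzNorm ℝ m b * K)
      rwa [mul_zero] at this
    exact ⟨squeeze_zero_norm (hbd b) (h0.comp tendsto_abs_atTop_atTop),
      squeeze_zero_norm (hbd b) (h0.comp tendsto_abs_atBot_atTop)⟩
  have e0 : ∀ b : 𝓢(ℝ, ℂ), translate (0 : ℝ) b = b := fun b => by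
    ext x; change b (x - 0) = b x; rw [sub_zero]
  -- primitives on the two half lines
  have hexpd : ∀ (q : ℂ) (y : ℝ), HasDerivAt (fun y : ℝ => Complex.exp (q * y))
      (Complex.exp (q * y) * (q * 1)) y := fun q y =>
    ((Complex.ofRealCLM.hasDerivAt (x := y)).const_mul q).cexp
  have hsplit : ∀ b : 𝓢(ℝ, ℂ), ∫ y : ℝ, Complex.exp (-p * |y|) * v (translate y b) =
      (∫ y in Iic (0 : ℝ), Complex.exp (p * y) * v (translate y b)) +
      ∫ y in Ioi (0 : ℝ), Complex.exp (-p * y) * v (translate y b) := fun b => by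
    rw [← intervalIntegral.integral_Iic_add_Ioi (b := 0) (hint b).integrableOn (hint b).integrableOn]
    congr 1
    · refine setIntegral_congr_fun measurableSet_Iic fun y hy => ?_
      rw [abs_of_nonpos hy]; push_cast; ring_nf
    · refine setIntegral_congr_fun measurableSet_Ioi fun y hy => ?_
      rw [abs_of_pos hy]
  have iI : ∀ b : 𝓢(ℝ, ℂ), IntegrableOn (fun y : ℝ => Complex.exp (p * y) * v (translate y b))
      (Iic 0) := fun b => (hint b).integrableOn.congr_fun (fun y hy => by
      beta_reduce; rw [abs_of_nonpos hy]; push_cast; ring_nf) measurableSet_Iic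
  have iJ : ∀ b : 𝓢(ℝ, ℂ), IntegrableOn (fun y : ℝ => Complex.exp (-p * y) * v (translate y b))
      (Ioi 0) := fun b => (hint b).integrableOn.congr_fun (fun y hy => by
      beta_reduce; rw [abs_of_pos hy]) measurableSet_Ioi
  have P : ∫ y in Ioi (0 : ℝ), (Complex.exp (-p * y) * v (translate y a2) -
      p ^ 2 * (Complex.exp (-p * y) * v (translate y a))) = 0 - (-v a1 + p * v a) := by
    rw [integral_Ioi_of_hasDerivAt_of_tendsto (a := (0 : ℝ)) (m := 0)
      (f := fun y : ℝ => Complex.exp (-p * y) * (-v (translate y a1) + p * v (translate y a)))]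
    · simp
    · exact Continuous.continuousWithinAt ((by fun_prop : Continuous fun y : ℝ =>
        Complex.exp (-p * y)).mul ((hcont a1).neg.add (continuous_const.mul (hcont a))))
    · intro y _
      exact ((hexpd (-p) y).fun_mul ((d a1 y).fun_neg.fun_add ((d a y).const_mul p))).congr_deriv
        (by simp only [← ha2, ← ha1]; ring)
    · exact (iJ a2).sub ((iJ a).const_mul _)
    · have := ((tend a1).1.const_mul (-1)).add ((tend a).1.const_mul p)
      simp only [mul_zero, add_zero] at this
      refine this.congr' ?_
      filter_upwards [eventually_ge_atTop 0] with y hy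
      rw [abs_of_nonneg hy]; ring
  have Q : ∫ y in Iic (0 : ℝ), (Complex.exp (p * y) * v (translate y a2) -
      p ^ 2 * (Complex.exp (p * y) * v (translate y a))) = (-v a1 - p * v a) - 0 := by
    rw [integral_Iic_of_hasDerivAt_of_tendsto (a := (0 : ℝ)) (m := 0)
      (f := fun y : ℝ => Complex.exp (p * y) * (-v (translate y a1) - p * v (translate y a)))]
    · simp
    · exact Continuous.continuousWithinAt ((by fun_prop : Continuous fun y : ℝ =>
        Complex.exp (p * y)).mul ((hcont a1).neg.sub (continuous_const.mul (hcont a))))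
    · intro y _
      exact ((hexpd p y).fun_mul ((d a1 y).fun_neg.fun_sub ((d a y).const_mul p))).congr_deriv
        (by simp only [← ha2, ← ha1]; ring)
    · exact (iI a2).sub ((iI a).const_mul _)
    · have := ((tend a1).2.const_mul (-1)).add ((tend a).2.const_mul (-p))
      simp only [mul_zero, add_zero] at this
      refine this.congr' ?_
      filter_upwards [eventually_le_atBot 0] with y hy
      rw [abs_of_nonpos hy]; push_cast; ring_nf
  rw [integral_sub (iJ a2) ((iJ a).const_mul _), integral_const_mul] at P
  rw [integral_sub (iI a2) ((iI a).const_mul _), integral_const_mul] at Q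
  rw [hsplit a2, hsplit a]
  -- In the sum of the two boundary terms at 0 the contributions of v a' cancel, while those of p v
  -- a add up to -2p v a: this is the jump of the derivative of e^{-p|y|}.
  linear_combination P + Q

end SliceLaplace

/-! ### The Cauchy problem -/

section Cauchy

/-- A tempered distribution on the plane vanishing for `t < 0` is determined by its Laplace
transform in `t`. -/
theorem ext_laplace_slice {u v : 𝓢'(ℝ × ℝ, ℂ)} (hu : IsVanishingOn u {p : ℝ × ℝ | p.2 < 0})
    (hv : IsVanishingOn v {p : ℝ × ℝ | p.2 < 0})
    (h : ∀ (a : 𝓢(ℝ, ℂ)) (s : ℂ), 0 < s.re → laplace (slice u a) s = laplace (slice v a) s) :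
    u = v :=
  dist_ext_tensor fun a b => by
    rw [← slice_apply, ← slice_apply,
      eq_of_laplace_eq (isVanishingOn_slice hu a) (isVanishingOn_slice hv a) (h a)]

/-- Up to a power of `1 + s`, the function `Kt` is the Laplace transform of kernels of arbitrarily
high decay. -/
def HasKernels (Kt : ℝ → ℂ → ℂ) : Prop :=
  ∀ M : ℕ, ∃ (m : ℕ) (g : ℝ × ℝ → ℂ), IsKernel g M ∧ ∀ s : ℂ, 0 < s.re → ∀ y : ℝ,
    ∫ t : ℝ, Complex.exp (-s * t) * g (y, t) = ((1 + s) ^ m)⁻¹ * Kt y s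

variable {g : ℝ × ℝ → ℂ} {W : 𝓢'(ℝ × ℝ, ℂ)} {M m : ℕ} {Kt : ℝ → ℂ → ℂ} {u₀ v₀ : 𝓢'(ℝ, ℂ)}

/-- Shifting e^{-st} by ζ produces e^{-sζ.2}; the δ part of W then contributes 1 and the Heaviside
part 1/s. Integrating g against e^{-st} leaves Kt up to the power of 1 + s, which is cancelled by
the differential operator. -/
theorem laplace_slice_distOp_kernelConv (hg : IsKernel g M) (hW : HasGrowth W M)
    (ht : ∀ a b : 𝓢(ℝ, ℂ), W (tensorCLM a b) = u₀ a * b 0 + v₀ a * ∫ t in Ioi (0 : ℝ), b t)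
    (hL : ∀ s : ℂ, 0 < s.re → ∀ y : ℝ,
      ∫ t : ℝ, Complex.exp (-s * t) * g (y, t) = ((1 + s) ^ m)⁻¹ * Kt y s)
    (a : 𝓢(ℝ, ℂ)) {s : ℂ} (hs : 0 < s.re) :
    laplace (slice (distOp ((0, 1) : ℝ × ℝ) m (kernelConv hg hW)) a) s =
      ∫ y : ℝ, Kt y s * (u₀ (translate (-y) a) + s⁻¹ * v₀ (translate (-y) a)) := by
  have hs1 : 1 + s ≠ 0 := fun h => by
    have := congrArg Complex.re h
    simp at this
    linarith
  have hs0 : s ≠ 0 := fun h => by simp [h] at hs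
  rw [laplace_of_pos _ hs, slice_apply, distOp_apply, diffOp_tensorCLM, kernelConv_apply]
  have hi := integrable_kernel_mul hg hW (tensorCLM a (diffOp 1 (-1) m (laplaceKernel s hs)))
  have key : ∀ ζ : ℝ × ℝ, g ζ *
      W (translate (-ζ) (tensorCLM a (diffOp 1 (-1) m (laplaceKernel s hs)))) =
      ((1 + s) ^ m * (u₀ (translate (-ζ.1) a) + s⁻¹ * v₀ (translate (-ζ.1) a))) *
        (Complex.exp (-s * ζ.2) * g ζ) := fun ζ => by
    rcases lt_or_ge ζ.2 0 with h | h
    · rw [hg.zero ζ h]; simp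
    have hb : ∀ t : ℝ, 0 ≤ t → translate (-ζ.2) (diffOp 1 (-1) m (laplaceKernel s hs)) t =
        (1 + s) ^ m * Complex.exp (-s * ζ.2) * Complex.exp (-s * t) := fun t ht => by
      change diffOp 1 (-1) m (laplaceKernel s hs) (t - -ζ.2) = _
      rw [diffOp_of_eq_exp (fun t ht => laplaceKernel_of_gt hs ht) m (by linarith), mul_one,
        mul_assoc, ← Complex.exp_add]
      push_cast
      ring_nf
    have hint : ∫ t in Ioi (0 : ℝ), translate (-ζ.2) (diffOp 1 (-1) m (laplaceKernel s hs)) t =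
        (1 + s) ^ m * Complex.exp (-s * ζ.2) * s⁻¹ := by
      rw [setIntegral_congr_fun measurableSet_Ioi (fun t ht => hb t (le_of_lt ht)),
        integral_const_mul, integral_exp_mul_complex_Ioi (by simpa using hs)]
      congr 1
      simp only [Complex.ofReal_zero, mul_zero, Complex.exp_zero]
      field_simp
    rw [translate_tensorCLM, ht, Prod.fst_neg, Prod.snd_neg, hint, hb 0 le_rfl]
    simp only [Complex.ofReal_zero, mul_zero, Complex.exp_zero]
    ring
  simp only [key] at hi ⊢
  rw [Measure.volume_eq_prod, integral_prod _ hi]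
  refine integral_congr_ae (Eventually.of_forall fun y => ?_)
  simp only
  rw [integral_const_mul, hL s hs y]
  have := pow_ne_zero m hs1
  field_simp

theorem isFundamentalSolution_of_kernel {φσ φε : 𝓢'(ℝ, ℂ)} {W₀ : 𝓢'(ℝ × ℝ, ℂ)}
    (hg : IsKernel g M) (hW₀ : HasGrowth W₀ M)
    (hW₀e : W₀ = tensorDelta (TemperedDistribution.delta 0))
    (hL : ∀ s : ℂ, 0 < s.re → ∀ y : ℝ,
      ∫ t : ℝ, Complex.exp (-s * t) * g (y, t) = ((1 + s) ^ m)⁻¹ * Ktilde φσ φε y s) :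
    IsFundamentalSolution φσ φε (distOp ((0, 1) : ℝ × ℝ) m (kernelConv hg hW₀)) := by
  have hv0 : IsVanishingOn W₀ {p : ℝ × ℝ | p.2 < 0} := by
    rw [hW₀e]; exact isVanishingOn_tensorDelta _
  have hv := isVanishingOn_distOp ((0, 1) : ℝ × ℝ) m (isVanishingOn_kernelConv hg hW₀ hv0)
  refine ⟨hv, fun a => ⟨isVanishingOn_slice hv a, fun s hs => ?_⟩⟩
  rw [laplace_slice_distOp_kernelConv (u₀ := TemperedDistribution.delta 0) (v₀ := 0) hg hW₀
    (fun a b => by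
      rw [hW₀e, isTensor_tensorDelta]
      change _ = _ + 0 * _
      rw [zero_mul, add_zero, TemperedDistribution.delta_apply, TemperedDistribution.delta_apply])
    hL a hs]
  refine integral_congr_ae (Eventually.of_forall fun y => ?_)
  change _ * (a (0 - -y) + _ * 0) = _
  simp

theorem IsFundamentalSolution.unique {φσ φε : 𝓢'(ℝ, ℂ)} {K K' : 𝓢'(ℝ × ℝ, ℂ)}
    (h : IsFundamentalSolution φσ φε K) (h' : IsFundamentalSolution φσ φε K') : K = K' :=
  ext_laplace_slice h.1 h'.1 fun a s hs => by rw [(h.2 a).2 s hs, (h'.2 a).2 s hs]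

theorem existsUnique_fundamentalSolution {φσ φε : 𝓢'(ℝ, ℂ)} (h : HasKernels (Ktilde φσ φε)) :
    ∃! K : 𝓢'(ℝ × ℝ, ℂ), IsFundamentalSolution φσ φε K := by
  obtain ⟨M, hM⟩ := exists_hasGrowth (isVanishingOn_tensorDelta (TemperedDistribution.delta 0))
  obtain ⟨m, g, hg, hL⟩ := h M
  exact ⟨_, isFundamentalSolution_of_kernel hg hM rfl hL, fun K' hK' =>
    hK'.unique (isFundamentalSolution_of_kernel hg hM rfl hL)⟩

theorem isVanishingOn_lineDerivOp {E : Type*} [NormedAddCommGroup E] [NormedSpace ℝ E]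
    {u : 𝓢'(E, ℂ)} {s : Set E} (hu : IsVanishingOn u s) (v : E) :
    IsVanishingOn (∂_{v} u : 𝓢'(E, ℂ)) s := fun f hf => by
  rw [TemperedDistribution.lineDerivOp_apply_apply, map_neg,
    hu _ ((tsupport_lineDerivOp_subset v f).trans hf), neg_zero]

theorem laplace_slice_snd_deriv_two {u : 𝓢'(ℝ × ℝ, ℂ)}
    (hu : IsVanishingOn u {p : ℝ × ℝ | p.2 < 0}) (a : 𝓢(ℝ, ℂ)) {s : ℂ} (hs : 0 < s.re) :
    laplace (slice (∂_{((0, 1) : ℝ × ℝ)} (∂_{((0, 1) : ℝ × ℝ)} u)) a) s =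
      s ^ 2 * laplace (slice u a) s := by
  rw [laplace_slice_snd_deriv (isVanishingOn_lineDerivOp hu _) a hs, laplace_slice_snd_deriv hu a hs]
  ring

theorem laplace_slice_fst_deriv_two (u : 𝓢'(ℝ × ℝ, ℂ)) (a : 𝓢(ℝ, ℂ)) {s : ℂ} (hs : 0 < s.re) :
    laplace (slice (∂_{((1, 0) : ℝ × ℝ)} (∂_{((1, 0) : ℝ × ℝ)} u)) a) s =
      laplace (slice u (∂_{(1 : ℝ)} (∂_{(1 : ℝ)} a))) s := by
  rw [laplace_slice_fst_deriv _ a hs, laplace_slice_fst_deriv u _ hs, neg_neg]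

variable {ℓ : 𝓢'(ℝ, ℂ)} {p : ℂ → ℂ}

/-- The convolution term L is not assumed to vanish for t < 0. The equation expresses it through
terms that do, and only then does its Laplace transform factor. -/
theorem IsCauchySolution.laplace_eq (hℓ : IsVanishingOn ℓ (Iio 0)) {u : 𝓢'(ℝ × ℝ, ℂ)}
    (hu : IsCauchySolution ℓ u₀ v₀ u) (a : 𝓢(ℝ, ℂ)) {s : ℂ} (hs : 0 < s.re) :
    laplace ℓ s * laplace (slice u (∂_{(1 : ℝ)} (∂_{(1 : ℝ)} a))) s =
      s ^ 2 * laplace (slice u a) s - s * u₀ a - v₀ a := by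
  obtain ⟨hv, L, A, B, hL, hA, hB, heq⟩ := hu
  have eA := hA.unique (isTensor_derivDelta u₀)
  have eB := hB.unique (isTensor_tensorDelta v₀)
  have vA : IsVanishingOn A {p : ℝ × ℝ | p.2 < 0} := by
    rw [eA]; exact isVanishingOn_lineDerivOp (isVanishingOn_tensorDelta u₀) _
  have vB : IsVanishingOn B {p : ℝ × ℝ | p.2 < 0} := by
    rw [eB]; exact isVanishingOn_tensorDelta v₀
  have eL : L = ∂_{((0, 1) : ℝ × ℝ)} (∂_{((0, 1) : ℝ × ℝ)} u) - A - B := by rw [heq]; abel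
  have vL : IsVanishingOn L {p : ℝ × ℝ | p.2 < 0} := by
    rw [eL]
    exact isVanishingOn_sub (isVanishingOn_sub
      (isVanishingOn_lineDerivOp (isVanishingOn_lineDerivOp hv _) _) vA) vB
  have vx := isVanishingOn_lineDerivOp (isVanishingOn_lineDerivOp hv (1, 0)) (1, 0)
  have h1 := laplace_of_isConv hℓ (isVanishingOn_slice vx a) (isVanishingOn_slice vL a) (hL a) hs
  rw [laplace_slice_fst_deriv_two u a hs, eL, slice_sub, slice_sub, laplace_sub, laplace_sub,
    laplace_slice_snd_deriv_two hv a hs, eA, eB,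
    laplace_slice_snd_deriv (isVanishingOn_tensorDelta u₀) a hs, laplace_slice_tensorDelta _ a hs,
    laplace_slice_tensorDelta _ a hs] at h1
  exact h1.symm

/-- For fixed s the Laplace transform of the difference of two solutions is a tempered distribution
in x with V'' = p²V, which is zero by `eq_zero_of_second_deriv`. -/
theorem IsCauchySolution.unique (hℓ : IsVanishingOn ℓ (Iio 0))
    (hp : ∀ s : ℂ, 0 < s.re → 0 < (p s).re)
    (hℓp : ∀ s : ℂ, 0 < s.re → laplace ℓ s * p s ^ 2 = s ^ 2) {u u' : 𝓢'(ℝ × ℝ, ℂ)}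
    (hu : IsCauchySolution ℓ u₀ v₀ u) (hu' : IsCauchySolution ℓ u₀ v₀ u') : u = u' := by
  refine ext_laplace_slice hu.1 hu'.1 fun a s hs => ?_
  have hs0 : s ≠ 0 := fun h => by simp [h] at hs
  have hV : laplaceSlice u s hs - laplaceSlice u' s hs = 0 := by
    refine eq_zero_of_second_deriv (hp s hs) fun a => ?_
    change laplaceSlice u s hs _ - laplaceSlice u' s hs _ =
      _ * (laplaceSlice u s hs _ - laplaceSlice u' s hs _)
    simp only [laplaceSlice_apply]
    have h1 := hu.laplace_eq hℓ a hs
    have h2 := hu'.laplace_eq hℓ a hs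
    have h3 := hℓp s hs
    have hne : laplace ℓ s ≠ 0 := fun h => by
      rw [h, zero_mul] at h3; exact pow_ne_zero 2 hs0 h3.symm
    refine mul_left_cancel₀ hne ?_
    linear_combination h1 - h2 - h3 * (laplace (slice u a) s - laplace (slice u' a) s)
  have := DFunLike.congr_fun hV a
  change laplaceSlice u s hs a - laplaceSlice u' s hs a = 0 at this
  rwa [laplaceSlice_apply, laplaceSlice_apply, sub_eq_zero] at this

/-- The equation itself serves as the definition of the convolution term; that it is a convolution
is then read off from the Laplace transforms. -/
theorem isCauchySolution_of_laplace (hℓ : IsVanishingOn ℓ (Iio 0)) {u : 𝓢'(ℝ × ℝ, ℂ)}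
    (hv : IsVanishingOn u {p : ℝ × ℝ | p.2 < 0})
    (h : ∀ (a : 𝓢(ℝ, ℂ)) (s : ℂ), 0 < s.re →
      laplace ℓ s * laplace (slice u (∂_{(1 : ℝ)} (∂_{(1 : ℝ)} a))) s =
      s ^ 2 * laplace (slice u a) s - s * u₀ a - v₀ a) : IsCauchySolution ℓ u₀ v₀ u := by
  set A := ∂_{((0, 1) : ℝ × ℝ)} (tensorDelta u₀) with hA
  set B := tensorDelta v₀ with hB
  refine ⟨hv, ∂_{((0, 1) : ℝ × ℝ)} (∂_{((0, 1) : ℝ × ℝ)} u) - A - B, A, B, fun a => ?_,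
    isTensor_derivDelta u₀, isTensor_tensorDelta v₀, by abel⟩
  have vA : IsVanishingOn A {p : ℝ × ℝ | p.2 < 0} :=
    isVanishingOn_lineDerivOp (isVanishingOn_tensorDelta u₀) _
  have vL := isVanishingOn_sub (isVanishingOn_sub
      (isVanishingOn_lineDerivOp (isVanishingOn_lineDerivOp hv (0, 1)) (0, 1)) vA)
      (isVanishingOn_tensorDelta v₀)
  have vx := isVanishingOn_lineDerivOp (isVanishingOn_lineDerivOp hv (1, 0)) (1, 0)
  refine isConv_of_laplace hℓ (isVanishingOn_slice vx a) (isVanishingOn_slice vL a) fun s hs => ?_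
  rw [laplace_slice_fst_deriv_two u a hs, h a s hs, slice_sub, slice_sub, laplace_sub, laplace_sub,
    laplace_slice_snd_deriv_two hv a hs,
    laplace_slice_snd_deriv (isVanishingOn_tensorDelta u₀) a hs, laplace_slice_tensorDelta _ a hs,
    laplace_slice_tensorDelta _ a hs]

theorem cauchy_problem {φσ φε : 𝓢'(ℝ, ℂ)} (hℓ : IsVanishingOn ℓ (Iio 0))
    (hK : HasKernels (Ktilde φσ φε))
    (hp : ∀ s : ℂ, 0 < s.re → 0 < (s * sqrtRatio φσ φε s).re)
    (hℓp : ∀ s : ℂ, 0 < s.re → laplace ℓ s * (s * sqrtRatio φσ φε s) ^ 2 = s ^ 2)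
    {K : 𝓢'(ℝ × ℝ, ℂ)} (hfs : IsFundamentalSolution φσ φε K) (u₀ v₀ : 𝓢'(ℝ, ℂ)) :
    (∃! u : 𝓢'(ℝ × ℝ, ℂ), IsCauchySolution ℓ u₀ v₀ u) ∧
      ∀ u : 𝓢'(ℝ × ℝ, ℂ), IsCauchySolution ℓ u₀ v₀ u →
        ∃ A B : 𝓢'(ℝ × ℝ, ℂ), IsTensor u₀ (TemperedDistribution.delta 0) A ∧
          IsTensor v₀ heaviside B ∧ IsConv K (A + B) u := by
  set W := tensorDelta u₀ + tensorHeaviside v₀ with hW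
  have hv : IsVanishingOn W {p : ℝ × ℝ | p.2 < 0} :=
    isVanishingOn_add (isVanishingOn_tensorDelta _) (isVanishingOn_tensorHeaviside _)
  obtain ⟨M₀, hM₀⟩ := exists_hasGrowth (isVanishingOn_tensorDelta (TemperedDistribution.delta 0))
  obtain ⟨M₁, hM₁⟩ := exists_hasGrowth hv
  -- One and the same kernel must act on the Dirac distribution, to represent K, and on the data, to
  -- represent u. Its decay order therefore dominates both growth orders.
  obtain ⟨m, g, hg, hL⟩ := hK (max M₀ M₁)
  replace hM₀ := hM₀.mono (le_max_left M₀ M₁)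
  replace hM₁ := hM₁.mono (le_max_right M₀ M₁)
  have eK := hfs.unique (isFundamentalSolution_of_kernel hg hM₀ rfl hL)
  set U := distOp ((0, 1) : ℝ × ℝ) m (kernelConv hg hM₁) with hU
  have vU : IsVanishingOn U {p : ℝ × ℝ | p.2 < 0} :=
    isVanishingOn_distOp _ m (isVanishingOn_kernelConv hg hM₁ hv)
  have hWt : ∀ a b : 𝓢(ℝ, ℂ), W (tensorCLM a b) = u₀ a * b 0 + v₀ a * ∫ t in Ioi (0 : ℝ), b t :=
    fun a b => by
      change tensorDelta u₀ _ + tensorHeaviside v₀ _ = _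
      rw [isTensor_tensorDelta, tensorHeaviside_tensorCLM, TemperedDistribution.delta_apply]
  have hUs : IsCauchySolution ℓ u₀ v₀ U := by
    refine isCauchySolution_of_laplace hℓ vU fun a s hs => ?_
    have hs0 : s ≠ 0 := fun h => by simp [h] at hs
    set r := sqrtRatio φσ φε s with hr
    set w : 𝓢'(ℝ, ℂ) := u₀ + s⁻¹ • v₀ with hw
    -- The transform of U is w = u₀ + v₀/s convolved with ½ρe^{-p|y|}, p = sρ, which is p²/s times
    -- the Green function e^{-p|y|}/(2p) of p² - ∂². Multiplying by the transform s²/p² of ℓ leaves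
    -- the source s u₀ + v₀.
    have hT : ∀ b : 𝓢(ℝ, ℂ), laplace (slice U b) s =
        1 / 2 * r * ∫ y : ℝ, Complex.exp (-(s * r) * |y|) * w (translate y b) := fun b => by
      rw [hU, laplace_slice_distOp_kernelConv hg hM₁ hWt hL b hs, ← integral_neg_eq_self,
        ← integral_const_mul]
      refine integral_congr_ae (Eventually.of_forall fun y => ?_)
      simp only [Ktilde, abs_neg, neg_neg]
      change _ = _ * (_ * (u₀ (translate y b) + s⁻¹ * v₀ (translate y b)))
      rw [← hr]
      ring_nf
    have hbp := (integral_exp_mul_dist_translate w (hp s hs) a).2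
    have hℓs := hℓp s hs
    rw [hT, hT, hbp]
    have hwa : w a = u₀ a + s⁻¹ * v₀ a := rfl
    rw [hwa]
    set I := ∫ y : ℝ, Complex.exp (-(s * r) * |y|) * w (translate y a)
    have e : s * s⁻¹ = 1 := mul_inv_cancel₀ hs0
    have e2 : laplace ℓ s * r ^ 2 = 1 := by
      have h2 : s ^ 2 ≠ 0 := pow_ne_zero 2 hs0
      refine mul_left_cancel₀ h2 ?_
      linear_combination hℓs
    linear_combination (1 / 2 * r * I * s ^ 2 - s * (u₀ a + s⁻¹ * v₀ a)) * e2 - v₀ a * e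
  have huniq : ∀ u, IsCauchySolution ℓ u₀ v₀ u → u = U := fun u hu => hu.unique hℓ hp hℓp hUs
  refine ⟨⟨U, hUs, huniq⟩, fun u hu => ⟨tensorDelta u₀, tensorHeaviside v₀,
    isTensor_tensorDelta u₀, isTensor_tensorHeaviside v₀, ?_⟩⟩
  rw [huniq u hu, eK]
  refine isConv_distOp _ m (isConv_kernelConv hM₀ (fun ψ => ?_) hg hM₁ hv)
  rw [tensorDelta_apply, TemperedDistribution.delta_apply]
  rfl

end Cauchy

/-! ### The inverse Laplace integral -/

section InverseLaplace

theorem continuous_vertical {F : ℂ → ℂ} (hF : DifferentiableOn ℂ F {s | 0 < s.re}) {c : ℝ}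
    (hc : 0 < c) : Continuous fun w : ℝ => F (c + w * Complex.I) := by
  have h1 : Continuous fun w : ℝ => (c + w * Complex.I : ℂ) := by fun_prop
  exact hF.continuousOn.comp_continuous h1 fun w => by simpa using hc

/-- Cauchy's theorem on rectangles of height 2R; the horizontal sides are of size `invSq R`. -/
theorem integral_vertical_eq {f : ℂ → ℂ} {c₁ c₂ B : ℝ} (hf : DifferentiableOn ℂ f {s | 0 < s.re})
    (h₁ : 0 < c₁) (h₂ : 0 < c₂) (hb : ∀ s : ℂ, s.re ∈ uIcc c₁ c₂ → ‖f s‖ ≤ B * invSq s.im) :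
    ∫ w : ℝ, f (c₁ + w * Complex.I) = ∫ w : ℝ, f (c₂ + w * Complex.I) := by
  have hint : ∀ c, 0 < c → c ∈ uIcc c₁ c₂ → Integrable fun w : ℝ => f (c + w * Complex.I) :=
    fun c hc hm => (integrable_invSq.const_mul B).mono' (continuous_vertical hf hc).aestronglyMeasurable
      (Eventually.of_forall fun w => by simpa using hb (c + w * Complex.I) (by simpa using hm))
  have hrect : ∀ R : ℝ, (∫ w in (-R)..R, f (c₂ + w * Complex.I)) -
      (∫ w in (-R)..R, f (c₁ + w * Complex.I)) = Complex.I *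
      ((∫ x in c₁..c₂, f (x + (-R : ℝ) * Complex.I)) - ∫ x in c₁..c₂, f (x + R * Complex.I)) := by
    intro R
    have := Complex.integral_boundary_rect_eq_zero_of_differentiableOn f (⟨c₁, -R⟩ : ℂ) ⟨c₂, R⟩
      (hf.mono fun s hs => by
        have h := hs.1
        simp only [mem_preimage] at h
        exact lt_of_lt_of_le (lt_min h₁ h₂) h.1)
    simp only [smul_eq_mul] at this
    have hI : Complex.I * Complex.I = -1 := Complex.I_mul_I
    linear_combination (-Complex.I) * this + ((∫ w in (-R)..R, f (c₂ + w * Complex.I)) -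
      (∫ w in (-R)..R, f (c₁ + w * Complex.I))) * hI
  have hlim : ∀ σ : ℝ → ℝ, (∀ R, |σ R| = |R|) →
      Tendsto (fun R : ℝ => ∫ x in c₁..c₂, f (x + (σ R : ℝ) * Complex.I)) atTop (𝓝 0) := by
    intro σ hσ
    refine squeeze_zero_norm (a := fun R => B * invSq R * |c₂ - c₁|) (fun R => ?_) ?_
    · refine intervalIntegral.norm_integral_le_of_norm_le_const fun x hx => ?_
      have := hb (x + (σ R : ℝ) * Complex.I) (by simpa using uIoc_subset_uIcc hx)
      simpa [invSq, hσ] using this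
    · have h1 : Tendsto (fun R : ℝ => (1 + |R|) ^ 2) atTop atTop :=
        (tendsto_pow_atTop two_ne_zero).comp
          (tendsto_atTop_add_const_left _ _ tendsto_abs_atTop_atTop)
      have h2 := ((tendsto_inv_atTop_zero.comp h1).const_mul B).mul_const |c₂ - c₁|
      simpa [invSq, Function.comp_def] using h2
  have e1 := intervalIntegral_tendsto_integral (hint c₁ h₁ left_mem_uIcc)
    tendsto_neg_atTop_atBot tendsto_id
  have e2 := intervalIntegral_tendsto_integral (hint c₂ h₂ right_mem_uIcc)
    tendsto_neg_atTop_atBot tendsto_id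
  have e3 := ((hlim (fun R => -R) (fun R => abs_neg R)).sub (hlim id fun R => rfl)).const_mul
    Complex.I
  have e4 := e2.sub e1
  simp only [id, hrect] at e4
  have := tendsto_nhds_unique e4 e3
  rw [sub_zero, mul_zero, sub_eq_zero] at this
  exact this.symm

/-- The inverse Laplace integral along the line `Re s = c`. -/
def invLaplaceIntegral (F : ℂ → ℂ) (c t : ℝ) : ℂ :=
  (2 * Real.pi : ℂ)⁻¹ *
    ∫ w : ℝ, Complex.exp ((c + w * Complex.I) * t) * F (c + w * Complex.I)

variable {F : ℂ → ℂ} {A κ : ℝ} {N : ℕ}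

theorem norm_exp_mul_ofReal (s : ℂ) (t : ℝ) : ‖Complex.exp (s * t)‖ = Real.exp (s.re * t) := by
  rw [Complex.norm_exp]; simp

theorem norm_invLaplaceIntegral_le
    (hb : ∀ s : ℂ, 0 < s.re → ‖F s‖ ≤ A * (1 + s.re⁻¹) ^ N * Real.exp (-(κ * s.re)) * invSq s.im)
    {c : ℝ} (hc : 0 < c) (t : ℝ) : ‖invLaplaceIntegral F c t‖ ≤
      A * (1 + c⁻¹) ^ N * Real.exp (c * (t - κ)) * ∫ w, invSq w := by
  rw [invLaplaceIntegral, norm_mul]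
  have h1 : ‖(2 * Real.pi : ℂ)⁻¹‖ ≤ 1 := by
    rw [norm_inv]
    refine inv_le_one_of_one_le₀ ?_
    rw [norm_mul, Complex.norm_real, Real.norm_of_nonneg Real.pi_pos.le]
    simp
    linarith [Real.pi_gt_three]
  have h2 : ‖∫ w : ℝ, Complex.exp ((c + w * Complex.I) * t) * F (c + w * Complex.I)‖ ≤
      ∫ w, A * (1 + c⁻¹) ^ N * Real.exp (c * (t - κ)) * invSq w := by
    refine norm_integral_le_of_norm_le (integrable_invSq.const_mul _)
      (Eventually.of_forall fun w => ?_)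
    rw [norm_mul, norm_exp_mul_ofReal]
    have h := hb (c + w * Complex.I) (by simpa using hc)
    simp only [Complex.add_re, Complex.ofReal_re, Complex.mul_re, Complex.I_re, mul_zero,
      Complex.ofReal_im, Complex.I_im, mul_one, sub_self, add_zero, Complex.add_im, Complex.mul_im,
      zero_add] at h ⊢
    calc Real.exp (c * t) * ‖F (c + w * Complex.I)‖
        ≤ Real.exp (c * t) * (A * (1 + c⁻¹) ^ N * Real.exp (-(κ * c)) * invSq w) := by gcongr
      _ = A * (1 + c⁻¹) ^ N * (Real.exp (c * t) * Real.exp (-(κ * c))) * invSq w := by ring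
      _ = _ := by rw [← Real.exp_add]; ring_nf
  rw [integral_const_mul] at h2
  exact (mul_le_of_le_one_left (norm_nonneg _) h1).trans h2

theorem invLaplaceIntegral_eq (hF : DifferentiableOn ℂ F {s | 0 < s.re}) (hA : 0 ≤ A)
    (hb : ∀ s : ℂ, 0 < s.re → ‖F s‖ ≤ A * (1 + s.re⁻¹) ^ N * invSq s.im)
    {c₁ c₂ : ℝ} (h₁ : 0 < c₁) (h₂ : 0 < c₂) (t : ℝ) :
    invLaplaceIntegral F c₁ t = invLaplaceIntegral F c₂ t := by
  rw [invLaplaceIntegral, invLaplaceIntegral]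
  congr 1
  refine integral_vertical_eq (f := fun s => Complex.exp (s * t) * F s)
    (B := Real.exp (max c₁ c₂ * |t|) * (A * (1 + (min c₁ c₂)⁻¹) ^ N)) ?_ h₁ h₂ fun s hs => ?_
  · exact (Complex.differentiable_exp.comp (differentiable_id.mul_const _)).differentiableOn.mul hF
  · have h0 : 0 < min c₁ c₂ := lt_min h₁ h₂
    have hs1 : min c₁ c₂ ≤ s.re := hs.1
    have hs2 : s.re ≤ max c₁ c₂ := hs.2
    have hs0 : 0 < s.re := h0.trans_le hs1
    have hi := invSq_nonneg s.im
    rw [norm_mul, norm_exp_mul_ofReal]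
    calc Real.exp (s.re * t) * ‖F s‖
        ≤ Real.exp (max c₁ c₂ * |t|) * (A * (1 + (min c₁ c₂)⁻¹) ^ N * invSq s.im) := by
          refine mul_le_mul (Real.exp_le_exp.2 ?_) ((hb s hs0).trans ?_) (norm_nonneg _)
            (Real.exp_nonneg _)
          · exact (mul_le_mul_of_nonneg_left (le_abs_self t) hs0.le).trans
              (mul_le_mul_of_nonneg_right hs2 (abs_nonneg t))
          · gcongr
      _ = _ := by ring

/-- The line can be moved to Re s = c for every c ≥ 1, and the bound contains e^{c(t - κ)}, which
tends to 0 as c → ∞. With κ = k|x| this becomes finite speed of propagation. -/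
theorem invLaplaceIntegral_eq_zero (hF : DifferentiableOn ℂ F {s | 0 < s.re}) (hA : 0 ≤ A)
    (hκ : 0 ≤ κ)
    (hb : ∀ s : ℂ, 0 < s.re → ‖F s‖ ≤ A * (1 + s.re⁻¹) ^ N * Real.exp (-(κ * s.re)) * invSq s.im)
    {t : ℝ} (ht : t < κ) : invLaplaceIntegral F 1 t = 0 := by
  have hb' : ∀ s : ℂ, 0 < s.re → ‖F s‖ ≤ A * (1 + s.re⁻¹) ^ N * invSq s.im := fun s hs => by
    refine (hb s hs).trans ?_
    have := invSq_nonneg s.im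
    have h1 : Real.exp (-(κ * s.re)) ≤ 1 := Real.exp_le_one_iff.2 (by
      have : 0 ≤ κ * s.re := by positivity
      linarith)
    have h2 : 0 ≤ A * (1 + s.re⁻¹) ^ N := by positivity
    exact mul_le_mul_of_nonneg_right (mul_le_of_le_one_right h2 h1) this
  have hle : ∀ c : ℝ, 1 ≤ c → ‖invLaplaceIntegral F 1 t‖ ≤
      A * 2 ^ N * Real.exp (c * (t - κ)) * ∫ w, invSq w := fun c hc => by
    have hc0 : 0 < c := by linarith
    rw [invLaplaceIntegral_eq hF hA hb' one_pos hc0]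
    refine (norm_invLaplaceIntegral_le hb hc0 t).trans ?_
    have h0 : 0 ≤ ∫ w, invSq w := integral_nonneg invSq_nonneg
    have h1 : 1 + c⁻¹ ≤ 2 := by
      have := inv_le_one_of_one_le₀ hc
      linarith
    gcongr
  have hlim : Tendsto (fun c : ℝ => A * 2 ^ N * Real.exp (c * (t - κ)) * ∫ w, invSq w) atTop
      (𝓝 (A * 2 ^ N * 0 * ∫ w, invSq w)) := by
    refine Tendsto.mul_const _ (Tendsto.const_mul _ (Real.tendsto_exp_atBot.comp ?_))
    exact tendsto_id.atTop_mul_const_of_neg (by linarith)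
  rw [mul_zero, zero_mul] at hlim
  exact norm_le_zero_iff.1 (ge_of_tendsto hlim ((eventually_ge_atTop 1).mono hle))

theorem norm_invLaplaceIntegral_le_pow (hF : DifferentiableOn ℂ F {s | 0 < s.re}) (hA : 0 ≤ A)
    (hb : ∀ s : ℂ, 0 < s.re → ‖F s‖ ≤ A * (1 + s.re⁻¹) ^ N * invSq s.im) (t : ℝ) :
    ‖invLaplaceIntegral F 1 t‖ ≤ A * (3 * 2 ^ N * ∫ w, invSq w) * (1 + |t|) ^ N := by
  have hb' : ∀ s : ℂ, 0 < s.re →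
      ‖F s‖ ≤ A * (1 + s.re⁻¹) ^ N * Real.exp (-(0 * s.re)) * invSq s.im := fun s hs => by
    simpa using hb s hs
  have h0 : 0 ≤ ∫ w, invSq w := integral_nonneg invSq_nonneg
  rcases lt_or_ge t 0 with ht | ht
  · rw [invLaplaceIntegral_eq_zero hF hA le_rfl hb' ht, norm_zero]
    positivity
  -- On the line Re s = 1/(1 + t) the factor e^{st} has modulus at most e, and the powers of 1/Re s
  -- become powers of 1 + t.
  have hc : 0 < (1 + t)⁻¹ := by positivity
  rw [invLaplaceIntegral_eq hF hA hb one_pos hc]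
  refine (norm_invLaplaceIntegral_le hb' hc t).trans ?_
  have h1 : Real.exp ((1 + t)⁻¹ * (t - 0)) ≤ 3 := by
    refine le_trans (Real.exp_le_exp.2 ?_) (Real.exp_one_lt_d9.le.trans (by norm_num))
    rw [sub_zero, inv_mul_le_iff₀ (by positivity)]
    linarith
  have h2 : 1 + (1 + t)⁻¹⁻¹ ≤ 2 * (1 + |t|) := by
    rw [inv_inv, abs_of_nonneg ht]; linarith
  calc A * (1 + (1 + t)⁻¹⁻¹) ^ N * Real.exp ((1 + t)⁻¹ * (t - 0)) * ∫ w, invSq w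
      ≤ A * (2 * (1 + |t|)) ^ N * 3 * ∫ w, invSq w := by gcongr
    _ = _ := by rw [mul_pow]; ring

-- On the vertical line through s this is Fourier inversion: e^{-ct} times the inverse Laplace
-- integral is the inverse Fourier transform of F(c + 2πiξ). It is integrable because it vanishes
-- for t < 0 and grows polynomially before weighting.
open FourierTransform in
theorem integral_exp_mul_invLaplaceIntegral (hF : DifferentiableOn ℂ F {s | 0 < s.re}) (hA : 0 ≤ A)
    (hb : ∀ s : ℂ, 0 < s.re → ‖F s‖ ≤ A * (1 + s.re⁻¹) ^ N * invSq s.im)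
    (hc : Continuous fun t => invLaplaceIntegral F 1 t) {s : ℂ} (hs : 0 < s.re) :
    ∫ t : ℝ, Complex.exp (-s * t) * invLaplaceIntegral F 1 t = F s := by
  set c := s.re with hcdef
  have hb' : ∀ s : ℂ, 0 < s.re →
      ‖F s‖ ≤ A * (1 + s.re⁻¹) ^ N * Real.exp (-(0 * s.re)) * invSq s.im := fun s hs => by
    simpa using hb s hs
  let Φ : ℝ → ℂ := fun ξ => F (c + ((2 * Real.pi * ξ : ℝ) : ℂ) * Complex.I)
  have hΦc : Continuous Φ :=
    (continuous_vertical hF hs).comp (by fun_prop : Continuous fun ξ : ℝ => 2 * Real.pi * ξ)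
  have hFi : Integrable fun w : ℝ => F (c + w * Complex.I) :=
    (integrable_invSq.const_mul _).mono' (continuous_vertical hF hs).aestronglyMeasurable
      (Eventually.of_forall fun w => by simpa using hb (c + w * Complex.I) (by simpa using hs))
  have hΦi : Integrable Φ := hFi.comp_mul_left' (by positivity)
  have hinv : ∀ t : ℝ, 𝓕⁻ Φ t = Complex.exp (-c * t) * invLaplaceIntegral F 1 t := fun t => by
    rw [invLaplaceIntegral_eq hF hA hb one_pos hs, invLaplaceIntegral, Real.fourierInv_eq',
      mul_left_comm, ← integral_const_mul]
    have h1 := Measure.integral_comp_mul_left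
      (fun w : ℝ => Complex.exp (-c * t) *
        (Complex.exp ((c + w * Complex.I) * t) * F (c + w * Complex.I))) (2 * Real.pi)
    have h2 : |(2 * Real.pi)⁻¹| = (2 * Real.pi)⁻¹ := abs_of_pos (by positivity)
    rw [h2, Complex.real_smul] at h1
    have h3 : (((2 * Real.pi)⁻¹ : ℝ) : ℂ) = (2 * Real.pi : ℂ)⁻¹ := by push_cast; rfl
    rw [h3] at h1
    rw [← h1]
    refine integral_congr_ae (Eventually.of_forall fun ξ => ?_)
    simp only [smul_eq_mul, Φ]
    rw [← mul_assoc, ← Complex.exp_add]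
    congr 2
    simp [inner]
    ring
  have hii : Integrable (𝓕⁻ Φ) := by
    have h1 := integrable_exp_neg_mul (f := fun t => invLaplaceIntegral F 1 t) (a := 0)
      hc.aestronglyMeasurable
      (fun t ht => invLaplaceIntegral_eq_zero hF hA le_rfl hb' ht)
      (norm_invLaplaceIntegral_le_pow hF hA hb) (s := (c : ℂ)) (by simpa using hs)
    exact h1.congr (Eventually.of_forall fun t => (hinv t).symm)
  have hii' : Integrable (𝓕 Φ) := by
    refine hii.comp_neg.congr (Eventually.of_forall fun w => ?_)
    simp only [Real.fourierInv_eq_fourier_neg, neg_neg]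
  have key := congrFun (hΦc.fourier_fourierInv_eq hΦi hii') (s.im / (2 * Real.pi))
  rw [Real.fourier_eq'] at key
  have e : Φ (s.im / (2 * Real.pi)) = F s := by
    have : 2 * Real.pi * (s.im / (2 * Real.pi)) = s.im := by
      field_simp
    simp only [Φ, this, hcdef, Complex.re_add_im]
  rw [e] at key
  rw [← key]
  refine integral_congr_ae (Eventually.of_forall fun t => ?_)
  simp only [smul_eq_mul, hinv]
  rw [← mul_assoc, ← Complex.exp_add]
  congr 2
  have hs' : s = c + s.im * Complex.I := (Complex.re_add_im s).symm
  have hpi : (Real.pi : ℂ) ≠ 0 := by exact_mod_cast Real.pi_ne_zero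
  simp [inner]
  field_simp
  linear_combination (-(t : ℂ)) * hs'

end InverseLaplace

/-! ### Kernels of the fundamental solution -/

section WaveKernel

/-- The function `½ ρ(s) e^{-|x| s ρ(s)}`. -/
def waveSymbol (ρ : ℂ → ℂ) (x : ℝ) (s : ℂ) : ℂ :=
  1 / 2 * ρ s * Complex.exp (-((|x| : ℝ) : ℂ) * s * ρ s)

/-- The inverse Laplace transform of `(1 + s)^{-m} ½ ρ(s) e^{-|x| s ρ(s)}`. -/
def waveKernel (ρ : ℂ → ℂ) (m : ℕ) (ζ : ℝ × ℝ) : ℂ :=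
  invLaplaceIntegral (fun s => ((1 + s) ^ m)⁻¹ * waveSymbol ρ ζ.1 s) 1 ζ.2

/-- Analyticity and growth of `ρ` in the right half plane. -/
structure IsWaveSpeed (ρ : ℂ → ℂ) (k : ℝ) : Prop where
  nonneg : 0 ≤ k
  diff : DifferentiableOn ℂ ρ {s | 0 < s.re}
  pos : ∀ s : ℂ, 0 < s.re → 0 < (s * ρ s).re
  le_re : ∀ s : ℂ, 0 < s.re → k * s.re ≤ (s * ρ s).re
  bound : ∃ (C : ℝ) (N : ℕ), 1 ≤ C ∧ ∀ s : ℂ, 0 < s.re →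
    ‖ρ s‖ ≤ C * ((1 + ‖s‖) * (1 + s.re⁻¹)) ^ N ∧
    ((s * ρ s).re)⁻¹ ≤ C * ((1 + ‖s‖) * (1 + s.re⁻¹)) ^ N

variable {ρ : ℂ → ℂ} {k : ℝ}

theorem norm_waveSymbol (ρ : ℂ → ℂ) (x : ℝ) (s : ℂ) :
    ‖waveSymbol ρ x s‖ = 1 / 2 * ‖ρ s‖ * Real.exp (-((s * ρ s).re * |x|)) := by
  rw [waveSymbol, norm_mul, norm_mul, Complex.norm_exp]
  have : (-((|x| : ℝ) : ℂ) * s * ρ s).re = -((s * ρ s).re * |x|) := by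
    rw [mul_assoc, ← Complex.ofReal_neg, Complex.re_ofReal_mul]; ring
  rw [this]
  norm_num

theorem one_add_norm_le {s : ℂ} (hs : 0 < s.re) : 1 + ‖s‖ ≤ 2 * ‖1 + s‖ := by
  have h1 : 1 ≤ ‖1 + s‖ := by
    refine le_trans ?_ (Complex.re_le_norm _)
    simp; exact hs.le
  have h2 : ‖s‖ ≤ ‖1 + s‖ := by
    rw [Complex.norm_def, Complex.norm_def]
    refine Real.sqrt_le_sqrt ?_
    rw [Complex.normSq_apply, Complex.normSq_apply]
    simp
    nlinarith
  linarith

/-- Of the N + 2 powers of 1/(1 + s), N compensate the growth in |s| and two give integrability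
along vertical lines. -/
theorem norm_waveFactor_le {x B : ℝ} {s : ℂ} {N m : ℕ} (hs : 0 < s.re) (hm : m = N + 2)
    (h : ‖waveSymbol ρ x s‖ ≤ B * ((1 + ‖s‖) * (1 + s.re⁻¹)) ^ N) :
    ‖((1 + s) ^ m)⁻¹ * waveSymbol ρ x s‖ ≤ B * 2 ^ m * (1 + s.re⁻¹) ^ N * invSq s.im := by
  have h1 := one_add_norm_le hs
  have h0 : 0 < 1 + ‖s‖ := by positivity
  have h2 : 0 < ‖1 + s‖ := by linarith
  have hB : 0 ≤ B := by
    by_contra hB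
    have hp : 0 < ((1 + ‖s‖) * (1 + s.re⁻¹)) ^ N := by positivity
    have := mul_neg_of_neg_of_pos (not_le.1 hB) hp
    linarith [norm_nonneg (waveSymbol ρ x s)]
  have h3 : (‖1 + s‖ ^ m)⁻¹ ≤ 2 ^ m * ((1 + ‖s‖) ^ m)⁻¹ := by
    rw [← div_eq_mul_inv, ← div_pow, ← inv_pow]
    refine pow_le_pow_left₀ (by positivity) ?_ m
    rw [inv_eq_one_div, div_le_div_iff₀ h2 h0]
    linarith
  have h4 : ((1 + ‖s‖) ^ 2)⁻¹ ≤ invSq s.im := by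
    have := Complex.abs_im_le_norm s
    unfold invSq
    gcongr
  rw [norm_mul, norm_inv, norm_pow]
  calc (‖1 + s‖ ^ m)⁻¹ * ‖waveSymbol ρ x s‖
      ≤ (2 ^ m * ((1 + ‖s‖) ^ m)⁻¹) * (B * ((1 + ‖s‖) * (1 + s.re⁻¹)) ^ N) := by gcongr
    _ = B * 2 ^ m * (1 + s.re⁻¹) ^ N * ((1 + ‖s‖) ^ 2)⁻¹ := by
        rw [hm, mul_pow, pow_add (1 + ‖s‖)]
        field_simp
    _ ≤ _ := by gcongr

theorem differentiableOn_waveFactor (h : DifferentiableOn ℂ ρ {s | 0 < s.re}) (m : ℕ) (x : ℝ) :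
    DifferentiableOn ℂ (fun s => ((1 + s) ^ m)⁻¹ * waveSymbol ρ x s) {s | 0 < s.re} := by
  have h1 : DifferentiableOn ℂ (fun s : ℂ => ((1 + s) ^ m)⁻¹) {s | 0 < s.re} := by
    refine DifferentiableOn.inv (by fun_prop) fun s hs => pow_ne_zero m fun h0 => ?_
    have := congrArg Complex.re h0
    have hs' : 0 < s.re := hs
    simp at this
    linarith
  refine h1.mul ?_
  unfold waveSymbol
  have h2 : DifferentiableOn ℂ (fun s : ℂ => s) {s | 0 < s.re} := differentiableOn_id
  exact (h.const_mul _).mul ((h2.const_mul _).mul h).cexp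

/-- Kernels for the fundamental solution: for each decay order there is an order `m` of
regularization for which the inverse Laplace transform is a kernel. -/
theorem IsWaveSpeed.exists_kernel (h : IsWaveSpeed ρ k) (M : ℕ) : ∃ m : ℕ, 2 ≤ m ∧
    IsKernel (waveKernel ρ m) M ∧
    (∀ s : ℂ, 0 < s.re → ∀ y : ℝ, ∫ t : ℝ, Complex.exp (-s * t) * waveKernel ρ m (y, t) =
      ((1 + s) ^ m)⁻¹ * waveSymbol ρ y s) ∧
    (∀ y t : ℝ, t < k * |y| → waveKernel ρ m (y, t) = 0) ∧
    ∃ (A : ℝ) (N : ℕ), 0 ≤ A ∧ ∀ (x : ℝ) (s : ℂ), 0 < s.re →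
      ‖((1 + s) ^ m)⁻¹ * waveSymbol ρ x s‖ * (1 + |x|) ^ (M + 2) ≤
        A * (1 + s.re⁻¹) ^ N * invSq s.im := by
  obtain ⟨C, N, hC, hb⟩ := h.bound
  -- One factor of order N comes from ρ, and M + 2 more come from 1/Re p, which pays for the decay
  -- in x.
  set N' := N * (M + 3) with hN'
  set D := 1 / 2 * C * (3 * (M + 2).factorial * (2 * C) ^ (M + 2)) with hD
  have hD0 : 0 ≤ D := by positivity
  have hb1 : ∀ s : ℂ, 0 < s.re → 1 ≤ (1 + ‖s‖) * (1 + s.re⁻¹) := fun s hs => by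
    have h1 : 1 ≤ 1 + ‖s‖ := by linarith [norm_nonneg s]
    have h2 : 1 ≤ 1 + s.re⁻¹ := by linarith [inv_pos.2 hs]
    exact one_le_mul_of_one_le_of_one_le h1 h2
  -- Here the exponential e^{-|x| Re p} is spent entirely on powers of 1 + |x|.
  have hdec : ∀ (x : ℝ) (s : ℂ), 0 < s.re → ‖waveSymbol ρ x s‖ ≤
      D / (1 + |x|) ^ (M + 2) * ((1 + ‖s‖) * (1 + s.re⁻¹)) ^ N' := fun x s hs => by
    have hpx : 0 < (1 + |x|) ^ (M + 2) := by positivity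
    set b := ((1 + ‖s‖) * (1 + s.re⁻¹)) with hbd
    have hb' : 1 ≤ b := hb1 s hs
    have hbN : 1 ≤ b ^ N := one_le_pow₀ hb'
    obtain ⟨e1, e2⟩ := hb s hs
    have e3 := one_add_pow_mul_exp_neg_le (abs_nonneg x) (h.pos s hs) (M + 2)
    have e4 : 1 + ((s * ρ s).re)⁻¹ ≤ 2 * C * b ^ N := by
      have : 1 ≤ C * b ^ N := one_le_mul_of_one_le_of_one_le hC hbN
      linarith
    have hpos := inv_pos.2 (h.pos s hs)
    rw [norm_waveSymbol, div_mul_eq_mul_div D, le_div_iff₀ hpx]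
    calc 1 / 2 * ‖ρ s‖ * Real.exp (-((s * ρ s).re * |x|)) * (1 + |x|) ^ (M + 2)
        = 1 / 2 * ‖ρ s‖ * ((1 + |x|) ^ (M + 2) * Real.exp (-((s * ρ s).re * |x|))) := by ring
      _ ≤ 1 / 2 * (C * b ^ N) *
          (3 * (M + 2).factorial * (1 + ((s * ρ s).re)⁻¹) ^ (M + 2)) := by gcongr
      _ ≤ 1 / 2 * (C * b ^ N) * (3 * (M + 2).factorial * (2 * C * b ^ N) ^ (M + 2)) := by gcongr
      _ = D * b ^ N' := by
          rw [hD, hN', mul_pow (2 * C), ← pow_mul]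
          ring
  -- Here it is kept, in the weaker form e^{-k|x| Re s}, to give the support of the kernel.
  have hexp : ∀ (x : ℝ) (s : ℂ), 0 < s.re → ‖waveSymbol ρ x s‖ ≤
      C * Real.exp (-(k * |x| * s.re)) * ((1 + ‖s‖) * (1 + s.re⁻¹)) ^ N' := fun x s hs => by
    set b := ((1 + ‖s‖) * (1 + s.re⁻¹)) with hbd
    have hb' : 1 ≤ b := hb1 s hs
    have e1 := (hb s hs).1
    have e2 : b ^ N ≤ b ^ N' := pow_le_pow_right₀ hb' (by rw [hN']; nlinarith)
    have e3 : Real.exp (-((s * ρ s).re * |x|)) ≤ Real.exp (-(k * |x| * s.re)) := by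
      refine Real.exp_le_exp.2 (neg_le_neg ?_)
      have := mul_le_mul_of_nonneg_right (h.le_re s hs) (abs_nonneg x)
      linarith
    rw [norm_waveSymbol]
    calc 1 / 2 * ‖ρ s‖ * Real.exp (-((s * ρ s).re * |x|))
        ≤ 1 * (C * b ^ N') * Real.exp (-(k * |x| * s.re)) := by
          gcongr
          · norm_num
          · exact e1.trans (by gcongr)
      _ = _ := by ring
  set m := N' + 2 with hm
  have hF := fun x => differentiableOn_waveFactor h.diff m x
  have B1 : ∀ (x : ℝ) (s : ℂ), 0 < s.re → ‖((1 + s) ^ m)⁻¹ * waveSymbol ρ x s‖ ≤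
      D / (1 + |x|) ^ (M + 2) * 2 ^ m * (1 + s.re⁻¹) ^ N' * invSq s.im := fun x s hs =>
    norm_waveFactor_le hs hm (hdec x s hs)
  have B2 : ∀ (x : ℝ) (s : ℂ), 0 < s.re → ‖((1 + s) ^ m)⁻¹ * waveSymbol ρ x s‖ ≤
      C * 2 ^ m * (1 + s.re⁻¹) ^ N' * Real.exp (-(k * |x| * s.re)) * invSq s.im := fun x s hs => by
    refine (norm_waveFactor_le hs hm (hexp x s hs)).trans (le_of_eq (by ring))
  have hkx : ∀ x : ℝ, 0 ≤ k * |x| := fun x => mul_nonneg h.nonneg (abs_nonneg x)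
  have hzero : ∀ y t : ℝ, t < k * |y| → waveKernel ρ m (y, t) = 0 := fun y t ht =>
    invLaplaceIntegral_eq_zero (hF y) (by positivity) (hkx y) (B2 y) ht
  have hcont : Continuous (waveKernel ρ m) := by
    unfold waveKernel invLaplaceIntegral
    refine continuous_const.mul ?_
    have hcs : ∀ (t w : ℝ), ((1 : ℝ) + w * Complex.I) * t = t + (w * t : ℝ) * Complex.I := by
      intro t w; push_cast; ring
    have e : ∀ ζ : ℝ × ℝ, ∫ w : ℝ, Complex.exp (((1 : ℝ) + w * Complex.I) * ζ.2) *
        (((1 + ((1 : ℝ) + w * Complex.I)) ^ m)⁻¹ * waveSymbol ρ ζ.1 ((1 : ℝ) + w * Complex.I)) =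
        Complex.exp ζ.2 * ∫ w : ℝ, Complex.exp ((w * ζ.2 : ℝ) * Complex.I) *
        (((1 + ((1 : ℝ) + w * Complex.I)) ^ m)⁻¹ * waveSymbol ρ ζ.1 ((1 : ℝ) + w * Complex.I)) :=
      fun ζ => by
        rw [← integral_const_mul]
        refine integral_congr_ae (Eventually.of_forall fun w => ?_)
        simp only
        rw [hcs, Complex.exp_add]; ring
    simp only [e]
    refine (by fun_prop : Continuous fun ζ : ℝ × ℝ => Complex.exp ζ.2).mul ?_
    refine continuous_of_dominated (bound := fun w => C * 2 ^ m * (1 + (1 : ℝ)⁻¹) ^ N' * invSq w)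
      (fun ζ => ?_) (fun ζ => Eventually.of_forall fun w => ?_) (integrable_invSq.const_mul _)
      (Eventually.of_forall fun w => ?_)
    · exact ((by fun_prop : Continuous fun w : ℝ => Complex.exp ((w * ζ.2 : ℝ) * Complex.I)).mul
        (continuous_vertical (hF ζ.1) one_pos)).aestronglyMeasurable
    · rw [norm_mul, Complex.norm_exp_ofReal_mul_I, one_mul]
      refine (B2 ζ.1 _ (by simp)).trans ?_
      have h1 : Real.exp (-(k * |ζ.1| * 1)) ≤ 1 := Real.exp_le_one_iff.2 (by
        linarith [hkx ζ.1])
      have h2 := invSq_nonneg w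
      simp only [Complex.add_re, Complex.ofReal_re, Complex.mul_re, Complex.I_re, mul_zero,
        Complex.ofReal_im, Complex.I_im, mul_one, sub_self, add_zero, Complex.add_im,
        Complex.mul_im, zero_add] at h1 ⊢
      calc C * 2 ^ m * (1 + (1 : ℝ)⁻¹) ^ N' * Real.exp (-(k * |ζ.1|)) * invSq w
          ≤ C * 2 ^ m * (1 + (1 : ℝ)⁻¹) ^ N' * 1 * invSq w := by gcongr
        _ = _ := by ring
    · unfold waveSymbol
      fun_prop
  refine ⟨m, by omega, ⟨hcont, fun ζ hζ => hzero ζ.1 ζ.2 (hζ.trans_le (hkx _)), N',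
    D * 2 ^ m * (3 * 2 ^ N' * ∫ w, invSq w), ?_, fun ζ => ?_⟩, fun s hs y => ?_, hzero,
    D * 2 ^ m, N', by positivity, fun x s hs => ?_⟩
  · have : 0 ≤ ∫ w, invSq w := integral_nonneg invSq_nonneg
    positivity
  · have h1 := norm_invLaplaceIntegral_le_pow (hF ζ.1) (by positivity) (B1 ζ.1) ζ.2
    have hpx : 0 < (1 + |ζ.1|) ^ (M + 2) := by positivity
    calc ‖waveKernel ρ m ζ‖ * (1 + |ζ.1|) ^ (M + 2)
        ≤ (D / (1 + |ζ.1|) ^ (M + 2) * 2 ^ m * (3 * 2 ^ N' * ∫ w, invSq w) * (1 + |ζ.2|) ^ N') *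
          (1 + |ζ.1|) ^ (M + 2) := by gcongr; exact h1
      _ = _ := by field_simp
  · exact integral_exp_mul_invLaplaceIntegral (hF y) (by positivity) (B1 y)
      (hcont.comp (by fun_prop : Continuous fun t : ℝ => (y, t))) hs
  · have hpx : 0 < (1 + |x|) ^ (M + 2) := by positivity
    calc ‖((1 + s) ^ m)⁻¹ * waveSymbol ρ x s‖ * (1 + |x|) ^ (M + 2)
        ≤ (D / (1 + |x|) ^ (M + 2) * 2 ^ m * (1 + s.re⁻¹) ^ N' * invSq s.im) *
          (1 + |x|) ^ (M + 2) := by gcongr; exact B1 x s hs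
      _ = _ := by field_simp

theorem IsWaveSpeed.hasKernels {φσ φε : 𝓢'(ℝ, ℂ)} (h : IsWaveSpeed (sqrtRatio φσ φε) k) :
    HasKernels (Ktilde φσ φε) := fun M => by
  obtain ⟨m, -, hg, hL, -⟩ := h.exists_kernel M
  exact ⟨m, _, hg, hL⟩

theorem exists_eq_distOp_waveKernel {φσ φε : 𝓢'(ℝ, ℂ)} {K : 𝓢'(ℝ × ℝ, ℂ)} {m M : ℕ}
    (hK : IsFundamentalSolution φσ φε K) (hg : IsKernel (waveKernel (sqrtRatio φσ φε) m) M)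
    (hW : HasGrowth (tensorDelta (TemperedDistribution.delta 0)) M)
    (hL : ∀ s : ℂ, 0 < s.re → ∀ y : ℝ,
      ∫ t : ℝ, Complex.exp (-s * t) * waveKernel (sqrtRatio φσ φε) m (y, t) =
      ((1 + s) ^ m)⁻¹ * waveSymbol (sqrtRatio φσ φε) y s) (ψ : 𝓢(ℝ × ℝ, ℂ)) :
    Integrable (fun ζ => waveKernel (sqrtRatio φσ φε) m ζ *
      diffOp ((0, 1) : ℝ × ℝ) (-1) m ψ ζ) ∧
    K ψ = ∫ ζ : ℝ × ℝ, waveKernel (sqrtRatio φσ φε) m ζ *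
      diffOp ((0, 1) : ℝ × ℝ) (-1) m ψ ζ := by
  have h1 := hK.unique (isFundamentalSolution_of_kernel hg hW rfl hL)
  have h2 := integrable_kernel_mul hg hW (diffOp ((0, 1) : ℝ × ℝ) (-1) m ψ)
  have e : ∀ (f : 𝓢(ℝ × ℝ, ℂ)) (ζ : ℝ × ℝ),
      tensorDelta (TemperedDistribution.delta 0) (translate (-ζ) f) = f ζ := fun f ζ => by
    rw [tensorDelta_apply, TemperedDistribution.delta_apply]
    change f (0 - -ζ) = f ζ
    simp
  simp only [e] at h2
  refine ⟨h2, ?_⟩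
  rw [h1, distOp_apply, kernelConv_apply]
  simp only [e]

/-- The continuous kernel vanishes for t < k|x|, and differentiation in t does not enlarge supports.
-/
theorem IsWaveSpeed.isVanishingOn {φσ φε : 𝓢'(ℝ, ℂ)} (h : IsWaveSpeed (sqrtRatio φσ φε) k)
    {K : 𝓢'(ℝ × ℝ, ℂ)} (hK : IsFundamentalSolution φσ φε K) :
    IsVanishingOn K {p : ℝ × ℝ | p.2 < k * |p.1|} := fun ψ hψ => by
  obtain ⟨M, hM⟩ := exists_hasGrowth (isVanishingOn_tensorDelta (TemperedDistribution.delta 0))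
  obtain ⟨m, -, hg, hL, hz, -⟩ := h.exists_kernel M
  rw [(exists_eq_distOp_waveKernel hK hg hM hL ψ).2]
  refine integral_eq_zero_of_ae (Eventually.of_forall fun ζ => ?_)
  simp only [Pi.zero_apply, mul_eq_zero]
  by_cases hζ : ζ ∈ tsupport (diffOp ((0, 1) : ℝ × ℝ) (-1) m ψ)
  · exact Or.inl (hz ζ.1 ζ.2 (hψ (tsupport_diffOp_subset _ _ _ _ hζ)))
  · exact Or.inr (image_eq_zero_of_notMem_tsupport hζ)

end WaveKernel

/-! ### The symbols as entire functions of log s -/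

section SymbolGrowth

/-- The cutoff function in the definition of `expKernel`. -/
def unitBump : ContDiffBump (1 / 2 : ℝ) := ⟨1, 2, one_pos, one_lt_two⟩

theorem expKernel_apply (z : ℂ) (α : ℝ) :
    expKernel z α = (unitBump α : ℂ) * Complex.exp (α * z) := rfl

/-- The bump vanishes outside (-3/2, 5/2), so only |α| ≤ 5/2 matters. The constant does not depend
on e, which will be e^{αz} or a difference of such functions. -/
theorem exists_schwartzNorm_unitBump_mul_le (m : ℕ) : ∃ C : ℝ, 0 ≤ C ∧
    ∀ (f : 𝓢(ℝ, ℂ)) (e : ℝ → ℂ) (B : ℝ), 0 ≤ B → ContDiff ℝ ∞ e →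
      (∀ α, f α = (unitBump α : ℂ) * e α) →
      (∀ j ≤ m, ∀ α, |α| ≤ 5 / 2 → ‖iteratedDeriv j e α‖ ≤ B) → schwartzNorm ℝ m f ≤ C * B := by
  set χ : ℝ → ℂ := fun α => (unitBump α : ℂ) with hχ
  have hχs : ContDiff ℝ ∞ χ := Complex.ofRealCLM.contDiff.comp unitBump.contDiff
  have hχc : HasCompactSupport χ :=
    unitBump.hasCompactSupport.comp_left (g := fun y : ℝ => (y : ℂ)) Complex.ofReal_zero
  have hbd : ∀ j : ℕ, ∃ C : ℝ, ∀ x, ‖iteratedFDeriv ℝ j χ x‖ ≤ C := fun j =>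
    (hχc.iteratedFDeriv (𝕜 := ℝ) j).exists_bound_of_continuous
      (hχs.continuous_iteratedFDeriv (by exact_mod_cast le_top))
  choose C hC using hbd
  have hC0 : ∀ j, 0 ≤ C j := fun j => (norm_nonneg _).trans (hC j 0)
  set A := ∑ j ∈ Finset.range (m + 1), C j
  have hA0 : 0 ≤ A := Finset.sum_nonneg fun j _ => hC0 j
  have hCA : ∀ j ≤ m, C j ≤ A := fun j hj =>
    Finset.single_le_sum (f := C) (fun j _ => hC0 j) (Finset.mem_range.2 (Nat.lt_succ_iff.2 hj))
  refine ⟨3 ^ m * 2 ^ m * A, by positivity, fun f e B hB he hf hb => ?_⟩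
  refine schwartzNorm_le (by positivity) fun k hk n hn => ?_
  refine SchwartzMap.seminorm_le_bound ℂ k n _ (by positivity) fun α => ?_
  have hfun : (⇑f : ℝ → ℂ) = fun α => χ α * e α := funext hf
  rw [hfun]
  rcases le_or_gt |α| (5 / 2) with hα | hα
  · have hmul := norm_iteratedFDeriv_mul_le (𝕜 := ℝ) (N := (∞ : ℕ∞ω)) (f := χ) (g := e) hχs he α
      (n := n) (by exact_mod_cast le_top)
    have h1 : ‖α‖ ^ k ≤ 3 ^ m := by
      rw [Real.norm_eq_abs]
      exact (pow_le_pow_left₀ (abs_nonneg α) (by linarith) k).trans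
        (pow_le_pow_right₀ (by norm_num) hk)
    calc ‖α‖ ^ k * ‖iteratedFDeriv ℝ n (fun α => χ α * e α) α‖
        ≤ 3 ^ m * ∑ i ∈ Finset.range (n + 1), (n.choose i : ℝ) *
          ‖iteratedFDeriv ℝ i χ α‖ * ‖iteratedFDeriv ℝ (n - i) e α‖ := by gcongr
      _ ≤ 3 ^ m * ∑ i ∈ Finset.range (n + 1), (n.choose i : ℝ) * (A * B) := by
          refine mul_le_mul_of_nonneg_left (Finset.sum_le_sum fun i hi => ?_) (by positivity)
          have hin : i ≤ n := by simpa [Nat.lt_succ_iff] using hi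
          rw [mul_assoc]
          refine mul_le_mul_of_nonneg_left (mul_le_mul ((hC i α).trans (hCA i (hin.trans hn))) ?_
            (norm_nonneg _) hA0) (Nat.cast_nonneg _)
          rw [norm_iteratedFDeriv_eq_norm_iteratedDeriv]
          exact hb _ ((Nat.sub_le _ _).trans hn) α hα
      _ = 3 ^ m * (2 ^ n * (A * B)) := by
          rw [← Finset.sum_mul]
          congr 2
          exact_mod_cast Nat.sum_range_choose n
      _ ≤ 3 ^ m * (2 ^ m * (A * B)) := by
          gcongr
          exact one_le_two
      _ = _ := by ring
  · have hev : (fun α => χ α * e α) =ᶠ[𝓝 α] fun _ => (0 : ℂ) := by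
      filter_upwards [(isOpen_lt continuous_const continuous_abs).mem_nhds hα] with y hy
      have hy' : 5 / 2 < |y| := hy
      have : unitBump y = 0 := unitBump.zero_of_le_dist (by
        change (2 : ℝ) ≤ dist y (1 / 2)
        rw [Real.dist_eq]
        have := abs_sub_abs_le_abs_sub y (1 / 2)
        rw [abs_of_pos (show (0 : ℝ) < 1 / 2 by norm_num)] at this
        linarith)
      simp [hχ, this]
    rw [(hev.iteratedFDeriv ℝ n).eq_of_nhds]
    have : (fun _ : ℝ => (0 : ℂ)) = 0 := rfl
    rw [this, iteratedFDeriv_zero]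
    simp only [Pi.zero_apply, norm_zero, mul_zero]
    positivity

theorem contDiff_exp_mul (z : ℂ) : ContDiff ℝ ∞ fun α : ℝ => Complex.exp (α * z) :=
  Complex.contDiff_exp.comp (Complex.ofRealCLM.contDiff.mul contDiff_const)

theorem iteratedDeriv_exp_mul (z : ℂ) (j : ℕ) :
    iteratedDeriv j (fun α : ℝ => Complex.exp (α * z)) = fun α : ℝ => z ^ j * Complex.exp (α * z) := by
  induction j with
  | zero => simp
  | succ j ih =>
    rw [iteratedDeriv_succ, ih]
    funext α
    have hd : HasDerivAt (fun α : ℝ => Complex.exp (α * z)) (Complex.exp (α * z) * (1 * z)) α :=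
      ((Complex.ofRealCLM.hasDerivAt (x := α)).mul_const z).cexp
    rw [(hd.const_mul (z ^ j)).deriv]
    ring

theorem norm_exp_ofReal_mul_le (z : ℂ) {α : ℝ} (hα : |α| ≤ 5 / 2) :
    ‖Complex.exp (α * z)‖ ≤ Real.exp (3 * |z.re|) := by
  rw [Complex.norm_exp, Complex.re_ofReal_mul]
  refine Real.exp_le_exp.2 ((le_abs_self _).trans ?_)
  rw [abs_mul]
  nlinarith [abs_nonneg z.re]

theorem continuous_expKernel : Continuous expKernel := by
  rw [continuous_iff_continuousAt]
  intro w
  rw [ContinuousAt, tendsto_schwartz_iff]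
  intro m
  obtain ⟨C, hC, h⟩ := exists_schwartzNorm_unitBump_mul_le m
  set D := Real.exp (3 * |w.re|)
  set b : ℂ → ℝ := fun z => ∑ j ∈ Finset.range (m + 1),
    (‖z‖ ^ j * (D * (6 * ‖z - w‖)) + ‖z ^ j - w ^ j‖ * D) with hb
  have hbc : Continuous b := by fun_prop
  have hb0 : b w = 0 := by simp [hb]
  have hlim : Tendsto (fun z => C * b z) (𝓝 w) (𝓝 0) := by
    have := (hbc.const_mul C).tendsto w
    rwa [hb0, mul_zero] at this
  refine squeeze_zero' (Eventually.of_forall fun z => apply_nonneg _ _) ?_ hlim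
  filter_upwards [Metric.closedBall_mem_nhds w (show (0 : ℝ) < 1 / 3 by norm_num)] with z hz
  have hzw : ‖z - w‖ ≤ 1 / 3 := by rwa [Metric.mem_closedBall, dist_eq_norm] at hz
  refine h _ (fun α => Complex.exp (α * z) - Complex.exp (α * w)) (b z) ?_
    ((contDiff_exp_mul z).sub (contDiff_exp_mul w)) (fun α => ?_) fun j hj α hα => ?_
  · exact Finset.sum_nonneg fun j _ => by positivity
  · change expKernel z α - expKernel w α = _
    rw [expKernel_apply, expKernel_apply]; ring
  · have e1 : iteratedDeriv j (fun α : ℝ => Complex.exp (α * z) - Complex.exp (α * w)) α =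
        z ^ j * Complex.exp (α * z) - w ^ j * Complex.exp (α * w) := by
      have := iteratedDeriv_fun_sub (n := j) (x := α)
        (((contDiff_exp_mul z).of_le (by exact_mod_cast le_top)).contDiffAt)
        (((contDiff_exp_mul w).of_le (by exact_mod_cast le_top)).contDiffAt)
      rw [this, iteratedDeriv_exp_mul, iteratedDeriv_exp_mul]
    have e2 : ‖Complex.exp (α * z) - Complex.exp (α * w)‖ ≤ D * (6 * ‖z - w‖) := by
      have : Complex.exp (α * z) - Complex.exp (α * w) =
          Complex.exp (α * w) * (Complex.exp (α * (z - w)) - 1) := by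
        rw [mul_sub, ← Complex.exp_add]; ring_nf
      rw [this, norm_mul]
      have h3 : ‖(α : ℂ) * (z - w)‖ ≤ 3 * ‖z - w‖ := by
        rw [norm_mul, Complex.norm_real, Real.norm_eq_abs]
        gcongr
        linarith
      have h4 := Complex.norm_exp_sub_one_le (x := (α : ℂ) * (z - w)) (by linarith)
      gcongr
      · exact norm_exp_ofReal_mul_le w hα
      · linarith
    have e3 : z ^ j * Complex.exp (α * z) - w ^ j * Complex.exp (α * w) =
        z ^ j * (Complex.exp (α * z) - Complex.exp (α * w)) +
          (z ^ j - w ^ j) * Complex.exp (α * w) := by ring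
    rw [e1, e3]
    refine (norm_add_le _ _).trans ?_
    rw [norm_mul, norm_mul, norm_pow]
    refine le_trans (add_le_add (mul_le_mul_of_nonneg_left e2 (by positivity))
      (mul_le_mul_of_nonneg_left (norm_exp_ofReal_mul_le w hα) (norm_nonneg _))) ?_
    exact Finset.single_le_sum (f := fun j => ‖z‖ ^ j * (D * (6 * ‖z - w‖)) + ‖z ^ j - w ^ j‖ * D)
      (fun j _ => by positivity) (Finset.mem_range.2 (Nat.lt_succ_iff.2 hj))

/-- Each derivative of e^{αz} in α costs a factor z, and |α| ≤ 5/2 on the relevant range, whence the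
rate 3. -/
theorem exists_norm_symbolLog_le (φ : 𝓢'(ℝ, ℂ)) : ∃ (C : ℝ) (m : ℕ), 0 ≤ C ∧
    ∀ z : ℂ, ‖symbolLog φ z‖ ≤ C * (1 + ‖z‖) ^ m * Real.exp (3 * |z.re|) := by
  obtain ⟨m, C, hC, h⟩ := exists_norm_le_schwartzNorm φ
  obtain ⟨C', hC', h'⟩ := exists_schwartzNorm_unitBump_mul_le m
  refine ⟨C * C', m, by positivity, fun z => (h _).trans ?_⟩
  have := h' (expKernel z) (fun α => Complex.exp (α * z)) ((1 + ‖z‖) ^ m * Real.exp (3 * |z.re|))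
    (by positivity) (contDiff_exp_mul z) (expKernel_apply z) fun j hj α hα => by
      rw [iteratedDeriv_exp_mul, norm_mul, norm_pow]
      gcongr ?_ * ?_
      · exact (pow_le_pow_left₀ (norm_nonneg z) (by linarith) j).trans
          (pow_le_pow_right₀ (by linarith [norm_nonneg z]) hj)
      · exact norm_exp_ofReal_mul_le z hα
  calc C * schwartzNorm ℝ m (expKernel z) ≤ C * (C' * ((1 + ‖z‖) ^ m * Real.exp (3 * |z.re|))) := by
        gcongr
    _ = _ := by ring

/-- The increment from w to w + h equals h times the mean over τ of φ paired with αe^{α(w + τh)}, up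
to the bump. This mean is continuous in h, so the difference quotient converges. -/
theorem differentiable_symbolLog (φ : 𝓢'(ℝ, ℂ)) : Differentiable ℂ (symbolLog φ) := by
  intro w
  have hT : (fun x : ℝ => (x : ℂ)).HasTemperateGrowth := Complex.ofRealCLM.hasTemperateGrowth
  set Q : 𝓢(ℝ, ℂ) →L[ℂ] 𝓢(ℝ, ℂ) := SchwartzMap.smulLeftCLM ℂ (fun x : ℝ => (x : ℂ)) with hQ
  have hQa : ∀ z α, Q (expKernel z) α = α * expKernel z α := fun z α => by
    rw [hQ, SchwartzMap.smulLeftCLM_apply_apply hT]; rfl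
  set ψ : ℂ → ℂ := fun z => φ (Q (expKernel z)) with hψ
  have hψc : Continuous ψ := (map_continuous φ).comp (Q.continuous.comp continuous_expKernel)
  set G : ℂ → ℂ := fun h => ∫ τ in (0 : ℝ)..1, ψ (w + τ * h) with hG
  have hGc : Continuous G := by
    have e : Continuous fun q : ℂ × ℝ => w + (q.2 : ℂ) * q.1 := by fun_prop
    exact intervalIntegral.continuous_parametric_intervalIntegral_of_continuous'
      (f := fun (h : ℂ) (τ : ℝ) => ψ (w + τ * h)) (hψc.comp e) 0 1
  have key : ∀ h : ℂ, symbolLog φ (w + h) - symbolLog φ w = h * G h := fun h => by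
    have hc : Continuous fun τ : ℝ => h • Q (expKernel (w + τ * h)) :=
      Continuous.const_smul (Q.continuous.comp (continuous_expKernel.comp
        (show Continuous fun τ : ℝ => w + τ * h by fun_prop))) h
    have := dist_eq_intervalIntegral hc (a := 0) (b := 1)
      (f := expKernel (w + h) - expKernel w) (fun α => by
        have hd : ∀ τ : ℝ, HasDerivAt (fun τ : ℝ => (unitBump α : ℂ) *
            Complex.exp (α * (w + τ * h)))
            (h * (α * ((unitBump α : ℂ) * Complex.exp (α * (w + τ * h))))) τ := fun τ => by
          have e1 : HasDerivAt (fun τ : ℝ => (α : ℂ) * (w + τ * h)) (α * (1 * h)) τ :=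
            (((Complex.ofRealCLM.hasDerivAt (x := τ)).mul_const h).const_add w).const_mul (α : ℂ)
          exact (e1.cexp.const_mul _).congr_deriv (by ring)
        have e := intervalIntegral.integral_eq_sub_of_hasDerivAt (a := 0) (b := 1)
          (fun τ _ => hd τ) (Continuous.intervalIntegrable (by fun_prop) _ _)
        change expKernel (w + h) α - expKernel w α = ∫ τ in (0 : ℝ)..1, h * Q (expKernel (w + τ * h)) α
        simp only [hQa, expKernel_apply]
        rw [e]
        simp) φ
    rw [map_sub] at this
    simp only [map_smul, smul_eq_mul] at this
    rw [intervalIntegral.integral_const_mul] at this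
    exact this
  have hd : HasDerivAt (symbolLog φ) (G 0) w := by
    rw [hasDerivAt_iff_tendsto_slope_zero]
    refine (hGc.tendsto 0).mono_left nhdsWithin_le_nhds |>.congr' ?_
    filter_upwards [self_mem_nhdsWithin] with h hh
    rw [key, smul_eq_mul, inv_mul_cancel_left₀ hh]
  exact hd.differentiableAt

end SymbolGrowth

/-! ### Lower bounds for entire functions on vertical segments -/

section EntireQuotient

/-- `h` grows at most like `(1 + ‖z‖) ^ m * exp (3 |Re z|)`. -/
def HasExpGrowth (h : ℂ → ℂ) : Prop :=
  ∃ (C : ℝ) (m : ℕ), 0 ≤ C ∧ ∀ z, ‖h z‖ ≤ C * (1 + ‖z‖) ^ m * Real.exp (3 * |z.re|)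

theorem HasExpGrowth.comp_neg {h : ℂ → ℂ} (hh : HasExpGrowth h) :
    HasExpGrowth fun z => h (-z) := by
  obtain ⟨C, m, hC, h⟩ := hh
  exact ⟨C, m, hC, fun z => by simpa using h (-z)⟩

/-- A nonzero entire function of exponential growth does not decay faster than every exponential
along the real axis. -/
theorem HasExpGrowth.exists_frequently_le {h : ℂ → ℂ} (hg : HasExpGrowth h)
    (hd : Differentiable ℂ h) (h0 : ∃ z, h z ≠ 0) :
    ∃ n : ℕ, ∃ᶠ x : ℝ in atTop, Real.exp (-(n * x)) ≤ ‖h x‖ := by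
  by_contra! hcon
  obtain ⟨C, m, hC, hb⟩ := hg
  have hne : ∀ z : ℂ, 0 ≤ z.re → 1 + z ≠ 0 := fun z hz e => by
    have := congrArg Complex.re e
    simp at this
    linarith
  -- Dividing by (1 + z)^m makes the function bounded on the imaginary axis, as the
  -- Phragmén–Lindelöf principle for superexponential decay requires.
  set f : ℂ → ℂ := fun z => h z / (1 + z) ^ m with hf
  have hfb : ∀ z : ℂ, 0 ≤ z.re → ‖f z‖ ≤ C * 2 ^ m * Real.exp (3 * z.re) := fun z hz => by
    have e1 : 1 ≤ ‖1 + z‖ := by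
      have := Complex.abs_re_le_norm (1 + z)
      rw [Complex.add_re, Complex.one_re, abs_of_nonneg (by linarith)] at this
      linarith
    have e2 : ‖z‖ ≤ ‖1 + z‖ := by
      rw [Complex.norm_def, Complex.norm_def]
      refine Real.sqrt_le_sqrt ?_
      simp [Complex.normSq_apply]
      nlinarith
    rw [hf, norm_div, norm_pow, div_le_iff₀ (by positivity)]
    calc ‖h z‖ ≤ C * (1 + ‖z‖) ^ m * Real.exp (3 * |z.re|) := hb z
      _ ≤ C * (2 * ‖1 + z‖) ^ m * Real.exp (3 * |z.re|) := by gcongr; linarith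
      _ = _ := by rw [abs_of_nonneg hz, mul_pow]; ring
  have hz : EqOn f 0 {z : ℂ | 0 ≤ z.re} := by
    refine PhragmenLindelof.eq_zero_on_right_half_plane_of_superexponential_decay ?_ ?_ ?_ ?_
    · refine DifferentiableOn.diffContOnCl fun z hz => ?_
      have hz' : 0 ≤ z.re := by
        have : z ∈ closure {z : ℂ | 0 < z.re} := hz
        rwa [Complex.closure_setOfPred_lt_re] at this
      exact (hd z).differentiableWithinAt.div (by fun_prop) (pow_ne_zero _ (hne z hz'))
    · refine ⟨3 / 2, by norm_num, 3, Asymptotics.IsBigO.of_bound (C * 2 ^ m) ?_⟩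
      have : ∀ᶠ z : ℂ in Bornology.cobounded ℂ, 1 ≤ ‖z‖ :=
        tendsto_norm_cobounded_atTop.eventually_ge_atTop 1
      filter_upwards [this.filter_mono inf_le_left,
        (mem_principal_self {z : ℂ | 0 < z.re} : _ ∈ 𝓟 _) |> mem_inf_of_right] with z h1 h2
      have h2' : 0 < z.re := h2
      refine (hfb z h2'.le).trans ?_
      rw [Real.norm_eq_abs, abs_of_pos (Real.exp_pos _)]
      have : z.re ≤ ‖z‖ ^ (3 / 2 : ℝ) := (Complex.re_le_norm z).trans (by
        simpa using Real.rpow_le_rpow_of_exponent_le h1 (show (1 : ℝ) ≤ 3 / 2 by norm_num))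
      gcongr
    · intro n
      have e : Tendsto (fun x : ℝ => Real.exp (-x)) atTop (𝓝 0) :=
        Real.tendsto_exp_neg_atTop_nhds_zero
      refine tendsto_of_tendsto_of_tendsto_of_le_of_le' tendsto_const_nhds e
        (Eventually.of_forall fun x => by positivity) ?_
      filter_upwards [hcon (n + 1), eventually_ge_atTop 0] with x h1 h2
      have e3 : ‖f x‖ ≤ ‖h x‖ := by
        rw [hf, norm_div, norm_pow]
        refine div_le_self (norm_nonneg _) (one_le_pow₀ ?_)
        have := Complex.abs_re_le_norm (1 + (x : ℂ))
        rw [Complex.add_re, Complex.one_re, Complex.ofReal_re, abs_of_nonneg (by linarith)] at this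
        linarith
      calc Real.exp x ^ n * ‖f x‖ ≤ Real.exp x ^ n * Real.exp (-((n + 1 : ℕ) * x)) := by
            gcongr; exact e3.trans h1.le
        _ = Real.exp (-x) := by
            rw [← Real.exp_nat_mul, ← Real.exp_add]; congr 1; push_cast; ring
    · exact ⟨C * 2 ^ m, fun x => by simpa using hfb (x * Complex.I) (by simp)⟩
  obtain ⟨w, hw⟩ := h0
  refine hw ?_
  have hev : h =ᶠ[𝓝 1] fun _ => (0 : ℂ) := by
    filter_upwards [(isOpen_lt continuous_const Complex.continuous_re).mem_nhds
      (show (0 : ℝ) < (1 : ℂ).re by simp)] with z hz'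
    have hz0 : 0 ≤ z.re := le_of_lt hz'
    have := hz hz0
    simpa [hf, hne z hz0] using this
  exact congrFun (AnalyticOnNhd.eq_of_eventuallyEq (fun z _ => hd.analyticAt z)
    (fun z _ => analyticAt_const) hev) w

/-- Division by the zeros in a disc. -/
theorem exists_prod_mul_eq_of_norm_lt {R : ℝ} (hR : 0 < R) (N : ℕ) :
    ∀ {h : ℂ → ℂ} {M : ℝ}, Differentiable ℂ h → (∀ z, ‖z‖ ≤ R → ‖h z‖ ≤ M) →
      M < 2 ^ N * ‖h 0‖ →
    ∃ (l : List ℂ) (q : ℂ → ℂ), l.length ≤ N ∧ (∀ w ∈ l, w ≠ 0 ∧ ‖w‖ ≤ R / 3) ∧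
      Differentiable ℂ q ∧ (∀ z, ‖z‖ ≤ R → ‖q z‖ ≤ M) ∧ (∀ z, ‖z‖ ≤ R / 3 → q z ≠ 0) ∧
      q 0 = h 0 ∧ ∀ z, h z = (l.map fun w => 1 - z / w).prod * q z := by
  induction N with
  | zero =>
    intro h M hd hb hM
    have := hb 0 (by simpa using hR.le)
    simp at hM
    linarith
  | succ N ih =>
    intro h M hd hb hM
    by_cases hz : ∀ z, ‖z‖ ≤ R / 3 → h z ≠ 0
    · exact ⟨[], h, by simp, by simp, hd, hb, hz, rfl, by simp⟩
    push Not at hz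
    obtain ⟨w, hw, hw0⟩ := hz
    have hM0 : 0 ≤ M := (norm_nonneg _).trans (hb 0 (by simpa using hR.le))
    have h00 : h 0 ≠ 0 := fun e => by rw [e] at hM; simp at hM; linarith
    have hwne : w ≠ 0 := fun e => h00 (e ▸ hw0)
    set q : ℂ → ℂ := fun z => -w * dslope h w z with hq
    have hqd : Differentiable ℂ q := by
      have : DifferentiableOn ℂ (dslope h w) univ :=
        (Complex.differentiableOn_dslope univ_mem).2 hd.differentiableOn
      exact (differentiableOn_univ.1 this).const_mul _
    have hhq : ∀ z, h z = (1 - z / w) * q z := fun z => by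
      have := sub_smul_dslope h w z
      rw [hw0, sub_zero, smul_eq_mul] at this
      rw [← this, hq]
      field_simp
      ring
    -- Since ‖w‖ ≤ R/3, the factor 1 - z/w has modulus at least 2 on the circle ‖z‖ = R. Each
    -- removed zero halves the maximum while the value at 0 is kept, so at most N zeros can be
    -- removed.
    have hqb : ∀ z, ‖z‖ ≤ R → ‖q z‖ ≤ M / 2 := fun z hz => by
      refine Complex.norm_le_of_forall_mem_frontier_norm_le (U := Metric.ball 0 R)
        Metric.isBounded_ball hqd.diffContOnCl (fun z hz => ?_) ?_
      · rw [frontier_ball _ hR.ne', mem_sphere_zero_iff_norm] at hz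
        have e1 : 2 ≤ ‖1 - z / w‖ := by
          have e2 : 3 ≤ ‖z / w‖ := by
            rw [norm_div, le_div_iff₀ (norm_pos_iff.2 hwne), hz]
            linarith
          have := norm_sub_norm_le (z / w) 1
          rw [norm_one, norm_sub_rev] at this
          linarith
        have e3 := hb z hz.le
        rw [hhq, norm_mul] at e3
        nlinarith [norm_nonneg (q z)]
      · rw [closure_ball _ hR.ne']
        simpa using hz
    have hq0 : q 0 = h 0 := by rw [hhq 0]; simp
    obtain ⟨l, p, hl, hlw, hp, hpb, hp0, hpq, hprod⟩ := ih hqd hqb (by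
      rw [hq0, div_lt_iff₀ two_pos]
      rw [pow_succ] at hM
      linarith)
    refine ⟨w :: l, p, by simpa using hl, ?_, hp, fun z hz => (hpb z hz).trans (by linarith), hp0,
      hpq.trans hq0, fun z => ?_⟩
    · simpa using ⟨⟨hwne, hw⟩, hlw⟩
    · rw [hhq, hprod]
      simp [mul_assoc]

/-- A lower bound for a bounded function without zeros. -/
theorem norm_ge_of_forall_ne_zero {q : ℂ → ℂ} (hd : Differentiable ℂ q) {R L : ℝ} (hR : 0 < R)
    (hL : 0 < L) (hb : ∀ z, ‖z‖ ≤ R → ‖q z‖ ≤ Real.exp L * ‖q 0‖)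
    (hne : ∀ z, ‖z‖ ≤ R → q z ≠ 0) {z : ℂ} (hz : ‖z‖ ≤ R / 2) :
    Real.exp (-(2 * L)) * ‖q 0‖ ≤ ‖q z‖ := by
  have hdl : DifferentiableOn ℂ (fun z => deriv q z / q z) (Metric.ball 0 R) := fun z hz => by
    have hz' : ‖z‖ ≤ R := by simpa using (Metric.mem_ball.1 hz).le
    have : Differentiable ℂ (deriv q) := hd.contDiff.differentiable_deriv_two
    exact ((this z).div (hd z) (hne z hz')).differentiableWithinAt
  -- F is a logarithm of q up to a constant. The upper bound on |q| bounds Re (F - F 0) from above,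
  -- and the Borel–Carathéodory inequality converts this into a bound for its modulus on the half
  -- disc radius.
  obtain ⟨F, hF⟩ := hdl.isExactOn_ball
  have hR0 : (0 : ℂ) ∈ Metric.ball (0 : ℂ) R := Metric.mem_ball_self hR
  have hq0 : q 0 ≠ 0 := hne 0 (by simpa using hR.le)
  have hqF : ∀ z ∈ Metric.ball (0 : ℂ) R, q z = q 0 * Complex.exp (F z - F 0) := fun z hz => by
    have hc : ∀ w ∈ Metric.ball (0 : ℂ) R,
        HasDerivAt (fun w => q w * Complex.exp (-F w)) 0 w := fun w hw => by
      have hw' : ‖w‖ ≤ R := by simpa using (Metric.mem_ball.1 hw).le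
      have e := (hd w).hasDerivAt.fun_mul (hF w hw).fun_neg.cexp
      refine e.congr_deriv ?_
      field_simp [hne w hw']
      ring
    have hconst := (convex_ball (0 : ℂ) R).is_const_of_fderivWithin_eq_zero (𝕜 := ℂ)
      (f := fun w => q w * Complex.exp (-F w))
      (fun w hw => (hc w hw).differentiableAt.differentiableWithinAt) (fun w hw => by
        rw [fderivWithin_of_isOpen Metric.isOpen_ball hw]
        have := (hc w hw).hasFDerivAt.fderiv
        rw [this]; ext; simp) hz hR0
    have hconst' : q z * Complex.exp (-F z) = q 0 * Complex.exp (-F 0) := hconst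
    calc q z = q z * Complex.exp (-F z) * Complex.exp (F z) := by
          rw [mul_assoc, ← Complex.exp_add]; simp
      _ = _ := by rw [hconst', mul_assoc, ← Complex.exp_add]; congr 2; ring
  have hzR : z ∈ Metric.ball (0 : ℂ) R := by simpa using hz.trans_lt (by linarith)
  have hbc := Complex.borelCaratheodory_zero (f := fun z => F z - F 0) hL
    (fun w hw => ((hF w hw).differentiableAt.sub_const _).differentiableWithinAt)
    (fun w hw => by
      have hw' : ‖w‖ ≤ R := by simpa using (Metric.mem_ball.1 hw).le
      have h1 := hb w hw'
      rw [hqF w hw, norm_mul, Complex.norm_exp, mul_comm] at h1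
      exact Real.exp_le_exp.1 (le_of_mul_le_mul_right h1 (norm_pos_iff.2 hq0))) hR hzR (by simp)
  have h2 : ‖F z - F 0‖ ≤ 2 * L := hbc.trans (by
    rw [div_le_iff₀ (by linarith)]
    nlinarith)
  rw [hqF z hzR, norm_mul, Complex.norm_exp, mul_comm]
  gcongr
  have := Complex.abs_re_le_norm (F z - F 0)
  linarith [neg_abs_le (F z - F 0).re]

theorem HasExpGrowth.exists_norm_le_exp {h : ℂ → ℂ} (hg : HasExpGrowth h) :
    ∃ A : ℝ, 0 ≤ A ∧ ∀ x : ℝ, 1 ≤ x → ∀ z : ℂ, ‖z‖ ≤ 30 → ‖h (x + z)‖ ≤ Real.exp (A * x) := by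
  obtain ⟨C, m, hC, hb⟩ := hg
  refine ⟨C + 32 * m + 93, by positivity, fun x hx z hz => (hb _).trans ?_⟩
  have h1 : ‖(x : ℂ) + z‖ ≤ x + 30 := (norm_add_le _ _).trans (by
    rw [Complex.norm_real, Real.norm_eq_abs, abs_of_nonneg (by linarith)]; linarith)
  have h2 : |((x : ℂ) + z).re| ≤ 31 * x := (Complex.abs_re_le_norm _).trans (by linarith)
  have h3 : 1 + ‖(x : ℂ) + z‖ ≤ Real.exp (32 * x) := by
    linarith [Real.add_one_le_exp (32 * x)]
  have h4 : C ≤ Real.exp (C * x) := by nlinarith [Real.add_one_le_exp (C * x)]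
  calc C * (1 + ‖(x : ℂ) + z‖) ^ m * Real.exp (3 * |((x : ℂ) + z).re|)
      ≤ Real.exp (C * x) * Real.exp (32 * x) ^ m * Real.exp (3 * (31 * x)) := by gcongr
    _ = _ := by rw [← Real.exp_nat_mul, ← Real.exp_add, ← Real.exp_add]; congr 1; ring

/-- Given at most `N` numbers, some point of the grid `{0, 1/N, …, 1}` has distance at least
`1/(2N)` from all of them. -/
theorem exists_forall_mem_le_abs_sub {N : ℕ} (hN : 0 < N) {l : List ℂ} (hl : l.length ≤ N) :
    ∃ t : ℝ, 0 ≤ t ∧ t ≤ 1 ∧ ∀ w ∈ l, 1 / (2 * N : ℝ) ≤ |t - w.re| := by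
  have hN' : (0 : ℝ) < N := by exact_mod_cast hN
  by_contra! hcon
  have : ∀ j : Fin (N + 1), ∃ i : Fin l.length, |(j : ℝ) / N - (l.get i).re| < 1 / (2 * N) :=
    fun j => by
    obtain ⟨w, hw, hlt⟩ := hcon ((j : ℝ) / N) (by positivity) (by
      rw [div_le_one hN']
      exact_mod_cast Nat.lt_succ_iff.1 j.2)
    obtain ⟨i, rfl⟩ := List.mem_iff_get.1 hw
    exact ⟨i, hlt⟩
  choose f hf using this
  -- Pigeonhole: if each of the N + 1 grid points were closer than 1/(2N) to one of at most N
  -- numbers, two grid points would be closer than 1/N.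
  obtain ⟨a, b, hab, he⟩ := Fintype.exists_ne_map_eq_of_card_lt f (by simpa using by omega)
  have h1 := hf a
  have h2 := hf b
  rw [he] at h1
  have h3 : |(a : ℝ) / N - (b : ℝ) / N| < 1 / N := by
    have := abs_sub_le ((a : ℝ) / N) (l.get (f b)).re ((b : ℝ) / N)
    rw [abs_sub_comm (l.get (f b)).re] at this
    have e : 1 / (2 * N : ℝ) + 1 / (2 * N) = 1 / N := by field_simp; ring
    linarith
  rw [← sub_div, abs_div, abs_of_pos hN', div_lt_div_iff_of_pos_right hN'] at h3
  have h4 : |(a : ℤ) - (b : ℤ)| < 1 := by exact_mod_cast h3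
  rw [Int.abs_lt_one_iff, sub_eq_zero] at h4
  exact hab (Fin.ext (by exact_mod_cast h4))

/-- A quotient of two entire functions of exponential growth grows at most like `exp (C x ^ 2)` on
suitable vertical segments. -/
theorem HasExpGrowth.exists_segment {g h : ℂ → ℂ} (hg : HasExpGrowth g) (hh : HasExpGrowth h)
    (hd : Differentiable ℂ h) (h0 : ∃ z, h z ≠ 0) :
    ∃ C : ℝ, 0 ≤ C ∧ ∀ X : ℝ, ∃ x : ℝ, X ≤ x ∧ ∀ y : ℝ, |y| ≤ Real.pi →
      h (x + y * Complex.I) ≠ 0 ∧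
      ‖g (x + y * Complex.I)‖ ≤ Real.exp (C * x ^ 2) * ‖h (x + y * Complex.I)‖ := by
  obtain ⟨n, hn⟩ := hh.exists_frequently_le hd h0
  obtain ⟨A, hA, hbA⟩ := hh.exists_norm_le_exp
  obtain ⟨B, hB, hbB⟩ := hg.exists_norm_le_exp
  set D : ℝ := 2 * (A + n) + 1 with hD
  have hD0 : 0 ≤ D := by positivity
  refine ⟨20 * D ^ 2 + 2 * (A + n + 1) + n + B, by positivity, fun X => ?_⟩
  obtain ⟨x₀, hx, hx1, hxX⟩ :=
    (hn.and_eventually ((eventually_ge_atTop 1).and (eventually_ge_atTop X))).exists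
  have hne : h x₀ ≠ 0 := norm_pos_iff.1 ((Real.exp_pos _).trans_le hx)
  -- Near x₀ the maximum of |h| exceeds |h x₀| by at most e^{(A+n)x₀}, and log 2 > 1/2, so 2^N
  -- dominates the ratio. The number of zeros to remove is therefore at most linear in x₀.
  set N : ℕ := ⌊2 * (A + n) * x₀⌋₊ + 1 with hN
  have hNpos : 0 < N := Nat.succ_pos _
  have hN1 : 2 * (A + n) * x₀ < N := by
    have := Nat.lt_floor_add_one (2 * (A + n) * x₀)
    rw [hN]; push_cast; exact this
  have hN2 : (N : ℝ) ≤ D * x₀ := by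
    have := Nat.floor_le (show 0 ≤ 2 * (A + n) * x₀ by positivity)
    rw [hN, hD]; push_cast; nlinarith
  have hNr : (1 : ℝ) ≤ N := by exact_mod_cast hNpos
  obtain ⟨l, q, hl, hlw, hqd, hqb, hqne, hq0, hprod⟩ :=
    exists_prod_mul_eq_of_norm_lt (R := 30) (by norm_num) N (h := fun z => h (x₀ + z))
      (M := Real.exp (A * x₀)) (by fun_prop) (fun z hz => hbA x₀ hx1 z hz) (by
        have e1 : Real.exp ((A + n) * x₀) < 2 ^ N := by
          rw [← Real.exp_log (show (0 : ℝ) < 2 by norm_num), ← Real.exp_nat_mul]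
          refine Real.exp_lt_exp.2 ?_
          nlinarith [Real.log_two_gt_d9]
        calc Real.exp (A * x₀) = Real.exp ((A + n) * x₀) * Real.exp (-(n * x₀)) := by
              rw [← Real.exp_add]; congr 1; ring
          _ < 2 ^ N * Real.exp (-(n * x₀)) := by gcongr
          _ ≤ 2 ^ N * ‖h (x₀ + 0)‖ := by rw [add_zero]; gcongr)
  have hq0' : q 0 = h x₀ := by simpa using hq0
  obtain ⟨t, ht0, ht1, ht⟩ := exists_forall_mem_le_abs_sub hNpos hl
  refine ⟨x₀ + t, by linarith, fun y hy => ?_⟩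
  set z : ℂ := t + y * Complex.I with hz
  have hz5 : ‖z‖ ≤ 5 := by
    refine (norm_add_le _ _).trans ?_
    rw [norm_mul, Complex.norm_I, mul_one, Complex.norm_real, Complex.norm_real, Real.norm_eq_abs,
      Real.norm_eq_abs, abs_of_nonneg ht0]
    linarith [Real.pi_lt_d2]
  have hzeq : ((x₀ + t : ℝ) : ℂ) + y * Complex.I = x₀ + z := by rw [hz]; push_cast; ring
  -- The radii 30, 10 and 5 are those of the disc with the upper bound, the zero-free disc, and the
  -- disc that contains the segment. The summand 1 in A + n + 1 keeps the exponent strictly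
  -- positive.
  have hq : Real.exp (-(2 * ((A + n + 1) * x₀))) * Real.exp (-(n * x₀)) ≤ ‖q z‖ := by
    have := norm_ge_of_forall_ne_zero hqd (R := 10) (L := (A + n + 1) * x₀) (by norm_num)
      (by positivity) (fun z hz => (hqb z (hz.trans (by norm_num))).trans (by
        rw [hq0']
        calc Real.exp (A * x₀) ≤ Real.exp ((A + n + 1) * x₀) * Real.exp (-(n * x₀)) := by
              rw [← Real.exp_add]; exact Real.exp_le_exp.2 (by nlinarith)
          _ ≤ _ := by gcongr)) (fun z hz => hqne z (hz.trans (by norm_num))) (z := z)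
      (hz5.trans (by norm_num))
    rw [hq0'] at this
    exact (by gcongr : _ ≤ _).trans this
  -- The segment stays at distance 1/(2N) from every zero, and ‖w‖ ≤ 10, so each of at most N
  -- factors is at least 1/(20N). The resulting (20N)^{-N} is the source of the quadratic exponent.
  have hP : Real.exp (-(20 * N ^ 2)) ≤ ‖(l.map fun w => 1 - z / w).prod‖ := by
    have hlist : ∀ l' : List ℂ, (∀ w ∈ l', w ∈ l) →
        (1 / (20 * N : ℝ)) ^ l'.length ≤ ‖(l'.map fun w => 1 - z / w).prod‖ := fun l' => by
      induction l' with
      | nil => simp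
      | cons w l' ih =>
        intro hs
        rw [List.map_cons, List.prod_cons, norm_mul, List.length_cons, pow_succ']
        have hwl := hs w (by simp)
        obtain ⟨hw0, hw10⟩ := hlw w hwl
        refine mul_le_mul ?_ (ih fun v hv => hs v (by simp [hv])) (by positivity) (norm_nonneg _)
        have e : 1 - z / w = (w - z) / w := by field_simp
        rw [e, norm_div, le_div_iff₀ (norm_pos_iff.2 hw0)]
        have h1 := Complex.abs_re_le_norm (w - z)
        have h2 : (w - z).re = -(t - w.re) := by simp [hz]
        rw [h2, abs_neg] at h1
        refine le_trans ?_ ((ht w hwl).trans h1)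
        calc 1 / (20 * N : ℝ) * ‖w‖ ≤ 1 / (20 * N : ℝ) * 10 := by gcongr; linarith
          _ = _ := by field_simp; norm_num
    refine le_trans ?_ (hlist l fun _ => id)
    have e1 : (1 / (20 * N : ℝ)) ^ N ≤ (1 / (20 * N : ℝ)) ^ l.length := by
      refine pow_le_pow_of_le_one (by positivity) ?_ hl
      rw [div_le_one (by positivity)]
      linarith
    refine le_trans ?_ e1
    rw [one_div, inv_pow, Real.exp_neg]
    refine inv_anti₀ (by positivity) ?_
    calc (20 * N : ℝ) ^ N ≤ Real.exp (20 * N) ^ N := by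
          gcongr; linarith [Real.add_one_le_exp (20 * N : ℝ)]
      _ = _ := by rw [← Real.exp_nat_mul]; congr 1; ring
  have hlow : Real.exp (-(20 * N ^ 2) + (-(2 * ((A + n + 1) * x₀)) + -(n * x₀))) ≤ ‖h (x₀ + z)‖ := by
    rw [hprod, norm_mul, Real.exp_add, Real.exp_add]
    gcongr
  rw [hzeq]
  refine ⟨norm_pos_iff.1 ((Real.exp_pos _).trans_le hlow), ?_⟩
  refine (hbB x₀ hx1 z (hz5.trans (by norm_num))).trans (le_trans ?_
    (mul_le_mul_of_nonneg_left hlow (Real.exp_pos _).le))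
  rw [← Real.exp_add]
  refine Real.exp_le_exp.2 ?_
  have hN3 : (N : ℝ) ^ 2 ≤ D ^ 2 * x₀ ^ 2 := by rw [← mul_pow]; gcongr
  have hx2 : x₀ ≤ x₀ ^ 2 := by nlinarith
  have hx3 : x₀ ^ 2 ≤ (x₀ + t) ^ 2 := by gcongr; linarith
  have e1 : (20 * D ^ 2 + 2 * (A + n + 1) + n + B) * x₀ ^ 2 ≤
      (20 * D ^ 2 + 2 * (A + n + 1) + n + B) * (x₀ + t) ^ 2 := by gcongr
  have e2 : (2 * (A + n + 1) + n + B) * x₀ ≤ (2 * (A + n + 1) + n + B) * x₀ ^ 2 := by gcongr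
  nlinarith

end EntireQuotient

/-! ### Phragmén–Lindelöf in a half strip -/

section HalfStrip

/-- On suitable vertical segments arbitrarily far to the right, `f` is at most `exp (C x ^ 2)`. -/
def HasSegments (f : ℂ → ℂ) (a b : ℝ) : Prop :=
  ∃ C : ℝ, ∀ X : ℝ, ∃ x : ℝ, X ≤ x ∧ ∀ y : ℝ, a ≤ y → y ≤ b →
    ‖f (x + y * Complex.I)‖ ≤ Real.exp (C * x ^ 2)

theorem HasSegments.mul {f : ℂ → ℂ} {a b : ℝ} (hf : HasSegments f a b) {g : ℂ → ℂ} {A B : ℝ}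
    (hg : ∀ z : ℂ, B ≤ z.re → a ≤ z.im → z.im ≤ b → ‖g z‖ ≤ Real.exp (A * z.re ^ 2)) :
    HasSegments (fun z => f z * g z) a b := by
  obtain ⟨C, h⟩ := hf
  refine ⟨C + A, fun X => ?_⟩
  obtain ⟨x, hx, hxy⟩ := h (max X B)
  refine ⟨x, (le_max_left _ _).trans hx, fun y h1 h2 => ?_⟩
  rw [norm_mul, add_mul, Real.exp_add]
  have := hg (x + y * Complex.I) (by simpa using (le_max_right _ _).trans hx) (by simpa) (by simpa)
  simp only [Complex.add_re, Complex.ofReal_re, Complex.mul_re, Complex.I_re, Complex.ofReal_im,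
    Complex.I_im, mul_zero, zero_mul, sub_zero, add_zero] at this
  exact mul_le_mul (hxy y h1 h2) this (norm_nonneg _) (Real.exp_pos _).le

theorem tendsto_mul_sq_sub_mul_exp_atBot (C : ℝ) {ε : ℝ} (hε : 0 < ε) :
    Tendsto (fun x : ℝ => C * x ^ 2 - ε * Real.exp (x / 4)) atTop atBot := by
  have h1 : Tendsto (fun x : ℝ => Real.exp (x / 4) / (x / 4) ^ 2) atTop atTop :=
    (Real.tendsto_exp_div_pow_atTop 2).comp (tendsto_id.atTop_div_const (by norm_num))
  have h2 : Tendsto (fun x : ℝ => ε * (Real.exp (x / 4) / (x / 4) ^ 2) / 16 - C) atTop atTop :=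
    tendsto_atTop_add_const_right _ _ ((h1.const_mul_atTop hε).atTop_div_const (by norm_num))
  have h3 := tendsto_neg_atTop_atBot.comp
    ((tendsto_pow_atTop (α := ℝ) (n := 2) (by norm_num)).atTop_mul_atTop₀ h2)
  refine h3.congr' ?_
  filter_upwards [eventually_gt_atTop 0] with x hx
  simp only [Function.comp]
  field_simp
  ring

/-- The Phragmén–Lindelöf principle in a half strip. -/
theorem norm_le_of_halfStrip {f : ℂ → ℂ} {X a b B : ℝ} (hab : a < b) (ha : -Real.pi ≤ a)
    (hb : b ≤ Real.pi) (hB : 0 < B)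
    (hd : ∀ z : ℂ, X ≤ z.re → a ≤ z.im → z.im ≤ b → DifferentiableAt ℂ f z)
    (hseg : HasSegments f a b)
    (hX : ∀ z : ℂ, z.re = X → a ≤ z.im → z.im ≤ b → ‖f z‖ ≤ B)
    (hfa : ∀ z : ℂ, X ≤ z.re → z.im = a → ‖f z‖ ≤ B)
    (hfb : ∀ z : ℂ, X ≤ z.re → z.im = b → ‖f z‖ ≤ B)
    {z : ℂ} (hz : X ≤ z.re) (hza : a ≤ z.im) (hzb : z.im ≤ b) : ‖f z‖ ≤ B := by
  -- In the strip |Im w / 4| ≤ π/4 < π/3, so Re e^{w/4} ≥ ½e^{Re w/4}. Hence the auxiliary factor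
  -- exp(-εe^{w/4}) beats exp(Cx²) on the distant segments, and ε → 0 removes it.
  have hcos : ∀ w : ℂ, a ≤ w.im → w.im ≤ b →
      1 / 2 * Real.exp (w.re / 4) ≤ (Complex.exp (w / 4)).re := fun w h1 h2 => by
    have e1 : (w / 4).re = w.re / 4 := by
      rw [show (4 : ℂ) = ((4 : ℝ) : ℂ) by norm_num, Complex.div_ofReal_re]
    have e2 : (w / 4).im = w.im / 4 := by
      rw [show (4 : ℂ) = ((4 : ℝ) : ℂ) by norm_num, Complex.div_ofReal_im]
    rw [Complex.exp_re, e1, e2, mul_comm]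
    refine mul_le_mul_of_nonneg_left ?_ (Real.exp_pos _).le
    rw [← Real.cos_pi_div_three, ← Real.cos_abs (w.im / 4)]
    refine Real.cos_le_cos_of_nonneg_of_le_pi (abs_nonneg _) (by linarith [Real.pi_pos]) ?_
    rw [abs_le]
    constructor <;> linarith [Real.pi_pos]
  have key : ∀ ε : ℝ, 0 < ε →
      ‖f z * Complex.exp (-(ε : ℂ) * Complex.exp (z / 4))‖ ≤ B := fun ε hε => by
    obtain ⟨C, hC⟩ := hseg
    set F : ℂ → ℂ := fun w => f w * Complex.exp (-(ε : ℂ) * Complex.exp (w / 4)) with hF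
    have hFn : ∀ w : ℂ, a ≤ w.im → w.im ≤ b →
        ‖F w‖ ≤ ‖f w‖ * Real.exp (-(ε / 2 * Real.exp (w.re / 4))) := fun w h1 h2 => by
      rw [hF, norm_mul, Complex.norm_exp]
      gcongr
      have := mul_le_mul_of_nonneg_left (hcos w h1 h2) hε.le
      rw [← Complex.ofReal_neg, Complex.re_ofReal_mul]
      linarith
    have hFn' : ∀ w : ℂ, a ≤ w.im → w.im ≤ b → ‖F w‖ ≤ ‖f w‖ := fun w h1 h2 =>
      (hFn w h1 h2).trans (mul_le_of_le_one_right (norm_nonneg _)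
        (Real.exp_le_one_iff.2 (neg_nonpos.2 (by positivity))))
    obtain ⟨T, hT⟩ := eventually_atTop.1 ((tendsto_mul_sq_sub_mul_exp_atBot C
      (half_pos hε)).eventually_le_atBot (Real.log B))
    obtain ⟨x, hx, hxy⟩ := hC (max T (z.re + 1))
    have hxz : z.re + 1 ≤ x := (le_max_right _ _).trans hx
    have hxX : X < x := by linarith
    have hcl : closure (Ioo X x ×ℂ Ioo a b) = Icc X x ×ℂ Icc a b := by
      rw [Complex.closure_reProdIm, closure_Ioo hxX.ne, closure_Ioo hab.ne]
    refine Complex.norm_le_of_forall_mem_frontier_norm_le (f := F) (U := Ioo X x ×ℂ Ioo a b)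
      ((Metric.isBounded_Ioo _ _).reProdIm (Metric.isBounded_Ioo _ _)) ?_ ?_ ?_
    · refine DifferentiableOn.diffContOnCl fun w hw => ?_
      rw [hcl] at hw
      have e : DifferentiableAt ℂ (fun w : ℂ => Complex.exp (-(ε : ℂ) * Complex.exp (w / 4))) w := by
        fun_prop
      exact ((hd w hw.1.1 hw.2.1 hw.2.2).mul e).differentiableWithinAt
    · intro w hw
      have hwc : w ∈ Icc X x ×ℂ Icc a b := hcl ▸ frontier_subset_closure hw
      obtain ⟨⟨h1, h2⟩, h3, h4⟩ := hwc
      have hwn : w ∉ Ioo X x ×ℂ Ioo a b := fun h => by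
        have : IsOpen (Ioo X x ×ℂ Ioo a b) := isOpen_Ioo.reProdIm isOpen_Ioo
        rw [this.frontier_eq] at hw
        exact hw.2 h
      by_cases e1 : w.re = X
      · exact (hFn' w h3 h4).trans (hX w e1 h3 h4)
      by_cases e2 : w.im = a
      · exact (hFn' w h3 h4).trans (hfa w h1 e2)
      by_cases e3 : w.im = b
      · exact (hFn' w h3 h4).trans (hfb w h1 e3)
      have e4 : w.re = x := by
        by_contra e4
        exact hwn ⟨⟨lt_of_le_of_ne h1 (Ne.symm e1), lt_of_le_of_ne h2 e4⟩,
          lt_of_le_of_ne h3 (Ne.symm e2), lt_of_le_of_ne h4 e3⟩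
      refine (hFn w h3 h4).trans ?_
      have e5 := hxy w.im h3 h4
      rw [← e4, Complex.re_add_im] at e5
      calc ‖f w‖ * Real.exp (-(ε / 2 * Real.exp (w.re / 4)))
          ≤ Real.exp (C * w.re ^ 2) * Real.exp (-(ε / 2 * Real.exp (w.re / 4))) := by gcongr
        _ ≤ Real.exp (Real.log B) := by
            rw [← Real.exp_add, ← sub_eq_add_neg]
            exact Real.exp_le_exp.2 (hT _ (by rw [e4]; exact (le_max_left _ _).trans hx))
        _ = B := Real.exp_log hB
    · rw [hcl]
      exact ⟨⟨hz, by linarith⟩, hza, hzb⟩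
  have hlim : Tendsto (fun ε : ℝ => ‖f z * Complex.exp (-(ε : ℂ) * Complex.exp (z / 4))‖)
      (𝓝[>] 0) (𝓝 ‖f z * Complex.exp (-((0 : ℝ) : ℂ) * Complex.exp (z / 4))‖) := by
    refine (Continuous.tendsto ?_ 0).mono_left nhdsWithin_le_nhds
    fun_prop
  simp only [Complex.ofReal_zero, neg_zero, zero_mul, Complex.exp_zero, mul_one] at hlim
  exact le_of_tendsto hlim (eventually_mem_nhdsWithin.mono fun ε hε => key ε hε)

/-- A bound for the upper limit on the two edges of a half strip holds uniformly inside. -/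
theorem eventually_norm_le_of_halfStrip {f : ℂ → ℂ} {X a b k : ℝ} (hab : a < b)
    (ha : -Real.pi ≤ a) (hb : b ≤ Real.pi) (hk : 0 ≤ k)
    (hd : ∀ z : ℂ, X ≤ z.re → a ≤ z.im → z.im ≤ b → DifferentiableAt ℂ f z)
    (hseg : HasSegments f a b)
    (hfa : ∀ ε : ℝ, 0 < ε → ∀ᶠ x : ℝ in atTop, ‖f (x + a * Complex.I)‖ ≤ k + ε)
    (hfb : ∀ ε : ℝ, 0 < ε → ∀ᶠ x : ℝ in atTop, ‖f (x + b * Complex.I)‖ ≤ k + ε)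
    {ε : ℝ} (hε : 0 < ε) :
    ∀ᶠ x : ℝ in atTop, ∀ y : ℝ, a ≤ y → y ≤ b → ‖f (x + y * Complex.I)‖ ≤ k + ε := by
  obtain ⟨T, hT⟩ := eventually_atTop.1 ((hfa (ε / 2) (half_pos hε)).and
    (hfb (ε / 2) (half_pos hε)))
  set Y : ℝ := max T X with hY
  have hYX : X ≤ Y := le_max_right _ _
  have hYT : T ≤ Y := le_max_left _ _
  have hcont : ContinuousOn (fun y : ℝ => f (Y + y * Complex.I)) (Icc a b) := fun y hy => by
    have h1 : DifferentiableAt ℂ f (Y + y * Complex.I) :=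
      hd _ (by simpa using hYX) (by simpa using hy.1) (by simpa using hy.2)
    have h2 : ContinuousAt (fun y : ℝ => (Y : ℂ) + y * Complex.I) y := by fun_prop
    exact (ContinuousAt.comp (f := fun y : ℝ => (Y : ℂ) + y * Complex.I) h1.continuousAt
      h2).continuousWithinAt
  obtain ⟨M, hM⟩ := isCompact_Icc.exists_bound_of_continuousOn hcont
  set κ : ℝ := k + ε / 2 with hκ
  have hκ0 : 0 < κ := by positivity
  -- The factor (z - Y)/(z - Y + A) has modulus at most 1 and tends to 1 to the right. On the
  -- initial side Re z = Y its modulus is at most π/A, so that the maximum M of |f| there is reduced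
  -- below κ and does not affect the limit.
  set A : ℝ := Real.pi * |M| / κ + 1 with hA
  have hA0 : 0 < A := by have := Real.pi_pos; positivity
  have hne : ∀ z : ℂ, Y ≤ z.re → z - Y + A ≠ 0 := fun z hz e => by
    have := congrArg Complex.re e
    simp at this
    linarith
  have hm1 : ∀ z : ℂ, Y ≤ z.re → ‖(z - Y) / (z - Y + A)‖ ≤ 1 := fun z hz => by
    rw [norm_div, div_le_one (norm_pos_iff.2 (hne z hz)), Complex.norm_def, Complex.norm_def]
    refine Real.sqrt_le_sqrt ?_
    simp [Complex.normSq_apply]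
    nlinarith
  have key : ∀ z : ℂ, Y ≤ z.re → a ≤ z.im → z.im ≤ b → ‖f z * ((z - Y) / (z - Y + A))‖ ≤ κ := by
    have hline : ∀ z : ℂ, Y ≤ z.re → ‖f z‖ ≤ κ → ‖f z * ((z - Y) / (z - Y + A))‖ ≤ κ :=
      fun z hz h => by
      rw [norm_mul]
      exact (mul_le_of_le_one_right (norm_nonneg _) (hm1 z hz)).trans h
    intro z h1 h2 h3
    refine norm_le_of_halfStrip (f := fun z => f z * ((z - Y) / (z - Y + A))) hab ha hb hκ0
      (fun w h4 h5 h6 => ?_) (hseg.mul (A := 0) (B := Y) fun w h4 _ _ => by simpa using hm1 w h4)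
      (fun w h4 h5 h6 => ?_) (fun w h4 h5 => hline w h4 ?_) (fun w h4 h5 => hline w h4 ?_) h1 h2 h3
    · exact (hd w (hYX.trans h4) h5 h6).mul ((by fun_prop : DifferentiableAt ℂ _ w).div
        (by fun_prop) (hne w h4))
    · have e1 : ‖f w‖ ≤ |M| := by
        have := hM w.im ⟨h5, h6⟩
        rw [← h4, Complex.re_add_im] at this
        exact this.trans (le_abs_self M)
      have e2 : ‖w - Y‖ ≤ Real.pi := by
        have : w - Y = ((w.im : ℝ) : ℂ) * Complex.I := by
          apply Complex.ext <;> simp [h4]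
        rw [this, norm_mul, Complex.norm_I, mul_one, Complex.norm_real, Real.norm_eq_abs, abs_le]
        constructor <;> linarith
      have e3 : A ≤ ‖w - Y + A‖ := by
        have := Complex.abs_re_le_norm (w - Y + A)
        simp [h4] at this
        exact (le_abs_self A).trans this
      rw [norm_mul, norm_div, mul_div_assoc', div_le_iff₀ (hA0.trans_le e3)]
      calc ‖f w‖ * ‖w - Y‖ ≤ |M| * Real.pi := by gcongr
        _ = κ * (A - 1) := by rw [hA]; field_simp; ring
        _ ≤ κ * ‖w - Y + A‖ := by gcongr; linarith
    · have := (hT w.re (hYT.trans h4)).1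
      rwa [← h5, Complex.re_add_im] at this
    · have := (hT w.re (hYT.trans h4)).2
      rwa [← h5, Complex.re_add_im] at this
  have hlim : Tendsto (fun x : ℝ => κ / (1 - A / (x - Y + A))) atTop (𝓝 (κ / (1 - 0))) := by
    refine tendsto_const_nhds.div (tendsto_const_nhds.sub (Tendsto.div_atTop tendsto_const_nhds ?_))
      (by norm_num)
    exact tendsto_atTop_add_const_right _ _ (tendsto_atTop_add_const_right _ _ tendsto_id)
  have hlt : κ / (1 - 0) < k + ε := by rw [hκ]; simp; linarith
  filter_upwards [hlim.eventually_lt_const hlt, eventually_gt_atTop Y] with x hx hxY y h1 h2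
  refine le_trans ?_ hx.le
  have e0 : 0 < x - Y + A := by linarith
  have e1 : 1 - A / (x - Y + A) = (x - Y) / (x - Y + A) := by field_simp; ring
  have e2 : 0 < (x - Y) / (x - Y + A) := div_pos (by linarith) e0
  rw [e1, le_div_iff₀ e2]
  have e3 := key (x + y * Complex.I) (by simpa using hxY.le) (by simpa) (by simpa)
  rw [norm_mul] at e3
  refine le_trans (mul_le_mul_of_nonneg_left ?_ (norm_nonneg _)) e3
  set w : ℂ := x + y * Complex.I - Y with hw
  have hwre : w.re = x - Y := by simp [hw]
  have e4 : ‖w + A‖ ≤ ‖w‖ + A := (norm_add_le _ _).trans (by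
    rw [Complex.norm_real, Real.norm_eq_abs, abs_of_pos hA0])
  have e5 : x - Y ≤ ‖w‖ := hwre ▸ Complex.re_le_norm w
  have e6 : 0 < ‖w + A‖ := norm_pos_iff.2 (hne _ (by simpa using hxY.le))
  rw [norm_div, div_le_div_iff₀ e0 e6]
  nlinarith

end HalfStrip

/-! ### Self-maps of the right half plane -/

section HalfPlane

open scoped ComplexConjugate

/-- This identity translates between the pseudo-hyperbolic distance |a - b| / |a + b̄| of the half
plane and real parts. -/
theorem sq_norm_add_conj_sub_sq_norm_sub (a b : ℂ) :
    ‖a + conj b‖ ^ 2 - ‖a - b‖ ^ 2 = 4 * a.re * b.re := by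
  rw [← Complex.normSq_eq_norm_sq, ← Complex.normSq_eq_norm_sq]
  simp [Complex.normSq_apply]
  ring

/-- The Schwarz–Pick lemma for the right half plane. -/
theorem schwarz_pick_halfPlane {P : ℂ → ℂ} (hd : DifferentiableOn ℂ P {s | 0 < s.re})
    (hP : ∀ s : ℂ, 0 < s.re → 0 < (P s).re) {s₁ s : ℂ} (hs₁ : 0 < s₁.re) (hs : 0 < s.re) :
    ‖P s + conj (P s₁)‖ ^ 2 * (s.re * s₁.re) ≤ ‖s + conj s₁‖ ^ 2 * ((P s).re * (P s₁).re) := by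
  have hne : ∀ {a b : ℂ}, 0 < a.re → 0 < b.re → a + conj b ≠ 0 := fun ha hb e => by
    have := congrArg Complex.re e
    simp at this
    linarith
  have hlt : ∀ {a b : ℂ}, 0 < a.re → 0 < b.re → ‖(a - b) / (a + conj b)‖ < 1 :=
    fun {a b} ha hb => by
    rw [norm_div, div_lt_one (norm_pos_iff.2 (hne ha hb))]
    refine lt_of_pow_lt_pow_left₀ 2 (norm_nonneg _) ?_
    nlinarith [sq_norm_add_conj_sub_sq_norm_sub a b, mul_pos ha hb]
  -- T is the Cayley map of the unit disc onto the half plane that takes 0 to s₁. Conjugating P by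
  -- Cayley maps gives a self-map of the disc fixing 0, to which the Schwarz lemma applies.
  set T : ℂ → ℂ := fun z => (s₁ + conj s₁ * z) / (1 - z) with hT
  have h1z : ∀ z ∈ Metric.ball (0 : ℂ) 1, 1 - z ≠ 0 := fun z hz e => by
    rw [sub_eq_zero] at e
    rw [← e] at hz
    simp at hz
  have hTre : ∀ z ∈ Metric.ball (0 : ℂ) 1, 0 < (T z).re := fun z hz => by
    have h1 := Complex.normSq_pos.2 (h1z z hz)
    have h2 : z.re ^ 2 + z.im ^ 2 < 1 := by
      have h3 : ‖z‖ ^ 2 < 1 := by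
        rw [mem_ball_zero_iff] at hz
        exact pow_lt_one₀ (norm_nonneg _) hz two_ne_zero
      rw [← Complex.normSq_eq_norm_sq, Complex.normSq_apply] at h3
      linarith
    rw [hT, Complex.div_re, ← add_div]
    refine div_pos ?_ h1
    simp
    nlinarith
  set f : ℂ → ℂ := fun z => (P (T z) - P s₁) / (P (T z) + conj (P s₁)) with hf
  set z₀ : ℂ := (s - s₁) / (s + conj s₁) with hz₀
  have hz₀' : z₀ ∈ Metric.ball (0 : ℂ) 1 := mem_ball_zero_iff.2 (hlt hs hs₁)
  have hTz₀ : T z₀ = s := by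
    have e1 := hne hs hs₁
    have e2 : s₁ + conj s₁ ≠ 0 := hne hs₁ hs₁
    have e3 : 1 - z₀ = (s₁ + conj s₁) / (s + conj s₁) := by
      rw [hz₀]; field_simp; ring
    have e4 : s₁ + conj s₁ * z₀ = s * (s₁ + conj s₁) / (s + conj s₁) := by
      rw [hz₀]; field_simp; ring
    rw [hT]
    simp only
    rw [e3, e4]
    field_simp
  have hT0 : T 0 = s₁ := by simp [hT]
  have hfz := Complex.norm_le_norm_of_mapsTo_ball (f := f) (R := 1) (z := z₀) (fun z hz => by
      have e1 : DifferentiableAt ℂ P (T z) :=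
        hd.differentiableAt ((isOpen_lt continuous_const Complex.continuous_re).mem_nhds
          (hTre z hz))
      have e2 : DifferentiableAt ℂ T z := by
        refine DifferentiableAt.div (by fun_prop) (by fun_prop) (h1z z hz)
      have e3 : DifferentiableAt ℂ (fun z => P (T z)) z := DifferentiableAt.comp z e1 e2
      exact ((e3.sub_const _).div (e3.add_const _)
        (hne (hP _ (hTre z hz)) (hP _ hs₁))).differentiableWithinAt)
    (fun z hz => mem_closedBall_zero_iff.2 (hlt (hP _ (hTre z hz)) (hP _ hs₁)).le)
    (by simp [hf, hT0]) (mem_ball_zero_iff.1 hz₀')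
  simp only [hf, hTz₀] at hfz
  rw [hz₀, norm_div, norm_div, div_le_div_iff₀ (norm_pos_iff.2 (hne (hP _ hs) (hP _ hs₁)))
    (norm_pos_iff.2 (hne hs hs₁))] at hfz
  have h5 := pow_le_pow_left₀ (by positivity) hfz 2
  rw [mul_pow, mul_pow] at h5
  have h6 := sq_norm_add_conj_sub_sq_norm_sub (P s) (P s₁)
  have h7 := sq_norm_add_conj_sub_sq_norm_sub s s₁
  have h8 : ‖P s - P s₁‖ ^ 2 = ‖P s + conj (P s₁)‖ ^ 2 - 4 * (P s).re * (P s₁).re := by linarith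
  have h9 : ‖s - s₁‖ ^ 2 = ‖s + conj s₁‖ ^ 2 - 4 * s.re * s₁.re := by linarith
  rw [h8, h9] at h5
  nlinarith

/-- Schwarz–Pick with one factor ‖P s + conj (P s₁)‖ ≥ Re P(s) cancelled: the value at a single
point s₁ controls P everywhere. -/
theorem norm_add_conj_le_of_re_pos {P : ℂ → ℂ} (hd : DifferentiableOn ℂ P {s | 0 < s.re})
    (hP : ∀ s : ℂ, 0 < s.re → 0 < (P s).re) {s₁ s : ℂ} (hs₁ : 0 < s₁.re) (hs : 0 < s.re) :
    ‖P s + conj (P s₁)‖ * (s.re * s₁.re) ≤ ‖s + conj s₁‖ ^ 2 * (P s₁).re := by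
  have h := schwarz_pick_halfPlane hd hP hs₁ hs
  have h1 : (P s).re ≤ ‖P s + conj (P s₁)‖ := by
    have := Complex.re_le_norm (P s + conj (P s₁))
    simp at this
    linarith [hP s₁ hs₁]
  have h2 : 0 < ‖P s + conj (P s₁)‖ := (hP s hs).trans_le h1
  refine le_of_mul_le_mul_left ?_ h2
  have h3 := mul_le_mul_of_nonneg_left h1 (show 0 ≤ ‖s + conj s₁‖ ^ 2 * (P s₁).re from
    mul_nonneg (by positivity) (hP s₁ hs₁).le)
  nlinarith

/-- The angular derivative at infinity of a holomorphic self-map of the right half plane. -/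
theorem exists_tendsto_div_of_re_pos {P : ℂ → ℂ} (hd : DifferentiableOn ℂ P {s | 0 < s.re})
    (hP : ∀ s : ℂ, 0 < s.re → 0 < (P s).re) :
    ∃ k : ℝ, 0 ≤ k ∧ (∀ s : ℂ, 0 < s.re → k * s.re ≤ (P s).re) ∧
      Tendsto (fun R : ℝ => P R / R) atTop (𝓝 k) := by
  set S : Set ℝ := (fun s : ℂ => (P s).re / s.re) '' {s | 0 < s.re} with hS
  have hS0 : ∀ x ∈ S, 0 ≤ x := by
    rintro _ ⟨s, hs, rfl⟩
    exact div_nonneg (hP s hs).le (le_of_lt hs)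
  have hSne : S.Nonempty := ⟨_, 1, by simp, rfl⟩
  have hle : ∀ s : ℂ, 0 < s.re → sInf S * s.re ≤ (P s).re := fun s hs => by
    rw [← le_div_iff₀ hs]
    exact csInf_le ⟨0, hS0⟩ ⟨s, hs, rfl⟩
  refine ⟨sInf S, le_csInf hSne hS0, hle, ?_⟩
  set k := sInf S with hk
  rw [Metric.tendsto_atTop]
  intro ε hε
  set δ : ℝ := ε / 6 with hδ
  have hδ0 : 0 < δ := by positivity
  obtain ⟨_, ⟨s₁, hs₁, rfl⟩, hlt⟩ := exists_lt_of_csInf_lt hSne (show sInf S < k + δ by linarith)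
  have hs₁' : 0 < s₁.re := hs₁
  -- Subtracting (k - δ)s, rather than ks, keeps the real part strictly positive. At the nearly
  -- minimizing point s₁ the real part is at most 2δ Re s₁, so the growth bound makes |Q(R)|/R small
  -- for large R.
  set Q : ℂ → ℂ := fun s => P s - ((k - δ : ℝ) : ℂ) * s with hQ
  have hQre : ∀ s : ℂ, (Q s).re = (P s).re - (k - δ) * s.re := fun s => by
    rw [hQ, Complex.sub_re, Complex.re_ofReal_mul]
  have hQpos : ∀ s : ℂ, 0 < s.re → 0 < (Q s).re := fun s hs => by
    rw [hQre]
    nlinarith [hle s hs, mul_pos hδ0 hs]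
  have hQd : DifferentiableOn ℂ Q {s | 0 < s.re} := hd.sub (by fun_prop)
  have hQ1 : (Q s₁).re ≤ 2 * δ * s₁.re := by
    rw [hQre]
    rw [div_lt_iff₀ hs₁'] at hlt
    nlinarith
  have hb : ∀ R : ℝ, 0 < R →
      ‖P R / R - k‖ ≤ δ + ‖Q s₁‖ / R + 2 * δ * (1 + ‖s₁‖ / R) ^ 2 := fun R hR => by
    have h1 := norm_add_conj_le_of_re_pos hQd hQpos hs₁' (show 0 < (R : ℂ).re by simpa)
    rw [Complex.ofReal_re] at h1
    have h2 : ‖(R : ℂ) + conj s₁‖ ≤ R + ‖s₁‖ := (norm_add_le _ _).trans (by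
      rw [Complex.norm_real, Real.norm_eq_abs, abs_of_pos hR, Complex.norm_conj])
    have h3 : ‖Q R + conj (Q s₁)‖ * R ≤ (R + ‖s₁‖) ^ 2 * (2 * δ) := by
      refine le_of_mul_le_mul_right ?_ hs₁'
      calc ‖Q R + conj (Q s₁)‖ * R * s₁.re ≤ ‖(R : ℂ) + conj s₁‖ ^ 2 * (Q s₁).re := by
            rw [mul_assoc]; exact h1
        _ ≤ (R + ‖s₁‖) ^ 2 * (2 * δ * s₁.re) := by
            have := (hQpos s₁ hs₁').le
            gcongr
        _ = _ := by ring
    have h4 : ‖Q R‖ ≤ ‖Q R + conj (Q s₁)‖ + ‖Q s₁‖ := by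
      have := norm_sub_le (Q R + conj (Q s₁)) (conj (Q s₁))
      rwa [add_sub_cancel_right, Complex.norm_conj] at this
    have h5 : P R / R - k = -(δ : ℂ) + Q R / R := by
      have : (R : ℂ) ≠ 0 := by exact_mod_cast hR.ne'
      rw [hQ]
      push_cast
      field_simp
      ring
    rw [h5]
    refine (norm_add_le _ _).trans ?_
    rw [norm_neg, Complex.norm_real, Real.norm_eq_abs, abs_of_pos hδ0, norm_div, Complex.norm_real,
      Real.norm_eq_abs, abs_of_pos hR, add_assoc]
    gcongr
    have h6 : ‖Q s₁‖ / R + 2 * δ * (1 + ‖s₁‖ / R) ^ 2 =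
        (‖Q s₁‖ + (R + ‖s₁‖) ^ 2 * (2 * δ) / R) / R := by field_simp
    rw [h6]
    gcongr
    have h7 : ‖Q R + conj (Q s₁)‖ ≤ (R + ‖s₁‖) ^ 2 * (2 * δ) / R := by rwa [le_div_iff₀ hR]
    linarith
  have hlim : Tendsto (fun R : ℝ => δ + ‖Q s₁‖ / R + 2 * δ * (1 + ‖s₁‖ / R) ^ 2) atTop
      (𝓝 (δ + 0 + 2 * δ * (1 + 0) ^ 2)) := by
    have e : ∀ c : ℝ, Tendsto (fun R : ℝ => c / R) atTop (𝓝 0) := fun c =>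
      tendsto_const_nhds.div_atTop tendsto_id
    exact (tendsto_const_nhds.add (e _)).add
      (tendsto_const_nhds.mul ((tendsto_const_nhds.add (e _)).pow 2))
  obtain ⟨N, hN⟩ := eventually_atTop.1 ((hlim.eventually_lt_const
    (show δ + 0 + 2 * δ * (1 + 0) ^ 2 < ε by rw [hδ]; linarith)).and (eventually_gt_atTop 0))
  refine ⟨N, fun R hR => ?_⟩
  rw [dist_eq_norm]
  exact (hb R (hN R hR).2).trans_lt (hN R hR).1

/-- The polynomial bounds come for free from positivity: Schwarz–Pick with base point 1 bounds p(s)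
= sρ(s) from above and Re p(s) from below. -/
theorem IsWaveSpeed.of_pos {ρ : ℂ → ℂ} {k : ℝ} (hk : 0 ≤ k)
    (hd : DifferentiableOn ℂ ρ {s | 0 < s.re}) (hpos : ∀ s : ℂ, 0 < s.re → 0 < (s * ρ s).re)
    (hle : ∀ s : ℂ, 0 < s.re → k * s.re ≤ (s * ρ s).re) : IsWaveSpeed ρ k := by
  refine ⟨hk, hd, hpos, hle, ?_⟩
  have hpd : DifferentiableOn ℂ (fun s => s * ρ s) {s | 0 < s.re} := differentiableOn_id.mul hd
  set p₁ : ℂ := (1 : ℂ) * ρ 1 with hp₁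
  have hp₁pos : 0 < p₁.re := hpos 1 (by simp)
  refine ⟨1 + 2 * ‖p₁‖ + p₁.re⁻¹, 2, by have := inv_pos.2 hp₁pos; linarith [norm_nonneg p₁],
    fun s hs => ?_⟩
  set q : ℝ := (1 + ‖s‖) * (1 + s.re⁻¹) with hq
  have hsi : 0 < s.re⁻¹ := inv_pos.2 hs
  have hn := norm_nonneg s
  have hq1 : 1 ≤ q := one_le_mul_of_one_le_of_one_le (by linarith) (by linarith)
  have hps := norm_add_conj_le_of_re_pos hpd hpos (s₁ := 1) (s := s) (by simp) hs
  simp only [map_one, Complex.one_re, mul_one] at hps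
  have hs1 : ‖s + 1‖ ≤ 1 + ‖s‖ := (norm_add_le _ _).trans (by rw [norm_one, add_comm])
  have hps' : ‖s * ρ s + conj p₁‖ * s.re ≤ (1 + ‖s‖) ^ 2 * p₁.re :=
    hps.trans (by gcongr)
  constructor
  · have h1 : ‖s * ρ s‖ ≤ ‖s * ρ s + conj p₁‖ + ‖p₁‖ := by
      have := norm_sub_le (s * ρ s + conj p₁) (conj p₁)
      rwa [add_sub_cancel_right, Complex.norm_conj] at this
    have h2 : s.re * ‖ρ s‖ ≤ ‖s * ρ s‖ := by
      rw [norm_mul]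
      gcongr
      exact Complex.re_le_norm s
    have h3 : p₁.re ≤ ‖p₁‖ := Complex.re_le_norm p₁
    have h4 : ‖ρ s‖ ≤ ((1 + ‖s‖) ^ 2 * ‖p₁‖ * s.re⁻¹ + ‖p₁‖) * s.re⁻¹ := by
      rw [← div_eq_mul_inv _ s.re, le_div_iff₀ hs, mul_comm]
      refine h2.trans (h1.trans ?_)
      gcongr
      rw [← div_eq_mul_inv, le_div_iff₀ hs]
      exact hps'.trans (by gcongr)
    have h5 : 1 ≤ (1 + ‖s‖) ^ 2 := one_le_pow₀ (by linarith)
    refine h4.trans ?_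
    have h6 : ((1 + ‖s‖) ^ 2 * ‖p₁‖ * s.re⁻¹ + ‖p₁‖) * s.re⁻¹ ≤ 2 * ‖p₁‖ * q ^ 2 := by
      rw [hq, mul_pow]
      have e1 : s.re⁻¹ * s.re⁻¹ ≤ (1 + s.re⁻¹) ^ 2 := by nlinarith
      have e2 : s.re⁻¹ ≤ (1 + s.re⁻¹) ^ 2 := by nlinarith
      have e3 := mul_le_mul_of_nonneg_left e1
        (show 0 ≤ (1 + ‖s‖) ^ 2 * ‖p₁‖ by positivity)
      have e4 := mul_le_mul_of_nonneg_left e2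
        (show 0 ≤ (1 + ‖s‖) ^ 2 * ‖p₁‖ by positivity)
      have e5 : ‖p₁‖ * s.re⁻¹ ≤ (1 + ‖s‖) ^ 2 * ‖p₁‖ * s.re⁻¹ := by
        gcongr
        exact le_mul_of_one_le_left (norm_nonneg _) h5
      nlinarith
    refine h6.trans ?_
    gcongr
    linarith [inv_pos.2 hp₁pos]
  · have h1 : 0 < (s * ρ s).re := hpos s hs
    have h2 := schwarz_pick_halfPlane hpd hpos (s₁ := 1) (s := s) (by simp) hs
    simp only [map_one, Complex.one_re, mul_one] at h2
    have h3 : p₁.re ≤ ‖s * ρ s + conj p₁‖ := by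
      have := Complex.re_le_norm (s * ρ s + conj p₁)
      rw [Complex.add_re, Complex.conj_re] at this
      linarith
    have h4 : p₁.re ^ 2 * s.re ≤ (1 + ‖s‖) ^ 2 * ((s * ρ s).re * p₁.re) := by
      refine le_trans (by gcongr) (h2.trans ?_)
      gcongr
    have h5 : p₁.re * s.re ≤ (1 + ‖s‖) ^ 2 * (s * ρ s).re := by
      refine le_of_mul_le_mul_left ?_ hp₁pos
      nlinarith
    have h6 : ((s * ρ s).re)⁻¹ ≤ (1 + ‖s‖) ^ 2 * p₁.re⁻¹ * s.re⁻¹ := by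
      rw [inv_le_iff_one_le_mul₀ h1]
      have : (1 + ‖s‖) ^ 2 * p₁.re⁻¹ * s.re⁻¹ * (s * ρ s).re =
        ((1 + ‖s‖) ^ 2 * (s * ρ s).re) / (p₁.re * s.re) := by field_simp
      rw [this, one_le_div (by positivity)]
      exact h5
    refine h6.trans ?_
    have h7 : (1 + ‖s‖) ^ 2 * p₁.re⁻¹ * s.re⁻¹ ≤ p₁.re⁻¹ * q ^ 2 := by
      rw [hq, mul_pow, mul_comm ((1 + ‖s‖) ^ 2), mul_assoc]
      have : s.re⁻¹ ≤ (1 + s.re⁻¹) ^ 2 := by nlinarith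
      have := inv_pos.2 hp₁pos
      gcongr
    refine h7.trans ?_
    gcongr
    linarith [norm_nonneg p₁]

end HalfPlane

/-! ### Uniform asymptotics in the cut plane and identification of k -/

section CutSpeed

/-- `r`, a function of `z = log s`, continues the slowness `ρ` to the closed strip `|Im z| ≤ π`; it
is asymptotically bounded by `k` at `s = ∞` and is `o(1 / |s|)` at `s = 0`, uniformly in `arg s`. -/
structure IsCutSpeed (ρ r : ℂ → ℂ) (k : ℝ) : Prop where
  analytic : AnalyticOnNhd ℂ r {z | |z.im| ≤ Real.pi}
  eq : ∀ z : ℂ, |z.im| < Real.pi / 2 → r z = ρ (Complex.exp z)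
  top : ∀ ε : ℝ, 0 < ε → ∀ᶠ x : ℝ in atTop, ∀ y : ℝ, |y| ≤ Real.pi →
    ‖r (x + y * Complex.I)‖ ≤ k + ε
  bot : ∀ ε : ℝ, 0 < ε → ∀ᶠ x : ℝ in atBot, ∀ y : ℝ, |y| ≤ Real.pi →
    ‖Complex.exp (x + y * Complex.I) * r (x + y * Complex.I)‖ ≤ ε

theorem HasSegments.of_norm_le {f : ℂ → ℂ} {a b X B : ℝ}
    (h : ∀ x : ℝ, X ≤ x → ∀ y : ℝ, a ≤ y → y ≤ b → ‖f (x + y * Complex.I)‖ ≤ B) :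
    HasSegments f a b := by
  refine ⟨|B|, fun Y => ⟨max 1 (max X Y), (le_max_right _ _).trans (le_max_right _ _),
    fun y h1 h2 => (h _ ((le_max_left _ _).trans (le_max_right _ _)) y h1 h2).trans ?_⟩⟩
  set x := max 1 (max X Y)
  have hx : 1 ≤ x := le_max_left _ _
  calc B ≤ |B| * 1 := by simpa using le_abs_self B
    _ ≤ |B| * x ^ 2 := by gcongr; exact one_le_pow₀ hx
    _ ≤ Real.exp (|B| * x ^ 2) := by linarith [Real.add_one_le_exp (|B| * x ^ 2)]

/-- On the segments where |g/h| ≤ E with E = exp(Cx²) ≥ 1, the relation |f|² ≤ E gives |f| ≤ E. -/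
theorem HasSegments.of_sq_mul_eq {g h f : ℂ → ℂ} (hg : HasExpGrowth g) (hh : HasExpGrowth h)
    (hd : Differentiable ℂ h) (h0 : ∃ z, h z ≠ 0)
    (hf : ∀ z : ℂ, |z.im| ≤ Real.pi → f z ^ 2 * h z = g z) :
    HasSegments f (-Real.pi) Real.pi := by
  obtain ⟨C, hC, hseg⟩ := hg.exists_segment hh hd h0
  refine ⟨C, fun X => ?_⟩
  obtain ⟨x, hx, hxy⟩ := hseg X
  refine ⟨x, hx, fun y h1 h2 => ?_⟩
  have hy : |y| ≤ Real.pi := abs_le.2 ⟨h1, h2⟩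
  obtain ⟨hne, hle⟩ := hxy y hy
  set z : ℂ := x + y * Complex.I with hz
  rw [← hf z (by simpa [hz] using hy), norm_mul, norm_pow] at hle
  have h3 := le_of_mul_le_mul_right hle (norm_pos_iff.2 hne)
  have h4 : 1 ≤ Real.exp (C * x ^ 2) := Real.one_le_exp (by positivity)
  by_contra! h5
  nlinarith [norm_nonneg (f z)]

/-- Lindelöf's theorem: the limit along the positive half axis is also the limit along the ray
`arg s = 3π/4`. -/
theorem IsCutSpeed.tendsto_of_tendsto {ρ r : ℂ → ℂ} {k k' : ℝ} (hk : 0 ≤ k)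
    (h : IsCutSpeed ρ r k) (hr : Tendsto (fun x : ℝ => r x) atTop (𝓝 (k' : ℂ))) :
    Tendsto (fun x : ℝ => r (x + (3 * Real.pi / 4 : ℝ) * Complex.I)) atTop (𝓝 (k' : ℂ)) := by
  have hpi := Real.pi_pos
  set B : ℝ := k + 1 + |k'| with hB
  have hB0 : 0 < B := by positivity
  obtain ⟨T, hT⟩ := eventually_atTop.1 (h.top 1 one_pos)
  have hTB : ∀ x : ℝ, T ≤ x → ∀ y : ℝ, 0 ≤ y → y ≤ Real.pi →
      ‖r (x + y * Complex.I) - k'‖ ≤ B := fun x hx y h1 h2 => by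
    refine (norm_sub_le _ _).trans (add_le_add (hT x hx y ?_) ?_)
    · rw [abs_of_nonneg h1]; exact h2
    · rw [Complex.norm_real, Real.norm_eq_abs]
  rw [Metric.tendsto_nhds]
  intro δ hδ
  obtain ⟨a, ha0, ha⟩ : ∃ a : ℝ, 0 < a ∧ 2 * B * Real.exp (-(a * (Real.pi / 4))) < δ := by
    have h1 : Tendsto (fun a : ℝ => 2 * B * Real.exp (-(a * (Real.pi / 4)))) atTop
        (𝓝 (2 * B * 0)) :=
      (Real.tendsto_exp_neg_atTop_nhds_zero.comp
        (tendsto_id.atTop_mul_const (by positivity))).const_mul _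
    rw [mul_zero] at h1
    obtain ⟨a, h2, h3⟩ := ((eventually_gt_atTop 0).and (h1.eventually_lt_const hδ)).exists
    exact ⟨a, h2, h3⟩
  -- The factor has modulus e^{-ay}: f tends to 0 on the edge y = 0 and is at most Be^{-aπ} on y =
  -- π. Undoing the factor at y = 3π/4 leaves 2Be^{-aπ/4}, small for large a.
  set f : ℂ → ℂ := fun z => (r z - k') * Complex.exp (a * Complex.I * z) with hf
  have hfn : ∀ x y : ℝ, ‖f (x + y * Complex.I)‖ =
      ‖r (x + y * Complex.I) - k'‖ * Real.exp (-(a * y)) := fun x y => by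
    rw [hf, norm_mul, Complex.norm_exp]
    simp
  set κ : ℝ := B * Real.exp (-(a * Real.pi)) with hκ
  have hκ0 : 0 < κ := by positivity
  have hev := eventually_norm_le_of_halfStrip (f := f) (X := T) (k := κ) hpi (by linarith) le_rfl
    hκ0.le
    (fun z _ h1 h2 => ((h.analytic z (abs_le.2 ⟨by linarith, h2⟩)).differentiableAt.sub_const
      _).mul (by fun_prop))
    (HasSegments.of_norm_le (X := T) (B := B) fun x hx y h1 h2 => by
      rw [hfn]
      refine (mul_le_of_le_one_right (norm_nonneg _) ?_).trans (hTB x hx y h1 h2)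
      exact Real.exp_le_one_iff.2 (neg_nonpos.2 (by positivity)))
    (fun ε hε => by
      have h1 := (hr.sub_const (k' : ℂ)).norm
      rw [sub_self, norm_zero] at h1
      filter_upwards [h1.eventually_lt_const (show 0 < κ + ε by positivity)] with x hx
      have := hfn x 0
      simp only [Complex.ofReal_zero, zero_mul, add_zero, mul_zero, neg_zero, Real.exp_zero,
        mul_one] at this ⊢
      rw [this]
      exact hx.le)
    (fun ε hε => by
      filter_upwards [eventually_ge_atTop T] with x hx
      rw [hfn]
      have := mul_le_mul_of_nonneg_right (hTB x hx Real.pi hpi.le le_rfl)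
        (Real.exp_pos (-(a * Real.pi))).le
      linarith) hκ0
  filter_upwards [hev] with x hx
  have h1 := hx (3 * Real.pi / 4) (by positivity) (by linarith)
  rw [hfn] at h1
  rw [dist_eq_norm]
  refine lt_of_le_of_lt ?_ ha
  refine le_of_mul_le_mul_right (h1.trans (le_of_eq ?_))
    (Real.exp_pos (-(a * (3 * Real.pi / 4))))
  rw [mul_assoc, ← Real.exp_add, hκ]
  have : -(a * (Real.pi / 4)) + -(a * (3 * Real.pi / 4)) = -(a * Real.pi) := by ring
  rw [this]
  ring

variable {φσ φε : 𝓢'(ℝ, ℂ)}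

theorem hasExpGrowth_symbolLog (φ : 𝓢'(ℝ, ℂ)) : HasExpGrowth (symbolLog φ) :=
  exists_norm_symbolLog_le φ

theorem re_cpow_half_pos {w : ℂ} (hw : w ∈ Complex.slitPlane) : 0 < (w ^ (1 / 2 : ℂ)).re := by
  rw [one_div, Complex.cpow_inv_two_re]
  refine Real.sqrt_pos.2 (half_pos ?_)
  have h1 := (abs_le.1 (Complex.abs_re_le_norm w)).1
  rcases Complex.mem_slitPlane_iff.1 hw with h | h
  · linarith [norm_nonneg w]
  · refine lt_of_le_of_ne (by linarith) fun e => h ?_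
    have h2 : ‖w‖ ^ 2 = w.re ^ 2 := by rw [show ‖w‖ = -w.re by linarith]; ring
    rw [← Complex.normSq_eq_norm_sq, Complex.normSq_apply] at h2
    nlinarith [mul_self_eq_zero.1 (show w.im * w.im = 0 by linarith)]

theorem mul_sqrtRatio {s : ℂ} (hs : s ≠ 0) :
    s * sqrtRatio φσ φε s = (s ^ 2 * (symbol φσ s / symbol φε s)) ^ (1 / 2 : ℂ) := by
  rw [sqrtRatio, mul_div_cancel₀ _ hs]

theorem sq_mul_sqrtRatio {s : ℂ} (hs : s ≠ 0) :
    (s * sqrtRatio φσ φε s) ^ 2 = s ^ 2 * (symbol φσ s / symbol φε s) := by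
  rw [mul_sqrtRatio hs, one_div]
  exact Complex.cpow_ofNat_inv_pow _ 2

theorem ne_zero_of_re_pos {s : ℂ} (hs : 0 < s.re) : s ≠ 0 := fun e => by simp [e] at hs

variable (hA2 : ∀ s : ℂ, 0 < s.re → s ^ 2 * (symbol φσ s / symbol φε s) ∈ Complex.slitPlane)

include hA2

theorem symbol_ne_zero {s : ℂ} (hs : 0 < s.re) : symbol φσ s ≠ 0 ∧ symbol φε s ≠ 0 := by
  have := Complex.slitPlane_ne_zero (hA2 s hs)
  constructor <;> intro e <;> simp [e] at this

theorem re_mul_sqrtRatio_pos {s : ℂ} (hs : 0 < s.re) : 0 < (s * sqrtRatio φσ φε s).re := by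
  rw [mul_sqrtRatio (ne_zero_of_re_pos hs)]
  exact re_cpow_half_pos (hA2 s hs)

theorem differentiableOn_sqrtRatio : DifferentiableOn ℂ (sqrtRatio φσ φε) {s | 0 < s.re} := by
  intro s hs
  have hs0 := ne_zero_of_re_pos hs
  have hlog : DifferentiableAt ℂ Complex.log s :=
    (Complex.hasDerivAt_log (Complex.mem_slitPlane_iff.2 (Or.inl hs))).differentiableAt
  have h1 : ∀ φ : 𝓢'(ℝ, ℂ), DifferentiableAt ℂ (symbol φ) s := fun φ =>
    (differentiable_symbolLog φ _).comp s hlog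
  have h2 : DifferentiableAt ℂ (fun s => s ^ 2 * (symbol φσ s / symbol φε s)) s :=
    (by fun_prop : DifferentiableAt ℂ (fun s : ℂ => s ^ 2) s).mul
      ((h1 φσ).div (h1 φε) (symbol_ne_zero hA2 hs).2)
  exact ((h2.cpow_const (hA2 s hs)).div differentiableAt_id hs0).differentiableWithinAt

/-- The angular derivative k' of sρ(s) at infinity is the limit of ρ along the positive axis, hence
by Lindelöf also along arg s = 3π/4, where its modulus is k. So k' = k, and k Re s ≤ Re (sρ(s))
follows. -/
theorem IsCutSpeed.isWaveSpeed {r : ℂ → ℂ} {k : ℝ} (hk : 0 ≤ k)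
    (hA5 : ∀ θ : ℝ, Real.pi / 2 < |θ| → |θ| ≤ Real.pi →
      Tendsto (fun R : ℝ => ‖r (polarLog R θ)‖) atTop (𝓝 k))
    (h : IsCutSpeed (sqrtRatio φσ φε) r k) : IsWaveSpeed (sqrtRatio φσ φε) k := by
  have hpi := Real.pi_pos
  have hd := differentiableOn_sqrtRatio hA2
  have hpos : ∀ s : ℂ, 0 < s.re → 0 < (s * sqrtRatio φσ φε s).re := fun s =>
    re_mul_sqrtRatio_pos hA2
  obtain ⟨k', hk', hle, hlim⟩ := exists_tendsto_div_of_re_pos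
    (P := fun s => s * sqrtRatio φσ φε s) (differentiableOn_id.mul hd) hpos
  have hr : Tendsto (fun x : ℝ => r x) atTop (𝓝 (k' : ℂ)) := by
    refine (hlim.comp Real.tendsto_exp_atTop).congr fun x => ?_
    rw [h.eq x (by simpa using hpi)]
    simp only [Function.comp]
    rw [mul_div_cancel_left₀ _ (by exact_mod_cast (Real.exp_pos x).ne'), Complex.ofReal_exp]
  have h1 := (h.tendsto_of_tendsto hk hr).norm
  have h2 := (hA5 (3 * Real.pi / 4) (by rw [abs_of_pos (by positivity)]; linarith)
    (by rw [abs_of_pos (by positivity)]; linarith)).comp Real.tendsto_exp_atTop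
  have h3 : ‖(k' : ℂ)‖ = k := tendsto_nhds_unique h1 (h2.congr fun x => by
    simp [Function.comp, polarLog, Real.log_exp])
  rw [Complex.norm_real, Real.norm_eq_abs, abs_of_nonneg hk'] at h3
  subst h3
  exact IsWaveSpeed.of_pos hk hd hpos hle

variable {r : ℂ → ℂ} (hA4 : IsCutPlaneContinuation (sqrtRatio φσ φε) r)

include hA4

/-- Identity theorem on the closed strip. The relation is kept free of division because Φε is known
to be nonzero only in the right half plane. -/
theorem IsCutPlaneContinuation.sq_mul_symbolLog {z : ℂ} (hz : |z.im| ≤ Real.pi) :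
    r z ^ 2 * symbolLog φε z = symbolLog φσ z := by
  have ha : ∀ φ : 𝓢'(ℝ, ℂ), AnalyticOnNhd ℂ (symbolLog φ) {z | |z.im| ≤ Real.pi} :=
    fun φ z _ => (differentiable_symbolLog φ).analyticAt z
  have hconv : Convex ℝ {z : ℂ | |z.im| ≤ Real.pi} := by
    have : {z : ℂ | |z.im| ≤ Real.pi} = Complex.imLm ⁻¹' Icc (-Real.pi) Real.pi := by
      ext z; simp [abs_le]
    rw [this]
    exact (convex_Icc _ _).linear_preimage _
  refine AnalyticOnNhd.eqOn_of_preconnected_of_eventuallyEq ((hA4.1.pow 2).mul (ha φε)) (ha φσ)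
    hconv.isPreconnected (z₀ := 0) (by simpa using Real.pi_pos.le) ?_ hz
  have hnhds : {z : ℂ | |z.im| < Real.pi / 2} ∈ 𝓝 (0 : ℂ) :=
    (isOpen_lt (continuous_abs.comp Complex.continuous_im) continuous_const).mem_nhds
      (by simpa using Real.pi_pos)
  filter_upwards [hnhds] with w hw
  have hw' : |w.im| < Real.pi / 2 := hw
  have hexp : 0 < (Complex.exp w).re := by
    rw [Complex.exp_re]
    exact mul_pos (Real.exp_pos _) (Real.cos_pos_of_mem_Ioo (abs_lt.1 hw'))
  have hsym : ∀ φ : 𝓢'(ℝ, ℂ), symbol φ (Complex.exp w) = symbolLog φ w := fun φ => by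
    rw [symbol, Complex.log_exp] <;> linarith [abs_lt.1 hw', Real.pi_pos]
  have h1 := sq_mul_sqrtRatio (φσ := φσ) (φε := φε) (Complex.exp_ne_zero w)
  rw [mul_pow, hsym, hsym] at h1
  have h2 := mul_left_cancel₀ (pow_ne_zero 2 (Complex.exp_ne_zero w)) h1
  change r w ^ 2 * symbolLog φε w = _
  rw [hA4.2 w hw', h2, div_mul_cancel₀]
  rw [← hsym]
  exact (symbol_ne_zero hA2 hexp).2

/-- The limits on the two edges arg s = ±π become uniform in arg s by Phragmén–Lindelöf; the
segments needed for it come from r² = Φσ/Φε as a quotient of entire functions of log s. The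
behaviour at s = 0 is treated by the substitution z ↦ -z. -/
theorem IsCutPlaneContinuation.isCutSpeed {k : ℝ} (hk : 0 ≤ k)
    (hA5 : ∀ θ : ℝ, Real.pi / 2 < |θ| → |θ| ≤ Real.pi →
      Tendsto (fun R : ℝ => ‖r (polarLog R θ)‖) atTop (𝓝 k))
    (hA6 : ∀ θ : ℝ, |θ| ≤ Real.pi →
      Tendsto (fun η : ℝ => ‖(η : ℂ) * r (polarLog η θ)‖) (𝓝[>] 0) (𝓝 0)) :
    IsCutSpeed (sqrtRatio φσ φε) r k := by
  have hpi := Real.pi_pos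
  have hne : ∃ z, symbolLog φε z ≠ 0 := ⟨_, (symbol_ne_zero hA2 (s := 1) (by simp)).2⟩
  have hsq : ∀ z : ℂ, |z.im| ≤ Real.pi → r z ^ 2 * symbolLog φε z = symbolLog φσ z :=
    fun z hz => hA4.sq_mul_symbolLog hA2 hz
  have habs : ∀ y : ℝ, -Real.pi ≤ y → y ≤ Real.pi → |y| ≤ Real.pi := fun y h1 h2 =>
    abs_le.2 ⟨h1, h2⟩
  have hpol : ∀ x θ : ℝ, polarLog (Real.exp x) θ = x + θ * Complex.I := fun x θ => by
    rw [polarLog, Real.log_exp]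
  refine ⟨hA4.1, hA4.2, fun ε hε => ?_, fun ε hε => ?_⟩
  · have hlim : ∀ θ : ℝ, |θ| = Real.pi → ∀ ε : ℝ, 0 < ε →
        ∀ᶠ x : ℝ in atTop, ‖r (x + θ * Complex.I)‖ ≤ k + ε := fun θ hθ ε hε => by
      have h1 := (hA5 θ (by rw [hθ]; linarith) hθ.le).comp Real.tendsto_exp_atTop
      filter_upwards [h1.eventually_lt_const (show k < k + ε by linarith)] with x hx
      simpa [hpol] using hx.le
    have h := eventually_norm_le_of_halfStrip (f := r) (X := 0) (by linarith : -Real.pi < Real.pi)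
      le_rfl le_rfl hk (fun z _ h1 h2 => (hA4.1 z (habs _ h1 h2)).differentiableAt)
      (HasSegments.of_sq_mul_eq (hasExpGrowth_symbolLog φσ) (hasExpGrowth_symbolLog φε)
        (differentiable_symbolLog φε) hne hsq)
      (hlim _ (by rw [abs_neg, abs_of_pos hpi])) (hlim _ (abs_of_pos hpi)) hε
    exact h.mono fun x hx y hy => hx y (abs_le.1 hy).1 (abs_le.1 hy).2
  · have hlim : ∀ θ : ℝ, |θ| = Real.pi → ∀ ε : ℝ, 0 < ε →
        ∀ᶠ x : ℝ in atTop, ‖r (-(x + θ * Complex.I)) * Complex.exp (-(x + θ * Complex.I))‖ ≤ 0 + ε :=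
      fun θ hθ ε hε => by
      have h0 : Tendsto (fun x : ℝ => Real.exp (-x)) atTop (𝓝[>] 0) :=
        tendsto_nhdsWithin_iff.2 ⟨Real.tendsto_exp_neg_atTop_nhds_zero,
          Eventually.of_forall fun x => Real.exp_pos _⟩
      have h1 := (hA6 (-θ) (by rw [abs_neg, hθ])).comp h0
      filter_upwards [h1.eventually_lt_const hε] with x hx
      have e1 : -((x : ℂ) + θ * Complex.I) = ((-x : ℝ) : ℂ) + ((-θ : ℝ) : ℂ) * Complex.I := by
        push_cast; ring
      simp only [Function.comp, hpol] at hx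
      rw [e1, zero_add, mul_comm, norm_mul, Complex.norm_exp]
      rw [norm_mul, Complex.norm_real, Real.norm_eq_abs, abs_of_pos (Real.exp_pos _)] at hx
      simpa using hx.le
    have hseg : HasSegments (fun z => r (-z)) (-Real.pi) Real.pi :=
      HasSegments.of_sq_mul_eq (hasExpGrowth_symbolLog φσ).comp_neg
        (hasExpGrowth_symbolLog φε).comp_neg
        ((differentiable_symbolLog φε).comp differentiable_neg)
        (by obtain ⟨z, hz⟩ := hne; exact ⟨-z, by simpa using hz⟩)
        (fun z hz => hsq (-z) (by simpa using hz))
    have h := eventually_norm_le_of_halfStrip (f := fun z => r (-z) * Complex.exp (-z)) (X := 0)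
      (by linarith : -Real.pi < Real.pi) le_rfl le_rfl le_rfl
      (fun z _ h1 h2 => by
        have e1 : DifferentiableAt ℂ r (-z) :=
          (hA4.1 (-z) (by simpa using habs _ h1 h2)).differentiableAt
        have e2 : DifferentiableAt ℂ (fun z => r (-z)) z :=
          DifferentiableAt.comp (f := fun z : ℂ => -z) z e1 differentiableAt_id.neg
        exact e2.mul (by fun_prop))
      (hseg.mul (A := 0) (B := 0) fun z h1 _ _ => by
        rw [Complex.norm_exp, zero_mul]
        exact Real.exp_le_exp.2 (by simpa using h1))
      (hlim _ (by rw [abs_neg, abs_of_pos hpi])) (hlim _ (abs_of_pos hpi)) hε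
    refine (tendsto_neg_atBot_atTop.eventually h).mono fun x hx y hy => ?_
    have h1 := hx (-y) (by linarith [(abs_le.1 hy).2]) (by linarith [(abs_le.1 hy).1])
    have e1 : -(((-x : ℝ) : ℂ) + ((-y : ℝ) : ℂ) * Complex.I) = (x : ℂ) + y * Complex.I := by
      push_cast; ring
    rw [e1, zero_add] at h1
    rwa [mul_comm]

end CutSpeed

/-! ### Contour integrals in the cut plane -/

section CutContour

/-- The integrand `½ c e^{-|x| s c} e^{st}` of the inversion integral, where `c` stands for
`√(Φσ/Φε)` at `s`. -/
def waveIntegrand (c s : ℂ) (x t : ℝ) : ℂ :=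
  1 / 2 * c * Complex.exp (-((|x| : ℝ) : ℂ) * s * c) * Complex.exp (s * t)

theorem norm_waveIntegrand (c s : ℂ) (x t : ℝ) :
    ‖waveIntegrand c s x t‖ = 1 / 2 * ‖c‖ * Real.exp (-|x| * (s * c).re + s.re * t) := by
  rw [waveIntegrand, norm_mul, norm_mul, norm_mul, Complex.norm_exp, Complex.norm_exp, mul_assoc _ s,
    ← Complex.ofReal_neg, Complex.re_ofReal_mul, Complex.re_mul_ofReal, Real.exp_add]
  norm_num
  ring

theorem continuous_waveIntegrand :
    Continuous fun p : (ℂ × ℂ) × ℝ × ℝ => waveIntegrand p.1.1 p.1.2 p.2.1 p.2.2 := by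
  unfold waveIntegrand
  fun_prop

/-- The contribution of the circle `|s| = e^u`, from `arg s = -π` to `arg s = π`, to the inversion
integral. -/
def circleIntegralMean (r : ℂ → ℂ) (x t u : ℝ) : ℂ :=
  (2 * Real.pi : ℂ)⁻¹ * ∫ θ in (-Real.pi)..Real.pi,
    waveIntegrand (r (u + θ * Complex.I)) (Complex.exp (u + θ * Complex.I)) x t *
      Complex.exp (u + θ * Complex.I)

variable {ρ r : ℂ → ℂ} {k : ℝ}

theorem IsCutSpeed.continuousAt (h : IsCutSpeed ρ r k) {z : ℂ} (hz : |z.im| ≤ Real.pi) :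
    ContinuousAt r z := (h.analytic z hz).continuousAt

theorem IsCutSpeed.exists_norm_le (h : IsCutSpeed ρ r k) (hk : 0 ≤ k) {ε : ℝ} (hε : 0 < ε) :
    ∃ A : ℝ, 0 ≤ A ∧ ∀ z : ℂ, |z.im| ≤ Real.pi →
      ‖Complex.exp z * r z‖ ≤ A + (k + ε) * Real.exp z.re := by
  obtain ⟨T, hT⟩ := eventually_atTop.1 (h.top ε hε)
  obtain ⟨T', hT'⟩ := eventually_atBot.1 (h.bot 1 one_pos)
  have hcont : ContinuousOn (fun z => Complex.exp z * r z)
      (Icc T' T ×ℂ Icc (-Real.pi) Real.pi) := fun z hz =>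
    (Complex.continuous_exp.continuousAt.mul
      (h.continuousAt (abs_le.2 hz.2))).continuousWithinAt
  obtain ⟨M, hM⟩ := (isCompact_Icc.reProdIm isCompact_Icc).exists_bound_of_continuousOn hcont
  refine ⟨1 + |M|, by positivity, fun z hz => ?_⟩
  have e0 : 0 ≤ (k + ε) * Real.exp z.re := by positivity
  have e1 := Complex.re_add_im z
  rcases le_total T z.re with h1 | h1
  · have := hT z.re h1 z.im hz
    rw [e1] at this
    rw [norm_mul, Complex.norm_exp, mul_comm]
    have := mul_le_mul_of_nonneg_right this (Real.exp_pos z.re).le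
    linarith [abs_nonneg M]
  rcases le_total z.re T' with h2 | h2
  · have := hT' z.re h2 z.im hz
    rw [e1] at this
    linarith [abs_nonneg M]
  · have := hM z ⟨⟨h2, h1⟩, abs_le.1 hz⟩
    linarith [le_abs_self M]

/-- The imaginary axis arg s = ±π/2 is included by continuity from the open half plane. -/
theorem IsCutSpeed.re_nonneg (h : IsCutSpeed ρ r k)
    (hpos : ∀ s : ℂ, 0 < s.re → 0 < (s * ρ s).re) {z : ℂ} (hz : |z.im| ≤ Real.pi / 2) :
    0 ≤ (Complex.exp z * r z).re := by
  have hpi := Real.pi_pos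
  set γ : ℝ → ℂ := fun τ => z.re + ((τ * z.im : ℝ) : ℂ) * Complex.I with hγ
  have hγ1 : γ 1 = z := by simp [hγ]
  have hγc : Continuous γ := by fun_prop
  have hc : ContinuousAt (fun τ => (Complex.exp (γ τ) * r (γ τ)).re) 1 := by
    have h1 : ContinuousAt r (γ 1) := by
      rw [hγ1]; exact h.continuousAt (hz.trans (by linarith))
    have h2 : ContinuousAt (fun τ => r (γ τ)) 1 :=
      ContinuousAt.comp (f := γ) h1 hγc.continuousAt
    exact Complex.continuous_re.continuousAt.comp
      ((Complex.continuous_exp.comp hγc).continuousAt.mul h2)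
  have hlim := (hc.tendsto.mono_left (nhdsWithin_le_nhds (s := Iio 1)))
  rw [hγ1] at hlim
  refine ge_of_tendsto hlim ?_
  filter_upwards [self_mem_nhdsWithin, mem_nhdsWithin_of_mem_nhds (Ioi_mem_nhds one_pos)] with τ h1 h2
  have h1' : τ < 1 := h1
  have h2' : 0 < τ := h2
  have him : |(γ τ).im| < Real.pi / 2 := by
    have : (γ τ).im = τ * z.im := by simp [hγ]
    rw [this, abs_mul, abs_of_pos h2']
    rcases eq_or_ne |z.im| 0 with h3 | h3
    · rw [h3, mul_zero]; positivity
    · have : 0 < |z.im| := lt_of_le_of_ne (abs_nonneg _) (Ne.symm h3)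
      nlinarith
  rw [h.eq _ him]
  refine (hpos _ ?_).le
  rw [Complex.exp_re]
  exact mul_pos (Real.exp_pos _) (Real.cos_pos_of_mem_Ioo (abs_lt.1 him))

/-- In the left half plane the real part of `s √(Φσ/Φε)` is at least `(k + ε) Re s` up to a
constant. -/
theorem IsCutSpeed.exists_neg_re_le (h : IsCutSpeed ρ r k) (hk : 0 ≤ k)
    (hpos : ∀ s : ℂ, 0 < s.re → 0 < (s * ρ s).re) {ε : ℝ} (hε : 0 < ε) :
    ∃ A : ℝ, 0 ≤ A ∧ ∀ z : ℂ, Real.pi / 2 ≤ |z.im| → |z.im| ≤ Real.pi →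
      -(Complex.exp z * r z).re ≤ A - (k + ε) * (Complex.exp z).re := by
  have hpi := Real.pi_pos
  obtain ⟨A, hA, hb⟩ := h.exists_norm_le hk hε
  refine ⟨A, hA, ?_⟩
  -- F is bounded on the sides of each left quadrant: for arg s = ±π/2 because Re s = 0 and Re (sr)
  -- ≥ 0, for arg s = ±π because |sr| ≤ A + (k + ε)|s| and Re s = -|s|. Its exponent is O(|s|),
  -- below the order 2 allowed by Phragmén–Lindelöf in a quadrant.
  set F : ℂ → ℂ := fun z => Complex.exp (-(Complex.exp z * r z) + ((k + ε : ℝ) : ℂ) * Complex.exp z)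
    with hF
  have hFn : ∀ z, ‖F z‖ = Real.exp (-(Complex.exp z * r z).re + (k + ε) * (Complex.exp z).re) :=
    fun z => by rw [hF, Complex.norm_exp, Complex.add_re, Complex.neg_re, Complex.re_ofReal_mul]
  have hneg : ∀ z, -(Complex.exp z * r z).re ≤ ‖Complex.exp z * r z‖ := fun z => by
    linarith [(abs_le.1 (Complex.abs_re_le_norm (Complex.exp z * r z))).1]
  have key : ∀ a b : ℝ, b - a = Real.pi / 2 → -Real.pi ≤ a → b ≤ Real.pi →
      (|a| = Real.pi / 2 ∨ |a| = Real.pi) → (|b| = Real.pi / 2 ∨ |b| = Real.pi) →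
      ∀ z : ℂ, a ≤ z.im → z.im ≤ b → ‖F z‖ ≤ Real.exp A := by
    intro a b hab ha hb' haπ hbπ z hza hzb
    have hedge : ∀ w : ℂ, (|w.im| = Real.pi / 2 ∨ |w.im| = Real.pi) → ‖F w‖ ≤ Real.exp A := by
      intro w hw
      rw [hFn]
      refine Real.exp_le_exp.2 ?_
      rcases hw with hw | hw
      · have h1 := h.re_nonneg hpos hw.le
        have h2 : (Complex.exp w).re = 0 := by
          rw [Complex.exp_re, ← Real.cos_abs, hw, Real.cos_pi_div_two, mul_zero]
        rw [h2]
        linarith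
      · have h1 := hb w hw.le
        have h2 : (Complex.exp w).re = -Real.exp w.re := by
          rw [Complex.exp_re, ← Real.cos_abs, hw, Real.cos_pi]; ring
        rw [h2]
        linarith [hneg w]
    have hcl : ∀ w ∈ closure (Complex.im ⁻¹' Ioo a b), |w.im| ≤ Real.pi := fun w hw => by
      have : w ∈ Complex.im ⁻¹' Icc a b :=
        closure_minimal (preimage_mono Ioo_subset_Icc_self)
          (isClosed_Icc.preimage Complex.continuous_im) hw
      exact abs_le.2 ⟨ha.trans this.1, this.2.trans hb'⟩
    refine PhragmenLindelof.horizontal_strip (a := a) (b := b) (f := F)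
      (DifferentiableOn.diffContOnCl fun w hw => ?_) ⟨1, ?_, A + 2 * (k + ε), ?_⟩
      (fun w hw => hedge w (by rw [hw]; exact haπ)) (fun w hw => hedge w (by rw [hw]; exact hbπ))
      hza hzb
    · have e := (h.analytic w (hcl w hw)).differentiableAt
      have e1 : DifferentiableAt ℂ Complex.exp w := Complex.differentiable_exp w
      exact ((e1.mul e).neg.add (e1.const_mul _)).cexp.differentiableWithinAt
    · rw [hab]
      have : Real.pi / (Real.pi / 2) = 2 := by field_simp
      rw [this]
      norm_num
    · refine Asymptotics.IsBigO.of_bound 1 ?_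
      have hmem : ∀ᶠ w : ℂ in comap (_root_.abs ∘ Complex.re) atTop ⊓ 𝓟 (Complex.im ⁻¹' Ioo a b),
          w ∈ Complex.im ⁻¹' Ioo a b := mem_inf_of_right (mem_principal_self _)
      filter_upwards [hmem] with w hw
      rw [one_mul, Real.norm_eq_abs, abs_of_pos (Real.exp_pos _), hFn]
      refine Real.exp_le_exp.2 ?_
      have h1 := hb w (hcl w (subset_closure hw))
      have h2 : (Complex.exp w).re ≤ Real.exp w.re := by
        simpa [Complex.norm_exp] using Complex.re_le_norm (Complex.exp w)
      have h3 : Real.exp w.re ≤ Real.exp (1 * |w.re|) := by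
        rw [one_mul]; exact Real.exp_le_exp.2 (le_abs_self _)
      have h4 : 1 ≤ Real.exp (1 * |w.re|) := Real.one_le_exp (by positivity)
      have h5 : (k + ε) * (Complex.exp w).re ≤ (k + ε) * Real.exp (1 * |w.re|) := by
        gcongr; exact h2.trans h3
      have h6 : (k + ε) * Real.exp w.re ≤ (k + ε) * Real.exp (1 * |w.re|) := by gcongr
      nlinarith [hneg w]
  intro z hz1 hz2
  have hFz : ‖F z‖ ≤ Real.exp A := by
    rcases le_total 0 z.im with h0 | h0
    · rw [abs_of_nonneg h0] at hz1 hz2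
      exact key (Real.pi / 2) Real.pi (by ring) (by linarith) le_rfl
        (Or.inl (abs_of_pos (by positivity))) (Or.inr (abs_of_pos hpi)) z hz1 hz2
    · rw [abs_of_nonpos h0] at hz1 hz2
      exact key (-Real.pi) (-(Real.pi / 2)) (by ring) le_rfl (by linarith)
        (Or.inr (by rw [abs_neg, abs_of_pos hpi]))
        (Or.inl (by rw [abs_neg, abs_of_pos (by positivity)])) z (by linarith) (by linarith)
  rw [hFn] at hFz
  have := Real.exp_le_exp.1 hFz
  linarith

/-- Cauchy's theorem in z = log s on the rectangle [log η, log R] × [-π, π]: the horizontal sides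
are the two edges of the cut, the vertical sides are the full circles. -/
theorem cutIntegral_eq (h : IsCutSpeed ρ r k) (x t : ℝ) {η R : ℝ} (hη : 0 < η) (hηR : η ≤ R) :
    cutIntegral r x t η R =
      circleIntegralMean r x t (Real.log R) - circleIntegralMean r x t (Real.log η) := by
  have hpi := Real.pi_pos
  have hR : 0 < R := hη.trans_le hηR
  set E : ℂ → ℂ := fun z => waveIntegrand (r z) (Complex.exp z) x t * Complex.exp z with hE
  have hEd : ∀ z : ℂ, |z.im| ≤ Real.pi → DifferentiableAt ℂ E z := fun z hz => by
    have e := (h.analytic z hz).differentiableAt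
    have e1 : DifferentiableAt ℂ Complex.exp z := Complex.differentiable_exp z
    exact (((e.const_mul _).mul ((e1.const_mul _).mul e).cexp).mul (e1.mul_const _).cexp).mul e1
  have hrect := Complex.integral_boundary_rect_eq_zero_of_differentiableOn E
    ((Real.log η : ℂ) + ((-Real.pi : ℝ) : ℂ) * Complex.I)
    ((Real.log R : ℂ) + (Real.pi : ℂ) * Complex.I) (fun z hz => by
      have h2 := hz.2
      simp only [Complex.add_im, Complex.ofReal_im, Complex.mul_im, Complex.ofReal_re,
        Complex.I_im, mul_one, Complex.I_re, mul_zero, add_zero, zero_add] at h2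
      have h3 : z.im ∈ uIcc (-Real.pi) Real.pi := h2
      rw [uIcc_of_le (by linarith)] at h3
      exact (hEd z (abs_le.2 h3)).differentiableWithinAt)
  simp only [Complex.add_re, Complex.ofReal_re, Complex.mul_re, Complex.ofReal_im, Complex.I_re,
    Complex.I_im, mul_zero, sub_zero, add_zero, Complex.add_im, Complex.mul_im, mul_one,
    zero_add, smul_eq_mul] at hrect
  have hline : ∀ θ : ℝ, |θ| ≤ Real.pi →
      IntervalIntegrable (fun u : ℝ => E (u + θ * Complex.I)) volume (Real.log η) (Real.log R) :=
    fun θ hθ => by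
    refine ContinuousOn.intervalIntegrable fun u _ => ?_
    have e : ContinuousAt E (u + θ * Complex.I) := (hEd _ (by simpa using hθ)).continuousAt
    have e' : ContinuousAt (fun u : ℝ => (u : ℂ) + θ * Complex.I) u := by fun_prop
    exact (ContinuousAt.comp (f := fun u : ℝ => (u : ℂ) + θ * Complex.I) e e').continuousWithinAt
  set g : ℝ → ℂ := fun q =>
    (r (polarLog q (-Real.pi)) * Complex.exp (((|x| : ℝ) : ℂ) * q * r (polarLog q (-Real.pi))) -
      r (polarLog q Real.pi) * Complex.exp (((|x| : ℝ) : ℂ) * q * r (polarLog q Real.pi))) *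
    Complex.exp (-q * t) with hg
  have hgc : ContinuousOn g (Ioi 0) := fun q hq => by
    have hq' : 0 < q := hq
    have e : ∀ θ : ℝ, |θ| ≤ Real.pi → ContinuousAt (fun q : ℝ => r (polarLog q θ)) q :=
      fun θ hθ => by
      have e1 : ContinuousAt r (polarLog q θ) := h.continuousAt (by simpa [polarLog] using hθ)
      have e2 : ContinuousAt (fun q : ℝ => polarLog q θ) q :=
        (Complex.continuous_ofReal.continuousAt.comp
          (Real.continuousAt_log hq'.ne')).add continuousAt_const
      exact ContinuousAt.comp (f := fun q : ℝ => polarLog q θ) e1 e2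
    have e1 := e (-Real.pi) (by rw [abs_neg, abs_of_pos hpi])
    have e2 := e Real.pi (abs_of_pos hpi).le
    have e3 : ContinuousAt (fun q : ℝ => ((|x| : ℝ) : ℂ) * q) q := by fun_prop
    have e4 : ContinuousAt (fun q : ℝ => Complex.exp (-q * t)) q := by fun_prop
    exact (((e1.mul (e3.mul e1).cexp).sub (e2.mul (e3.mul e2).cexp)).mul e4).continuousWithinAt
  have hsub := intervalIntegral.integral_deriv_smul_comp'' (a := Real.log η) (b := Real.log R)
    (f := Real.exp) (f' := Real.exp) (g := g) Real.continuous_exp.continuousOn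
    (fun u _ => (Real.hasDerivAt_exp u).hasDerivWithinAt) Real.continuous_exp.continuousOn
    (hgc.mono (by rintro _ ⟨u, -, rfl⟩; exact Real.exp_pos u))
  rw [Real.exp_log hη, Real.exp_log hR] at hsub
  -- On both edges s = -e^u; the factor -2 collects this sign and the ½ in the integrand.
  have hgE : ∀ u : ℝ, Real.exp u • (g ∘ Real.exp) u =
      -2 * (E (u + ((-Real.pi : ℝ) : ℂ) * Complex.I) - E (u + (Real.pi : ℂ) * Complex.I)) :=
    fun u => by
    have e1 : Complex.exp (u + ((-Real.pi : ℝ) : ℂ) * Complex.I) = -(Real.exp u : ℂ) := by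
      rw [Complex.exp_add, Complex.ofReal_neg, neg_mul, Complex.exp_neg, Complex.exp_pi_mul_I,
        Complex.ofReal_exp]
      norm_num
    have e2 : Complex.exp (u + (Real.pi : ℂ) * Complex.I) = -(Real.exp u : ℂ) := by
      rw [Complex.exp_add, Complex.exp_pi_mul_I, Complex.ofReal_exp]
      norm_num
    simp only [hE, hg, Function.comp, waveIntegrand, e1, e2, polarLog, Real.log_exp,
      Complex.real_smul, neg_mul]
    ring_nf
  rw [intervalIntegral.integral_congr fun u _ => hgE u, intervalIntegral.integral_const_mul,
    intervalIntegral.integral_sub (hline _ (by rw [abs_neg, abs_of_pos hpi]))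
      (hline _ (abs_of_pos hpi).le)] at hsub
  have hcut : cutIntegral r x t η R = 1 / (4 * Real.pi * Complex.I) * ∫ q in η..R, g q := rfl
  rw [hcut, ← hsub, circleIntegralMean, circleIntegralMean]
  have hpi' : (Real.pi : ℂ) ≠ 0 := by exact_mod_cast hpi.ne'
  have e3 : ∀ A B C D : ℂ, A - B + Complex.I * C - Complex.I * D = 0 →
      1 / (4 * Real.pi * Complex.I) * (-2 * (A - B)) =
        (2 * Real.pi : ℂ)⁻¹ * C - (2 * Real.pi : ℂ)⁻¹ * D := fun A B C D e => by
    have e4 : A - B = -(Complex.I * (C - D)) := by linear_combination e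
    rw [e4]
    field_simp
    ring
  exact e3 _ _ _ _ hrect

end CutContour

/-! ### Convergence of the circle and cut integrals in the cone -/

section ConeKernel

variable {ρ r : ℂ → ℂ} {k : ℝ}

/-- Clamping θ to [-π, π] yields a function continuous on the whole line, as the statements on
parametric integrals require. -/
theorem IsCutSpeed.exists_continuous_eq (h : IsCutSpeed ρ r k) (u : ℝ) :
    ∃ c : ℝ → ℂ, Continuous c ∧ ∀ θ : ℝ, |θ| ≤ Real.pi → c θ = r (u + θ * Complex.I) := by
  have hpi := Real.pi_pos
  refine ⟨fun θ => r (u + ((max (-Real.pi) (min θ Real.pi) : ℝ) : ℂ) * Complex.I), ?_,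
    fun θ hθ => ?_⟩
  · refine continuous_iff_continuousAt.2 fun θ => ?_
    have e1 : Continuous fun θ : ℝ =>
        (u : ℂ) + ((max (-Real.pi) (min θ Real.pi) : ℝ) : ℂ) * Complex.I := by fun_prop
    refine ContinuousAt.comp (f := fun θ : ℝ =>
        (u : ℂ) + ((max (-Real.pi) (min θ Real.pi) : ℝ) : ℂ) * Complex.I) (h.continuousAt ?_)
      e1.continuousAt
    have : ((u : ℂ) + ((max (-Real.pi) (min θ Real.pi) : ℝ) : ℂ) * Complex.I).im =
      max (-Real.pi) (min θ Real.pi) := by simp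
    rw [this, abs_le]
    exact ⟨le_max_left _ _, max_le (by linarith) (min_le_right _ _)⟩
  · simp only
    rw [min_eq_left (abs_le.1 hθ).2, max_eq_right (abs_le.1 hθ).1]

theorem norm_circleIntegralMean_le {x t u C : ℝ}
    (hC : ∀ θ : ℝ, |θ| ≤ Real.pi → ‖waveIntegrand (r (u + θ * Complex.I))
      (Complex.exp (u + θ * Complex.I)) x t * Complex.exp (u + θ * Complex.I)‖ ≤ C) :
    ‖circleIntegralMean r x t u‖ ≤ C := by
  have hpi := Real.pi_pos
  have h1 := intervalIntegral.norm_integral_le_of_norm_le_const (a := -Real.pi) (b := Real.pi)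
    (f := fun θ : ℝ => waveIntegrand (r (u + θ * Complex.I)) (Complex.exp (u + θ * Complex.I)) x t *
      Complex.exp (u + θ * Complex.I)) (C := C) fun θ hθ => hC θ (by
        rw [uIoc_of_le (by linarith)] at hθ
        exact abs_le.2 ⟨hθ.1.le, hθ.2⟩)
  have h2 : ‖(2 * Real.pi : ℂ)⁻¹‖ = (2 * Real.pi)⁻¹ := by
    rw [norm_inv, norm_mul, Complex.norm_real, Real.norm_eq_abs, abs_of_pos hpi]
    norm_num
  rw [circleIntegralMean, norm_mul, h2]
  rw [show Real.pi - -Real.pi = 2 * Real.pi by ring, abs_of_pos (by positivity)] at h1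
  rw [inv_mul_le_iff₀ (by positivity)]
  linarith

/-- The integrand on the circle is ½sr times an exponential, and sr → 0 uniformly in arg s while the
exponent stays bounded. -/
theorem IsCutSpeed.tendsto_circleIntegralMean_zero (h : IsCutSpeed ρ r k) (x t : ℝ) :
    Tendsto (fun η : ℝ => circleIntegralMean r x t (Real.log η)) (𝓝[>] 0) (𝓝 0) := by
  refine Tendsto.comp (g := fun u => circleIntegralMean r x t u) ?_ Real.tendsto_log_nhdsGT_zero
  rw [Metric.tendsto_nhds]
  intro ε hε
  set δ : ℝ := min 1 (ε * Real.exp (-(|x| + |t|))) with hδ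
  have hδ0 : 0 < δ := by positivity
  filter_upwards [h.bot δ hδ0, eventually_le_atBot 0] with u hu hu0
  rw [dist_zero_right]
  refine lt_of_le_of_lt (norm_circleIntegralMean_le (C := ε / 2) fun θ hθ => ?_) (by linarith)
  have h1 := hu θ hθ
  set z : ℂ := u + θ * Complex.I with hz
  have hzre : z.re = u := by simp [hz]
  have hs1 : ‖Complex.exp z‖ ≤ 1 := by
    rw [Complex.norm_exp, hzre]; exact Real.exp_le_one_iff.2 hu0
  have h2 : -|x| * (Complex.exp z * r z).re + (Complex.exp z).re * t ≤ |x| + |t| := by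
    have e1 := (abs_le.1 (Complex.abs_re_le_norm (Complex.exp z * r z))).1
    have e2 : ‖Complex.exp z * r z‖ ≤ 1 := h1.trans (min_le_left _ _)
    have e3 : (Complex.exp z).re * t ≤ 1 * |t| := by
      refine (le_abs_self _).trans ?_
      rw [abs_mul]
      gcongr
      exact (Complex.abs_re_le_norm _).trans hs1
    nlinarith [abs_nonneg x]
  rw [norm_mul, norm_waveIntegrand]
  calc 1 / 2 * ‖r z‖ * Real.exp (-|x| * (Complex.exp z * r z).re + (Complex.exp z).re * t) *
        ‖Complex.exp z‖
      = 1 / 2 * ‖Complex.exp z * r z‖ *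
        Real.exp (-|x| * (Complex.exp z * r z).re + (Complex.exp z).re * t) := by
        rw [norm_mul]; ring
    _ ≤ 1 / 2 * (ε * Real.exp (-(|x| + |t|))) * Real.exp (|x| + |t|) := by
        gcongr
        exact h1.trans (min_le_right _ _)
    _ = ε / 2 := by
        rw [mul_assoc, mul_assoc, ← Real.exp_add, neg_add_cancel, Real.exp_zero]; ring

/-- For large q the slowness is at most k + ε on both edges, so the integrand is at most 2(k +
ε)e^{((k+ε)|x| - t)q}, hence O(e^{-δq}). -/
theorem IsCutSpeed.exists_norm_cutIntegral_le (h : IsCutSpeed ρ r k) (hk : 0 ≤ k) {ε δ : ℝ}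
    (hε : 0 < ε) (hδ : 0 < δ) :
    ∃ C Q : ℝ, 0 < Q ∧ ∀ R R' : ℝ, Q ≤ R → R ≤ R' → ∀ x t : ℝ, (k + ε) * |x| + δ ≤ t →
      ‖cutIntegral r x t R R'‖ ≤ C * Real.exp (-(δ * R)) := by
  have hpi := Real.pi_pos
  obtain ⟨T, hT⟩ := eventually_atTop.1 (h.top ε hε)
  refine ⟨2 * (k + ε) / δ, Real.exp T, Real.exp_pos T, fun R R' hR hRR' x t hxt => ?_⟩
  have hR0 : 0 < R := (Real.exp_pos T).trans_le hR
  have hterm : ∀ q : ℝ, R ≤ q → ∀ θ : ℝ, |θ| ≤ Real.pi →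
      ‖r (polarLog q θ) * Complex.exp (((|x| : ℝ) : ℂ) * q * r (polarLog q θ))‖ ≤
        (k + ε) * Real.exp ((k + ε) * |x| * q) := fun q hq θ hθ => by
    have hq0 : 0 < q := hR0.trans_le hq
    have h1 : ‖r (polarLog q θ)‖ ≤ k + ε :=
      hT (Real.log q) ((Real.le_log_iff_exp_le hq0).2 (hR.trans hq)) θ hθ
    rw [norm_mul, Complex.norm_exp]
    have h2 : (((|x| : ℝ) : ℂ) * q * r (polarLog q θ)).re ≤ (k + ε) * |x| * q := by
      rw [← Complex.ofReal_mul, Complex.re_ofReal_mul]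
      have := mul_le_mul_of_nonneg_left ((Complex.re_le_norm _).trans h1)
        (show 0 ≤ |x| * q by positivity)
      linarith
    gcongr
  have hint : ‖∫ q in R..R',
      (r (polarLog q (-Real.pi)) * Complex.exp (((|x| : ℝ) : ℂ) * q * r (polarLog q (-Real.pi))) -
        r (polarLog q Real.pi) * Complex.exp (((|x| : ℝ) : ℂ) * q * r (polarLog q Real.pi))) *
      Complex.exp (-q * t)‖ ≤ ∫ q in R..R', 2 * (k + ε) * Real.exp (-δ * q) := by
    refine intervalIntegral.norm_integral_le_of_norm_le hRR' (Eventually.of_forall fun q hq => ?_)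
      (Continuous.intervalIntegrable (by fun_prop) _ _)
    have hq0 : 0 < q := hR0.trans hq.1
    have h1 := hterm q hq.1.le (-Real.pi) (by rw [abs_neg, abs_of_pos hpi])
    have h2 := hterm q hq.1.le Real.pi (abs_of_pos hpi).le
    rw [norm_mul, Complex.norm_exp]
    have h3 : (-(q : ℂ) * t).re = -(q * t) := by
      rw [← Complex.ofReal_neg, ← Complex.ofReal_mul, Complex.ofReal_re]; ring
    rw [h3]
    refine (mul_le_mul_of_nonneg_right ((norm_sub_le _ _).trans (add_le_add h1 h2))
      (Real.exp_pos _).le).trans ?_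
    rw [← two_mul, ← mul_assoc, mul_assoc (2 * (k + ε)), ← Real.exp_add]
    gcongr
    nlinarith
  have hval : ∫ q in R..R', 2 * (k + ε) * Real.exp (-δ * q) ≤
      2 * (k + ε) / δ * Real.exp (-(δ * R)) := by
    rw [intervalIntegral.integral_const_mul,
      intervalIntegral.integral_comp_mul_left (f := Real.exp) (neg_ne_zero.2 hδ.ne'), integral_exp,
      smul_eq_mul, inv_mul_eq_div]
    have : (Real.exp (-δ * R') - Real.exp (-δ * R)) / -δ ≤ Real.exp (-(δ * R)) / δ := by
      rw [div_neg, ← neg_div, neg_sub, neg_mul]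
      gcongr
      linarith [Real.exp_pos (-δ * R')]
    calc _ ≤ 2 * (k + ε) * (Real.exp (-(δ * R)) / δ) := by gcongr
      _ = _ := by ring
  rw [cutIntegral, norm_mul]
  refine (mul_le_of_le_one_left (norm_nonneg _) ?_).trans (hint.trans hval)
  rw [norm_div, norm_mul, norm_mul, Complex.norm_real, Real.norm_eq_abs, abs_of_pos hpi,
    Complex.norm_I, mul_one, norm_one, Complex.norm_ofNat, div_le_one (by positivity)]
  linarith [Real.pi_gt_three]

/-- The limit of the inversion integrals over large circles. -/
def coneKernel (r : ℂ → ℂ) (p : ℝ × ℝ) : ℂ :=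
  limUnder atTop fun R : ℝ => circleIntegralMean r p.1 p.2 (Real.log R)

/-- Differences of circle integrals are cut integrals, so the circle integrals are Cauchy, with a
rate that is uniform on the shrunken cone. -/
theorem IsCutSpeed.exists_norm_circleIntegralMean_sub_le (h : IsCutSpeed ρ r k) (hk : 0 ≤ k)
    {ε δ : ℝ} (hε : 0 < ε) (hδ : 0 < δ) :
    ∃ C Q : ℝ, ∀ R : ℝ, Q ≤ R → ∀ p : ℝ × ℝ, (k + ε) * |p.1| + δ ≤ p.2 →
      ‖circleIntegralMean r p.1 p.2 (Real.log R) - coneKernel r p‖ ≤ C * Real.exp (-(δ * R)) := by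
  obtain ⟨C, Q, hQ, hb⟩ := h.exists_norm_cutIntegral_le hk hε hδ
  refine ⟨C, Q, fun R hR p hp => ?_⟩
  have hdiff : ∀ R R' : ℝ, Q ≤ R → R ≤ R' →
      ‖circleIntegralMean r p.1 p.2 (Real.log R) - circleIntegralMean r p.1 p.2 (Real.log R')‖ ≤
        C * Real.exp (-(δ * R)) := fun R R' h1 h2 => by
    rw [norm_sub_rev, ← cutIntegral_eq h _ _ (hQ.trans_le h1) h2]
    exact hb R R' h1 h2 _ _ hp
  have hlim : Tendsto (fun R : ℝ => C * Real.exp (-(δ * R))) atTop (𝓝 (C * 0)) :=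
    (Real.tendsto_exp_neg_atTop_nhds_zero.comp (tendsto_id.const_mul_atTop hδ)).const_mul C
  rw [mul_zero] at hlim
  have hcau : CauchySeq fun R : ℝ => circleIntegralMean r p.1 p.2 (Real.log R) := by
    rw [Metric.cauchySeq_iff']
    intro ε' hε'
    obtain ⟨N, h1, h2⟩ := ((hlim.eventually_lt_const hε').and (eventually_ge_atTop Q)).exists
    refine ⟨N, fun R hR => ?_⟩
    rw [dist_comm, dist_eq_norm]
    exact (hdiff N R h2 hR).trans_lt h1
  have ht : Tendsto (fun R' : ℝ => ‖circleIntegralMean r p.1 p.2 (Real.log R) -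
      circleIntegralMean r p.1 p.2 (Real.log R')‖) atTop
      (𝓝 ‖circleIntegralMean r p.1 p.2 (Real.log R) - coneKernel r p‖) :=
    (tendsto_const_nhds.sub hcau.tendsto_limUnder).norm
  exact le_of_tendsto ht ((eventually_ge_atTop R).mono fun R' hR' => hdiff R R' hR hR')

theorem IsCutSpeed.tendstoUniformlyOn_circleIntegralMean (h : IsCutSpeed ρ r k) (hk : 0 ≤ k)
    {ε δ : ℝ} (hε : 0 < ε) (hδ : 0 < δ) :
    TendstoUniformlyOn (fun (R : ℝ) (p : ℝ × ℝ) => circleIntegralMean r p.1 p.2 (Real.log R))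
      (coneKernel r) atTop {p : ℝ × ℝ | (k + ε) * |p.1| + δ ≤ p.2} := by
  obtain ⟨C, Q, hb⟩ := h.exists_norm_circleIntegralMean_sub_le hk hε hδ
  rw [Metric.tendstoUniformlyOn_iff]
  intro ε' hε'
  have hlim : Tendsto (fun R : ℝ => C * Real.exp (-(δ * R))) atTop (𝓝 (C * 0)) :=
    (Real.tendsto_exp_neg_atTop_nhds_zero.comp (tendsto_id.const_mul_atTop hδ)).const_mul C
  rw [mul_zero] at hlim
  filter_upwards [hlim.eventually_lt_const hε', eventually_ge_atTop Q] with R h1 h2 p hp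
  rw [dist_comm, dist_eq_norm]
  exact (hb R h2 p hp).trans_lt h1

theorem IsCutSpeed.continuous_circleIntegralMean (h : IsCutSpeed ρ r k) (u : ℝ) :
    Continuous fun p : ℝ × ℝ => circleIntegralMean r p.1 p.2 u := by
  have hpi := Real.pi_pos
  obtain ⟨c, hc, hcr⟩ := h.exists_continuous_eq u
  have heq : (fun p : ℝ × ℝ => circleIntegralMean r p.1 p.2 u) = fun p : ℝ × ℝ =>
      (2 * Real.pi : ℂ)⁻¹ * ∫ θ in (-Real.pi)..Real.pi,
        waveIntegrand (c θ) (Complex.exp (u + θ * Complex.I)) p.1 p.2 *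
          Complex.exp (u + θ * Complex.I) := by
    funext p
    rw [circleIntegralMean]
    congr 1
    refine intervalIntegral.integral_congr fun θ hθ => ?_
    rw [uIcc_of_le (by linarith)] at hθ
    simp only [hcr θ (abs_le.2 hθ)]
  rw [heq]
  refine continuous_const.mul
    (intervalIntegral.continuous_parametric_intervalIntegral_of_continuous' ?_ _ _)
  have e1 : Continuous fun q : (ℝ × ℝ) × ℝ =>
      ((c q.2, Complex.exp (u + q.2 * Complex.I)), q.1.1, q.1.2) := by fun_prop
  have e2 : Continuous fun q : (ℝ × ℝ) × ℝ => Complex.exp (u + q.2 * Complex.I) := by fun_prop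
  exact (continuous_waveIntegrand.comp e1).mul e2

/-- On L the gap t - k|x| is at least some d > 0; one third of d pays for ε|x|, one third for δ. -/
theorem exists_forall_mem_le_of_isCompact {L : Set (ℝ × ℝ)} (hL : IsCompact L)
    (hLc : L ⊆ {p : ℝ × ℝ | k * |p.1| < p.2}) :
    ∃ ε δ : ℝ, 0 < ε ∧ 0 < δ ∧ ∀ p ∈ L, (k + ε) * |p.1| + δ < p.2 := by
  obtain ⟨d, hd, hLd⟩ := hL.exists_forall_le' (f := fun p : ℝ × ℝ => p.2 - k * |p.1|)
    (by fun_prop) (a := 0) fun p hp => sub_pos.2 (hLc hp)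
  obtain ⟨X, hX⟩ := hL.exists_bound_of_continuousOn (f := fun p : ℝ × ℝ => p.1)
    continuous_fst.continuousOn
  have hX0 : 0 < |X| + 1 := by positivity
  refine ⟨d / (3 * (|X| + 1)), d / 3, by positivity, by positivity, fun p hp => ?_⟩
  have h1 := hLd p hp
  have h2 : |p.1| ≤ |X| + 1 := by
    have := hX p hp
    rw [Real.norm_eq_abs] at this
    linarith [le_abs_self X]
  have h3 : d / (3 * (|X| + 1)) * |p.1| ≤ d / 3 := by
    calc d / (3 * (|X| + 1)) * |p.1| ≤ d / (3 * (|X| + 1)) * (|X| + 1) := by gcongr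
      _ = d / 3 := by field_simp
  linarith

theorem IsCutSpeed.continuousOn_coneKernel (h : IsCutSpeed ρ r k) (hk : 0 ≤ k) :
    ContinuousOn (coneKernel r) {p : ℝ × ℝ | k * |p.1| < p.2} := fun p hp => by
  obtain ⟨ε, δ, hε, hδ, hp'⟩ := exists_forall_mem_le_of_isCompact (k := k) isCompact_singleton
    (singleton_subset_iff.2 hp)
  have hc : ContinuousOn (coneKernel r) {p : ℝ × ℝ | (k + ε) * |p.1| + δ ≤ p.2} :=
    (h.tendstoUniformlyOn_circleIntegralMean hk hε hδ).continuousOn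
      (Frequently.of_forall fun R => (h.continuous_circleIntegralMean _).continuousOn)
  have hmem : {p : ℝ × ℝ | (k + ε) * |p.1| + δ ≤ p.2} ∈ 𝓝 p := by
    have ho : IsOpen {p : ℝ × ℝ | (k + ε) * |p.1| + δ < p.2} :=
      isOpen_lt (by fun_prop) (by fun_prop)
    filter_upwards [ho.mem_nhds (hp' p rfl)] with q hq using le_of_lt hq
  exact (hc.continuousAt hmem).continuousWithinAt

theorem IsCutSpeed.tendsto_cutIntegral (h : IsCutSpeed ρ r k) (hk : 0 ≤ k) {x t : ℝ}
    (hxt : k * |x| < t) :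
    Tendsto (fun p : ℝ × ℝ => cutIntegral r x t p.1 p.2) (𝓝[>] 0 ×ˢ atTop)
      (𝓝 (coneKernel r (x, t))) := by
  obtain ⟨ε, δ, hε, hδ, hp'⟩ := exists_forall_mem_le_of_isCompact (k := k) (L := {(x, t)})
    isCompact_singleton (singleton_subset_iff.2 (show (x, t) ∈ {p : ℝ × ℝ | k * |p.1| < p.2} from hxt))
  have h1 : Tendsto (fun R : ℝ => circleIntegralMean r x t (Real.log R)) atTop
      (𝓝 (coneKernel r (x, t))) :=
    (h.tendstoUniformlyOn_circleIntegralMean hk hε hδ).tendsto_at (x := (x, t)) (hp' (x, t) rfl).le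
  have h2 : Tendsto (fun p : ℝ × ℝ => circleIntegralMean r x t (Real.log p.2) -
      circleIntegralMean r x t (Real.log p.1)) (𝓝[>] 0 ×ˢ atTop)
      (𝓝 (coneKernel r (x, t) - 0)) :=
    (h1.comp tendsto_snd).sub ((h.tendsto_circleIntegralMean_zero x t).comp tendsto_fst)
  rw [sub_zero] at h2
  refine h2.congr' ?_
  have h3 : ∀ᶠ η : ℝ in 𝓝[>] 0, η ∈ Ioo (0 : ℝ) 1 := Ioo_mem_nhdsGT one_pos
  have h4 : ∀ᶠ p : ℝ × ℝ in 𝓝[>] 0 ×ˢ atTop, p.1 ∈ Ioo (0 : ℝ) 1 ∧ 1 ≤ p.2 :=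
    h3.prod_mk (eventually_ge_atTop 1)
  filter_upwards [h4] with p hp
  exact (cutIntegral_eq h x t hp.1.1 (hp.1.2.le.trans hp.2)).symm

end ConeKernel

/-! ### Pairing the inversion integrand with test functions -/

section WavePairing

/-- The pairing of the integrand of the inversion integral with a test function. -/
def wavePairing (c s : ℂ) (ψ : 𝓢(ℝ × ℝ, ℂ)) : ℂ :=
  ∫ ζ : ℝ × ℝ, waveIntegrand c s ζ.1 ζ.2 * ψ ζ

variable {ψ : 𝓢(ℝ × ℝ, ℂ)} {ρ r : ℂ → ℂ} {k : ℝ}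

theorem integrable_mul_of_hasCompactSupport {f : ℝ × ℝ → ℂ} (hf : Continuous f)
    (hψ : HasCompactSupport ψ) : Integrable fun ζ => f ζ * ψ ζ :=
  (hf.mul ψ.continuous).integrable_of_hasCompactSupport hψ.mul_left

theorem continuous_waveIntegrand_right (c s : ℂ) :
    Continuous fun ζ : ℝ × ℝ => waveIntegrand c s ζ.1 ζ.2 :=
  continuous_waveIntegrand.comp (by fun_prop : Continuous fun ζ : ℝ × ℝ => ((c, s), ζ.1, ζ.2))

theorem hasCompactSupport_lineDerivOp (v : ℝ × ℝ) (hψ : HasCompactSupport ψ) :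
    HasCompactSupport (∂_{v} ψ : 𝓢(ℝ × ℝ, ℂ)) :=
  hψ.mono' (subset_closure.trans (tsupport_lineDerivOp_subset v ψ))

theorem wavePairing_lineDerivOp (c s : ℂ) (hψ : HasCompactSupport ψ) :
    wavePairing c s (∂_{((0, 1) : ℝ × ℝ)} ψ) = -s * wavePairing c s ψ := by
  have hc := continuous_waveIntegrand_right c s
  have h := integral_bilinear_hasLineDerivAt_right_eq_neg_left_of_integrable (μ := volume)
    (f := fun ζ : ℝ × ℝ => waveIntegrand c s ζ.1 ζ.2)
    (f' := fun ζ : ℝ × ℝ => s * waveIntegrand c s ζ.1 ζ.2) (g := ψ)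
    (g' := (∂_{((0, 1) : ℝ × ℝ)} ψ : 𝓢(ℝ × ℝ, ℂ))) (v := ((0, 1) : ℝ × ℝ))
    (B := ContinuousLinearMap.mul ℝ ℂ)
    (integrable_mul_of_hasCompactSupport (continuous_const.mul hc) hψ)
    (integrable_mul_of_hasCompactSupport hc (hasCompactSupport_lineDerivOp _ hψ))
    (integrable_mul_of_hasCompactSupport hc hψ)
    (fun ζ _ => by
      have e1 : HasDerivAt (fun τ : ℝ => s * ((ζ.2 + τ * 1 : ℝ) : ℂ)) (s * 1) 0 := by
        have : HasDerivAt (fun τ : ℝ => ((ζ.2 + τ * 1 : ℝ) : ℂ)) ((1 * 1 : ℝ) : ℂ) 0 :=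
          (((hasDerivAt_id (0 : ℝ)).mul_const 1).const_add ζ.2).ofReal_comp
        simpa using this.const_mul s
      have e2 := e1.cexp.const_mul
        (1 / 2 * c * Complex.exp (-((|ζ.1 + 0 * 1| : ℝ) : ℂ) * s * c))
      rw [HasLineDerivAt]
      have e3 : (fun τ : ℝ => waveIntegrand c s (ζ + τ • ((0, 1) : ℝ × ℝ)).1
          (ζ + τ • ((0, 1) : ℝ × ℝ)).2) = fun τ : ℝ =>
          (1 / 2 * c * Complex.exp (-((|ζ.1 + 0 * 1| : ℝ) : ℂ) * s * c)) *
            Complex.exp (s * ((ζ.2 + τ * 1 : ℝ) : ℂ)) := by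
        funext τ
        simp [waveIntegrand]
      rw [e3]
      refine e2.congr_deriv ?_
      simp [waveIntegrand]
      ring)
    (fun ζ _ => by
      rw [SchwartzMap.lineDerivOp_apply]
      exact (ψ.differentiableAt).lineDifferentiableAt.hasLineDerivAt)
  simp only [ContinuousLinearMap.mul_apply'] at h
  rw [wavePairing, wavePairing, h, ← integral_neg, ← integral_const_mul]
  refine integral_congr_ae (Eventually.of_forall fun ζ => ?_)
  simp only
  ring

theorem wavePairing_add_smul (c s σ : ℂ) {ψ' : 𝓢(ℝ × ℝ, ℂ)} (hψ : HasCompactSupport ψ)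
    (hψ' : HasCompactSupport ψ') :
    wavePairing c s (ψ + σ • ψ') = wavePairing c s ψ + σ * wavePairing c s ψ' := by
  have hc := continuous_waveIntegrand_right c s
  rw [wavePairing, wavePairing, wavePairing, ← integral_const_mul,
    ← integral_add (integrable_mul_of_hasCompactSupport hc hψ)
      ((integrable_mul_of_hasCompactSupport hc hψ').const_mul σ)]
  refine integral_congr_ae (Eventually.of_forall fun ζ => ?_)
  simp only [add_apply, smul_apply, smul_eq_mul]
  ring

theorem wavePairing_diffOp (c s : ℂ) (m : ℕ) :
    ∀ {ψ : 𝓢(ℝ × ℝ, ℂ)}, HasCompactSupport ψ →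
      wavePairing c s (diffOp ((0, 1) : ℝ × ℝ) (-1) m ψ) = (1 + s) ^ m * wavePairing c s ψ := by
  induction m with
  | zero => intro ψ _; rw [diffOp_zero, pow_zero, one_mul]
  | succ m ih =>
    intro ψ hψ
    have h1 := hasCompactSupport_lineDerivOp ((0, 1) : ℝ × ℝ) hψ
    have h2 : HasCompactSupport (ψ + (-1 : ℂ) • (∂_{((0, 1) : ℝ × ℝ)} ψ : 𝓢(ℝ × ℝ, ℂ))) := by
      have := hasCompactSupport_diffOp ((0, 1) : ℝ × ℝ) (-1) 1 hψ
      rwa [diffOp_succ, diffOp_zero] at this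
    rw [diffOp_succ, ih h2, wavePairing_add_smul c s (-1) hψ h1, wavePairing_lineDerivOp c s hψ]
    ring

theorem intervalIntegral_integral_mul_swap {f : ℝ → ℝ × ℝ → ℂ} (hf : Continuous (Function.uncurry f))
    (hψ : HasCompactSupport ψ) (a b : ℝ) :
    ∫ w in a..b, ∫ ζ : ℝ × ℝ, f w ζ * ψ ζ = ∫ ζ : ℝ × ℝ, (∫ w in a..b, f w ζ) * ψ ζ := by
  have hcont : Continuous (Function.uncurry fun w ζ => f w ζ * ψ ζ) :=
    hf.mul (ψ.continuous.comp continuous_snd)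
  have hint : Integrable (Function.uncurry fun w ζ => f w ζ * ψ ζ)
      ((volume.restrict (uIoc a b)).prod volume) := by
    have h1 : IntegrableOn (Function.uncurry fun w ζ => f w ζ * ψ ζ) (uIcc a b ×ˢ tsupport ψ)
        (volume.prod volume) :=
      hcont.continuousOn.integrableOn_compact (isCompact_uIcc.prod hψ.isCompact)
    have h2 : IntegrableOn (Function.uncurry fun w ζ => f w ζ * ψ ζ) (uIcc a b ×ˢ univ)
        (volume.prod volume) := by
      refine h1.of_forall_sdiff_eq_zero (measurableSet_uIcc.prod MeasurableSet.univ) fun q hq => ?_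
      have : q.2 ∉ tsupport ψ := fun h => hq.2 ⟨hq.1.1, h⟩
      simp [Function.uncurry, image_eq_zero_of_notMem_tsupport this]
    have h3 := h2.mono_set (prod_mono uIoc_subset_uIcc (subset_univ univ))
    rw [IntegrableOn, ← Measure.prod_restrict, Measure.restrict_univ] at h3
    exact h3
  rw [intervalIntegral_integral_swap hint]
  refine integral_congr_ae (Eventually.of_forall fun ζ => ?_)
  simp only
  rw [intervalIntegral.integral_mul_const]

theorem continuous_wavePairing (hψ : HasCompactSupport ψ) {c s : ℝ → ℂ} (hc : Continuous c)
    (hs : Continuous s) : Continuous fun w => wavePairing (c w) (s w) ψ := by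
  have h1 : Continuous (Function.uncurry fun (w : ℝ) (ζ : ℝ × ℝ) =>
      waveIntegrand (c w) (s w) ζ.1 ζ.2 * ψ ζ) :=
    (continuous_waveIntegrand.comp (by fun_prop : Continuous fun q : ℝ × ℝ × ℝ =>
      ((c q.1, s q.1), q.2.1, q.2.2))).mul (ψ.continuous.comp continuous_snd)
  refine (continuous_parametric_integral_of_continuous (μ := volume) h1 hψ.isCompact).congr
    fun w => ?_
  rw [wavePairing]
  refine setIntegral_eq_integral_of_forall_compl_eq_zero fun ζ hζ => ?_
  simp [image_eq_zero_of_notMem_tsupport hζ]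

/-- The integral over a vertical chord of a circle about the origin equals the integral over the
arc. -/
theorem integral_chord_eq_integral_arc {f : ℂ → ℂ} (hf : DifferentiableOn ℂ f {s | 0 < s.re})
    {Ω : ℝ} (hΩ : 0 < Ω) :
    ∫ w in (-Ω)..Ω, f (((1 : ℝ) : ℂ) + w * Complex.I) =
      ∫ θ in (-Real.arctan Ω)..(Real.arctan Ω),
        f (Complex.exp (Real.log √(1 + Ω ^ 2) + θ * Complex.I)) *
          Complex.exp (Real.log √(1 + Ω ^ 2) + θ * Complex.I) := by
  set R : ℝ := √(1 + Ω ^ 2) with hR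
  have hR0 : 0 < R := Real.sqrt_pos.2 (by positivity)
  have hR2 : R ^ 2 = 1 + Ω ^ 2 := Real.sq_sqrt (by positivity)
  -- The disc with centre and radius R² lies in the right half plane and contains both the chord and
  -- the arc. A primitive on this disc makes the two integrals equal.
  have hball : ∀ s : ℂ, 1 ≤ s.re → ‖s‖ ≤ R → s ∈ Metric.ball ((R ^ 2 : ℝ) : ℂ) (R ^ 2) :=
    fun s h1 h2 => by
    rw [Metric.mem_ball, dist_eq_norm]
    refine lt_of_pow_lt_pow_left₀ 2 (by positivity) ?_
    have h3 := pow_le_pow_left₀ (norm_nonneg s) h2 2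
    rw [← Complex.normSq_eq_norm_sq, Complex.normSq_apply] at h3 ⊢
    simp only [Complex.sub_re, Complex.ofReal_re, Complex.sub_im, Complex.ofReal_im, sub_zero]
    nlinarith [sq_nonneg Ω]
  have hre : ∀ s ∈ Metric.ball ((R ^ 2 : ℝ) : ℂ) (R ^ 2), 0 < s.re := fun s hs => by
    rw [Metric.mem_ball, dist_eq_norm] at hs
    have := (abs_lt.1 ((Complex.abs_re_le_norm _).trans_lt hs)).1
    simp only [Complex.sub_re, Complex.ofReal_re] at this
    linarith
  obtain ⟨F, hF⟩ := (hf.mono (s := Metric.ball ((R ^ 2 : ℝ) : ℂ) (R ^ 2)) hre).isExactOn_ball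
  have hexp : ∀ θ : ℝ, Complex.exp (Real.log R + θ * Complex.I) =
      ((R * Real.cos θ : ℝ) : ℂ) + ((R * Real.sin θ : ℝ) : ℂ) * Complex.I := fun θ => by
    rw [Complex.exp_add, ← Complex.ofReal_exp, Real.exp_log hR0, Complex.exp_mul_I]
    push_cast
    ring
  have hcos : R * Real.cos (Real.arctan Ω) = 1 := by
    rw [Real.cos_arctan, ← hR]
    field_simp
  have hsin : R * Real.sin (Real.arctan Ω) = Ω := by
    rw [Real.sin_arctan, ← hR]
    field_simp
  have hatan : 0 < Real.arctan Ω := Real.arctan_pos.2 hΩ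
  have harc : ∀ θ ∈ uIcc (-Real.arctan Ω) (Real.arctan Ω),
      Complex.exp (Real.log R + θ * Complex.I) ∈ Metric.ball ((R ^ 2 : ℝ) : ℂ) (R ^ 2) :=
    fun θ hθ => by
    rw [uIcc_of_le (by linarith)] at hθ
    refine hball _ ?_ ?_
    · have h1 : (Complex.exp (Real.log R + θ * Complex.I)).re = R * Real.cos θ := by
        rw [hexp, Complex.add_re, Complex.ofReal_re, Complex.re_ofReal_mul, Complex.I_re, mul_zero,
          add_zero]
      rw [h1, ← hcos]
      refine mul_le_mul_of_nonneg_left ?_ hR0.le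
      rw [← Real.cos_abs θ]
      exact Real.cos_le_cos_of_nonneg_of_le_pi (abs_nonneg _)
        (by linarith [Real.arctan_lt_pi_div_two Ω, Real.pi_pos]) (abs_le.2 hθ)
    · rw [Complex.norm_exp]
      simp [Real.exp_log hR0]
  have hchord : ∀ w ∈ uIcc (-Ω) Ω,
      ((1 : ℝ) : ℂ) + w * Complex.I ∈ Metric.ball ((R ^ 2 : ℝ) : ℂ) (R ^ 2) := fun w hw => by
    rw [uIcc_of_le (by linarith)] at hw
    refine hball _ (by simp) (Real.le_sqrt_of_sq_le ?_)
    rw [← Complex.normSq_eq_norm_sq, Complex.normSq_apply]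
    simp
    nlinarith [hw.1, hw.2]
  have h1 := intervalIntegral.integral_eq_sub_of_hasDerivAt (a := -Ω) (b := Ω)
    (f := fun w : ℝ => F (((1 : ℝ) : ℂ) + w * Complex.I))
    (f' := fun w : ℝ => f (((1 : ℝ) : ℂ) + w * Complex.I) * Complex.I) (fun w hw => by
      have e1 : HasDerivAt (fun w : ℝ => ((1 : ℝ) : ℂ) + w * Complex.I) (1 * Complex.I) w :=
        ((Complex.ofRealCLM.hasDerivAt (x := w)).mul_const Complex.I).const_add _
      exact ((hF _ (hchord w hw)).comp w e1).congr_deriv (by ring))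
    (((continuous_vertical hf one_pos).mul_const _).intervalIntegrable _ _)
  have hfarc : ContinuousOn (fun θ : ℝ => f (Complex.exp (Real.log R + θ * Complex.I)))
      (uIcc (-Real.arctan Ω) (Real.arctan Ω)) :=
    hf.continuousOn.comp (by fun_prop) fun θ hθ => hre _ (harc θ hθ)
  have h2 := intervalIntegral.integral_eq_sub_of_hasDerivAt (a := -Real.arctan Ω)
    (b := Real.arctan Ω) (f := fun θ : ℝ => F (Complex.exp (Real.log R + θ * Complex.I)))
    (f' := fun θ : ℝ => f (Complex.exp (Real.log R + θ * Complex.I)) *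
      Complex.exp (Real.log R + θ * Complex.I) * Complex.I) (fun θ hθ => by
      have e1 : HasDerivAt (fun θ : ℝ => (Real.log R : ℂ) + θ * Complex.I) (1 * Complex.I) θ :=
        ((Complex.ofRealCLM.hasDerivAt (x := θ)).mul_const Complex.I).const_add _
      exact ((hF _ (harc θ hθ)).comp θ e1.cexp).congr_deriv (by ring))
    (((hfarc.mul (by fun_prop)).mul_const _).intervalIntegrable)
  have hend : ∀ θ w : ℝ, R * Real.cos θ = 1 → R * Real.sin θ = w →
      Complex.exp (Real.log R + θ * Complex.I) = ((1 : ℝ) : ℂ) + w * Complex.I :=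
    fun θ w e1 e2 => by rw [hexp, e1, e2]
  rw [hend (Real.arctan Ω) Ω hcos hsin, hend (-Real.arctan Ω) (-Ω) (by rw [Real.cos_neg, hcos])
    (by rw [Real.sin_neg, mul_neg, hsin])] at h2
  rw [← h1, intervalIntegral.integral_mul_const, intervalIntegral.integral_mul_const] at h2
  exact (mul_right_cancel₀ Complex.I_ne_zero h2).symm

end WavePairing

/-! ### The integral formula in the cone -/

section ConeFormula

variable {ψ : 𝓢(ℝ × ℝ, ℂ)} {ρ r : ℂ → ℂ} {k : ℝ}

/-- The inversion formula on the line `Re s = 1`, paired with a test function. -/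
theorem IsWaveSpeed.eq_integral_wavePairing {φσ φε : 𝓢'(ℝ, ℂ)} {K : 𝓢'(ℝ × ℝ, ℂ)}
    (hw : IsWaveSpeed (sqrtRatio φσ φε) k) (hK : IsFundamentalSolution φσ φε K)
    (hψ : HasCompactSupport ψ) :
    Integrable (fun w : ℝ => wavePairing (sqrtRatio φσ φε (((1 : ℝ) : ℂ) + w * Complex.I))
      (((1 : ℝ) : ℂ) + w * Complex.I) ψ) ∧
    K ψ = (2 * Real.pi : ℂ)⁻¹ *
      ∫ w : ℝ, wavePairing (sqrtRatio φσ φε (((1 : ℝ) : ℂ) + w * Complex.I))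
        (((1 : ℝ) : ℂ) + w * Complex.I) ψ := by
  set ρ := sqrtRatio φσ φε with hρ
  obtain ⟨M, hM⟩ := exists_hasGrowth (isVanishingOn_tensorDelta (TemperedDistribution.delta 0))
  obtain ⟨m, -, hg, hL, -, A, N, hA, hb⟩ := hw.exists_kernel M
  set D := diffOp ((0, 1) : ℝ × ℝ) (-1) m ψ with hD
  have hDc : HasCompactSupport D := hasCompactSupport_diffOp _ _ _ hψ
  set s : ℝ → ℂ := fun w => ((1 : ℝ) : ℂ) + w * Complex.I with hs
  have hsre : ∀ w, (s w).re = 1 := fun w => by simp [hs]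
  have hsim : ∀ w, (s w).im = w := fun w => by simp [hs]
  have hs1 : ∀ w, 1 + s w ≠ 0 := fun w e => by
    have := congrArg Complex.re e
    rw [Complex.add_re, hsre] at this
    norm_num at this
  have hsc : Continuous s := by fun_prop
  have hρc : Continuous fun w => ρ (s w) := continuous_vertical hw.diff one_pos
  -- The power (1 + s)^{-m} makes the double integral absolutely convergent. After Fubini it is
  -- cancelled by the m integrations by parts in t that take the operator off ψ.
  set Ψ : ℝ × ℝ → ℝ → ℂ := fun ζ w =>
    Complex.exp (s w * ζ.2) * (((1 + s w) ^ m)⁻¹ * waveSymbol ρ ζ.1 (s w)) * D ζ with hΨ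
  have hΨc : Continuous (Function.uncurry Ψ) := by
    have e1 : Continuous fun q : (ℝ × ℝ) × ℝ => ((1 + s q.2) ^ m)⁻¹ :=
      Continuous.inv₀ (by fun_prop) fun q => pow_ne_zero m (hs1 q.2)
    have e2 : Continuous fun q : (ℝ × ℝ) × ℝ => waveSymbol ρ q.1.1 (s q.2) := by
      have e4 : Continuous fun q : (ℝ × ℝ) × ℝ => ρ (s q.2) := hρc.comp continuous_snd
      have e5 : Continuous fun q : (ℝ × ℝ) × ℝ => -((|q.1.1| : ℝ) : ℂ) * s q.2 := by fun_prop
      exact (continuous_const.mul e4).mul (e5.mul e4).cexp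
    have e3 : Continuous fun q : (ℝ × ℝ) × ℝ => Complex.exp (s q.2 * q.1.2) := by fun_prop
    exact (e3.mul (e1.mul e2)).mul (D.continuous.comp continuous_fst)
  have hDe : Integrable fun ζ : ℝ × ℝ => (Real.exp ζ.2 : ℂ) * D ζ :=
    integrable_mul_of_hasCompactSupport (by fun_prop) hDc
  have hbound : ∀ ζ w, ‖Ψ ζ w‖ ≤ ‖(Real.exp ζ.2 : ℂ) * D ζ‖ * (A * 2 ^ N * invSq w) := fun ζ w => by
    have h1 := hb ζ.1 (s w) (by rw [hsre]; exact one_pos)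
    rw [hsre, hsim, inv_one, one_add_one_eq_two] at h1
    have h2 : ‖((1 + s w) ^ m)⁻¹ * waveSymbol ρ ζ.1 (s w)‖ ≤ A * 2 ^ N * invSq w :=
      (le_mul_of_one_le_right (norm_nonneg _)
        (one_le_pow₀ (by linarith [abs_nonneg ζ.1]))).trans h1
    rw [hΨ, norm_mul, norm_mul (Complex.exp _), norm_exp_mul_ofReal, hsre, one_mul,
      norm_mul ((Real.exp ζ.2 : ℝ) : ℂ), Complex.norm_real, Real.norm_eq_abs,
      abs_of_pos (Real.exp_pos _), mul_right_comm]
    gcongr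
  have hint : Integrable (Function.uncurry Ψ) (volume.prod volume) := by
    refine ((hDe.norm).mul_prod (integrable_invSq.const_mul (A * 2 ^ N))).mono'
      hΨc.aestronglyMeasurable (Eventually.of_forall fun q => hbound q.1 q.2)
  have hinner : ∀ w, ∫ ζ, Ψ ζ w = wavePairing (ρ (s w)) (s w) ψ := fun w => by
    have h1 : ∀ ζ, Ψ ζ w = ((1 + s w) ^ m)⁻¹ * (waveIntegrand (ρ (s w)) (s w) ζ.1 ζ.2 * D ζ) :=
      fun ζ => by
      simp only [hΨ, waveIntegrand, waveSymbol]
      ring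
    simp only [h1]
    rw [integral_const_mul]
    change ((1 + s w) ^ m)⁻¹ * wavePairing (ρ (s w)) (s w) D = _
    rw [hD, wavePairing_diffOp _ _ _ hψ, inv_mul_cancel_left₀ (pow_ne_zero m (hs1 w))]
  have hK' := (exists_eq_distOp_waveKernel hK hg hM hL ψ).2
  refine ⟨?_, ?_⟩
  · have := hint.integral_prod_right
    refine this.congr (Eventually.of_forall fun w => ?_)
    exact hinner w
  · rw [hK']
    have h2 : ∀ ζ, waveKernel ρ m ζ * D ζ = (2 * Real.pi : ℂ)⁻¹ * ∫ w, Ψ ζ w := fun ζ => by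
      rw [waveKernel, invLaplaceIntegral, mul_assoc, ← integral_mul_const]
    refine (integral_congr_ae (Eventually.of_forall h2)).trans ?_
    rw [integral_const_mul, integral_integral_swap hint]
    simp only [hinner]
    rfl

theorem integral_circleIntegralMean_mul (h : IsCutSpeed ρ r k) (hψ : HasCompactSupport ψ) (u : ℝ) :
    ∫ ζ : ℝ × ℝ, circleIntegralMean r ζ.1 ζ.2 u * ψ ζ =
      (2 * Real.pi : ℂ)⁻¹ * ∫ θ in (-Real.pi)..Real.pi,
        wavePairing (r (u + θ * Complex.I)) (Complex.exp (u + θ * Complex.I)) ψ *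
          Complex.exp (u + θ * Complex.I) := by
  have hpi := Real.pi_pos
  obtain ⟨c, hc, hcr⟩ := h.exists_continuous_eq u
  set f : ℝ → ℝ × ℝ → ℂ := fun θ ζ =>
    waveIntegrand (c θ) (Complex.exp (u + θ * Complex.I)) ζ.1 ζ.2 *
      Complex.exp (u + θ * Complex.I) with hf
  have hfc : Continuous (Function.uncurry f) := by
    have e1 : Continuous fun q : ℝ × ℝ × ℝ =>
        ((c q.1, Complex.exp (u + q.1 * Complex.I)), q.2.1, q.2.2) := by fun_prop
    have e2 : Continuous fun q : ℝ × ℝ × ℝ => Complex.exp (u + q.1 * Complex.I) := by fun_prop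
    exact (continuous_waveIntegrand.comp e1).mul e2
  have h1 := intervalIntegral_integral_mul_swap hfc hψ (-Real.pi) Real.pi
  have h2 : ∫ θ in (-Real.pi)..Real.pi,
      wavePairing (r (u + θ * Complex.I)) (Complex.exp (u + θ * Complex.I)) ψ *
          Complex.exp (u + θ * Complex.I) =
      ∫ θ in (-Real.pi)..Real.pi, ∫ ζ : ℝ × ℝ, f θ ζ * ψ ζ := by
    refine intervalIntegral.integral_congr fun θ hθ => ?_
    rw [uIcc_of_le (by linarith)] at hθ
    simp only [hf, hcr θ (abs_le.2 hθ)]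
    rw [wavePairing, ← integral_mul_const]
    refine integral_congr_ae (Eventually.of_forall fun ζ => ?_)
    simp only
    ring
  rw [h2, h1, ← integral_const_mul]
  refine integral_congr_ae (Eventually.of_forall fun ζ => ?_)
  simp only
  rw [← mul_assoc, circleIntegralMean]
  congr 2
  refine intervalIntegral.integral_congr fun θ hθ => ?_
  rw [uIcc_of_le (by linarith)] at hθ
  simp only [hf, hcr θ (abs_le.2 hθ)]

/-- Fubini reduces this to the deformation of the chord for each fixed (x, t). The arc stays in |arg
s| < π/2, where r agrees with ρ. -/
theorem integral_wavePairing_chord (h : IsCutSpeed ρ r k)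
    (hd : DifferentiableOn ℂ ρ {s | 0 < s.re}) (hψ : HasCompactSupport ψ) {Ω : ℝ} (hΩ : 0 < Ω) :
    ∫ w in (-Ω)..Ω, wavePairing (ρ (((1 : ℝ) : ℂ) + w * Complex.I))
        (((1 : ℝ) : ℂ) + w * Complex.I) ψ =
      ∫ θ in (-Real.arctan Ω)..(Real.arctan Ω),
        wavePairing (r (Real.log √(1 + Ω ^ 2) + θ * Complex.I))
          (Complex.exp (Real.log √(1 + Ω ^ 2) + θ * Complex.I)) ψ *
          Complex.exp (Real.log √(1 + Ω ^ 2) + θ * Complex.I) := by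
  have hpi := Real.pi_pos
  have hat := Real.arctan_lt_pi_div_two Ω
  have hat0 : 0 < Real.arctan Ω := Real.arctan_pos.2 hΩ
  set u : ℝ := Real.log √(1 + Ω ^ 2) with hu
  obtain ⟨c, hc, hcr⟩ := h.exists_continuous_eq u
  set f : ℝ → ℝ × ℝ → ℂ := fun θ ζ =>
    waveIntegrand (c θ) (Complex.exp (u + θ * Complex.I)) ζ.1 ζ.2 *
      Complex.exp (u + θ * Complex.I) with hf
  have hfc : Continuous (Function.uncurry f) := by
    have e1 : Continuous fun q : ℝ × ℝ × ℝ =>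
        ((c q.1, Complex.exp (u + q.1 * Complex.I)), q.2.1, q.2.2) := by fun_prop
    have e2 : Continuous fun q : ℝ × ℝ × ℝ => Complex.exp (u + q.1 * Complex.I) := by fun_prop
    exact (continuous_waveIntegrand.comp e1).mul e2
  set g : ℝ → ℝ × ℝ → ℂ := fun w ζ => waveIntegrand (ρ (((1 : ℝ) : ℂ) + w * Complex.I))
    (((1 : ℝ) : ℂ) + w * Complex.I) ζ.1 ζ.2 with hg
  have hgc : Continuous (Function.uncurry g) := by
    have e0 : Continuous fun w : ℝ => ρ (((1 : ℝ) : ℂ) + w * Complex.I) :=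
      continuous_vertical hd one_pos
    have e1 : Continuous fun q : ℝ × ℝ × ℝ => ((ρ (((1 : ℝ) : ℂ) + q.1 * Complex.I),
        ((1 : ℝ) : ℂ) + q.1 * Complex.I), q.2.1, q.2.2) :=
      ((e0.comp continuous_fst).prodMk (by fun_prop)).prodMk (by fun_prop)
    exact continuous_waveIntegrand.comp e1
  have hθ' : ∀ θ ∈ uIcc (-Real.arctan Ω) (Real.arctan Ω), |θ| < Real.pi / 2 := fun θ hθ => by
    rw [uIcc_of_le (by linarith)] at hθ
    exact (abs_le.2 hθ).trans_lt hat
  have h2 : ∫ θ in (-Real.arctan Ω)..(Real.arctan Ω),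
      wavePairing (r (u + θ * Complex.I)) (Complex.exp (u + θ * Complex.I)) ψ *
          Complex.exp (u + θ * Complex.I) =
      ∫ θ in (-Real.arctan Ω)..(Real.arctan Ω), ∫ ζ : ℝ × ℝ, f θ ζ * ψ ζ := by
    refine intervalIntegral.integral_congr fun θ hθ => ?_
    simp only [hf, hcr θ ((hθ' θ hθ).le.trans (by linarith))]
    rw [wavePairing, ← integral_mul_const]
    refine integral_congr_ae (Eventually.of_forall fun ζ => ?_)
    simp only
    ring
  have h3 := intervalIntegral_integral_mul_swap hgc hψ (-Ω) Ω
  rw [h2, intervalIntegral_integral_mul_swap hfc hψ]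
  refine h3.trans (integral_congr_ae (Eventually.of_forall fun ζ => ?_))
  simp only
  congr 1
  have h4 := integral_chord_eq_integral_arc
    (f := fun s => waveIntegrand (ρ s) s ζ.1 ζ.2) (by
      intro s hs
      have e1 := hd s hs
      unfold waveIntegrand
      exact ((e1.const_mul _).mul (((differentiableWithinAt_id.const_mul _).mul e1).cexp)).mul
        (by fun_prop)) hΩ
  refine h4.trans (intervalIntegral.integral_congr fun θ hθ => ?_)
  have h5 := hθ' θ hθ
  simp only [hf, hcr θ (h5.le.trans (by linarith))]
  rw [h.eq _ (by simpa using h5)]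

/-- Away from the right half plane the paired integrand decays like `1 / |s|`. -/
theorem IsCutSpeed.exists_norm_wavePairing_le (h : IsCutSpeed ρ r k) (hk : 0 ≤ k)
    (hpos : ∀ s : ℂ, 0 < s.re → 0 < (s * ρ s).re) (hψ : HasCompactSupport ψ)
    (hψc : tsupport ψ ⊆ {p : ℝ × ℝ | k * |p.1| < p.2}) :
    ∃ C Q : ℝ, ∀ z : ℂ, |z.im| ≤ Real.pi → Q ≤ z.re → (Complex.exp z).re ≤ 1 →
      ‖wavePairing (r z) (Complex.exp z) ψ * Complex.exp z‖ ≤ C * Real.exp (-z.re) := by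
  obtain ⟨ε, δ, hε, hδ, hL⟩ := exists_forall_mem_le_of_isCompact hψ.isCompact hψc
  obtain ⟨A, hA, hre⟩ := h.exists_neg_re_le hk hpos hε
  obtain ⟨Q, hQ⟩ := eventually_atTop.1 (h.top 1 one_pos)
  obtain ⟨X, hX0, hX⟩ := hasCompactSupport_bound hψ
  set ψ₁ : 𝓢(ℝ × ℝ, ℂ) := ∂_{((0, 1) : ℝ × ℝ)} ψ with hψ₁
  set ψ₂ : 𝓢(ℝ × ℝ, ℂ) := ∂_{((0, 1) : ℝ × ℝ)} ψ₁ with hψ₂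
  have hc₁ : HasCompactSupport ψ₁ := hasCompactSupport_lineDerivOp _ hψ
  have hts : tsupport ψ₂ ⊆ tsupport ψ :=
    (tsupport_lineDerivOp_subset _ ψ₁).trans (tsupport_lineDerivOp_subset _ ψ)
  have hXs : ∀ ζ ∈ tsupport ψ, ‖ζ‖ ≤ X := by
    have : tsupport ψ ⊆ {ζ | ‖ζ‖ ≤ X} := closure_minimal (fun ζ hζ => by
      by_contra hn
      exact hζ (hX ζ (not_le.1 hn))) (isClosed_le continuous_norm continuous_const)
    exact this
  set B : ℝ := 1 / 2 * (k + 1) * Real.exp (A * X + X) with hB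
  refine ⟨B * ∫ ζ, ‖ψ₂ ζ‖, Q, fun z hz hzQ hz1 => ?_⟩
  set s := Complex.exp z with hs
  have hs0 : s ≠ 0 := Complex.exp_ne_zero z
  have hsn : ‖s‖ = Real.exp z.re := Complex.norm_exp z
  have hrz : ‖r z‖ ≤ k + 1 := by
    have := hQ z.re hzQ z.im hz
    rwa [Complex.re_add_im] at this
  have hpair : wavePairing (r z) s ψ₂ = s ^ 2 * wavePairing (r z) s ψ := by
    rw [hψ₂, wavePairing_lineDerivOp _ _ hc₁, hψ₁, wavePairing_lineDerivOp _ _ hψ]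
    ring
  have hb : ‖wavePairing (r z) s ψ₂‖ ≤ B * ∫ ζ, ‖ψ₂ ζ‖ := by
    rw [wavePairing, ← integral_const_mul]
    refine norm_integral_le_of_norm_le ((ψ₂.integrable).norm.const_mul B)
      (Eventually.of_forall fun ζ => ?_)
    by_cases hζ : ζ ∈ tsupport ψ₂
    swap
    · simp [image_eq_zero_of_notMem_tsupport hζ]
    have hζ' := hts hζ
    have hcone := hL ζ hζ'
    have hnorm := hXs ζ hζ'
    have hx : |ζ.1| ≤ X := (norm_fst_le ζ).trans hnorm
    have ht : |ζ.2| ≤ X := (norm_snd_le ζ).trans hnorm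
    have hx0 := abs_nonneg ζ.1
    have ht0 : 0 ≤ ζ.2 := by
      have : 0 ≤ (k + ε) * |ζ.1| := by positivity
      linarith
    rw [norm_mul, norm_waveIntegrand]
    refine mul_le_mul_of_nonneg_right ?_ (norm_nonneg _)
    rw [hB]
    -- For |arg s| ≤ π/2 one has Re (sr) ≥ 0 and Re s ≤ 1. In the left half plane Re s ≤ 0, and it
    -- multiplies t - (k + ε)|x|, which is positive on the support of ψ.
    have hexp : -|ζ.1| * (s * r z).re + s.re * ζ.2 ≤ A * X + X := by
      rcases le_total |z.im| (Real.pi / 2) with h1 | h1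
      · have h2 := h.re_nonneg hpos h1
        have h3 : s.re * ζ.2 ≤ 1 * X := by
          refine (mul_le_mul_of_nonneg_right hz1 ht0).trans ?_
          linarith [le_abs_self ζ.2]
        have h4 : 0 ≤ |ζ.1| * (s * r z).re := mul_nonneg hx0 h2
        have h5 : 0 ≤ A * X := by positivity
        linarith
      · have h2 := mul_le_mul_of_nonneg_left (hre z h1 hz) hx0
        have h3 : s.re ≤ 0 := by
          rw [hs, Complex.exp_re, ← Real.cos_abs]
          refine mul_nonpos_of_nonneg_of_nonpos (Real.exp_pos _).le
            (Real.cos_nonpos_of_pi_div_two_le_of_le h1 ?_)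
          linarith [Real.pi_pos]
        have h4 : s.re * (ζ.2 - (k + ε) * |ζ.1|) ≤ 0 :=
          mul_nonpos_of_nonpos_of_nonneg h3 (by linarith)
        have h5 : |ζ.1| * A ≤ X * A := by gcongr
        nlinarith
    gcongr
  -- Two derivatives in t are worth s²; one power compensates the factor s from ds = is dθ, and the
  -- other gives the decay 1/|s|.
  have hfin : wavePairing (r z) s ψ * s = wavePairing (r z) s ψ₂ * s⁻¹ := by
    rw [hpair]
    field_simp
  rw [hfin, norm_mul, norm_inv, hsn, Real.exp_neg]
  gcongr

theorem IsCutSpeed.tendsto_integral_circleIntegralMean (h : IsCutSpeed ρ r k) (hk : 0 ≤ k)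
    (hψ : HasCompactSupport ψ) (hψc : tsupport ψ ⊆ {p : ℝ × ℝ | k * |p.1| < p.2}) :
    Tendsto (fun R : ℝ => ∫ ζ : ℝ × ℝ, circleIntegralMean r ζ.1 ζ.2 (Real.log R) * ψ ζ) atTop
      (𝓝 (∫ ζ : ℝ × ℝ, coneKernel r ζ * ψ ζ)) := by
  obtain ⟨ε, δ, hε, hδ, hL⟩ := exists_forall_mem_le_of_isCompact hψ.isCompact hψc
  have hunif := h.tendstoUniformlyOn_circleIntegralMean hk hε hδ
  rw [Metric.tendstoUniformlyOn_iff] at hunif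
  have hint : Integrable fun ζ => coneKernel r ζ * ψ ζ := by
    have h1 : IntegrableOn (fun ζ => coneKernel r ζ * ψ ζ) (tsupport ψ) :=
      (((h.continuousOn_coneKernel hk).mono hψc).mul
        ψ.continuous.continuousOn).integrableOn_compact hψ.isCompact
    rwa [integrableOn_iff_integrable_of_support_subset] at h1
    exact fun ζ hζ => subset_tsupport _ (right_ne_zero_of_mul hζ)
  rw [Metric.tendsto_nhds]
  intro ε' hε'
  set I : ℝ := ∫ ζ, ‖ψ ζ‖ with hI
  have hI0 : 0 ≤ I := integral_nonneg fun _ => norm_nonneg _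
  filter_upwards [hunif (ε' / (I + 1)) (by positivity)] with R hR
  rw [dist_eq_norm, ← integral_sub (integrable_mul_of_hasCompactSupport
    (h.continuous_circleIntegralMean _) hψ) hint]
  have h1 : ‖∫ ζ : ℝ × ℝ, (circleIntegralMean r ζ.1 ζ.2 (Real.log R) * ψ ζ - coneKernel r ζ * ψ ζ)‖ ≤
      ∫ ζ, ε' / (I + 1) * ‖ψ ζ‖ := by
    refine norm_integral_le_of_norm_le ((ψ.integrable).norm.const_mul _)
      (Eventually.of_forall fun ζ => ?_)
    rw [← sub_mul, norm_mul]
    by_cases hζ : ζ ∈ tsupport ψ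
    · refine mul_le_mul_of_nonneg_right ?_ (norm_nonneg _)
      rw [← dist_eq_norm, dist_comm]
      exact (hR ζ (hL ζ hζ).le).le
    · simp [image_eq_zero_of_notMem_tsupport hζ]
  refine h1.trans_lt ?_
  rw [integral_const_mul, ← hI, div_mul_eq_mul_div, div_lt_iff₀ (by positivity)]
  nlinarith

/-- In the cone `k |x| < t` the fundamental solution is the limit of the integrals over large
circles. -/
theorem IsCutSpeed.eq_integral_coneKernel {φσ φε : 𝓢'(ℝ, ℂ)} {K : 𝓢'(ℝ × ℝ, ℂ)}
    (h : IsCutSpeed (sqrtRatio φσ φε) r k) (hw : IsWaveSpeed (sqrtRatio φσ φε) k)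
    (hK : IsFundamentalSolution φσ φε K)
    (hψ : HasCompactSupport ψ) (hψc : tsupport ψ ⊆ {p : ℝ × ℝ | k * |p.1| < p.2}) :
    K ψ = ∫ ζ : ℝ × ℝ, coneKernel r ζ * ψ ζ := by
  have hpi := Real.pi_pos
  obtain ⟨hint, hKψ⟩ := hw.eq_integral_wavePairing hK hψ
  obtain ⟨C, Q, hb⟩ := h.exists_norm_wavePairing_le hw.nonneg hw.pos hψ hψc
  set R : ℝ → ℝ := fun Ω => √(1 + Ω ^ 2) with hR
  have hRpos : ∀ Ω, 0 < R Ω := fun Ω => Real.sqrt_pos.2 (by positivity)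
  have hRΩ : ∀ Ω, Ω ≤ R Ω := fun Ω => Real.le_sqrt_of_sq_le (by linarith)
  have hRtop : Tendsto R atTop atTop := tendsto_atTop_mono hRΩ tendsto_id
  set G : ℝ → ℝ → ℂ := fun u θ =>
    wavePairing (r (u + θ * Complex.I)) (Complex.exp (u + θ * Complex.I)) ψ *
      Complex.exp (u + θ * Complex.I) with hG
  have hGint : ∀ u a b : ℝ, |a| ≤ Real.pi → |b| ≤ Real.pi →
      IntervalIntegrable (G u) volume a b := fun u a b ha hb' => by
    obtain ⟨c, hc, hcr⟩ := h.exists_continuous_eq u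
    have h1 : Continuous fun θ : ℝ => wavePairing (c θ) (Complex.exp (u + θ * Complex.I)) ψ *
        Complex.exp (u + θ * Complex.I) :=
      (continuous_wavePairing hψ hc (by fun_prop)).mul (by fun_prop)
    refine ContinuousOn.intervalIntegrable (h1.continuousOn.congr fun θ hθ => ?_)
    have hθ' : |θ| ≤ Real.pi := by
      have := uIcc_subset_Icc (abs_le.1 ha) (abs_le.1 hb') hθ
      exact abs_le.2 this
    simp only [hG, hcr θ hθ']
  have h1 : Tendsto (fun Ω : ℝ => (2 * Real.pi : ℂ)⁻¹ *
      ∫ θ in (-Real.pi)..Real.pi, G (Real.log (R Ω)) θ) atTop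
      (𝓝 (∫ ζ : ℝ × ℝ, coneKernel r ζ * ψ ζ)) := by
    refine ((h.tendsto_integral_circleIntegralMean hw.nonneg hψ hψc).comp hRtop).congr fun Ω => ?_
    exact integral_circleIntegralMean_mul h hψ _
  have h2 : Tendsto (fun Ω : ℝ => (2 * Real.pi : ℂ)⁻¹ *
      ∫ θ in (-Real.arctan Ω)..(Real.arctan Ω), G (Real.log (R Ω)) θ) atTop (𝓝 (K ψ)) := by
    rw [hKψ]
    refine ((intervalIntegral_tendsto_integral hint tendsto_neg_atTop_atBot
      tendsto_id).const_mul _).congr' ?_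
    filter_upwards [eventually_gt_atTop 0] with Ω hΩ
    rw [← integral_wavePairing_chord h hw.diff hψ hΩ]
    rfl
  -- On the two remaining arcs arctan Ω ≤ |θ| ≤ π one has Re s ≤ 1, since the arcs start at the end
  -- points 1 ± iΩ of the chord. The integrand there is O(1/R).
  have h3 : Tendsto (fun Ω : ℝ => (2 * Real.pi : ℂ)⁻¹ *
      (∫ θ in (-Real.pi)..Real.pi, G (Real.log (R Ω)) θ) - (2 * Real.pi : ℂ)⁻¹ *
      ∫ θ in (-Real.arctan Ω)..(Real.arctan Ω), G (Real.log (R Ω)) θ) atTop (𝓝 0) := by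
    have hlim : Tendsto (fun Ω : ℝ => C * (R Ω)⁻¹) atTop (𝓝 (C * 0)) :=
      (tendsto_inv_atTop_zero.comp hRtop).const_mul C
    rw [mul_zero] at hlim
    refine squeeze_zero_norm' ?_ hlim
    have hQ : ∀ᶠ Ω : ℝ in atTop, Q ≤ Real.log (R Ω) :=
      (Real.tendsto_log_atTop.comp hRtop).eventually_ge_atTop Q
    filter_upwards [eventually_gt_atTop 0, hQ] with Ω hΩ hQΩ
    set u := Real.log (R Ω) with hu
    set α := Real.arctan Ω with hα
    have hα0 : 0 < α := Real.arctan_pos.2 hΩ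
    have hα1 : α < Real.pi / 2 := Real.arctan_lt_pi_div_two Ω
    have hbG : ∀ θ : ℝ, α ≤ |θ| → |θ| ≤ Real.pi → ‖G u θ‖ ≤ C * (R Ω)⁻¹ := fun θ h4 h5 => by
      have h6 := hb (u + θ * Complex.I) (by simpa using h5) (by simpa using hQΩ) (by
        rw [Complex.exp_re]
        simp only [Complex.add_re, Complex.ofReal_re, Complex.mul_re, Complex.I_re, mul_zero,
          Complex.ofReal_im, Complex.I_im, mul_one, sub_self, add_zero, Complex.add_im,
          Complex.mul_im, zero_add]
        rw [hu, Real.exp_log (hRpos Ω), ← Real.cos_abs]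
        have h7 : R Ω * Real.cos α = 1 := by
          rw [hα, Real.cos_arctan]
          have := hRpos Ω
          simp only [hR] at this ⊢
          field_simp
        rw [← h7]
        exact mul_le_mul_of_nonneg_left (Real.cos_le_cos_of_nonneg_of_le_pi hα0.le h5 h4)
          (hRpos Ω).le)
      have h8 : ((u : ℂ) + θ * Complex.I).re = u := by simp
      rwa [h8, Real.exp_neg, hu, Real.exp_log (hRpos Ω)] at h6
    have hC0 : 0 ≤ C * (R Ω)⁻¹ :=
      (norm_nonneg _).trans (hbG Real.pi (by rw [abs_of_pos hpi]; linarith) (abs_of_pos hpi).le)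
    have hsplit : (∫ θ in (-Real.pi)..Real.pi, G u θ) - ∫ θ in (-α)..α, G u θ =
        (∫ θ in (-Real.pi)..(-α), G u θ) + ∫ θ in α..Real.pi, G u θ := by
      have hαpi : |α| ≤ Real.pi := by rw [abs_of_pos hα0]; linarith
      have hπ : |Real.pi| ≤ Real.pi := (abs_of_pos hpi).le
      rw [← intervalIntegral.integral_add_adjacent_intervals
        (hGint u (-Real.pi) (-α) (by rwa [abs_neg]) (by rwa [abs_neg]))
        (hGint u (-α) Real.pi (by rwa [abs_neg]) hπ),
        ← intervalIntegral.integral_add_adjacent_intervals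
        (hGint u (-α) α (by rwa [abs_neg]) hαpi) (hGint u α Real.pi hαpi hπ)]
      ring
    have e1 : ‖∫ θ in (-Real.pi)..(-α), G u θ‖ ≤ C * (R Ω)⁻¹ * Real.pi := by
      refine (intervalIntegral.norm_integral_le_of_norm_le_const (C := C * (R Ω)⁻¹)
        fun θ hθ => ?_).trans ?_
      · rw [uIoc_of_le (by linarith)] at hθ
        have : |θ| = -θ := abs_of_nonpos (by linarith [hθ.2])
        exact hbG θ (by linarith [hθ.2]) (by linarith [hθ.1])
      · rw [abs_of_nonneg (by linarith)]
        exact mul_le_mul_of_nonneg_left (by linarith) hC0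
    have e2 : ‖∫ θ in α..Real.pi, G u θ‖ ≤ C * (R Ω)⁻¹ * Real.pi := by
      refine (intervalIntegral.norm_integral_le_of_norm_le_const (C := C * (R Ω)⁻¹)
        fun θ hθ => ?_).trans ?_
      · rw [uIoc_of_le (by linarith)] at hθ
        have : |θ| = θ := abs_of_nonneg (by linarith [hθ.1])
        exact hbG θ (by linarith [hθ.1]) (by linarith [hθ.2])
      · rw [abs_of_nonneg (by linarith)]
        exact mul_le_mul_of_nonneg_left (by linarith) hC0
    rw [← mul_sub, hsplit, norm_mul]
    have e3 : ‖(2 * Real.pi : ℂ)⁻¹‖ = (2 * Real.pi)⁻¹ := by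
      rw [norm_inv, norm_mul, Complex.norm_real, Real.norm_eq_abs, abs_of_pos hpi]
      norm_num
    rw [e3, inv_mul_le_iff₀ (by positivity)]
    refine (norm_add_le _ _).trans ((add_le_add e1 e2).trans (le_of_eq (by ring)))
  have h4 := h1.sub h2
  exact (sub_eq_zero.1 (tendsto_nhds_unique h4 h3)).symm

end ConeFormula

end DOWave

end

/-! ### The main theorem -/

theorem mainTheorem2 (φσ φε ℓ : 𝓢'(ℝ, ℂ))
    (hσ : IsVanishingOn φσ (Icc (0 : ℝ) 1)ᶜ) (hε : IsVanishingOn φε (Icc (0 : ℝ) 1)ᶜ)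
    -- (A1), with `ℓ` the inverse Laplace transform, (A2) and (A3)
    (hA1 : DOWave.IsInvLaplace (fun s => DOWave.symbol φε s / DOWave.symbol φσ s) ℓ)
    (hA2 : ∀ s : ℂ, 0 < s.re →
      s ^ 2 * (DOWave.symbol φσ s / DOWave.symbol φε s) ∈ Complex.slitPlane)
    (hA3 : ∃ m : 𝓢'(ℝ, ℂ),
      DOWave.IsInvLaplace (fun s => DOWave.symbol φσ s / DOWave.symbol φε s) m)
    -- (A4), with `r z` the continuation of `√(Φσ/Φε)` at `s = e^z`
    (r : ℂ → ℂ) (hA4 : DOWave.IsCutPlaneContinuation (DOWave.sqrtRatio φσ φε) r)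
    -- (A5)
    (k : ℝ) (hk : 0 ≤ k)
    (hA5 : ∀ θ : ℝ, Real.pi / 2 < |θ| → |θ| ≤ Real.pi →
      Tendsto (fun R : ℝ => ‖r (DOWave.polarLog R θ)‖) atTop (𝓝 k))
    -- (A6)
    (hA6 : ∀ θ : ℝ, |θ| ≤ Real.pi →
      Tendsto (fun η : ℝ => ‖(η : ℂ) * r (DOWave.polarLog η θ)‖) (𝓝[>] 0) (𝓝 0)) :
    (∃! K : 𝓢'(ℝ × ℝ, ℂ), DOWave.IsFundamentalSolution φσ φε K) ∧
    ∀ K : 𝓢'(ℝ × ℝ, ℂ), DOWave.IsFundamentalSolution φσ φε K →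
      -- the solution is `u = K * (u₀ δ + v₀ H)`
      (∀ u₀ v₀ : 𝓢'(ℝ, ℂ),
        (∃! u : 𝓢'(ℝ × ℝ, ℂ), DOWave.IsCauchySolution ℓ u₀ v₀ u) ∧
        ∀ u : 𝓢'(ℝ × ℝ, ℂ), DOWave.IsCauchySolution ℓ u₀ v₀ u →
          ∃ A B : 𝓢'(ℝ × ℝ, ℂ),
            DOWave.IsTensor u₀ (TemperedDistribution.delta 0) A ∧
            DOWave.IsTensor v₀ DOWave.heaviside B ∧
            DOWave.IsConv K (A + B) u) ∧
      -- in the open cone `k |x| < t`, `K` is the function given by the integral formula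
      (∃ κ : ℝ × ℝ → ℂ,
        ContinuousOn κ {p : ℝ × ℝ | k * |p.1| < p.2} ∧
        (∀ x t : ℝ, k * |x| < t →
          Tendsto (fun p : ℝ × ℝ => DOWave.cutIntegral r x t p.1 p.2)
            (𝓝[>] 0 ×ˢ atTop) (𝓝 (κ (x, t)))) ∧
        ∀ ψ : 𝓢(ℝ × ℝ, ℂ), HasCompactSupport ψ →
          tsupport ψ ⊆ {p : ℝ × ℝ | k * |p.1| < p.2} →
          K ψ = ∫ p : ℝ × ℝ, κ p * ψ p) ∧
      -- `K` vanishes outside the closed cone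
      IsVanishingOn K {p : ℝ × ℝ | p.2 < k * |p.1|} := by
  have hcut := hA4.isCutSpeed hA2 hk hA5 hA6
  have hwave := hcut.isWaveSpeed hA2 hk hA5
  -- The transform Φε/Φσ of ℓ is s²/p², with p = sρ: this links the convolution operator of the
  -- equation to the kernel K̃.
  have hsym : ∀ s : ℂ, 0 < s.re →
      DOWave.laplace ℓ s * (s * DOWave.sqrtRatio φσ φε s) ^ 2 = s ^ 2 := fun s hs => by
    obtain ⟨h1, h2⟩ := DOWave.symbol_ne_zero hA2 hs
    rw [hA1.2 s hs, DOWave.sq_mul_sqrtRatio (DOWave.ne_zero_of_re_pos hs)]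
    field_simp
  refine ⟨DOWave.existsUnique_fundamentalSolution hwave.hasKernels, fun K hK =>
    ⟨DOWave.cauchy_problem hA1.1 hwave.hasKernels hwave.pos hsym hK,
      ⟨DOWave.coneKernel r, hcut.continuousOn_coneKernel hk,
        fun x t hxt => hcut.tendsto_cutIntegral hk hxt,
        fun ψ hψ hψc => hcut.eq_integral_coneKernel hwave hK hψ hψc⟩,
      hwave.isVanishingOn hK⟩⟩
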